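/- Let $\mathbb T=(S^1)^r$ be a torus with Lie algebra $\mathfrak t=\mathbb R^r$. Orbifolds are smooth, effective and Hausdorff, and all torus actions on them are smooth. For circle subgroups $S_i\subset\mathbb T$ and a finite index set $I$, write $S_I$ for the subgroup generated by the $S_i$, $i\in I$, and $U_I=\bigcap_{i\in I}U_i$. A \emph{good cover} of a $\mathbb T$-space $\Sigma$ is a finite open cover $U_1,\dots,U_k$ of $\Sigma$ by $\mathbb T$-invariant sets together with circle subgroups $S_1,\dots,S_k$ of $\mathbb T$ such that: each $S_i$ is a factor in some presentation $\mathbb T= S^1\times\dots\times S^1$ and acts locally freely (with finite isotropy groups) on $U_i$; and for every $I\subseteq\{1,\dots,k\}$ with $U_I\neq\emptyset$, the group $S_I$ has dimension $|I|$ and acts locally freely on $U_I$. (1) Let $\Sigma$ be a compact $n$-dimensional $\mathbb T$-orbifold with a good cover $\{U_i,S_i\}_{i=1}^k$, each $S_i$ being identified with $S^1$ by the factor presentation. Then there is a compact $(n+1)$-dimensional $\mathbb T$-orbifold with boundary $W$ whose boundary is $\mathbb T$-equivariantly isomorphic to $\Sigma$. More precisely, there are a smooth $\mathbb T$-invariant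 partition of unity $\{\varphi_i\}$ subordinate to $\{U_i\}$ and numbers $\alpha_i>1$, such that for every $I$ the point $(\alpha_i)_{i\in I}$ is a regular value of $U_I\times[1,\infty)\to\mathbb R^{I}$, $(m,t)\mapsto (t\varphi_i(m))_{i\in I}$, for which $W$ can be taken to be obtained by gluing the local cuts $$W_I=\{(m,t,z)\in U_I\times[1,\infty)\times\mathbb C^{I}:\ t\varphi_i(m)+|z_i|^2=\alpha_i\ (i\in I),\ t\varphi_j(m)<\alpha_j\ (j\notin I)\}/(S^1)^{I},$$ where the $i$-th circle acts on $m$ through $S_i$ and rotates $z_i$; that is, $W$ is the quotient orbifold $$W=\{(m,t,z)\in\Sigma\times[1,\infty)\times\mathbb C^k:\ t\varphi_i(m)+|z_i|^2=\alpha_i,\ 1\le i\le k\}/(S^1)^k ,$$ with $\mathbb T$ acting through $m$, and the isomorphism of $\Sigma$ onto $\partial W$ is $m\mapsto[m,1,(\sqrt{\alpha_i-\varphi_i(m)})_i]$. (2) Let $\overline M$ be a compact $\mathbb T$-orbifold with boundary $\Sigma$ and interior $M$, and let $\phi:M\to\mathfrak t$ be a continuous $\mathbb T$-equivariant (i.e.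 invariant) map whose vanishing set $M^\phi=\{m\in M: V^\phi(m)=0\}$, where $V^\phi(m)=\frac{d}{dt}\big|_{t=0}\exp(-t\phi(m))\cdot m$, is compact. Then $\Sigma$ has a good cover. In particular this holds for the boundary $\Sigma$ of every K-cycle $(M,E,\phi)$ with compact vanishing set, that is, when $M$ moreover carries a $\mathbb T$-invariant stable complex structure and a $\mathbb T$-equivariant orbifold vector bundle $E$ with which $\phi$ is compatible. -/

import Mathlib

open Set Topology

open scoped ContDiff

universe u v

/-! ## Orbifolds, possibly with boundary (effective, in the sense of Satake) -/

/-- The Euclidean space `ℝⁿ`. -/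
abbrev Euc (n : ℕ) : Type := EuclideanSpace ℝ (Fin n)

/-- The closed half space `{x ∈ ℝⁿ⁺¹ | 0 ≤ x₀}`. -/
def halfSpace (n : ℕ) : Set (Euc (n + 1)) := {x | 0 ≤ x 0}

/-- An orbifold chart on `X`, modelled on the subset `H` of `E` (the whole space, or a half space):
a connected relatively open set `dom ⊆ H`, a finite group acting effectively on `dom` by
diffeomorphisms, and a map `proj` inducing a homeomorphism of the orbit space `dom / group` onto an
open subset of `X`. The values of `proj` and of the group elements outside `dom` are irrelevant. -/
structure OrbifoldChart {E : Type*} [NormedAddCommGroup E] [NormedSpace ℝ E] (H : Set E)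
    (X : Type*) [TopologicalSpace X] where
  dom : Set E
  relOpen_dom : ∃ O : Set E, IsOpen O ∧ dom = H ∩ O
  isConnected_dom : IsConnected dom
  group : Subgroup (Equiv.Perm E)
  finite_group : Finite group
  mapsTo_group : ∀ γ ∈ group, MapsTo γ dom dom
  smooth_group : ∀ γ ∈ group, ContDiffOn ℝ ∞ γ dom
  effective_group : ∀ γ ∈ group, (∀ x ∈ dom, γ x = x) → γ = 1
  proj : E → X
  continuousOn_proj : ContinuousOn proj dom
  isOpen_image_proj : ∀ O : Set E, IsOpen O → IsOpen (proj '' (dom ∩ O))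
  proj_eq_iff : ∀ x ∈ dom, ∀ y ∈ dom, proj x = proj y ↔ ∃ γ ∈ group, γ x = y

/-- `h` is a diffeomorphism from a relatively open subset of `A` onto a relatively open subset
of `B`. -/
def IsLocalDiffeo {E F : Type*} [NormedAddCommGroup E] [NormedSpace ℝ E]
    [NormedAddCommGroup F] [NormedSpace ℝ F] (A : Set E) (B : Set F) (h : PartialEquiv E F) :
    Prop :=
  (∃ O : Set E, IsOpen O ∧ h.source = A ∩ O) ∧ (∃ O : Set F, IsOpen O ∧ h.target = B ∩ O) ∧
    ContDiffOn ℝ ∞ h h.source ∧ ContDiffOn ℝ ∞ h.symm h.target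

/-- Two orbifold charts are compatible if any two points with the same image in `X` are related by
a local diffeomorphism over `X`. -/
def OrbifoldChart.Compatible {E : Type*} [NormedAddCommGroup E] [NormedSpace ℝ E] {H : Set E}
    {X : Type*} [TopologicalSpace X] (c c' : OrbifoldChart H X) : Prop :=
  ∀ x ∈ c.dom, ∀ y ∈ c'.dom, c.proj x = c'.proj y →
    ∃ h : PartialEquiv E E, IsLocalDiffeo c.dom c'.dom h ∧ x ∈ h.source ∧ h x = y ∧
      ∀ v ∈ h.source, c'.proj (h v) = c.proj v

/-- A smooth orbifold structure on `X` with charts modelled on `H`, given by an atlas. -/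
structure OrbifoldAtlas {E : Type*} [NormedAddCommGroup E] [NormedSpace ℝ E] (H : Set E)
    (X : Type*) [TopologicalSpace X] where
  charts : Set (OrbifoldChart H X)
  covers : ∀ p : X, ∃ c ∈ charts, ∃ x ∈ c.dom, c.proj x = p
  compatible : ∀ c ∈ charts, ∀ c' ∈ charts, c.Compatible c'

/-- An `n`-dimensional orbifold (without boundary). -/
abbrev Orbifold (n : ℕ) (X : Type*) [TopologicalSpace X] :=
  OrbifoldAtlas (univ : Set (Euc n)) X

/-- An `(n + 1)`-dimensional orbifold with (possibly empty) boundary. -/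
abbrev OrbifoldWithBoundary (n : ℕ) (X : Type*) [TopologicalSpace X] :=
  OrbifoldAtlas (halfSpace n) X

/-- The boundary points of an orbifold with boundary. -/
def OrbifoldAtlas.boundary {n : ℕ} {X : Type*} [TopologicalSpace X]
    (A : OrbifoldWithBoundary n X) : Set X :=
  {p | ∃ c ∈ A.charts, ∃ x ∈ c.dom, x 0 = 0 ∧ c.proj x = p}

/-- `f` is an isomorphism of the orbifold `Y` onto the boundary of the orbifold `X`: a homeomorphism
onto `∂X` which lifts, in charts of `Y` and of `X`, to diffeomorphisms between open subsets of the
charts of `Y` and open subsets of the boundaries of the charts of `X`. -/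
def IsBoundaryIso {n : ℕ} {Y X : Type*} [TopologicalSpace Y] [TopologicalSpace X]
    (B : Orbifold n Y) (A : OrbifoldWithBoundary n X) (f : Y → X) : Prop :=
  IsEmbedding f ∧ range f = A.boundary ∧
    ∀ c ∈ B.charts, ∀ c' ∈ A.charts, ∀ x ∈ c.dom, ∀ y ∈ c'.dom, f (c.proj x) = c'.proj y →
      ∃ h : PartialEquiv (Euc n) (Euc (n + 1)),
        IsLocalDiffeo c.dom (c'.dom ∩ {v | v 0 = 0}) h ∧ x ∈ h.source ∧ h x = y ∧
          ∀ v ∈ h.source, c'.proj (h v) = f (c.proj v)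

/-- Smooth real functions on an orbifold. -/
def OrbifoldAtlas.SmoothFunction {E : Type*} [NormedAddCommGroup E] [NormedSpace ℝ E] {H : Set E}
    {X : Type*} [TopologicalSpace X] (A : OrbifoldAtlas H X) (f : X → ℝ) : Prop :=
  ∀ c ∈ A.charts, ContDiffOn ℝ ∞ (fun x => f (c.proj x)) c.dom

/-! ## Torus actions -/

/-- The torus `𝕋 = S¹ × ⋯ × S¹` of dimension `r`. -/
abbrev Torus (r : ℕ) : Type := Fin r → Circle

/-- The exponential map of the torus; its Lie algebra is `ℝʳ`. -/
noncomputable def torusExp {r : ℕ} (ξ : Fin r → ℝ) : Torus r := fun i => Circle.exp (ξ i)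

theorem torusExp_zero {r : ℕ} : torusExp (0 : Fin r → ℝ) = 1 := by
  funext i
  simp [torusExp]

theorem torusExp_add {r : ℕ} (ξ η : Fin r → ℝ) :
    torusExp (ξ + η) = torusExp ξ * torusExp η := by
  funext i
  simp [torusExp, Circle.exp_add]

/-- The Lie algebra of a (closed) subgroup of the torus. -/
noncomputable def lieAlg {r : ℕ} (S : Subgroup (Torus r)) : Submodule ℝ (Fin r → ℝ) where
  carrier := {ξ | ∀ t : ℝ, torusExp (t • ξ) ∈ S}
  add_mem' := by
    intro ξ η hξ hη t
    rw [smul_add, torusExp_add]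
    exact S.mul_mem (hξ t) (hη t)
  zero_mem' := by
    intro t
    rw [smul_zero, torusExp_zero]
    exact S.one_mem
  smul_mem' := by
    intro a ξ hξ t
    rw [smul_smul]
    exact hξ (t * a)

/-- The action of the torus on the orbifold `X` is smooth: it is continuous and, for all charts,
the map `(ξ, p) ↦ exp ξ · t₀ · p` lifts locally to a smooth map of charts. -/
def SmoothAction {E : Type*} [NormedAddCommGroup E] [NormedSpace ℝ E] {H : Set E} {r : ℕ}
    {X : Type*} [TopologicalSpace X] [MulAction (Torus r) X] (A : OrbifoldAtlas H X) : Prop :=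
  ContinuousSMul (Torus r) X ∧
    ∀ c ∈ A.charts, ∀ c' ∈ A.charts, ∀ t₀ : Torus r, ∀ x ∈ c.dom, ∀ y ∈ c'.dom,
      t₀ • c.proj x = c'.proj y →
        ∃ (g : (Fin r → ℝ) × E → E) (O : Set ((Fin r → ℝ) × E)), IsOpen O ∧ (0, x) ∈ O ∧
          g (0, x) = y ∧ ContDiffOn ℝ ∞ g (O ∩ univ ×ˢ c.dom) ∧
          ∀ v ∈ O ∩ univ ×ˢ c.dom, g v ∈ c'.dom ∧
            c'.proj (g v) = (torusExp v.1 * t₀) • c.proj v.2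

/-- The subgroup `S` acts locally freely on the set `U`: all its isotropy groups are finite. -/
def LocallyFreeOn {r : ℕ} {X : Type*} [MulAction (Torus r) X] (S : Subgroup (Torus r))
    (U : Set X) : Prop :=
  ∀ x ∈ U, Finite (S ⊓ MulAction.stabilizer (Torus r) x : Subgroup (Torus r))

/-- The circle `σ : S¹ → 𝕋` is a factor in some presentation `𝕋 = S¹ × ⋯ × S¹`. -/
def IsCircleFactor {r : ℕ} (σ : Circle →ₜ* Torus r) : Prop :=
  ∃ (e : Torus r ≃ₜ* Torus r) (j : Fin r), ∀ z : Circle, σ z = e (Pi.mulSingle j z)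

/-- The subgroup `S_I` generated by the circles `σ i`, `i ∈ I`. -/
noncomputable def circlesSubgroup {r k : ℕ} (σ : Fin k → Circle →ₜ* Torus r) (I : Finset (Fin k)) :
    Subgroup (Torus r) :=
  ⨆ i ∈ I, (σ i).toMonoidHom.range

/-- Good covers of a space with torus action. -/
structure IsGoodCover {r k : ℕ} {X : Type*} [TopologicalSpace X] [MulAction (Torus r) X]
    (U : Fin k → Set X) (σ : Fin k → Circle →ₜ* Torus r) : Prop where
  isOpen : ∀ i, IsOpen (U i)
  covers : ⋃ i, U i = univ
  invariant : ∀ (i : Fin k) (τ : Torus r), ∀ x ∈ U i, τ • x ∈ U i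
  factor : ∀ i, IsCircleFactor (σ i)
  locallyFree : ∀ i, LocallyFreeOn (σ i).toMonoidHom.range (U i)
  compatible : ∀ I : Finset (Fin k), (⋂ i ∈ I, U i).Nonempty →
    Module.finrank ℝ (lieAlg (circlesSubgroup σ I)) = I.card ∧
      LocallyFreeOn (circlesSubgroup σ I) (⋂ i ∈ I, U i)

/-! ## The vanishing set -/

/-- The vector `V^φ(m) = d/dt|₀ exp(-t φ(m)) · m` is zero; the derivative is taken of a lift of the
curve to an orbifold chart. -/
def VectorFieldVanishesAt {E : Type*} [NormedAddCommGroup E] [NormedSpace ℝ E] {H : Set E} {r : ℕ}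
    {X : Type*} [TopologicalSpace X] [MulAction (Torus r) X] (A : OrbifoldAtlas H X)
    (φ : X → Fin r → ℝ) (m : X) : Prop :=
  ∃ c ∈ A.charts, ∃ u : ℝ → E, c.proj (u 0) = m ∧
    (∀ᶠ t in 𝓝 (0 : ℝ), u t ∈ c.dom ∧ c.proj (u t) = torusExp (-(t • φ m)) • m) ∧
    HasDerivAt u 0 0

/-! ## Lerman cuts -/

/-- The data of a (multiple) cut of `Y × [1, ∞)` relative to a cover `U`: a smooth torus invariant
partition of unity subordinate to `U`, and numbers `α i > 1` such that, for every `I`, the point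
`(α i)_{i ∈ I}` is a regular value of `(m, t) ↦ (t φ_i(m))_{i ∈ I}` on `U_I × [1, ∞)`. -/
structure IsCutData {n r k : ℕ} {Y : Type*} [TopologicalSpace Y] [MulAction (Torus r) Y]
    (B : Orbifold n Y) (U : Fin k → Set Y) (φ : Fin k → Y → ℝ) (α : Fin k → ℝ) : Prop where
  smooth : ∀ i, B.SmoothFunction (φ i)
  invariant : ∀ (i : Fin k) (τ : Torus r) (m : Y), φ i (τ • m) = φ i m
  nonneg : ∀ i m, 0 ≤ φ i m
  sum_eq_one : ∀ m, ∑ i, φ i m = 1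
  support_subset : ∀ i, tsupport (φ i) ⊆ U i
  one_lt : ∀ i, 1 < α i
  regular : ∀ I : Finset (Fin k), ∀ c ∈ B.charts, ∀ x ∈ c.dom, ∀ t : ℝ, 1 ≤ t →
    (∀ i ∈ I, c.proj x ∈ U i) → (∀ i ∈ I, t * φ i (c.proj x) = α i) →
      Function.Surjective
        (fderiv ℝ (fun (v : Euc n × ℝ) (i : I) => v.2 * φ i (c.proj v.1)) (x, t))

/-- The zero level in `Y × [1, ∞) × ℂᵏ` of `χ(m, t, z) = (α i - t φ_i(m) - |z_i|²)_i`. -/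
def cutLevel {k : ℕ} {Y : Type*} (φ : Fin k → Y → ℝ) (α : Fin k → ℝ) :
    Set (Y × ℝ × (Fin k → ℂ)) :=
  {w | 1 ≤ w.2.1 ∧ ∀ i, α i - w.2.1 * φ i w.1 - ‖w.2.2 i‖ ^ 2 = 0}

/-- The diagonal action of `(S¹)ᵏ` on `Y × ℝ × ℂᵏ`, the `i`-th circle acting on `Y` through `σ i` and
on the `i`-th coordinate of `ℂᵏ` by rotation. -/
noncomputable def cutRotate {r k : ℕ} {Y : Type*} [MulAction (Torus r) Y] (σ : Fin k → Circle →ₜ* Torus r)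
    (l : Fin k → Circle) (w : Y × ℝ × (Fin k → ℂ)) : Y × ℝ × (Fin k → ℂ) :=
  ((∏ i, σ i (l i)) • w.1, w.2.1, fun i => (l i : ℂ) * w.2.2 i)

/-- The inverse image of the level set `χ = 0` in the orbifold chart `c × [1, ∞) × ℂᵏ`. -/
def cutLevelChart {n k : ℕ} {Y : Type*} [TopologicalSpace Y] (c : OrbifoldChart (univ : Set (Euc n)) Y)
    (φ : Fin k → Y → ℝ) (α : Fin k → ℝ) : Set (Euc n × ℝ × (Fin k → ℂ)) :=
  {v | v.1 ∈ c.dom ∧ (c.proj v.1, v.2) ∈ cutLevel φ α}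

/-- `p` exhibits the orbifold with boundary `X` as the quotient orbifold `χ⁻¹(0) / (S¹)ᵏ`:
`p` is a continuous open surjection of `χ⁻¹(0)` onto `X` which is equivariant for the torus and
whose fibres are the orbits of `(S¹)ᵏ`, and in charts it lifts to smooth submersions, that is, to
smooth maps `g` with smooth local sections `s`.
The open subsets `{m ∈ U_I, z_i ≠ 0 for i ∉ I} / (S¹)ᵏ` are the local cuts
`{m ∈ U_I, t φ_i(m) < α_i for i ∉ I, t φ_i(m) + |z_i|² = α_i for i ∈ I} / (S¹)ᴵ`, glued together. -/
structure IsCutQuotient {n r k : ℕ} {Y X : Type*} [TopologicalSpace Y] [TopologicalSpace X]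
    [MulAction (Torus r) Y] [MulAction (Torus r) X] (B : Orbifold n Y)
    (A : OrbifoldWithBoundary n X) (σ : Fin k → Circle →ₜ* Torus r)
    (φ : Fin k → Y → ℝ) (α : Fin k → ℝ) (p : Y × ℝ × (Fin k → ℂ) → X) : Prop where
  continuousOn : ContinuousOn p (cutLevel φ α)
  isOpen_image : ∀ O : Set (Y × ℝ × (Fin k → ℂ)), IsOpen O → IsOpen (p '' (cutLevel φ α ∩ O))
  surj : SurjOn p (cutLevel φ α) univ
  equivariant : ∀ (τ : Torus r), ∀ w ∈ cutLevel φ α, p (τ • w.1, w.2) = τ • p w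
  fibre : ∀ w ∈ cutLevel φ α, ∀ w' ∈ cutLevel φ α,
    p w = p w' ↔ ∃ l : Fin k → Circle, cutRotate σ l w = w'
  submersion : ∀ c ∈ B.charts, ∀ c' ∈ A.charts, ∀ w ∈ cutLevelChart c φ α, ∀ y ∈ c'.dom,
    p (c.proj w.1, w.2) = c'.proj y →
      ∃ (g : Euc n × ℝ × (Fin k → ℂ) → Euc (n + 1)) (s : Euc (n + 1) → Euc n × ℝ × (Fin k → ℂ))
        (O : Set (Euc n × ℝ × (Fin k → ℂ))) (O' : Set (Euc (n + 1))),
        IsOpen O ∧ w ∈ O ∧ IsOpen O' ∧ y ∈ O' ∧ g w = y ∧ s y = w ∧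
        ContDiffOn ℝ ∞ g (cutLevelChart c φ α ∩ O) ∧
        (∀ v ∈ cutLevelChart c φ α ∩ O,
          g v ∈ c'.dom ∧ c'.proj (g v) = p (c.proj v.1, v.2)) ∧
        ContDiffOn ℝ ∞ s (c'.dom ∩ O') ∧
        ∀ v ∈ c'.dom ∩ O', s v ∈ cutLevelChart c φ α ∩ O ∧ g (s v) = v

/-- The inclusion of `Y = Y × {1}` in `χ⁻¹(0)`. -/
noncomputable def cutBoundaryPoint {k : ℕ} {Y : Type*} (φ : Fin k → Y → ℝ) (α : Fin k → ℝ) (m : Y) :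
    Y × ℝ × (Fin k → ℂ) :=
  (m, 1, fun i => ((Real.sqrt (α i - φ i m) : ℝ) : ℂ))

/-! Part (1). Let χ(m, t, z) = (α_i - t φ_i(m) - |z_i|²)_i on Σ × [1, ∞) × ℂᵏ. At a zero of χ put J
= {i : z_i = 0}. For i ∈ J the equation gives t φ_i(m) = α_i > 0, hence m ∈ U_J. Two facts follow.
The differential of χ is onto: components with z_i ≠ 0 are adjusted by scaling z_i, those in J by
regularity of the values α_i (`IsCutData.surjective_fderiv_cutFun`). And (S¹)ᵏ acts locally freely:
an infinitesimal stabilizer is supported on J, so it generates a one-parameter group inside S_J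
fixing m. As S_J acts locally freely on U_J this group is trivial, and as dim S_J = |J| the
generators of the S_i, i ∈ J, are independent, so the stabilizer vanishes. Hence there are slices
(`exists_slice`, `IsCutData.exists_cut_slice`). By compactness of (S¹)ᵏ the orbit relation on a
slice comes from finitely many local symmetries (`SmoothAction.exists_slice_symmetries`), and
Bochner averaging (`exists_linearization`) turns these into a finite linear group; this gives the
charts where t > 1. Near t = 1 no z_i vanishes, each z_i can be rotated to a positive real in
exactly one way, and the quotient is a collar Σ × [0, ε). The zero level is compact because t = ∑ t
φ_i ≤ ∑ α_i. The φ_i are obtained by averaging a smooth partition of unity over the torus, and the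
α_i one after the other from Sard's theorem for real functions (`volume_critical_values`).

A chart of the quotient is admitted when the quotient map lifts to it smoothly with smooth local
sections (`IsCutChart`). Compatibility of such charts then rests on the rigidity of lifts: an
element of a chart group is determined by its first jet at one fixed point, and two lifts of one map
differ to first order by a single group element (`exists_fderivWithin_eq`, since a real vector space
is not a finite union of proper subspaces). The same rigidity lifts the torus action to local flows
of ℝʳ on charts (`SmoothAction.exists_isLocalFlow`).

Part (2). The torus has no fixed point on Σ. Otherwise consider, in a chart at such a boundary point
x, the lifts of the N-torsion of the torus together with the chart group. Those fixing x have a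
finite group of linear parts preserving the half space. Averaging the inward normal gives an
invariant inward vector, so these symmetries have common fixed points u in the interior, arbitrarily
close to x (`exists_interior_fixed`). The flow of each coordinate circle returns u to itself after
the short time 2π/N, and a flow near a fixed point has no nonconstant closed orbit of short period
(`deriv_eq_zero_of_periodic`). So all infinitesimal motions vanish at u, and V^φ vanishes at points
of M accumulating at the boundary, against compactness of the vanishing set. Without fixed points on
the compact space Σ, the circle generated by (1, a, a², …) has no fixed point for some a: these
circles become dense as a grows, and a cluster point of fixed points would be fixed by the torus
(`exists_forall_powerVector_not_fixed`). A shear shows that this circle is a factor, and Σ itself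
with this one circle is a good cover. -/

open Filter

/-! ## Calculus within half spaces -/

section Calculus

variable {E F G P : Type*} [NormedAddCommGroup E] [NormedSpace ℝ E]
  [NormedAddCommGroup F] [NormedSpace ℝ F] [NormedAddCommGroup G] [NormedSpace ℝ G]
  [NormedAddCommGroup P] [NormedSpace ℝ P]

/-- The convex sets which at each of their points contain a ray in every direction or in its
opposite direction, such as the whole space and the closed half spaces. -/
structure IsModelSet (s : Set E) : Prop where
  convex : Convex ℝ s
  interior_nonempty : (interior s).Nonempty
  ray : ∀ x ∈ s, ∀ v : E, (∀ᶠ t in 𝓝[>] (0 : ℝ), x + t • v ∈ s) ∨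
    ∀ᶠ t in 𝓝[>] (0 : ℝ), x - t • v ∈ s

theorem IsModelSet.uniqueDiffWithinAt {s : Set E} (hs : IsModelSet s) {x : E} (hx : x ∈ s) :
    UniqueDiffWithinAt ℝ s x :=
  uniqueDiffOn_convex hs.convex hs.interior_nonempty x hx

theorem isModelSet_univ : IsModelSet (univ : Set E) :=
  ⟨convex_univ, by simp, by simp⟩

theorem IsModelSet.univ_prod {s : Set E} (hs : IsModelSet s) :
    IsModelSet ((univ : Set P) ×ˢ s) where
  convex := convex_univ.prod hs.convex
  interior_nonempty := by
    rw [interior_prod_eq, interior_univ]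
    exact univ_nonempty.prod hs.interior_nonempty
  ray := by
    rintro ⟨p, x⟩ ⟨-, hx⟩ ⟨w, v⟩
    rcases hs.ray x hx v with h | h
    · exact Or.inl (h.mono fun t ht => ⟨mem_univ _, ht⟩)
    · exact Or.inr (h.mono fun t ht => ⟨mem_univ _, ht⟩)

theorem isModelSet_halfSpace (n : ℕ) : IsModelSet (halfSpace n) where
  convex := by
    intro x hx y hy a b ha hb _
    simp only [halfSpace, mem_ofPred_eq, PiLp.add_apply, PiLp.smul_apply, smul_eq_mul] at *
    positivity
  interior_nonempty := by
    refine ⟨EuclideanSpace.single 0 1, mem_interior.2 ⟨{x | 0 < x 0}, ?_, ?_, ?_⟩⟩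
    · intro x hx
      exact le_of_lt (by simpa using hx)
    · exact isOpen_lt continuous_const (by fun_prop)
    · simp
  ray := by
    intro x hx v
    simp only [halfSpace, mem_ofPred_eq, PiLp.add_apply, PiLp.smul_apply, smul_eq_mul,
      PiLp.sub_apply] at *
    rcases le_total 0 (v 0) with h | h
    · refine Or.inl (eventually_mem_nhdsWithin.mono fun t (ht : 0 < t) => ?_)
      positivity
    · refine Or.inr (eventually_mem_nhdsWithin.mono fun t (ht : 0 < t) => ?_)
      nlinarith

/-- A function which near each point agrees with a member of a finite family agrees to first order
with a single member. -/
theorem exists_fderivWithin_eq {ι : Type*} [Finite ι] {f : P → F} {g : ι → P → F} {s : Set P} {p : P}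
    (hray : ∀ v : P, (∀ᶠ t in 𝓝[>] (0 : ℝ), p + t • v ∈ s) ∨ ∀ᶠ t in 𝓝[>] (0 : ℝ), p - t • v ∈ s)
    {f' : P →L[ℝ] F} {g' : ι → P →L[ℝ] F} (hf : HasFDerivWithinAt f f' s p)
    (hg : ∀ a, HasFDerivWithinAt (g a) (g' a) s p)
    (h : ∀ᶠ q in 𝓝[s] p, ∃ a, f q = g a q) : ∃ a, f p = g a p ∧ f' = g' a := by
  -- Along the points p + v/(n+1) some member of the finite family agrees with `f` infinitely often,
  -- by pigeonhole. On that subsequence the difference quotients coincide, and so do their limits.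
  have key : ∀ v : P, (∀ᶠ t in 𝓝[>] (0 : ℝ), p + t • v ∈ s) → ∃ a, f p = g a p ∧ f' v = g' a v := by
    intro v hv
    have hseq : Tendsto (fun n : ℕ => 1 / ((n : ℝ) + 1)) atTop (𝓝[>] 0) :=
      tendsto_nhdsWithin_iff.2 ⟨tendsto_one_div_add_atTop_nhds_zero_nat,
        Eventually.of_forall fun n => by simp only [mem_Ioi]; positivity⟩
    have h1 : Tendsto (fun t : ℝ => p + t • v) (𝓝[>] 0) (𝓝[s] p) := by
      refine tendsto_nhdsWithin_iff.2 ⟨?_, hv⟩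
      have : Tendsto (fun t : ℝ => p + t • v) (𝓝 0) (𝓝 (p + (0 : ℝ) • v)) := by
        apply Continuous.tendsto; fun_prop
      simpa using this.mono_left nhdsWithin_le_nhds
    have h2 := (h1.comp hseq).eventually h
    have h3 : ∃ a, ∃ᶠ n : ℕ in atTop, f (p + (1 / ((n : ℝ) + 1)) • v) =
        g a (p + (1 / ((n : ℝ) + 1)) • v) := by
      by_contra hcon
      push Not at hcon
      have := eventually_all.2 hcon
      obtain ⟨n, hn1, hn2⟩ := (this.and h2).exists
      obtain ⟨a, ha⟩ := hn2
      exact hn1 a ha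
    obtain ⟨a, ha⟩ := h3
    obtain ⟨φ, hφ, hφa⟩ := extraction_of_frequently_atTop ha
    have hs2 : Tendsto (fun n : ℕ => p + (1 / ((φ n : ℝ) + 1)) • v) atTop (𝓝[s] p) :=
      (h1.comp hseq).comp hφ.tendsto_atTop
    have e1 : f p = g a p := by
      have t1 := hf.continuousWithinAt.tendsto.comp hs2
      have t2 := (hg a).continuousWithinAt.tendsto.comp hs2
      refine tendsto_nhds_unique t1 (t2.congr fun n => (hφa n).symm)
    refine ⟨a, e1, ?_⟩
    have hlim : ∀ {k : P → F} {k' : P →L[ℝ] F}, HasFDerivWithinAt k k' s p →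
        Tendsto (fun n : ℕ => ((φ n : ℝ) + 1) • (k (p + (1 / ((φ n : ℝ) + 1)) • v) - k p)) atTop
          (𝓝 (k' v)) := by
      intro k k' hk
      refine hk.lim (l := atTop) (c := fun n => (φ n : ℝ) + 1)
        (d := fun n => (1 / ((φ n : ℝ) + 1)) • v) (v := v) ?_ ?_ ?_
      · have := (tendsto_nhdsWithin_iff.1 hs2).1.sub_const p
        simpa using this
      · exact (tendsto_nhdsWithin_iff.1 hs2).2
      · refine tendsto_const_nhds.congr fun n => ?_
        rw [smul_smul, mul_one_div_cancel (by positivity), one_smul]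
    refine tendsto_nhds_unique (hlim hf) ((hlim (hg a)).congr fun n => ?_)
    have : f (p + (1 / ((φ n : ℝ) + 1)) • v) = g a (p + (1 / ((φ n : ℝ) + 1)) • v) := hφa n
    rw [this, e1]
  -- The member found depends on the direction. Its kernels of `f' - g' a` therefore only cover `P`
  -- jointly, and a finite union of subspaces equal to the whole space contains the whole space as a
  -- member.
  have hcov : ⋃ a : {a // f p = g a p}, ((LinearMap.ker (f' - g' a).toLinearMap : Submodule ℝ P) :
      Set P) = univ := by
    refine eq_univ_of_forall fun v => ?_
    simp only [mem_iUnion, SetLike.mem_coe, LinearMap.mem_ker]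
    rcases hray v with hv | hv
    · obtain ⟨a, ha, h⟩ := key v hv
      exact ⟨⟨a, ha⟩, by simp [h]⟩
    · obtain ⟨a, ha, h⟩ := key (-v) (by simpa [sub_eq_add_neg] using hv)
      refine ⟨⟨a, ha⟩, ?_⟩
      have : f' v = g' a v := by simpa using h
      simp [this]
  obtain ⟨⟨a, ha⟩, htop⟩ := Subspace.exists_eq_top_of_iUnion_eq_univ hcov
  refine ⟨a, ha, ?_⟩
  ext v
  have : v ∈ LinearMap.ker (f' - g' a).toLinearMap := by rw [htop]; trivial
  simpa [sub_eq_zero] using this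

/-- Strict differentiability of `C¹` functions within convex sets. -/
theorem ContDiffWithinAt.eventually_approx {s : Set E} (hs : IsModelSet s) {x : E} (hx : x ∈ s)
    {f : E → F} {f' : E →L[ℝ] F} (hf : ContDiffWithinAt ℝ 1 f s x)
    (hf' : HasFDerivWithinAt f f' s x) {c : ℝ} (hc : 0 < c) :
    ∃ ε > 0, ∀ y ∈ s ∩ Metric.ball x ε, ∀ z ∈ s ∩ Metric.ball x ε,
      ‖f y - f z - f' (y - z)‖ ≤ c * ‖y - z‖ := by
  obtain ⟨u, hu, hus, -, D, hD, hDc⟩ :=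
    (contDiffWithinAt_succ_iff_hasFDerivWithinAt' (n := 0) (by simp)).1
      (by simpa using hf)
  rw [insert_eq_of_mem hx] at hu hus
  have hDx : D x = f' :=
    (hs.uniqueDiffWithinAt hx).eq (hD x (mem_of_mem_nhdsWithin hx hu)) hf'
  have h1 : ∀ᶠ y in 𝓝[s] x, y ∈ u ∧ ‖D y - f'‖ < c := by
    refine Filter.Eventually.and hu ?_
    have := hDc.continuousWithinAt.tendsto
    rw [hDx] at this
    filter_upwards [this (Metric.ball_mem_nhds f' hc)] with y hy
    simpa [dist_eq_norm] using hy
  obtain ⟨ε, hε, h2⟩ := Metric.mem_nhdsWithin_iff.1 h1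
  refine ⟨ε, hε, fun y hy z hz => ?_⟩
  have hconv : Convex ℝ (s ∩ Metric.ball x ε) := hs.convex.inter (convex_ball x ε)
  exact hconv.norm_image_sub_le_of_norm_hasFDerivWithin_le' (f' := D)
    (fun w hw => (hD w (h2 ⟨hw.2, hw.1⟩).1).mono inter_subset_left)
    (fun w hw => (h2 ⟨hw.2, hw.1⟩).2.le) hz hy

/-- A `C¹` function with invertible derivative is locally injective. -/
theorem ContDiffWithinAt.eventually_injective {s : Set E} (hs : IsModelSet s) {x : E} (hx : x ∈ s)
    {f : E → F} {f' : E ≃L[ℝ] F} (hf : ContDiffWithinAt ℝ 1 f s x)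
    (hf' : HasFDerivWithinAt f (f' : E →L[ℝ] F) s x) :
    ∃ ε > 0, ∀ y ∈ s ∩ Metric.ball x ε, ∀ z ∈ s ∩ Metric.ball x ε, f y = f z → y = z := by
  set K : ℝ := ‖(f'.symm : F →L[ℝ] E)‖ + 1 with hK
  have hKpos : 0 < K := by positivity
  -- With error 1/(2K), where K exceeds the norm of the inverse, two points with the same image
  -- satisfy ‖y - z‖ ≤ ‖y - z‖ / 2.
  obtain ⟨ε, hε, h⟩ := hf.eventually_approx hs hx hf' (c := 1 / (2 * K)) (by positivity)
  refine ⟨ε, hε, fun y hy z hz hyz => ?_⟩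
  have h1 := h y hy z hz
  rw [hyz, sub_self, zero_sub, norm_neg] at h1
  have h2 : ‖y - z‖ ≤ K * ‖f' (y - z)‖ := by
    calc ‖y - z‖ = ‖(f'.symm : F →L[ℝ] E) (f' (y - z))‖ := by simp
      _ ≤ ‖(f'.symm : F →L[ℝ] E)‖ * ‖f' (y - z)‖ := ContinuousLinearMap.le_opNorm _ _
      _ ≤ K * ‖f' (y - z)‖ := by gcongr; simp [hK]
  have h3 : ‖y - z‖ ≤ 1 / 2 * ‖y - z‖ := by
    calc ‖y - z‖ ≤ K * ‖f' (y - z)‖ := h2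
      _ ≤ K * (1 / (2 * K) * ‖y - z‖) := by gcongr; exact h1
      _ = 1 / 2 * ‖y - z‖ := by field_simp
  have : ‖y - z‖ = 0 := by linarith [norm_nonneg (y - z)]
  exact sub_eq_zero.1 (norm_eq_zero.1 this)

end Calculus

/-! ## Linearization of local symmetries -/

section LocalSymm

variable {E : Type*} [NormedAddCommGroup E] [NormedSpace ℝ E] {W : Type*}

/-- A local symmetry of `q` on `s` at the fixed point `x`. -/
structure IsLocalSymm (q : E → W) (s : Set E) (x : E) (k : E → E) : Prop where
  fix : k x = x
  smooth : ContDiffWithinAt ℝ 1 k s x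
  maps : ∀ᶠ y in 𝓝[s] x, k y ∈ s
  invariant : ∀ᶠ y in 𝓝[s] x, q (k y) = q y

variable {q : E → W} {s : Set E} {x : E}

theorem IsLocalSymm.tendsto {k : E → E} (hk : IsLocalSymm q s x k) : Tendsto k (𝓝[s] x) (𝓝[s] x) := by
  refine tendsto_nhdsWithin_iff.2 ⟨?_, hk.maps⟩
  simpa [hk.fix] using hk.smooth.continuousWithinAt.tendsto

theorem IsLocalSymm.refl : IsLocalSymm q s x id :=
  ⟨rfl, contDiffWithinAt_id, eventually_mem_nhdsWithin, by simp⟩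

theorem IsLocalSymm.comp {k l : E → E} (hk : IsLocalSymm q s x k) (hl : IsLocalSymm q s x l) :
    IsLocalSymm q s x (k ∘ l) where
  fix := by simp [hl.fix, hk.fix]
  smooth := by
    refine ContDiffWithinAt.comp_of_preimage_mem_nhdsWithin (t := s) x ?_ hl.smooth hl.maps
    rw [hl.fix]; exact hk.smooth
  maps := hl.tendsto.eventually hk.maps
  invariant := by
    filter_upwards [hl.invariant, hl.tendsto.eventually hk.invariant] with y h1 h2
    simp [h1, h2]

theorem IsLocalSymm.iterate {k : E → E} (hk : IsLocalSymm q s x k) (n : ℕ) :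
    IsLocalSymm q s x (k^[n]) := by
  induction n with
  | zero => exact IsLocalSymm.refl
  | succ n ih => rw [Function.iterate_succ']; exact hk.comp ih

theorem IsLocalSymm.hasFDerivWithinAt_comp {k l : E → E} (hl : IsLocalSymm q s x l)
    {k' l' : E →L[ℝ] E} (hk' : HasFDerivWithinAt k k' s x) (hl' : HasFDerivWithinAt l l' s x) :
    HasFDerivWithinAt (k ∘ l) (k'.comp l') s x := by
  refine HasFDerivWithinAt.comp_of_tendsto (t := s) x (by rwa [hl.fix]) hl' ?_
  rw [hl.fix]; exact hl.tendsto

theorem IsLocalSymm.differentiable {k : E → E} (hk : IsLocalSymm q s x k) :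
    HasFDerivWithinAt k (fderivWithin ℝ k s x) s x :=
  (hk.smooth.differentiableWithinAt (by simp)).hasFDerivWithinAt

/-- Local injectivity allows a map with invertible derivative to be cancelled on the left.
Identities between germs of symmetries are proved by composing with such a map and cancelling it. -/
theorem HasFDerivWithinAt.eventually_eq_of_injective [FiniteDimensional ℝ E]
    (hs : IsModelSet s) (hx : x ∈ s) {f : E → E} {f' : E ≃L[ℝ] E} (hf : ContDiffWithinAt ℝ 1 f s x)
    (hf' : HasFDerivWithinAt f (f' : E →L[ℝ] E) s x) {α : Type*} {l : Filter α} {k k' : α → E}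
    (hk : Tendsto k l (𝓝[s] x)) (hk' : Tendsto k' l (𝓝[s] x))
    (h : ∀ᶠ a in l, f (k a) = f (k' a)) : ∀ᶠ a in l, k a = k' a := by
  obtain ⟨ε, hε, hinj⟩ := hf.eventually_injective hs hx hf'
  have hb := inter_mem_nhdsWithin s (Metric.ball_mem_nhds x hε)
  filter_upwards [hk hb, hk' hb, h] with a h1 h2 h3 using hinj _ h1 _ h2 h3

/-- A local symmetry with trivial linear part is trivial, if the equivalence relation `q y = q z` is
given by a finite family of maps. -/
theorem IsLocalSymm.eventually_eq_of_fderiv_eq_id [FiniteDimensional ℝ E] (hs : IsModelSet s)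
    (hx : x ∈ s) {ι : Type*} [Finite ι] {h : ι → E → E}
    (hcov : ∀ᶠ p in 𝓝[s] x ×ˢ 𝓝[s] x, q p.1 = q p.2 → ∃ a, h a p.1 = p.2)
    {k : E → E} (hk : IsLocalSymm q s x k)
    (hk' : HasFDerivWithinAt k (ContinuousLinearMap.id ℝ E) s x) : ∀ᶠ y in 𝓝[s] x, k y = y := by
  have hiter : ∀ n, HasFDerivWithinAt (k^[n]) (ContinuousLinearMap.id ℝ E) s x := by
    intro n
    induction n with
    | zero => exact hasFDerivWithinAt_id x s
    | succ n ih =>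
      rw [Function.iterate_succ']
      simpa using (hk.iterate n).hasFDerivWithinAt_comp hk' ih
  cases nonempty_fintype ι
  set M := Fintype.card ι
  set N := M.factorial
  -- Among the M + 1 points y, k y, …, k^M y, all of the form `h a y`, two have the same index `a`.
  -- Cancelling an iterate gives y a period between 1 and M, which divides N = M!.
  have hNper : ∀ᶠ y in 𝓝[s] x, k^[N] y = y := by
    have h1 : ∀ n, ∀ᶠ y in 𝓝[s] x, q (k^[n] y) = q y ∧ ∃ a, h a y = k^[n] y := by
      intro n
      have ht : Tendsto (fun y => (y, k^[n] y)) (𝓝[s] x) (𝓝[s] x ×ˢ 𝓝[s] x) :=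
        tendsto_id.prodMk (hk.iterate n).tendsto
      filter_upwards [(hk.iterate n).invariant, ht.eventually hcov] with y h2 h3
      exact ⟨h2, h3 h2.symm⟩
    have h2 : ∀ᶠ y in 𝓝[s] x, ∀ i ∈ Finset.range (M + 1), ∀ j ∈ Finset.range (M + 1),
        k^[i] y = k^[i] (k^[j] y) → y = k^[j] y := by
      rw [Finset.eventually_all]
      intro i _
      rw [Finset.eventually_all]
      intro j _
      obtain ⟨ε, hε, hinj⟩ := (hk.iterate i).smooth.eventually_injective hs hx
        (f' := ContinuousLinearEquiv.refl ℝ E) (hiter i)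
      have hb := inter_mem_nhdsWithin s (Metric.ball_mem_nhds x hε)
      filter_upwards [hb, (hk.iterate j).tendsto hb] with y hy1 hy2 hy3
      exact hinj _ hy1 _ hy2 hy3
    have h3 : ∀ᶠ y in 𝓝[s] x, ∀ n ∈ Finset.range (M + 1), ∃ a, h a y = k^[n] y :=
      (Finset.eventually_all _).2 fun n _ => (h1 n).mono fun y hy => hy.2
    filter_upwards [h2, h3] with y hy2 hy3
    have : Nonempty ι := ⟨(hy3 0 (by simp)).choose⟩
    choose! a ha using hy3
    obtain ⟨i, hi, j, hj, hij, heq⟩ : ∃ i ∈ Finset.range (M + 1), ∃ j ∈ Finset.range (M + 1),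
        i < j ∧ a i = a j := by
      obtain ⟨i, hi, j, hj, hne, heq⟩ := Finset.exists_ne_map_eq_of_card_lt_of_maps_to
        (s := Finset.range (M + 1)) (t := (Finset.univ : Finset ι)) (by simp [M]) (f := a)
        (fun i _ => Finset.mem_univ (a i))
      rcases lt_or_gt_of_ne hne with h | h
      · exact ⟨i, hi, j, hj, h, heq⟩
      · exact ⟨j, hj, i, hi, h, heq.symm⟩
    have h4 : k^[i] y = k^[i] (k^[j - i] y) := by
      rw [← Function.iterate_add_apply, Nat.add_sub_cancel' hij.le, ← ha i hi, ← ha j hj, heq]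
    simp only [Finset.mem_range] at hi hj
    have h5 : y = k^[j - i] y := hy2 i (by simpa using hi) (j - i) (by simp; omega) h4
    have h6 : Function.IsPeriodicPt k (j - i) y := h5.symm
    obtain ⟨d, hd⟩ : (j - i) ∣ N := Nat.dvd_factorial (by omega) (by omega)
    rw [hd]
    exact h6.mul_const d
  -- The sum over one full period is invariant under `k` and has derivative N · id, so cancelling it
  -- in ψ (k y) = ψ y gives k y = y.
  set ψ : E → E := fun y => ∑ i ∈ Finset.range N, k^[i] y with hψ
  have hNpos : (N : ℝ) ≠ 0 := by exact_mod_cast (Nat.factorial_pos M).ne'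
  have hψ1 : ContDiffWithinAt ℝ 1 ψ s x := ContDiffWithinAt.sum fun i _ => (hk.iterate i).smooth
  have hψ2 : HasFDerivWithinAt ψ ((ContinuousLinearEquiv.smulLeft (Units.mk0 (N : ℝ) hNpos) :
      E ≃L[ℝ] E) : E →L[ℝ] E) s x := by
    have := HasFDerivWithinAt.fun_sum (u := Finset.range N) fun i _ => hiter i
    convert this using 1
    ext v
    simp [Units.smul_def, Nat.cast_smul_eq_nsmul]
  refine HasFDerivWithinAt.eventually_eq_of_injective hs hx hψ1 hψ2 hk.tendsto tendsto_id ?_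
  filter_upwards [hNper] with y hy
  simp only [hψ]
  have e1 := Finset.sum_range_succ' (fun i => k^[i] y) N
  have e2 := Finset.sum_range_succ (fun i => k^[i] y) N
  rw [e2, hy] at e1
  rw [Function.iterate_zero_apply] at e1
  rw [add_right_cancel e1]
  refine Finset.sum_congr rfl fun i _ => ?_
  rw [Function.iterate_succ_apply]

end LocalSymm

/-! ### Finite groups of linear parts and Bochner linearization. -/

section LocalSymm

variable {E : Type*} [NormedAddCommGroup E] [NormedSpace ℝ E] {W : Type*}
  {q : E → W} {s : Set E} {x : E}

omit [NormedSpace ℝ E] in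
/-- Members of a finite family which do not fix `x` are irrelevant near `x`. -/
theorem eventually_exists_subtype {ι : Type*} [Finite ι] {h : ι → E → E}
    (hcont : ∀ a, Tendsto (h a) (𝓝[s] x) (𝓝 (h a x)))
    (hcov : ∀ᶠ p in 𝓝[s] x ×ˢ 𝓝[s] x, q p.1 = q p.2 → ∃ a, h a p.1 = p.2) :
    ∀ᶠ p in 𝓝[s] x ×ˢ 𝓝[s] x, q p.1 = q p.2 → ∃ a : {a // h a x = x}, h a p.1 = p.2 := by
  have h1 : ∀ᶠ p in 𝓝[s] x ×ˢ 𝓝[s] x, ∀ a, h a x ≠ x → h a p.1 ≠ p.2 := by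
    rw [eventually_all]
    intro a
    by_cases ha : h a x = x
    · simp [ha]
    · have t1 : Tendsto (fun p : E × E => h a p.1) (𝓝[s] x ×ˢ 𝓝[s] x) (𝓝 (h a x)) :=
        (hcont a).comp tendsto_fst
      have t2 : Tendsto (fun p : E × E => p.2) (𝓝[s] x ×ˢ 𝓝[s] x) (𝓝 x) :=
        tendsto_snd.mono_right nhdsWithin_le_nhds
      have hopen : {z : E × E | z.1 ≠ z.2} ∈ 𝓝 (h a x, x) :=
        (isOpen_ne_fun continuous_fst continuous_snd).mem_nhds ha
      filter_upwards [(t1.prodMk_nhds t2) hopen] with p hp _ using hp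
  filter_upwards [hcov, h1] with p k1 k2 k3
  obtain ⟨a, ha⟩ := k1 k3
  exact ⟨⟨a, by_contra fun hne => k2 a hne ha⟩, ha⟩

/-- Pointwise `k` is given by members of the family, with an index that may jump; to first order a
single index suffices by `exists_fderivWithin_eq`. -/
theorem IsLocalSymm.exists_fderiv_eq (hs : IsModelSet s) (hx : x ∈ s) {ι : Type*} [Finite ι]
    {h : ι → E → E} (hh : ∀ a, IsLocalSymm q s x (h a))
    (hcov : ∀ᶠ p in 𝓝[s] x ×ˢ 𝓝[s] x, q p.1 = q p.2 → ∃ a, h a p.1 = p.2)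
    {k : E → E} (hk : IsLocalSymm q s x k) {k' : E →L[ℝ] E} (hk' : HasFDerivWithinAt k k' s x) :
    ∃ a, HasFDerivWithinAt (h a) k' s x := by
  have ht : Tendsto (fun y => (y, k y)) (𝓝[s] x) (𝓝[s] x ×ˢ 𝓝[s] x) := tendsto_id.prodMk hk.tendsto
  have h1 : ∀ᶠ y in 𝓝[s] x, ∃ a, k y = h a y := by
    filter_upwards [ht.eventually hcov, hk.invariant] with y hy1 hy2
    obtain ⟨a, ha⟩ := hy1 hy2.symm
    exact ⟨a, ha.symm⟩
  obtain ⟨a, -, ha⟩ := exists_fderivWithin_eq (hs.ray x hx) hk' (fun a => (hh a).differentiable) h1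
  exact ⟨a, ha ▸ (hh a).differentiable⟩

/-- The covering hypothesis is applied to the pair (k y, y) instead of (y, k y), so that some member
composed with `k` is the identity to first order. This is the source of inverses in the group of
linear parts. -/
theorem IsLocalSymm.exists_left_inverse (hs : IsModelSet s) (hx : x ∈ s) {ι : Type*} [Finite ι]
    {h : ι → E → E} (hh : ∀ a, IsLocalSymm q s x (h a))
    (hcov : ∀ᶠ p in 𝓝[s] x ×ˢ 𝓝[s] x, q p.1 = q p.2 → ∃ a, h a p.1 = p.2)
    {k : E → E} (hk : IsLocalSymm q s x k) {k' : E →L[ℝ] E} (hk' : HasFDerivWithinAt k k' s x) :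
    ∃ a, ∃ h' : E →L[ℝ] E, HasFDerivWithinAt (h a) h' s x ∧
      h'.comp k' = ContinuousLinearMap.id ℝ E := by
  have ht : Tendsto (fun y => (k y, y)) (𝓝[s] x) (𝓝[s] x ×ˢ 𝓝[s] x) := hk.tendsto.prodMk tendsto_id
  have h1 : ∀ᶠ y in 𝓝[s] x, ∃ a, id y = (h a ∘ k) y := by
    filter_upwards [ht.eventually hcov, hk.invariant] with y hy1 hy2
    obtain ⟨a, ha⟩ := hy1 hy2
    exact ⟨a, ha.symm⟩
  obtain ⟨a, -, ha⟩ := exists_fderivWithin_eq (hs.ray x hx) (hasFDerivWithinAt_id x s)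
    (fun a => hk.hasFDerivWithinAt_comp (hh a).differentiable hk') h1
  exact ⟨a, _, (hh a).differentiable, ha.symm⟩

/-- The group of linear parts of the local symmetries. -/
def linearParts (hs : IsModelSet s) (hx : x ∈ s) {ι : Type*} [Finite ι]
    {h : ι → E → E} (hh : ∀ a, IsLocalSymm q s x (h a))
    (hcov : ∀ᶠ p in 𝓝[s] x ×ˢ 𝓝[s] x, q p.1 = q p.2 → ∃ a, h a p.1 = p.2) :
    Subgroup (E ≃L[ℝ] E) where
  carrier := {g | ∃ k, IsLocalSymm q s x k ∧ HasFDerivWithinAt k (g : E →L[ℝ] E) s x}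
  mul_mem' := by
    rintro g g' ⟨k, hk, hk'⟩ ⟨l, hl, hl'⟩
    exact ⟨k ∘ l, hk.comp hl, hl.hasFDerivWithinAt_comp hk' hl'⟩
  one_mem' := ⟨id, IsLocalSymm.refl, hasFDerivWithinAt_id x s⟩
  inv_mem' := by
    rintro g ⟨k, hk, hk'⟩
    obtain ⟨a, h', ha, hcomp⟩ := hk.exists_left_inverse hs hx hh hcov hk'
    refine ⟨h a, hh a, ?_⟩
    convert ha using 1
    ext v
    have := congrArg (fun T : E →L[ℝ] E => T (g⁻¹ v)) hcomp
    have e : g (g⁻¹ v) = v := g.apply_symm_apply v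
    simp only [ContinuousLinearMap.comp_apply, ContinuousLinearEquiv.coe_coe, e,
      ContinuousLinearMap.id_apply] at this
    exact this.symm

/-- Bochner's linearization: near a fixed point, an equivalence relation given by a finite family of
local symmetries is, in suitable coordinates, given by a finite group of linear maps. -/
theorem exists_linearization [FiniteDimensional ℝ E] (hs : IsModelSet s) (hx : x ∈ s) {ι : Type*}
    [Finite ι] {h : ι → E → E} (hh : ∀ a, IsLocalSymm q s x (h a))
    (hcov : ∀ᶠ p in 𝓝[s] x ×ˢ 𝓝[s] x, q p.1 = q p.2 → ∃ a, h a p.1 = p.2) :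
    ∃ (Γ : Subgroup (E ≃L[ℝ] E)) (_ : Fintype Γ) (b : Γ → ι) (ψ : E → E),
      (∀ g : Γ, HasFDerivWithinAt (h (b g)) ((g : E ≃L[ℝ] E) : E →L[ℝ] E) s x) ∧
      (ψ = fun y => ∑ g : Γ, (g : E ≃L[ℝ] E).symm (h (b g) y - x)) ∧
      (∃ ψ' : E ≃L[ℝ] E, (∀ v, ψ' v = (Fintype.card Γ : ℝ) • v) ∧
        HasFDerivWithinAt ψ (ψ' : E →L[ℝ] E) s x) ∧
      (∀ a, ∃ g, ∀ᶠ y in 𝓝[s] x, h a y = h (b g) y) ∧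
      (∀ g : Γ, ∀ᶠ y in 𝓝[s] x, ψ (h (b g) y) = (g : E ≃L[ℝ] E) (ψ y)) ∧
      ∀ᶠ p in 𝓝[s] x ×ˢ 𝓝[s] x, q p.1 = q p.2 ↔ ∃ g : Γ, (g : E ≃L[ℝ] E) (ψ p.1) = ψ p.2 := by
  set Γ := linearParts hs hx hh hcov
  have hΓ : ∀ g : Γ, ∃ a, HasFDerivWithinAt (h a) ((g : E ≃L[ℝ] E) : E →L[ℝ] E) s x := by
    rintro ⟨g, k, hk, hk'⟩
    exact hk.exists_fderiv_eq hs hx hh hcov hk'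
  choose b hb using hΓ
  -- A member of the family has only one derivative at x, so the linear parts inject into the finite
  -- index set.
  have hbinj : Function.Injective b := by
    intro g g' hgg
    have h1 := hb g
    rw [hgg] at h1
    have h2 := (hs.uniqueDiffWithinAt hx).eq h1 (hb g')
    exact Subtype.ext (ContinuousLinearEquiv.coe_injective h2)
  have : Finite Γ := Finite.of_injective b hbinj
  have hfin : Fintype Γ := Fintype.ofFinite Γ
  -- The linear part determines the germ: composition with the member belonging to g⁻¹ gives
  -- symmetries with trivial linear part, which are trivial, and that member can then be cancelled.
  have huniq : ∀ (g : Γ) (k l : E → E), IsLocalSymm q s x k → IsLocalSymm q s x l →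
      HasFDerivWithinAt k ((g : E ≃L[ℝ] E) : E →L[ℝ] E) s x →
      HasFDerivWithinAt l ((g : E ≃L[ℝ] E) : E →L[ℝ] E) s x → ∀ᶠ y in 𝓝[s] x, k y = l y := by
    intro g k l hk hl hk' hl'
    have hm := hh (b g⁻¹)
    have hm' := hb g⁻¹
    have aux : ∀ k : E → E, IsLocalSymm q s x k →
        HasFDerivWithinAt k ((g : E ≃L[ℝ] E) : E →L[ℝ] E) s x →
        ∀ᶠ y in 𝓝[s] x, h (b g⁻¹) (k y) = y := by
      intro k hk hk'
      refine (hm.comp hk).eventually_eq_of_fderiv_eq_id hs hx hcov ?_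
      convert hk.hasFDerivWithinAt_comp hm' hk' using 1
      ext v
      exact ((g : E ≃L[ℝ] E).symm_apply_apply v).symm
    refine HasFDerivWithinAt.eventually_eq_of_injective hs hx hm.smooth hm' hk.tendsto hl.tendsto ?_
    filter_upwards [aux k hk hk', aux l hl hl'] with y h1 h2
    rw [h1, h2]
  -- Bochner's average of g⁻¹ ∘ h_g. Each summand has derivative the identity, and the germ identity
  -- h_g ∘ h_g' = h_gg' makes the sum intertwine h_g' with g'.
  set ψ : E → E := fun y => ∑ g : Γ, (g : E ≃L[ℝ] E).symm (h (b g) y - x) with hψ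
  have hψs : ContDiffWithinAt ℝ 1 ψ s x := by
    refine ContDiffWithinAt.sum fun g _ => ?_
    exact ((g : E ≃L[ℝ] E).symm.contDiff.contDiffAt).comp_contDiffWithinAt x
      ((hh (b g)).smooth.sub contDiffWithinAt_const)
  have hcard : (Fintype.card Γ : ℝ) ≠ 0 := by exact_mod_cast Fintype.card_ne_zero
  have hψ' : HasFDerivWithinAt ψ ((ContinuousLinearEquiv.smulLeft (Units.mk0 (Fintype.card Γ : ℝ)
      hcard) : E ≃L[ℝ] E) : E →L[ℝ] E) s x := by
    have := HasFDerivWithinAt.fun_sum (u := (Finset.univ : Finset Γ)) fun g _ =>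
      ((g : E ≃L[ℝ] E).symm : E →L[ℝ] E).hasFDerivAt.comp_hasFDerivWithinAt x
        ((hb g).sub_const x)
    refine HasFDerivWithinAt.congr_fderiv (f := ψ) this ?_
    ext v
    simp [Units.smul_def, Nat.cast_smul_eq_nsmul]
  have heq : ∀ g' : Γ, ∀ᶠ y in 𝓝[s] x, ψ (h (b g') y) = (g' : E ≃L[ℝ] E) (ψ y) := by
    intro g'
    have h1 : ∀ᶠ y in 𝓝[s] x, ∀ g : Γ, h (b g) (h (b g') y) = h (b (g * g')) y := by
      rw [eventually_all]
      intro g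
      exact huniq (g * g') _ _ ((hh _).comp (hh _)) (hh _)
        ((hh _).hasFDerivWithinAt_comp (hb g) (hb g')) (hb _)
    filter_upwards [h1] with y hy
    simp only [hψ, map_sum, hy]
    refine Fintype.sum_equiv (Equiv.mulRight g') _ _ fun g => ?_
    simp only [Equiv.coe_mulRight]
    have e : ((g * g' : Γ) : E ≃L[ℝ] E) = (g : E ≃L[ℝ] E) * g' := rfl
    generalize h (b (g * g')) y - x = w
    rw [e, ContinuousLinearEquiv.symm_apply_eq]
    have e2 : ∀ z, ((g : E ≃L[ℝ] E) * (g' : E ≃L[ℝ] E)) z = (g : E ≃L[ℝ] E) ((g' : E ≃L[ℝ] E) z) :=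
      fun _ => rfl
    rw [← e2, ContinuousLinearEquiv.apply_symm_apply]
  -- The derivative of `h a` has a left inverse, so it is invertible in finite dimension and itself
  -- belongs to Γ; uniqueness of germs does the rest.
  have hall : ∀ a, ∃ g, ∀ᶠ y in 𝓝[s] x, h a y = h (b g) y := by
    intro a
    obtain ⟨c, h', hc, hcomp⟩ := (hh a).exists_left_inverse hs hx hh hcov (hh a).differentiable
    have hinj : Function.Injective (fderivWithin ℝ (h a) s x) := by
      intro v w hvw
      have := congrArg h' hvw
      have e : ∀ v, h' (fderivWithin ℝ (h a) s x v) = v := fun v =>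
        congrArg (fun T : E →L[ℝ] E => T v) hcomp
      rwa [e, e] at this
    let g : E ≃L[ℝ] E := (LinearEquiv.ofInjectiveEndo
      (fderivWithin ℝ (h a) s x).toLinearMap hinj).toContinuousLinearEquiv
    have hg : (g : E →L[ℝ] E) = fderivWithin ℝ (h a) s x := by
      ext v; rfl
    have hgd : HasFDerivWithinAt (h a) (g : E →L[ℝ] E) s x := hg ▸ (hh a).differentiable
    refine ⟨⟨g, h a, hh a, hgd⟩, ?_⟩
    exact huniq ⟨g, h a, hh a, hgd⟩ _ _ (hh a) (hh _) hgd (hb _)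
  refine ⟨Γ, hfin, b, ψ, hb, rfl, ⟨_, fun v => rfl, hψ'⟩, hall, heq, ?_⟩
  have h1 : ∀ᶠ p in 𝓝[s] x ×ˢ 𝓝[s] x, ∀ a, ∃ g : Γ, h a p.1 = h (b g) p.1 := by
    cases nonempty_fintype ι
    rw [eventually_all]
    intro a
    obtain ⟨g, hg⟩ := hall a
    exact (tendsto_fst.eventually hg).mono fun p hp => ⟨g, hp⟩
  have h2 : ∀ᶠ p in 𝓝[s] x ×ˢ 𝓝[s] x, ∀ g : Γ, ψ (h (b g) p.1) = (g : E ≃L[ℝ] E) (ψ p.1) :=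
    eventually_all.2 fun g => tendsto_fst.eventually (heq g)
  have h3 : ∀ᶠ p in 𝓝[s] x ×ˢ 𝓝[s] x, ∀ g : Γ, q (h (b g) p.1) = q p.1 :=
    eventually_all.2 fun g => tendsto_fst.eventually (hh (b g)).invariant
  have h4 : ∀ᶠ p in 𝓝[s] x ×ˢ 𝓝[s] x, ∀ g : Γ, ψ (h (b g) p.1) = ψ p.2 → h (b g) p.1 = p.2 := by
    rw [eventually_all]
    intro g
    obtain ⟨ε, hε, hinj⟩ := hψs.eventually_injective hs hx hψ'
    have hball := inter_mem_nhdsWithin s (Metric.ball_mem_nhds x hε)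
    filter_upwards [tendsto_fst.eventually ((hh (b g)).tendsto hball), tendsto_snd.eventually hball]
      with p hp1 hp2 hp3
    exact hinj _ hp1 _ hp2 hp3
  filter_upwards [hcov, h1, h2, h3, h4] with p k1 k2 k3 k4 k5
  constructor
  · intro hq
    obtain ⟨a, ha⟩ := k1 hq
    obtain ⟨g, hg⟩ := k2 a
    exact ⟨g, by rw [← k3, ← hg, ha]⟩
  · rintro ⟨g, hg⟩
    rw [← k5 g (by rw [k3, hg]), k4]

end LocalSymm

/-! ## Rigidity of lifts to orbifold charts -/

section Chart

variable {E : Type*} [NormedAddCommGroup E] [NormedSpace ℝ E] {H : Set E}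
  {X : Type*} [TopologicalSpace X]

theorem OrbifoldChart.dom_subset (c : OrbifoldChart H X) : c.dom ⊆ H := by
  obtain ⟨O, -, h⟩ := c.relOpen_dom
  rw [h]; exact inter_subset_left

theorem OrbifoldChart.dom_mem (c : OrbifoldChart H X) {x : E} (hx : x ∈ c.dom) :
    c.dom ∈ 𝓝[H] x := by
  obtain ⟨O, hO, h⟩ := c.relOpen_dom
  rw [h] at hx ⊢
  exact inter_mem_nhdsWithin H (hO.mem_nhds hx.2)

theorem OrbifoldChart.nhdsWithin_dom (c : OrbifoldChart H X) {x : E} (hx : x ∈ c.dom) :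
    𝓝[c.dom] x = 𝓝[H] x := by
  refine le_antisymm (nhdsWithin_mono x c.dom_subset) ?_
  exact nhdsWithin_le_of_mem (c.dom_mem hx)

theorem OrbifoldChart.contDiffWithinAt_group (c : OrbifoldChart H X) {γ : Equiv.Perm E}
    (hγ : γ ∈ c.group) {x : E} (hx : x ∈ c.dom) : ContDiffWithinAt ℝ ∞ γ H x :=
  (c.smooth_group γ hγ x hx).mono_of_mem_nhdsWithin (c.dom_mem hx)

theorem OrbifoldChart.tendsto_group (c : OrbifoldChart H X) {γ : Equiv.Perm E}
    (hγ : γ ∈ c.group) {x : E} (hx : x ∈ c.dom) : Tendsto γ (𝓝[H] x) (𝓝[H] (γ x)) := by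
  refine tendsto_nhdsWithin_iff.2 ⟨(c.contDiffWithinAt_group hγ hx).continuousWithinAt, ?_⟩
  filter_upwards [c.dom_mem hx] with y hy using c.dom_subset (c.mapsTo_group γ hγ hy)

theorem OrbifoldChart.proj_group (c : OrbifoldChart H X) {γ : Equiv.Perm E}
    (hγ : γ ∈ c.group) {x : E} (hx : x ∈ c.dom) : c.proj (γ x) = c.proj x :=
  ((c.proj_eq_iff x hx _ (c.mapsTo_group γ hγ hx)).2 ⟨γ, hγ, rfl⟩).symm

theorem OrbifoldChart.eventually_exists_group (c : OrbifoldChart H X) {x : E} (hx : x ∈ c.dom) :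
    ∀ᶠ p in 𝓝[H] x ×ˢ 𝓝[H] x, c.proj p.1 = c.proj p.2 →
      ∃ γ : c.group, (γ : Equiv.Perm E) p.1 = p.2 := by
  filter_upwards [prod_mem_prod (c.dom_mem hx) (c.dom_mem hx)] with p hp h
  obtain ⟨γ, hγ, h⟩ := (c.proj_eq_iff _ hp.1 _ hp.2).1 h
  exact ⟨⟨γ, hγ⟩, h⟩

theorem OrbifoldChart.isLocalSymm (c : OrbifoldChart H X) {γ : Equiv.Perm E}
    (hγ : γ ∈ c.group) {x : E} (hx : x ∈ c.dom) (hfix : γ x = x) : IsLocalSymm c.proj H x γ where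
  fix := hfix
  smooth := (c.contDiffWithinAt_group hγ hx).of_le (by simp)
  maps := by
    filter_upwards [c.dom_mem hx] with y hy using c.dom_subset (c.mapsTo_group γ hγ hy)
  invariant := by
    filter_upwards [c.dom_mem hx] with y hy using c.proj_group hγ hy

/-- An element of the group of a chart is determined by its first jet at a point. -/
theorem OrbifoldChart.eq_one_of_fderivWithin_eq_id [FiniteDimensional ℝ E] (hH : IsModelSet H)
    (c : OrbifoldChart H X) {γ : Equiv.Perm E} (hγ : γ ∈ c.group) {x : E} (hx : x ∈ c.dom)
    (hfix : γ x = x) (hd : fderivWithin ℝ γ H x = ContinuousLinearMap.id ℝ E) : γ = 1 := by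
  have := c.finite_group
  have hdiff : ∀ y ∈ c.dom, HasFDerivWithinAt γ (fderivWithin ℝ γ H y) H y := fun y hy =>
    ((c.contDiffWithinAt_group hγ hy).differentiableWithinAt (by simp)).hasFDerivWithinAt
  have hloc : ∀ y ∈ c.dom, γ y = y → fderivWithin ℝ γ H y = ContinuousLinearMap.id ℝ E →
      ∀ᶠ z in 𝓝[H] y, γ z = z := by
    intro y hy hy1 hy2
    exact (c.isLocalSymm hγ hy hy1).eventually_eq_of_fderiv_eq_id hH (c.dom_subset hy)
      (c.eventually_exists_group hy) (hy2 ▸ hdiff y hy)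
  have hconn : PreconnectedSpace c.dom :=
    isPreconnected_iff_preconnectedSpace.1 c.isConnected_dom.isPreconnected
  -- Continuation along the connected domain: the set where the germ of γ is the identity is open by
  -- construction and will be shown closed, so γ is trivial on the whole domain and effectivity
  -- applies.
  set S : Set c.dom := {y | ∀ᶠ z in 𝓝[H] (y : E), γ z = z} with hS
  have hSnhds : ∀ y : c.dom, y ∈ S ↔ ∀ᶠ z : c.dom in 𝓝 y, γ (z : E) = z := by
    intro y
    rw [hS, mem_ofPred_eq, ← c.nhdsWithin_dom y.2, nhdsWithin_eq_map_subtype_coe y.2]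
    simp
  have hSopen : IsOpen S := by
    have : S = {y : c.dom | ∀ᶠ z : c.dom in 𝓝 y, γ (z : E) = z} := by ext y; exact hSnhds y
    rw [this]
    exact isOpen_setOfPred_eventually_nhds
  have hSsub : ∀ y ∈ S, γ (y : E) = y ∧
      fderivWithin ℝ γ H (y : E) = ContinuousLinearMap.id ℝ E := by
    intro y hy
    have h1 : γ (y : E) = y := hy.self_of_nhdsWithin (c.dom_subset y.2)
    refine ⟨h1, ?_⟩
    have : HasFDerivWithinAt γ (ContinuousLinearMap.id ℝ E) H y :=
      (hasFDerivWithinAt_id (y : E) H).congr_of_eventuallyEq hy h1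
    exact (hH.uniqueDiffWithinAt (c.dom_subset y.2)).eq (hdiff y y.2) this
  have hdc : ContinuousOn (fderivWithin ℝ γ H) c.dom := by
    intro y hy
    have := (c.contDiffWithinAt_group hγ hy).fderivWithin_right (m := 0)
      (uniqueDiffOn_convex hH.convex hH.interior_nonempty) (by simp) (c.dom_subset hy)
    exact this.continuousWithinAt.mono c.dom_subset
  -- At a limit point γ still has the first jet of the identity by continuity, and a local symmetry
  -- with that jet has trivial germ.
  have hSclosed : IsClosed S := by
    refine isClosed_of_closure_subset fun y hy => ?_
    have h1 : IsClosed {z : c.dom | γ (z : E) = z ∧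
        fderivWithin ℝ γ H (z : E) = ContinuousLinearMap.id ℝ E} := by
      refine IsClosed.inter ?_ ?_
      · exact isClosed_eq (continuousOn_iff_continuous_domRestrict.1 (c.smooth_group γ hγ).continuousOn)
          continuous_subtype_val
      · exact isClosed_eq (continuousOn_iff_continuous_domRestrict.1 hdc) continuous_const
    have h2 := h1.closure_subset_iff.2 hSsub hy
    exact hloc y y.2 h2.1 h2.2
  have hSuniv : S = univ :=
    IsClopen.eq_univ ⟨hSclosed, hSopen⟩ ⟨⟨x, hx⟩, hloc x hx hfix hd⟩
  refine c.effective_group γ hγ fun y hy => ?_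
  exact (hSsub ⟨y, hy⟩ (hSuniv ▸ mem_univ _)).1

variable {P : Type*} [NormedAddCommGroup P] [NormedSpace ℝ P] {S : Set P}

/-- Two lifts to a chart of the same map are related to first order by the group of the chart. -/
theorem OrbifoldChart.exists_group_fderivWithin_eq (c : OrbifoldChart H X)
    (hS : IsModelSet S) {F₁ F₂ : P → E} {p : P} (hp : p ∈ S)
    {D₁ D₂ : P →L[ℝ] E} (h₁ : HasFDerivWithinAt F₁ D₁ S p) (h₂ : HasFDerivWithinAt F₂ D₂ S p)
    (hd₁ : ∀ᶠ z in 𝓝[S] p, F₁ z ∈ c.dom) (hd₂ : ∀ᶠ z in 𝓝[S] p, F₂ z ∈ c.dom)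
    (h : ∀ᶠ z in 𝓝[S] p, c.proj (F₁ z) = c.proj (F₂ z)) :
    ∃ γ ∈ c.group, F₁ p = γ (F₂ p) ∧ D₁ = (fderivWithin ℝ γ H (F₂ p)).comp D₂ := by
  have := c.finite_group
  have hp2 : F₂ p ∈ c.dom := hd₂.self_of_nhdsWithin hp
  have ht : Tendsto F₂ (𝓝[S] p) (𝓝[H] (F₂ p)) := tendsto_nhdsWithin_iff.2
    ⟨h₂.continuousWithinAt, hd₂.mono fun z hz => c.dom_subset hz⟩
  obtain ⟨γ, h3, h4⟩ := exists_fderivWithin_eq (ι := c.group) (hS.ray p hp) h₁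
    (g := fun γ => (γ : Equiv.Perm E) ∘ F₂)
    (fun γ => HasFDerivWithinAt.comp_of_tendsto (t := H) p ((c.contDiffWithinAt_group γ.2
      hp2).differentiableWithinAt (by simp)).hasFDerivWithinAt h₂ ht) (by
      filter_upwards [hd₁, hd₂, h] with z k1 k2 k3
      obtain ⟨γ, hγ, e⟩ := (c.proj_eq_iff _ k2 _ k1).1 k3.symm
      exact ⟨⟨γ, hγ⟩, e.symm⟩)
  exact ⟨γ, γ.2, h3, h4⟩

/-- Two lifts to a chart of the same map agree if they agree to first order in
directions in which they are submersive. -/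
theorem OrbifoldChart.eventually_eq_of_fderivWithin_eq [FiniteDimensional ℝ E] (hH : IsModelSet H)
    (c : OrbifoldChart H X)
    (hS : IsModelSet S) {F₁ F₂ : P → E} {p : P} (hp : p ∈ S)
    (h₁ : ContDiffWithinAt ℝ 1 F₁ S p) (h₂ : ContDiffWithinAt ℝ 1 F₂ S p)
    (hd₁ : ∀ᶠ z in 𝓝[S] p, F₁ z ∈ c.dom) (hd₂ : ∀ᶠ z in 𝓝[S] p, F₂ z ∈ c.dom)
    (h : ∀ᶠ z in 𝓝[S] p, c.proj (F₁ z) = c.proj (F₂ z))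
    (hF12 : F₁ p = F₂ p) {κ' : E →L[ℝ] P} {D : E →L[ℝ] E}
    (hD₁ : (fderivWithin ℝ F₁ S p).comp κ' = D) (hD₂ : (fderivWithin ℝ F₂ S p).comp κ' = D)
    (hDs : Function.Surjective D) : ∀ᶠ z in 𝓝[S] p, F₁ z = F₂ z := by
  have := c.finite_group
  have hU : UniqueDiffOn ℝ S := uniqueDiffOn_convex hS.convex hS.interior_nonempty
  have hev : ∀ {F : P → E}, ContDiffWithinAt ℝ 1 F S p → ∀ᶠ z in 𝓝[S] p,
      HasFDerivWithinAt F (fderivWithin ℝ F S z) S z := by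
    intro F hF
    have := hF.eventually (by simp)
    rw [insert_eq_of_mem hp] at this
    exact this.mono fun z hz => (hz.differentiableWithinAt (by simp)).hasFDerivWithinAt
  have hcont : ∀ {F : P → E}, ContDiffWithinAt ℝ 1 F S p →
      Tendsto (fderivWithin ℝ F S) (𝓝[S] p) (𝓝 (fderivWithin ℝ F S p)) := by
    intro F hF
    exact (hF.fderivWithin_right (m := 0) hU (by simp) hp).continuousWithinAt
  have hp2 : F₂ p ∈ c.dom := hd₂.self_of_nhdsWithin hp
  -- If a nontrivial γ related the first jets of F₁ and F₂ at points accumulating at p, it would do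
  -- so at p. There both lifts agree along `κ'` with surjective derivative, which forces the first
  -- jet of γ to be that of the identity.
  have key : ∀ γ : c.group, (γ : Equiv.Perm E) ≠ 1 → ∀ᶠ z in 𝓝[S] p,
      ¬ (F₁ z = (γ : Equiv.Perm E) (F₂ z) ∧ fderivWithin ℝ F₁ S z =
        (fderivWithin ℝ (γ : Equiv.Perm E) H (F₂ z)).comp (fderivWithin ℝ F₂ S z)) := by
    intro γ hγ
    by_contra hcon
    have hfr : ∃ᶠ z in 𝓝[S] p, _ := (not_eventually.1 hcon).mono fun z hz => not_not.1 hz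
    apply hγ
    have ht : Tendsto F₂ (𝓝[S] p) (𝓝[H] (F₂ p)) := tendsto_nhdsWithin_iff.2
      ⟨h₂.continuousWithinAt, hd₂.mono fun z hz => c.dom_subset hz⟩
    have e1 : F₁ p = (γ : Equiv.Perm E) (F₂ p) :=
      tendsto_nhds_unique_of_frequently_eq h₁.continuousWithinAt.tendsto
        ((tendsto_nhdsWithin_iff.1 (c.tendsto_group γ.2 hp2)).1.comp ht)
        (hfr.mono fun z hz => hz.1)
    have hγc : Tendsto (fderivWithin ℝ (γ : Equiv.Perm E) H) (𝓝[H] (F₂ p))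
        (𝓝 (fderivWithin ℝ (γ : Equiv.Perm E) H (F₂ p))) :=
      ((c.contDiffWithinAt_group γ.2 hp2).fderivWithin_right (m := 0)
        (uniqueDiffOn_convex hH.convex hH.interior_nonempty) (by simp)
        (c.dom_subset hp2)).continuousWithinAt
    have e2 : fderivWithin ℝ F₁ S p = (fderivWithin ℝ (γ : Equiv.Perm E) H (F₂ p)).comp
        (fderivWithin ℝ F₂ S p) :=
      tendsto_nhds_unique_of_frequently_eq (hcont h₁)
        ((isBoundedBilinearMap_comp.continuous.tendsto _).comp ((hγc.comp ht).prodMk_nhds (hcont h₂))) (hfr.mono fun z hz => hz.2)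
    refine c.eq_one_of_fderivWithin_eq_id hH γ.2 hp2 (by rw [← e1, hF12]) ?_
    ext v
    obtain ⟨w, rfl⟩ := hDs v
    have := congrArg (fun T : E →L[ℝ] E => T w) hD₁
    rw [e2, ContinuousLinearMap.comp_assoc, hD₂] at this
    exact this
  have key' : ∀ᶠ z in 𝓝[S] p, ∀ γ : c.group, (γ : Equiv.Perm E) ≠ 1 →
      ¬ (F₁ z = (γ : Equiv.Perm E) (F₂ z) ∧ fderivWithin ℝ F₁ S z =
        (fderivWithin ℝ (γ : Equiv.Perm E) H (F₂ z)).comp (fderivWithin ℝ F₂ S z)) := by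
    rw [eventually_all]
    intro γ
    by_cases hγ : (γ : Equiv.Perm E) = 1
    · simp [hγ]
    · exact (key γ hγ).mono fun z hz _ => hz
  have hd₁' := eventually_eventually_nhdsWithin.2 hd₁
  have hd₂' := eventually_eventually_nhdsWithin.2 hd₂
  have h' := eventually_eventually_nhdsWithin.2 h
  filter_upwards [key', hd₁', hd₂', h', hev h₁, hev h₂, self_mem_nhdsWithin]
    with z k1 k2 k3 k4 k5 k6 hz
  -- At each nearby point some group element relates the two jets, and only the identity has not
  -- been excluded.
  obtain ⟨γ, hγ, e1, e2⟩ := c.exists_group_fderivWithin_eq hS hz k5 k6 k2 k3 k4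
  by_cases hγ1 : γ = 1
  · simpa [hγ1] using e1
  · exact absurd ⟨e1, e2⟩ (k1 ⟨γ, hγ⟩ hγ1)

/-- Two lifts to a chart of the same map agree if they agree on the image of a map `κ` along which
they are submersive. -/
theorem OrbifoldChart.eventually_eq_of_proj_eq [FiniteDimensional ℝ E] (hH : IsModelSet H)
    (c : OrbifoldChart H X)
    (hS : IsModelSet S) {F₁ F₂ : P → E} {p : P} (hp : p ∈ S)
    (h₁ : ContDiffWithinAt ℝ 1 F₁ S p) (h₂ : ContDiffWithinAt ℝ 1 F₂ S p)
    (hd₁ : ∀ᶠ z in 𝓝[S] p, F₁ z ∈ c.dom) (hd₂ : ∀ᶠ z in 𝓝[S] p, F₂ z ∈ c.dom)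
    (h : ∀ᶠ z in 𝓝[S] p, c.proj (F₁ z) = c.proj (F₂ z))
    {x : E} (hx : x ∈ H) {κ : E → P} {κ' : E →L[ℝ] P} (hκ : HasFDerivWithinAt κ κ' H x)
    (hκx : κ x = p) (hκt : Tendsto κ (𝓝[H] x) (𝓝[S] p))
    (hκF : ∀ᶠ y in 𝓝[H] x, F₁ (κ y) = F₂ (κ y)) {D : E →L[ℝ] E}
    (hD : HasFDerivWithinAt (F₂ ∘ κ) D H x) (hDs : Function.Surjective D) :
    ∀ᶠ z in 𝓝[S] p, F₁ z = F₂ z := by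
  refine c.eventually_eq_of_fderivWithin_eq hH hS hp h₁ h₂ hd₁ hd₂ h ?_ (κ' := κ') (D := D) ?_ ?_ hDs
  · have := hκF.self_of_nhdsWithin hx
    rwa [hκx] at this
  · have h3 : HasFDerivWithinAt (F₁ ∘ κ) D H x :=
      hD.congr_of_eventuallyEq hκF (hκF.self_of_nhdsWithin hx)
    refine (hH.uniqueDiffWithinAt hx).eq (HasFDerivWithinAt.comp_of_tendsto (t := S) x ?_ hκ ?_) h3
    · rw [hκx]; exact (h₁.differentiableWithinAt (by simp)).hasFDerivWithinAt
    · rw [hκx]; exact hκt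
  · refine (hH.uniqueDiffWithinAt hx).eq (HasFDerivWithinAt.comp_of_tendsto (t := S) x ?_ hκ ?_) hD
    · rw [hκx]; exact (h₂.differentiableWithinAt (by simp)).hasFDerivWithinAt
    · rw [hκx]; exact hκt

end Chart

/-! ### The smooth inverse function theorem. -/

section InverseFunction

variable {E F : Type*} [NormedAddCommGroup E] [NormedSpace ℝ E] [CompleteSpace E]
  [NormedAddCommGroup F] [NormedSpace ℝ F]

/-- The inverse function theorem for smooth maps, with smoothness on open sets. -/
theorem exists_openPartialHomeomorph_contDiffOn {f : E → F} {x : E} {f' : E ≃L[ℝ] F}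
    (hf : ∀ᶠ y in 𝓝 x, ContDiffAt ℝ ∞ f y) (hf' : HasFDerivAt f (f' : E →L[ℝ] F) x) {U : Set E}
    (hU : U ∈ 𝓝 x) :
    ∃ e : OpenPartialHomeomorph E F, (∀ y, e y = f y) ∧ x ∈ e.source ∧ e.source ⊆ U ∧
      ContDiffOn ℝ ∞ e e.source ∧ ContDiffOn ℝ ∞ e.symm e.target := by
  have hfx := hf.self_of_nhds
  set e₀ := hfx.toOpenPartialHomeomorph f hf' (by simp)
  have he₀ : ∀ y, e₀ y = f y := fun y => rfl
  -- Invertible operators form an open set, so the derivative is invertible near x; restricting to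
  -- such points makes the inverse smooth on the whole target.
  have hd : ∀ᶠ y in 𝓝 x, ∃ D : E ≃L[ℝ] F, HasFDerivAt f (D : E →L[ℝ] F) y := by
    have hc : ContinuousAt (fderiv ℝ f) x :=
      (hfx.fderiv_right (m := 0) (by simp)).continuousAt
    have h1 : range ((↑) : (E ≃L[ℝ] F) → E →L[ℝ] F) ∈ 𝓝 (fderiv ℝ f x) := by
      rw [hf'.fderiv]; exact ContinuousLinearEquiv.nhds f'
    filter_upwards [hc h1, hf] with y ⟨D, hD⟩ hy
    exact ⟨D, hD ▸ (hy.differentiableAt (by simp)).hasFDerivAt⟩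
  obtain ⟨V, hV, hVo, hxV⟩ := mem_nhds_iff.1 (inter_mem (hf.and hd) hU)
  have hsrc : (e₀.restrOpen V hVo).source = e₀.source ∩ V := rfl
  refine ⟨e₀.restrOpen V hVo, he₀, ?_, ?_, ?_, ?_⟩
  · exact ⟨hfx.mem_toOpenPartialHomeomorph_source hf' (by simp), hxV⟩
  · exact fun y hy => (hV hy.2).2
  · exact fun y hy => (hV hy.2).1.1.contDiffWithinAt
  · intro z hz
    have hy := (e₀.restrOpen V hVo).map_target hz
    obtain ⟨⟨h1, D, h2⟩, -⟩ := hV hy.2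
    exact (OpenPartialHomeomorph.contDiffAt_symm (e₀.restrOpen V hVo) hz (f₀' := D) h2
      h1).contDiffWithinAt

end InverseFunction

/-! ### Lifts of a smooth torus action to charts, and local flows. -/

section Chart

variable {E : Type*} [NormedAddCommGroup E] [NormedSpace ℝ E] {H : Set E}
  {X : Type*} [TopologicalSpace X]

theorem OrbifoldChart.exists_fderivWithin_group_equiv (hH : IsModelSet H)
    (c : OrbifoldChart H X) {γ : Equiv.Perm E} (hγ : γ ∈ c.group) {x : E} (hx : x ∈ c.dom) :
    ∃ D : E ≃L[ℝ] E, HasFDerivWithinAt γ (D : E →L[ℝ] E) H x := by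
  have hd : ∀ γ ∈ c.group, ∀ y ∈ c.dom, HasFDerivWithinAt γ (fderivWithin ℝ γ H y) H y :=
    fun γ hγ y hy =>
      ((c.contDiffWithinAt_group hγ hy).differentiableWithinAt (by simp)).hasFDerivWithinAt
  have key : ∀ γ ∈ c.group, ∀ y ∈ c.dom,
      (fderivWithin ℝ (γ⁻¹ : Equiv.Perm E) H (γ y)).comp (fderivWithin ℝ γ H y) =
        ContinuousLinearMap.id ℝ E := by
    intro γ hγ y hy
    refine (hH.uniqueDiffWithinAt (c.dom_subset hy)).eq (HasFDerivWithinAt.comp_of_tendsto (t := H) y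
      (hd _ (inv_mem hγ) _ (c.mapsTo_group γ hγ hy)) (hd γ hγ y hy) (c.tendsto_group hγ hy)) ?_
    have : ⇑(γ⁻¹) ∘ ⇑γ = id := by ext z; simp
    rw [this]
    exact hasFDerivWithinAt_id y H
  have k1 := key γ hγ x hx
  have k2 := key γ⁻¹ (inv_mem hγ) (γ x) (c.mapsTo_group γ hγ hx)
  have e : γ⁻¹ (γ x) = x := γ.symm_apply_apply x
  rw [inv_inv, e] at k2
  refine ⟨ContinuousLinearEquiv.equivOfInverse (fderivWithin ℝ γ H x)
    (fderivWithin ℝ (γ⁻¹ : Equiv.Perm E) H (γ x)) (fun v => ?_) (fun v => ?_), hd γ hγ x hx⟩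
  · exact congrArg (fun T : E →L[ℝ] E => T v) k1
  · exact congrArg (fun T : E →L[ℝ] E => T v) k2

variable {r : ℕ} [MulAction (Torus r) X]

/-- `g` lifts the maps `p ↦ exp ξ · τ · p` to charts near `(0, x)`. -/
structure IsLocalLift (c c' : OrbifoldChart H X) (τ : Torus r) (x : E)
    (g : (Fin r → ℝ) × E → E) : Prop where
  smooth : ∀ᶠ v in 𝓝[univ ×ˢ H] (0, x), ContDiffWithinAt ℝ ∞ g (univ ×ˢ H) v
  maps : ∀ᶠ v in 𝓝[univ ×ˢ H] (0, x), g v ∈ c'.dom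
  lifts : ∀ᶠ v in 𝓝[univ ×ˢ H] (0, x), c'.proj (g v) = torusExp v.1 • τ • c.proj v.2

theorem SmoothAction.exists_isLocalLift {A : OrbifoldAtlas H X} (hA : SmoothAction (r := r) A)
    {c c' : OrbifoldChart H X} (hc : c ∈ A.charts) (hc' : c' ∈ A.charts) {τ : Torus r} {x y : E}
    (hx : x ∈ c.dom) (hy : y ∈ c'.dom) (h : τ • c.proj x = c'.proj y) :
    ∃ g, IsLocalLift c c' τ x g ∧ g (0, x) = y := by
  obtain ⟨g, O, hO, h0, hg0, hgs, hgl⟩ := hA.2 c hc c' hc' τ x hx y hy h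
  have hmem : ∀ v ∈ O ∩ univ ×ˢ c.dom, O ∩ univ ×ˢ c.dom ∈ 𝓝[univ ×ˢ H] v := by
    rintro v hv
    rw [inter_comm]
    refine inter_mem ?_ (mem_nhdsWithin_of_mem_nhds (hO.mem_nhds hv.1))
    rw [← Prod.mk.eta (p := v), nhdsWithin_prod_eq]
    exact prod_mem_prod univ_mem (c.dom_mem hv.2.2)
  have h0' := hmem (0, x) ⟨h0, mem_univ _, hx⟩
  refine ⟨g, ⟨?_, ?_, ?_⟩, hg0⟩
  · filter_upwards [h0'] with v hv using (hgs v hv).mono_of_mem_nhdsWithin (hmem v hv)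
  · filter_upwards [h0'] with v hv using (hgl v hv).1
  · filter_upwards [h0'] with v hv
    rw [(hgl v hv).2, mul_smul]

omit [NormedSpace ℝ E] in
theorem tendsto_zero_prodMk {Q : Type*} [NormedAddCommGroup Q] {x : E} :
    Tendsto (fun y : E => ((0 : Q), y)) (𝓝[H] x) (𝓝[univ ×ˢ H] (0, x)) := by
  rw [nhdsWithin_prod_eq, nhdsWithin_univ]
  exact tendsto_const_nhds.prodMk tendsto_id

theorem hasFDerivWithinAt_zero_prodMk {Q : Type*} [NormedAddCommGroup Q] [NormedSpace ℝ Q] {x : E} :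
    HasFDerivWithinAt (fun y : E => ((0 : Q), y)) (ContinuousLinearMap.inr ℝ Q E) H x :=
  (hasFDerivWithinAt_const (0 : Q) x H).prodMk (hasFDerivWithinAt_id x H)

variable {c c' c'' : OrbifoldChart H X} {τ : Torus r} {x : E} {g : (Fin r → ℝ) × E → E}

theorem IsLocalLift.smoothAt (hg : IsLocalLift c c' τ x g) (hx : x ∈ H) :
    ContDiffWithinAt ℝ ∞ g (univ ×ˢ H) (0, x) :=
  hg.smooth.self_of_nhdsWithin ⟨mem_univ _, hx⟩

theorem IsLocalLift.mem_dom (hg : IsLocalLift c c' τ x g) (hx : x ∈ H) : g (0, x) ∈ c'.dom :=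
  hg.maps.self_of_nhdsWithin (show (0, x) ∈ univ ×ˢ H from ⟨mem_univ _, hx⟩)

theorem IsLocalLift.tendsto (hg : IsLocalLift c c' τ x g) (hx : x ∈ H) :
    Tendsto g (𝓝[univ ×ˢ H] (0, x)) (𝓝[H] (g (0, x))) :=
  tendsto_nhdsWithin_iff.2 ⟨(hg.smoothAt hx).continuousWithinAt,
    hg.maps.mono fun _ h => c'.dom_subset h⟩

theorem IsLocalLift.smooth_zero (hg : IsLocalLift c c' τ x g) (hx : x ∈ H) :
    ContDiffWithinAt ℝ ∞ (fun y => g (0, y)) H x :=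
  (hg.smoothAt hx).comp x (contDiffWithinAt_const.prodMk contDiffWithinAt_id)
    fun _ hy => ⟨mem_univ _, hy⟩

theorem IsLocalLift.tendsto_zero (hg : IsLocalLift c c' τ x g) (hx : x ∈ H) :
    Tendsto (fun y => g (0, y)) (𝓝[H] x) (𝓝[H] (g (0, x))) :=
  (hg.tendsto hx).comp tendsto_zero_prodMk

theorem IsLocalLift.maps_zero (hg : IsLocalLift c c' τ x g) :
    ∀ᶠ y in 𝓝[H] x, g (0, y) ∈ c'.dom := tendsto_zero_prodMk.eventually hg.maps

theorem IsLocalLift.lifts_zero (hg : IsLocalLift c c' τ x g) :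
    ∀ᶠ y in 𝓝[H] x, c'.proj (g (0, y)) = τ • c.proj y := by
  filter_upwards [tendsto_zero_prodMk.eventually hg.lifts] with y hy
  rw [hy, torusExp_zero, one_smul]

/-- The composition of a lift with an element of the group of a chart is a lift. -/
theorem IsLocalLift.group_comp (hg : IsLocalLift c c' τ x g) {γ : Equiv.Perm E}
    (hγ : γ ∈ c'.group) : IsLocalLift c c' τ x (γ ∘ g) where
  smooth := by
    filter_upwards [hg.smooth, eventually_eventually_nhdsWithin.2 hg.maps, self_mem_nhdsWithin]
      with v hv1 hv2 hv3
    refine ContDiffWithinAt.comp_of_preimage_mem_nhdsWithin (t := H) v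
      (c'.contDiffWithinAt_group hγ (hv2.self_of_nhdsWithin hv3)) hv1 ?_
    exact hv2.mono fun w hw => c'.dom_subset hw
  maps := hg.maps.mono fun v hv => c'.mapsTo_group γ hγ hv
  lifts := by
    filter_upwards [hg.lifts, hg.maps] with v hv1 hv2
    rw [Function.comp_apply, c'.proj_group hγ hv2, hv1]

/-- Lifts are local diffeomorphisms. -/
theorem IsLocalLift.exists_fderiv_surjective (hH : IsModelSet H) {A : OrbifoldAtlas H X}
    (hA : SmoothAction (r := r) A)
    (hc : c ∈ A.charts) (hc' : c' ∈ A.charts) (hx : x ∈ c.dom) (hg : IsLocalLift c c' τ x g) :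
    ∃ D : E →L[ℝ] E, HasFDerivWithinAt (fun y => g (0, y)) D H x ∧ Function.Surjective D := by
  have hxH := c.dom_subset hx
  have hy := hg.mem_dom hxH
  have hyH := c'.dom_subset hy
  have hlift := hg.lifts_zero.self_of_nhdsWithin hxH
  -- A lift of τ⁻¹ in the opposite direction: following it by `g` gives a lift of the identity,
  -- whose derivative is that of a group element and hence invertible.
  obtain ⟨g', hg', hg'y⟩ := hA.exists_isLocalLift hc' hc (τ := τ⁻¹) hy hx
    (by rw [hlift, inv_smul_smul])
  have hD := ((hg.smooth_zero hxH).differentiableWithinAt (by simp)).hasFDerivWithinAt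
  refine ⟨_, hD, ?_⟩
  have hD' := ((hg'.smooth_zero hyH).differentiableWithinAt (by simp)).hasFDerivWithinAt
  have ht : Tendsto (fun y => g' (0, y)) (𝓝[H] (g (0, x))) (𝓝[H] x) := by
    simpa [hg'y] using hg'.tendsto_zero hyH
  have hcomp := HasFDerivWithinAt.comp_of_tendsto (t := H) (g (0, x)) (g := fun y => g (0, y))
    (f := fun y => g' (0, y)) (by simpa [hg'y] using hD) hD' (by simpa [hg'y] using ht)
  obtain ⟨γ, hγ, -, h2⟩ := c'.exists_group_fderivWithin_eq hH hyH hcomp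
    (hasFDerivWithinAt_id (g (0, x)) H) (ht.eventually hg.maps_zero) (c'.dom_mem hy) (by
      filter_upwards [ht.eventually hg.lifts_zero, hg'.lifts_zero] with z h1 h2
      simp only [Function.comp_apply, h1, h2, smul_inv_smul, id])
  obtain ⟨T, hT⟩ := c'.exists_fderivWithin_group_equiv hH hγ hy
  have hT' := hT.fderivWithin (hH.uniqueDiffWithinAt hyH)
  simp only [id] at h2
  rw [hT', ContinuousLinearMap.comp_id] at h2
  intro v
  obtain ⟨w, hw⟩ := T.surjective v
  refine ⟨fderivWithin ℝ (fun y => g' (0, y)) H (g (0, x)) w, ?_⟩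
  rw [← hw]
  exact congrArg (fun S : E →L[ℝ] E => S w) h2

/-- A lift of the action to a chart near `x` which is a local action. -/
structure IsLocalFlow (c : OrbifoldChart H X) (x : E) (g : (Fin r → ℝ) × E → E) : Prop extends
    IsLocalLift c c 1 x g where
  zero : ∀ᶠ y in 𝓝[H] x, g (0, y) = y
  add : ∀ᶠ v in 𝓝[univ ×ˢ (univ ×ˢ H)] ((0 : Fin r → ℝ), (0 : Fin r → ℝ), x),
    g (v.1, g (v.2.1, v.2.2)) = g (v.1 + v.2.1, v.2.2)

theorem IsLocalLift.smooth_one (hg : IsLocalLift c c' τ x g) (hx : x ∈ H) :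
    ContDiffWithinAt ℝ 1 g (univ ×ˢ H) (0, x) := (hg.smoothAt hx).of_le (by simp)

/-- A lift of the action near the unit restricts at ξ = 0 to a lift of the identity, that is, to an
element γ of the chart group; composing with γ⁻¹ normalizes it. Additivity is then not a choice but
a consequence of rigidity. -/
theorem SmoothAction.exists_isLocalFlow [FiniteDimensional ℝ E] (hH : IsModelSet H)
    {A : OrbifoldAtlas H X}
    (hA : SmoothAction (r := r) A) (hc : c ∈ A.charts) (hx : x ∈ c.dom) :
    ∃ g : (Fin r → ℝ) × E → E, IsLocalFlow c x g := by
  have hxH := c.dom_subset hx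
  obtain ⟨g₀, hg₀, hg₀x⟩ := hA.exists_isLocalLift hc hc (τ := 1) hx hx (one_smul _ _)
  have hD := ((hg₀.smooth_zero hxH).differentiableWithinAt (by simp)).hasFDerivWithinAt
  obtain ⟨γ, hγ, h1, h2⟩ := c.exists_group_fderivWithin_eq hH hxH hD
    (hasFDerivWithinAt_id x H) hg₀.maps_zero (c.dom_mem hx) (by
      filter_upwards [hg₀.lifts_zero] with z h1
      simp [h1])
  simp only [id, hg₀x] at h1
  have hproj : ∀ᶠ y in 𝓝[H] x, c.proj (g₀ (0, y)) = c.proj y := by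
    filter_upwards [hg₀.lifts_zero] with y h1
    rw [h1, one_smul]
  have hzero : ∀ᶠ y in 𝓝[H] x, g₀ (0, y) = γ y := by
    obtain ⟨T, hT⟩ := c.exists_fderivWithin_group_equiv hH hγ hx
    have hT' := hT.fderivWithin (hH.uniqueDiffWithinAt hxH)
    simp only [id, ContinuousLinearMap.comp_id] at h2
    refine c.eventually_eq_of_fderivWithin_eq hH hH hxH ((hg₀.smooth_zero hxH).of_le (by simp))
      ((c.contDiffWithinAt_group hγ hx).of_le (by simp)) hg₀.maps_zero
      (Filter.Eventually.mono (c.dom_mem hx) fun y hy => c.mapsTo_group γ hγ hy) ?_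
      (by rw [hg₀x]; exact h1) (κ' := ContinuousLinearMap.id ℝ E) (D := (T : E →L[ℝ] E)) ?_ ?_
      T.surjective
    · filter_upwards [hproj, c.dom_mem hx] with y k1 k2
      rw [k1, c.proj_group hγ k2]
    · rw [ContinuousLinearMap.comp_id, h2, hT']
    · rw [ContinuousLinearMap.comp_id, hT']
  have hg := hg₀.group_comp (inv_mem hγ)
  set g : (Fin r → ℝ) × E → E := ⇑γ⁻¹ ∘ g₀ with hgdef
  have hz : ∀ᶠ y in 𝓝[H] x, g (0, y) = y := by
    filter_upwards [hzero] with y hy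
    rw [hgdef, Function.comp_apply, hy]
    exact γ.symm_apply_apply y
  have hgx : g (0, x) = x := hz.self_of_nhdsWithin hxH
  have hgt : Tendsto g (𝓝[univ ×ˢ H] (0, x)) (𝓝[H] x) := by
    simpa only [hgx] using hg.tendsto hxH
  refine ⟨g, hg, hz, ?_⟩
  set S : Set ((Fin r → ℝ) × (Fin r → ℝ) × E) := univ ×ˢ (univ ×ˢ H) with hSdef
  set p : (Fin r → ℝ) × (Fin r → ℝ) × E := (0, 0, x) with hpdef
  have hp : p ∈ S := ⟨mem_univ _, mem_univ _, hxH⟩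
  have hS : IsModelSet S := hH.univ_prod.univ_prod
  set m₁ : (Fin r → ℝ) × (Fin r → ℝ) × E → (Fin r → ℝ) × E := fun v => (v.1, g v.2) with hm₁
  set m₂ : (Fin r → ℝ) × (Fin r → ℝ) × E → (Fin r → ℝ) × E := fun v => (v.1 + v.2.1, v.2.2) with hm₂
  have hm₁p : m₁ p = (0, x) := by simp [hm₁, hpdef, hgx]
  have hm₂p : m₂ p = (0, x) := by simp [hm₂, hpdef]
  have hsnd : Tendsto (fun v : (Fin r → ℝ) × (Fin r → ℝ) × E => v.2) (𝓝[S] p)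
      (𝓝[univ ×ˢ H] (0, x)) := by
    rw [hSdef, hpdef, nhdsWithin_prod_eq (s := univ)]
    exact tendsto_snd
  have hfst : Tendsto (fun v : (Fin r → ℝ) × (Fin r → ℝ) × E => v.1) (𝓝[S] p) (𝓝 0) :=
    (continuous_fst.tendsto p).mono_left nhdsWithin_le_nhds
  have ht₁ : Tendsto m₁ (𝓝[S] p) (𝓝[univ ×ˢ H] (0, x)) := by
    rw [nhdsWithin_prod_eq (0 : Fin r → ℝ) x, nhdsWithin_univ]
    exact hfst.prodMk (hgt.comp hsnd)
  have ht₂ : Tendsto m₂ (𝓝[S] p) (𝓝[univ ×ˢ H] (0, x)) := by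
    refine tendsto_nhdsWithin_iff.2 ⟨?_, ?_⟩
    · rw [← hm₂p]
      exact Continuous.continuousAt (by fun_prop) |>.tendsto.mono_left nhdsWithin_le_nhds
    · exact eventually_mem_nhdsWithin.mono fun v hv => ⟨mem_univ _, hv.2.2⟩
  have hs₁ : ContDiffWithinAt ℝ 1 (g ∘ m₁) S p := by
    refine ContDiffWithinAt.comp_of_preimage_mem_nhdsWithin (t := univ ×ˢ H) p ?_ ?_ ?_
    · rw [hm₁p]; exact hg.smooth_one hxH
    · refine contDiffWithinAt_fst.prodMk ?_
      exact ContDiffWithinAt.comp (g := g) (t := univ ×ˢ H) p (hg.smooth_one hxH)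
        contDiffWithinAt_snd fun v hv => hv.2
    · exact (tendsto_nhdsWithin_iff.1 ht₁).2
  have hs₂ : ContDiffWithinAt ℝ 1 (g ∘ m₂) S p := by
    refine ContDiffWithinAt.comp_of_preimage_mem_nhdsWithin (t := univ ×ˢ H) p ?_ ?_ ?_
    · rw [hm₂p]; exact hg.smooth_one hxH
    · exact ContDiff.contDiffWithinAt (by fun_prop)
    · exact (tendsto_nhdsWithin_iff.1 ht₂).2
  have hκt : Tendsto (fun y : E => ((0 : Fin r → ℝ), (0 : Fin r → ℝ), y)) (𝓝[H] x) (𝓝[S] p) :=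
    tendsto_zero_prodMk.comp tendsto_zero_prodMk |>.mono_right le_rfl
  have hF₂ : ∀ᶠ y in 𝓝[H] x, (g ∘ m₂) (0, 0, y) = y := by
    filter_upwards [hz] with y hy
    simp [hm₂, hy]
  have hF₁ : ∀ᶠ y in 𝓝[H] x, (g ∘ m₁) (0, 0, y) = y := by
    filter_upwards [hz] with y hy
    simp [hm₁, hy]
  -- Both sides of the additivity law lift (ξ, η, y) ↦ exp(ξ + η) · y, and both are the identity on
  -- ξ = η = 0.
  refine c.eventually_eq_of_proj_eq hH hS hp hs₁ hs₂ (ht₁.eventually hg.maps)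
    (ht₂.eventually hg.maps) ?_ hxH (κ := fun y => (0, 0, y))
    (κ' := (ContinuousLinearMap.inr ℝ (Fin r → ℝ) ((Fin r → ℝ) × E)).comp
      (ContinuousLinearMap.inr ℝ (Fin r → ℝ) E)) ?_ rfl hκt ?_ (D := ContinuousLinearMap.id ℝ E)
      ?_ Function.surjective_id
  · filter_upwards [ht₁.eventually hg.lifts, ht₂.eventually hg.lifts, hsnd.eventually hg.lifts]
      with v k1 k2 k3
    have k1 : c.proj (g (v.1, g v.2)) = torusExp v.1 • (1 : Torus r) • c.proj (g v.2) := k1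
    have k2 : c.proj (g (v.1 + v.2.1, v.2.2)) =
      torusExp (v.1 + v.2.1) • (1 : Torus r) • c.proj v.2.2 := k2
    exact k1.trans (by rw [k2, k3, one_smul, one_smul, torusExp_add, mul_smul])
  · exact ((ContinuousLinearMap.inr ℝ (Fin r → ℝ) ((Fin r → ℝ) × E)).comp
      (ContinuousLinearMap.inr ℝ (Fin r → ℝ) E)).hasFDerivWithinAt
  · filter_upwards [hF₁, hF₂] with y k1 k2
    exact k1.trans k2.symm
  · exact (hasFDerivWithinAt_id x H).congr_of_eventuallyEq hF₂ (hF₂.self_of_nhdsWithin hxH)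

/-- Near a point, a lift is the composition of its restriction to `ξ = 0` and the local flow. -/
theorem IsLocalLift.eventually_eq_flow [FiniteDimensional ℝ E] (hH : IsModelSet H)
    {A : OrbifoldAtlas H X}
    (hA : SmoothAction (r := r) A)
    (hc : c ∈ A.charts) (hc' : c' ∈ A.charts) (hx : x ∈ c.dom) (hg : IsLocalLift c c' τ x g)
    {f : (Fin r → ℝ) × E → E} (hf : IsLocalFlow c' (g (0, x)) f) :
    ∀ᶠ v in 𝓝[univ ×ˢ H] (0, x), g v = f (v.1, g (0, v.2)) := by
  have hxH := c.dom_subset hx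
  have hyH := c'.dom_subset (hg.mem_dom hxH)
  obtain ⟨D, hD, hDs⟩ := hg.exists_fderiv_surjective hH hA hc hc' hx
  set S : Set ((Fin r → ℝ) × E) := univ ×ˢ H with hSdef
  have hS : IsModelSet S := hH.univ_prod
  have hp : ((0 : Fin r → ℝ), x) ∈ S := ⟨mem_univ _, hxH⟩
  set m : (Fin r → ℝ) × E → (Fin r → ℝ) × E := fun v => (v.1, g (0, v.2)) with hm
  have hsnd : Tendsto (fun v : (Fin r → ℝ) × E => v.2) (𝓝[S] (0, x)) (𝓝[H] x) := by
    rw [hSdef, nhdsWithin_prod_eq]; exact tendsto_snd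
  have hmt : Tendsto m (𝓝[S] (0, x)) (𝓝[S] (0, g (0, x))) := by
    have h1 : Tendsto (fun v : (Fin r → ℝ) × E => v.1) (𝓝[S] (0, x)) (𝓝 0) :=
      (continuous_fst.tendsto ((0 : Fin r → ℝ), x)).mono_left nhdsWithin_le_nhds
    have h2 := h1.prodMk ((hg.tendsto_zero hxH).comp hsnd)
    rw [hSdef, nhdsWithin_prod_eq (0 : Fin r → ℝ) (g (0, x)), nhdsWithin_univ]
    exact h2
  have hf0 : ∀ᶠ y in 𝓝[H] x, f (0, g (0, y)) = g (0, y) := (hg.tendsto_zero hxH).eventually hf.zero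
  -- The two lifts coincide at ξ = 0, and the common restriction y ↦ g (0, y) has surjective
  -- derivative.
  refine c'.eventually_eq_of_proj_eq hH hS hp (hg.smooth_one hxH) (F₂ := f ∘ m) ?_ hg.maps
    (hmt.eventually hf.maps) ?_ hxH (κ := fun y => (0, y)) hasFDerivWithinAt_zero_prodMk rfl
    tendsto_zero_prodMk ?_ (D := D) ?_ hDs
  · refine ContDiffWithinAt.comp_of_preimage_mem_nhdsWithin (t := S) _ ?_ ?_ ?_
    · exact (hf.smooth_one hyH)
    · refine contDiffWithinAt_fst.prodMk ?_
      exact ContDiffWithinAt.comp (g := fun y => g (0, y)) (t := H) ((0 : Fin r → ℝ), x)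
        ((hg.smooth_zero hxH).of_le (by simp)) contDiffWithinAt_snd fun v hv => hv.2
    · exact (tendsto_nhdsWithin_iff.1 hmt).2
  · filter_upwards [hg.lifts, hmt.eventually hf.lifts, hsnd.eventually hg.lifts_zero] with v k1 k2 k3
    have k2 : c'.proj (f (v.1, g (0, v.2))) =
      torusExp v.1 • (1 : Torus r) • c'.proj (g (0, v.2)) := k2
    exact k1.trans (by rw [Function.comp_apply, k2, k3, one_smul])
  · filter_upwards [hf0] with y k
    exact k.symm
  · exact hD.congr_of_eventuallyEq hf0 (hf0.self_of_nhdsWithin hxH)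

end Chart

/-! ### One-parameter subgroups and Lie algebras in the torus. -/

section OneParameter

/-- Continuous one-parameter subgroups of the circle. -/
theorem exists_eq_circleExp {F : ℝ → Circle} (hF : Continuous F) (hadd : ∀ s t, F (s + t) = F s * F t) :
    ∃ a : ℝ, ∀ t, F t = Circle.exp (t * a) := by
  set G : ℝ → ℂ := fun t => (F t : ℂ) with hG
  have hGc : Continuous G := continuous_subtype_val.comp hF
  have hGadd : ∀ s t, G (s + t) = G s * G t := fun s t => by simp [hG, hadd]
  have hG0 : G 0 = 1 := by
    have h1 : F 0 = 1 := by simpa using hadd 0 0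
    simp [hG, h1]
  -- Integration regularizes: the homomorphism property writes G t as a multiple of Φ (t + δ) - Φ t,
  -- so the continuous G is differentiable. Then G' = G κ, and |G| = 1 makes κ imaginary.
  set Φ : ℝ → ℂ := fun x => ∫ s in (0 : ℝ)..x, G s with hΦ
  have hΦd : ∀ t, HasDerivAt Φ (G t) t := fun t =>
    intervalIntegral.integral_hasDerivAt_right (hGc.intervalIntegrable _ _)
      (hGc.stronglyMeasurableAtFilter _ _) hGc.continuousAt
  obtain ⟨δ, hδ⟩ : ∃ δ, Φ δ ≠ 0 := by
    by_contra hcon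
    push Not at hcon
    have h0 : HasDerivAt Φ 0 0 := (hasDerivAt_const (0 : ℝ) (0 : ℂ)).congr_of_eventuallyEq
      (Eventually.of_forall hcon)
    have := (hΦd 0).unique h0
    simp [hG0] at this
  have hshift : ∀ t, G t = (Φ δ)⁻¹ * (Φ (t + δ) - Φ t) := by
    intro t
    have h1 : Φ (t + δ) - Φ t = ∫ s in t..(t + δ), G s :=
      intervalIntegral.integral_interval_sub_left (hGc.intervalIntegrable _ _)
        (hGc.intervalIntegrable _ _)
    have h2 : ∫ s in t..(t + δ), G s = G t * Φ δ := by
      have := intervalIntegral.integral_comp_add_left (a := 0) (b := δ) G t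
      rw [add_zero] at this
      rw [← this, hΦ, ← intervalIntegral.integral_const_mul]
      simp only [hGadd]
    rw [h1, h2, mul_comm, mul_assoc, mul_inv_cancel₀ hδ, mul_one]
  have hdiff : DifferentiableAt ℝ G 0 := by
    have : G = fun t => (Φ δ)⁻¹ * (Φ (t + δ) - Φ t) := funext hshift
    rw [this]
    have hΦdiff : Differentiable ℝ Φ := fun t => (hΦd t).differentiableAt
    fun_prop
  set κ := deriv G 0 with hκ
  have hGd : ∀ t, HasDerivAt G (G t * κ) t := by
    intro t
    have h1 : HasDerivAt (fun s => G t * G (s - t)) (G t * κ) t := by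
      refine HasDerivAt.const_mul _ ?_
      have h2 : HasDerivAt G κ (t - t) := by rw [sub_self]; exact hdiff.hasDerivAt
      simpa using h2.comp_sub_const t t
    refine h1.congr_of_eventuallyEq (Eventually.of_forall fun s => ?_)
    simp only
    rw [← hGadd, add_sub_cancel]
  have hexp : ∀ t : ℝ, G t = Complex.exp (t * κ) := by
    have hd : ∀ t : ℝ, HasDerivAt (fun t : ℝ => G t * Complex.exp (-(t * κ))) 0 t := by
      intro t
      have h1 : HasDerivAt (fun t : ℝ => Complex.exp (-(t * κ)))
          (Complex.exp (-(t * κ)) * (-(1 * κ))) t :=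
        (((Complex.ofRealCLM.hasDerivAt (x := t)).mul_const κ).neg).cexp
      exact ((hGd t).mul h1).congr_deriv (by ring)
    intro t
    have h2 := is_const_of_deriv_eq_zero (fun t => (hd t).differentiableAt) (fun t => (hd t).deriv) t 0
    simp only [Complex.ofReal_zero, zero_mul, neg_zero, Complex.exp_zero, hG0, mul_one] at h2
    rw [Complex.exp_neg] at h2
    field_simp at h2
    simpa using h2
  have hre : κ.re = 0 := by
    have h1 : ‖G 1‖ = 1 := Circle.norm_coe _
    rw [hexp, Complex.norm_exp] at h1
    simpa using h1
  refine ⟨κ.im, fun t => Circle.ext ?_⟩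
  rw [Circle.coe_exp]
  have : G t = Complex.exp (t * κ) := hexp t
  rw [show ((F t : Circle) : ℂ) = G t from rfl, this]
  congr 1
  apply Complex.ext <;> simp [hre]

/-- Each coordinate of the circle is a continuous one-parameter subgroup of S¹. The vector obtained
is the infinitesimal generator, through which the rest of the proof handles the circles. -/
theorem exists_eq_torusExp {r : ℕ} (σ : Circle →ₜ* Torus r) :
    ∃ ξ : Fin r → ℝ, ∀ θ : ℝ, σ (Circle.exp θ) = torusExp (θ • ξ) := by
  have h : ∀ j : Fin r, ∃ a : ℝ, ∀ t, σ (Circle.exp t) j = Circle.exp (t * a) := by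
    intro j
    refine exists_eq_circleExp (F := fun t => σ (Circle.exp t) j) ?_ ?_
    · exact (continuous_apply j).comp (σ.continuous_toFun.comp Circle.exp.continuous)
    · intro s t
      simp [Circle.exp_add, map_mul]
  choose ξ hξ using h
  exact ⟨ξ, fun θ => funext fun j => by simp [hξ, torusExp]⟩

variable {r : ℕ}

theorem continuous_torusExp : Continuous (torusExp (r := r)) :=
  continuous_pi fun i => Circle.exp.continuous.comp (continuous_apply i)

theorem torusExp_eq_one_iff {ξ : Fin r → ℝ} :
    torusExp ξ = 1 ↔ ∃ n : Fin r → ℤ, ξ = fun i => (n i : ℝ) * (2 * Real.pi) := by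
  constructor
  · intro h
    have : ∀ i, ∃ n : ℤ, ξ i = n * (2 * Real.pi) := fun i => by
      have h1 : Circle.exp (ξ i) = 1 := congrFun h i
      obtain ⟨n, hn⟩ := Circle.exp_eq_one.1 h1
      exact ⟨n, hn⟩
    choose n hn using this
    exact ⟨n, funext hn⟩
  · rintro ⟨n, rfl⟩
    funext i
    exact Circle.exp_eq_one.2 ⟨n i, rfl⟩

theorem torusExp_sub (ξ η : Fin r → ℝ) : torusExp (ξ - η) = torusExp ξ * (torusExp η)⁻¹ := by
  rw [eq_mul_inv_iff_mul_eq, ← torusExp_add, sub_add_cancel]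

theorem torusExp_sum {ι : Type*} (s : Finset ι) (f : ι → Fin r → ℝ) :
    torusExp (∑ i ∈ s, f i) = ∏ i ∈ s, torusExp (f i) := by
  classical
  induction s using Finset.induction_on with
  | empty => simp [torusExp_zero]
  | insert a s ha ih => rw [Finset.sum_insert ha, Finset.prod_insert ha, torusExp_add, ih]

theorem torusExp_surjective : Function.Surjective (torusExp (r := r)) := by
  intro τ
  refine ⟨fun i => Complex.arg (τ i), funext fun i => ?_⟩
  exact Circle.exp_arg (τ i)

/-- The Lie algebra of the subgroup generated by a subspace of `ℝʳ`. -/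
theorem mem_of_forall_torusExp_mem {V : Submodule ℝ (Fin r → ℝ)} {ξ : Fin r → ℝ}
    (h : ∀ t : ℝ, ∃ η ∈ V, torusExp (t • ξ) = torusExp η) : ξ ∈ V := by
  have h1 : ∀ t : ℝ, ∃ n : Fin r → ℤ, t • ξ - (fun i => (n i : ℝ) * (2 * Real.pi)) ∈ V := by
    intro t
    obtain ⟨η, hη, he⟩ := h t
    have : torusExp (t • ξ - η) = 1 := by rw [torusExp_sub, he, mul_inv_cancel]
    obtain ⟨n, hn⟩ := torusExp_eq_one_iff.1 this
    exact ⟨n, by rw [← hn]; simpa using hη⟩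
  choose n hn using h1
  -- There are uncountably many times but only countably many lattice vectors. Two times with the
  -- same lattice correction put a nonzero multiple of ξ into V.
  have hninj : ¬ Function.Injective n := by
    intro hinj
    have hc : Countable ℝ := hinj.countable
    exact Cardinal.not_countable_real (Set.countable_univ_iff.2 hc)
  simp only [Function.Injective] at hninj
  push Not at hninj
  obtain ⟨s, t, hst, hne⟩ := hninj
  have h2 := V.sub_mem (hn s) (hn t)
  rw [hst, sub_sub_sub_cancel_right, ← sub_smul] at h2
  exact (V.smul_mem_iff (sub_ne_zero.2 hne)).1 h2

variable {k : ℕ} {σ : Fin k → Circle →ₜ* Torus r} {ξ : Fin k → Fin r → ℝ}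

theorem torusExp_mem_circlesSubgroup (hξ : ∀ i θ, σ i (Circle.exp θ) = torusExp (θ • ξ i))
    (I : Finset (Fin k)) (θ : Fin k → ℝ) :
    torusExp (∑ i ∈ I, θ i • ξ i) ∈ circlesSubgroup σ I := by
  rw [torusExp_sum]
  refine Subgroup.prod_mem _ fun i hi => ?_
  rw [← hξ]
  exact (le_iSup₂ (f := fun i (_ : i ∈ I) => (σ i).toMonoidHom.range) i hi) ⟨_, rfl⟩

theorem exists_torusExp_eq_of_mem_circlesSubgroup
    (hξ : ∀ i θ, σ i (Circle.exp θ) = torusExp (θ • ξ i))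
    {I : Finset (Fin k)} {τ : Torus r} (hτ : τ ∈ circlesSubgroup σ I) :
    ∃ η ∈ Submodule.span ℝ (ξ '' I), τ = torusExp η := by
  let S : Subgroup (Torus r) :=
    { carrier := {τ | ∃ η ∈ Submodule.span ℝ (ξ '' I), τ = torusExp η}
      mul_mem' := by
        rintro _ _ ⟨η, hη, rfl⟩ ⟨η', hη', rfl⟩
        exact ⟨η + η', Submodule.add_mem _ hη hη', (torusExp_add _ _).symm⟩
      one_mem' := ⟨0, Submodule.zero_mem _, torusExp_zero.symm⟩
      inv_mem' := by
        rintro _ ⟨η, hη, rfl⟩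
        refine ⟨-η, Submodule.neg_mem _ hη, ?_⟩
        rw [← zero_sub, torusExp_sub, torusExp_zero, one_mul] }
  have : circlesSubgroup σ I ≤ S := by
    refine iSup₂_le fun i hi => ?_
    rintro _ ⟨z, rfl⟩
    refine ⟨Complex.arg z • ξ i, Submodule.smul_mem _ _ (Submodule.subset_span ⟨i, hi, rfl⟩), ?_⟩
    rw [← hξ, Circle.exp_arg]
    rfl
  exact this hτ

/-- Every element of the generated subgroup is the exponential of a vector in the span, and
`mem_of_forall_torusExp_mem` recovers the span from this; closedness of the subgroup plays no role.
-/
theorem lieAlg_circlesSubgroup (hξ : ∀ i θ, σ i (Circle.exp θ) = torusExp (θ • ξ i))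
    (I : Finset (Fin k)) : lieAlg (circlesSubgroup σ I) = Submodule.span ℝ (ξ '' I) := by
  apply le_antisymm
  · intro η hη
    exact mem_of_forall_torusExp_mem fun t => exists_torusExp_eq_of_mem_circlesSubgroup hξ (hη t)
  · refine Submodule.span_le.2 ?_
    rintro _ ⟨i, hi, rfl⟩ t
    rw [← hξ]
    exact (le_iSup₂ (f := fun i (_ : i ∈ I) => (σ i).toMonoidHom.range) i hi) ⟨_, rfl⟩

/-- The generators of the circles are linearly independent if the subgroup generated by the circles
has the right dimension. -/
theorem linearIndependent_of_finrank_lieAlg (hξ : ∀ i θ, σ i (Circle.exp θ) = torusExp (θ • ξ i))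
    {I : Finset (Fin k)} (h : Module.finrank ℝ (lieAlg (circlesSubgroup σ I)) = I.card) :
    LinearIndependent ℝ (fun i : I => ξ i) := by
  rw [lieAlg_circlesSubgroup hξ] at h
  have e : ξ '' I = range fun i : I => ξ i := by ext; simp
  rw [linearIndependent_iff_card_eq_finrank_span, Set.finrank, Fintype.card_coe, ← h, e]

/-- A vector whose one-parameter group fixes a point is zero if it lies in the Lie algebra of a
locally free group. -/
theorem eq_zero_of_locallyFree {X : Type*} [MulAction (Torus r) X] {S : Subgroup (Torus r)} {x : X}
    (hfin : Finite (S ⊓ MulAction.stabilizer (Torus r) x : Subgroup (Torus r))) {η : Fin r → ℝ}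
    (hS : ∀ t : ℝ, torusExp (t • η) ∈ S) {ε : ℝ} (hε : 0 < ε)
    (hfix : ∀ t ∈ Ioo 0 ε, torusExp (t • η) • x = x) : η = 0 := by
  by_contra hη
  obtain ⟨j, hj⟩ : ∃ j, η j ≠ 0 := by
    by_contra hcon
    push Not at hcon
    exact hη (funext hcon)
  -- Below π/|η j| the j-th coordinate of exp(tη) determines t, so an interval of times would inject
  -- into the finite isotropy group.
  set δ := min ε (Real.pi / |η j|) with hδ
  have hδpos : 0 < δ := lt_min hε (by positivity)
  set f : Ioo 0 δ → (S ⊓ MulAction.stabilizer (Torus r) x : Subgroup (Torus r)) := fun t =>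
    ⟨torusExp ((t : ℝ) • η), hS t, hfix t ⟨t.2.1, t.2.2.trans_le (min_le_left _ _)⟩⟩
  have hinj : Function.Injective f := by
    intro s t hst
    have h1 : Circle.exp ((s : ℝ) * η j) = Circle.exp ((t : ℝ) * η j) :=
      congrFun (congrArg Subtype.val hst) j
    have hb : ∀ u : Ioo (0 : ℝ) δ, |(u : ℝ) * η j| < Real.pi := by
      intro u
      rw [abs_mul, abs_of_pos u.2.1]
      calc (u : ℝ) * |η j| < Real.pi / |η j| * |η j| := by
            have : 0 < |η j| := abs_pos.2 hj
            have := u.2.2.trans_le (min_le_right _ _)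
            gcongr
        _ = Real.pi := by have : 0 < |η j| := abs_pos.2 hj; field_simp
    have h2 : (s : ℝ) * η j = (t : ℝ) * η j := by
      have := Circle.injective_arg
      have e1 := Circle.arg_exp (abs_lt.1 (hb s)).1 (abs_lt.1 (hb s)).2.le
      have e2 := Circle.arg_exp (abs_lt.1 (hb t)).1 (abs_lt.1 (hb t)).2.le
      rw [← e1, ← e2, h1]
    exact Subtype.ext (mul_right_cancel₀ hj h2)
  have := Finite.of_injective f hinj
  exact (Ioo_infinite hδpos) (Set.toFinite _)

end OneParameter

/-! ## Good covers by a single circle -/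

section GenericCircle

/-- The orbits of `(1, a, a², …)` become dense in the torus as `a` grows. -/
theorem exists_forall_pow_mul_near (r : ℕ) {a : ℕ} (ha : 1 ≤ a) (θ : ℕ → ℝ) :
    ∃ t : ℝ, ∀ i < r, ∃ n : ℤ, |(a : ℝ) ^ i * t - θ i - 2 * Real.pi * n| ≤ 2 * Real.pi / a := by
  induction r generalizing θ with
  | zero => exact ⟨0, by simp⟩
  | succ r ih =>
    have ha' : (0 : ℝ) < a := by exact_mod_cast ha
    obtain ⟨t, ht⟩ := ih fun i => θ (i + 1)
    -- The time t handles the coordinates after the first. Replacing it by (t + 2πn)/a changes their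
    -- angles by multiples of 2π only, and n is chosen so that the first angle comes within 2π/a of
    -- θ 0.
    set n : ℤ := ⌊(a * θ 0 - t) / (2 * Real.pi)⌋ with hn
    refine ⟨(t + 2 * Real.pi * n) / a, fun i hi => ?_⟩
    rcases i with _ | i
    · refine ⟨0, ?_⟩
      have hpi := Real.two_pi_pos
      have h1 := Int.floor_le ((a * θ 0 - t) / (2 * Real.pi))
      have h2 := Int.lt_floor_add_one ((a * θ 0 - t) / (2 * Real.pi))
      rw [← hn] at h1 h2
      rw [le_div_iff₀ hpi] at h1
      rw [div_lt_iff₀ hpi] at h2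
      have e : (a : ℝ) ^ 0 * ((t + 2 * Real.pi * n) / a) - θ 0 - 2 * Real.pi * ((0 : ℤ) : ℝ) =
          (t + 2 * Real.pi * n - a * θ 0) / a := by
        field_simp; simp
      rw [e, abs_div, abs_of_pos ha']
      gcongr
      rw [abs_le]
      constructor <;> linarith
    · obtain ⟨m, hm⟩ := ht i (by omega)
      refine ⟨m + a ^ i * n, ?_⟩
      have e : (a : ℝ) ^ (i + 1) * ((t + 2 * Real.pi * n) / a) - θ (i + 1) -
          2 * Real.pi * ((m + a ^ i * n : ℤ) : ℝ) = (a : ℝ) ^ i * t - θ (i + 1) - 2 * Real.pi * m := by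
        push_cast
        field_simp
        ring
      rw [e]; exact hm

variable {r : ℕ}

/-- The vector `(1, a, a², …)`. -/
def powerVector (r a : ℕ) : Fin r → ℝ := fun i => (a : ℝ) ^ (i : ℕ)

theorem exists_tendsto_torusExp_powerVector (τ : Torus r) :
    ∃ t : ℕ → ℝ, Tendsto (fun a => torusExp (t a • powerVector r a)) atTop (𝓝 τ) := by
  obtain ⟨θ, rfl⟩ := torusExp_surjective τ
  have h : ∀ a : ℕ, ∃ t : ℝ, 1 ≤ a → ∀ i : Fin r, ∃ n : ℤ,
      |(a : ℝ) ^ (i : ℕ) * t - θ i - 2 * Real.pi * n| ≤ 2 * Real.pi / a := by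
    intro a
    by_cases ha : 1 ≤ a
    · obtain ⟨t, ht⟩ := exists_forall_pow_mul_near r ha fun i => if h : i < r then θ ⟨i, h⟩ else 0
      exact ⟨t, fun _ i => by simpa using ht i i.2⟩
    · exact ⟨0, fun h => absurd h ha⟩
  choose t ht using h
  have h' : ∀ a : ℕ, ∀ i : Fin r, ∃ n : ℤ, 1 ≤ a →
      |(a : ℝ) ^ (i : ℕ) * t a - θ i - 2 * Real.pi * n| ≤ 2 * Real.pi / a := by
    intro a i
    by_cases ha : 1 ≤ a
    · obtain ⟨n, hn⟩ := ht a ha i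
      exact ⟨n, fun _ => hn⟩
    · exact ⟨0, fun h => absurd h ha⟩
  choose n hn using h'
  refine ⟨t, tendsto_pi_nhds.2 fun i => ?_⟩
  have h1 : Tendsto (fun a : ℕ => (a : ℝ) ^ (i : ℕ) * t a - θ i - 2 * Real.pi * n a i) atTop (𝓝 0) := by
    rw [tendsto_zero_iff_abs_tendsto_zero]
    refine squeeze_zero' (Eventually.of_forall fun a => abs_nonneg _) ?_
      (tendsto_const_div_atTop_nhds_zero_nat (2 * Real.pi))
    filter_upwards [eventually_ge_atTop 1] with a ha using hn a i ha
  have h2 : Tendsto (fun a : ℕ => Circle.exp (θ i + ((a : ℝ) ^ (i : ℕ) * t a - θ i -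
      2 * Real.pi * n a i))) atTop (𝓝 (Circle.exp (θ i + 0))) :=
    (Circle.exp.continuous.tendsto _).comp (tendsto_const_nhds.add h1)
  rw [add_zero] at h2
  refine h2.congr fun a => ?_
  have e : θ i + ((a : ℝ) ^ (i : ℕ) * t a - θ i - 2 * Real.pi * n a i) =
      t a * (a : ℝ) ^ (i : ℕ) - n a i * (2 * Real.pi) := by ring
  have h3 : Circle.exp (n a i * (2 * Real.pi)) = 1 := Circle.exp_eq_one.2 ⟨n a i, rfl⟩
  rw [e, Circle.exp_sub, h3, div_one]
  rfl

/-- If the torus has no fixed point then some generic circle has no fixed point. -/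
theorem exists_forall_powerVector_not_fixed {Y : Type*} [TopologicalSpace Y] [CompactSpace Y]
    [T2Space Y] [MulAction (Torus r) Y] [ContinuousSMul (Torus r) Y]
    (h : ∀ y : Y, ∃ τ : Torus r, τ • y ≠ y) :
    ∃ a : ℕ, ∀ y : Y, ∃ t : ℝ, torusExp (t • powerVector r a) • y ≠ y := by
  by_contra hcon
  push Not at hcon
  choose y hy using hcon
  obtain ⟨z, hz⟩ := exists_clusterPt_of_compactSpace (map y atTop)
  obtain ⟨l, hl, hlz⟩ := mapClusterPt_iff_ultrafilter.1 hz
  obtain ⟨τ, hτ⟩ := h z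
  obtain ⟨t, ht⟩ := exists_tendsto_torusExp_powerVector τ
  apply hτ
  -- The point y a is fixed by the circle with parameter a, so this sequence is y itself, and its
  -- limit shows that τ fixes z.
  have h1 : Tendsto (fun a => torusExp (t a • powerVector r a) • y a) l (𝓝 (τ • z)) :=
    (ht.mono_left hl).smul hlz
  simp only [hy] at h1
  exact tendsto_nhds_unique h1 hlz

/-- The circle generated by `(1, a, a², …)`. -/
noncomputable def powerCircle (r a : ℕ) : Circle →ₜ* Torus r where
  toFun z i := z ^ a ^ (i : ℕ)
  map_one' := by funext i; simp
  map_mul' z w := by funext i; simp [mul_pow]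
  continuous_toFun := by fun_prop

theorem powerCircle_exp (r a : ℕ) (θ : ℝ) :
    powerCircle r a (Circle.exp θ) = torusExp (θ • powerVector r a) := by
  funext i
  simp only [powerCircle, torusExp, powerVector, Pi.smul_apply, smul_eq_mul]
  change Circle.exp θ ^ a ^ (i : ℕ) = _
  rw [← Circle.exp_natCast_mul]
  push_cast
  rw [mul_comm]

/-- The automorphism `τ ↦ (τ₀, τ₁ τ₀ᵃ, τ₂ τ₀^(a²), …)`. -/
noncomputable def powerShear (s a : ℕ) : Torus (s + 1) ≃ₜ* Torus (s + 1) where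
  toFun τ i := if i = 0 then τ 0 else τ i * τ 0 ^ a ^ (i : ℕ)
  invFun τ i := if i = 0 then τ 0 else τ i * (τ 0 ^ a ^ (i : ℕ))⁻¹
  left_inv τ := by
    funext i
    by_cases hi : i = 0 <;> simp [hi]
  right_inv τ := by
    funext i
    by_cases hi : i = 0 <;> simp [hi]
  map_mul' τ υ := by
    funext i
    by_cases hi : i = 0
    · simp [hi]
    · simp only [hi, if_false, Pi.mul_apply, mul_pow]
      exact mul_mul_mul_comm _ _ _ _
  continuous_toFun := by
    refine continuous_pi fun i => ?_
    by_cases hi : i = 0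
    · simp only [hi, if_true]; fun_prop
    · simp only [hi, if_false]; fun_prop
  continuous_invFun := by
    refine continuous_pi fun i => ?_
    by_cases hi : i = 0
    · simp only [hi, if_true]; fun_prop
    · simp only [hi, if_false]; fun_prop

theorem isCircleFactor_powerCircle (s a : ℕ) : IsCircleFactor (powerCircle (s + 1) a) := by
  refine ⟨powerShear s a, 0, fun z => funext fun i => ?_⟩
  change z ^ a ^ (i : ℕ) = if i = 0 then (Pi.mulSingle 0 z : Torus (s + 1)) 0 else
    (Pi.mulSingle 0 z : Torus (s + 1)) i * (Pi.mulSingle 0 z : Torus (s + 1)) 0 ^ a ^ (i : ℕ)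
  by_cases hi : i = 0
  · simp [hi]
  · simp [hi]

/-- The isotropy groups of a circle action are finite at the points which are not fixed. -/
theorem finite_range_inf_stabilizer {Y : Type*} [TopologicalSpace Y] [T2Space Y]
    [MulAction (Torus r) Y] [ContinuousSMul (Torus r) Y] {σ : Circle →ₜ* Torus r} {y : Y}
    (h : ∃ z : Circle, σ z • y ≠ y) :
    Finite (σ.toMonoidHom.range ⊓ MulAction.stabilizer (Torus r) y : Subgroup (Torus r)) := by
  set S : AddSubgroup ℝ :=
    { carrier := {θ | σ (Circle.exp θ) • y = y}
      add_mem' := by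
        intro s t hs ht
        rw [mem_ofPred_eq] at hs ht ⊢
        rw [Circle.exp_add, map_mul, mul_smul, ht, hs]
      zero_mem' := by simp
      neg_mem' := by
        intro s hs
        rw [mem_ofPred_eq] at hs ⊢
        rw [Circle.exp_neg, map_inv, inv_smul_eq_iff, hs] } with hS
  have hSmem : ∀ θ, θ ∈ S ↔ σ (Circle.exp θ) • y = y := fun θ => Iff.rfl
  have hcont : Continuous fun θ => σ (Circle.exp θ) • y :=
    ((σ.continuous_toFun.comp Circle.exp.continuous).smul continuous_const)
  have hclosed : IsClosed (S : Set ℝ) := isClosed_eq hcont continuous_const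
  -- The times fixing y form a closed subgroup of ℝ. A dense one would be everything, against the
  -- moving element; a cyclic one contains 2π = n • g, which leaves at most |n| isotropy elements.
  rcases S.dense_or_cyclic with hd | ⟨g, hg⟩
  · exfalso
    obtain ⟨z, hz⟩ := h
    apply hz
    have : (S : Set ℝ) = univ := by rw [← hclosed.closure_eq]; exact hd.closure_eq
    have h1 : Complex.arg z ∈ (S : Set ℝ) := this ▸ mem_univ _
    have h2 := (hSmem _).1 h1
    rwa [Circle.exp_arg] at h2
  · have h2π : 2 * Real.pi ∈ S := by rw [hSmem]; simp
    rw [hg, AddSubgroup.mem_closure_singleton] at h2π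
    obtain ⟨n, hn⟩ := h2π
    have hn0 : n ≠ 0 := by
      rintro rfl
      simp at hn
    have hsub : ((σ.toMonoidHom.range ⊓ MulAction.stabilizer (Torus r) y : Subgroup (Torus r)) :
        Set (Torus r)) ⊆ (fun m : ℤ => σ (Circle.exp (m • g))) '' (Ico 0 |n|) := by
      rintro _ ⟨⟨z, rfl⟩, hz⟩
      have h1 : Complex.arg z ∈ S := by
        rw [hSmem, Circle.exp_arg]; exact hz
      rw [hg, AddSubgroup.mem_closure_singleton] at h1
      obtain ⟨m, hm⟩ := h1
      refine ⟨m % n, ⟨Int.emod_nonneg _ hn0, Int.emod_lt_abs _ hn0⟩, ?_⟩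
      have h3 : m • g = (m % n) • g + (m / n) • (2 * Real.pi) := by
        have e : m % n + m / n * n = m := by rw [mul_comm]; exact Int.emod_add_mul_ediv m n
        rw [← hn, smul_smul, ← add_smul, e]
      have h4 : Circle.exp (m • g) = Circle.exp ((m % n) • g) := by
        rw [h3, Circle.exp_add]
        have : Circle.exp ((m / n) • (2 * Real.pi)) = 1 :=
          Circle.exp_eq_one.2 ⟨m / n, by simp⟩
        rw [this, mul_one]
      simp only
      rw [← h4, hm, Circle.exp_arg]
      rfl
    exact ((Set.finite_Ico _ _).image _).subset hsub

/-- A compact space without torus fixed points has a good cover. -/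
theorem exists_isGoodCover_of_no_fixed_point {Y : Type*} [TopologicalSpace Y] [CompactSpace Y]
    [T2Space Y] [MulAction (Torus r) Y] [ContinuousSMul (Torus r) Y]
    (h : ∀ y : Y, ∃ τ : Torus r, τ • y ≠ y) :
    ∃ (k : ℕ) (U : Fin k → Set Y) (σ : Fin k → Circle →ₜ* Torus r), IsGoodCover U σ := by
  rcases isEmpty_or_nonempty Y with hY | ⟨⟨y₀⟩⟩
  · refine ⟨0, fun _ => ∅, fun i => i.elim0, fun i => i.elim0, Subsingleton.elim _ _,
      fun i => i.elim0, fun i => i.elim0, fun i => i.elim0, fun I hI => ?_⟩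
    obtain ⟨y, -⟩ := hI
    exact hY.elim y
  obtain ⟨s, rfl⟩ : ∃ s, r = s + 1 := by
    refine Nat.exists_eq_succ_of_ne_zero ?_
    rintro rfl
    obtain ⟨τ, hτ⟩ := h y₀
    exact hτ (by rw [Subsingleton.elim τ 1, one_smul])
  obtain ⟨a, ha⟩ := exists_forall_powerVector_not_fixed h
  have hfin : ∀ y : Y, Finite ((powerCircle (s + 1) a).toMonoidHom.range ⊓
      MulAction.stabilizer (Torus (s + 1)) y : Subgroup (Torus (s + 1))) := by
    intro y
    obtain ⟨t, ht⟩ := ha y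
    exact finite_range_inf_stabilizer ⟨Circle.exp t, by rwa [powerCircle_exp]⟩
  -- One open set, the whole space, and one generic circle already form a good cover.
  refine ⟨1, fun _ => univ, fun _ => powerCircle (s + 1) a, fun _ => isOpen_univ, iUnion_const univ,
    fun _ _ _ _ => mem_univ _, fun _ => isCircleFactor_powerCircle s a, fun _ y _ => hfin y,
    fun I _ => ?_⟩
  have hlie := lieAlg_circlesSubgroup (σ := fun _ : Fin 1 => powerCircle (s + 1) a)
    (ξ := fun _ => powerVector (s + 1) a) (fun _ θ => powerCircle_exp (s + 1) a θ) I
  have hle : circlesSubgroup (fun _ : Fin 1 => powerCircle (s + 1) a) I ≤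
      (powerCircle (s + 1) a).toMonoidHom.range := iSup₂_le fun _ _ => le_rfl
  refine ⟨?_, fun y _ => ?_⟩
  · rw [hlie]
    rcases I.eq_empty_or_nonempty with rfl | hI
    · simp
    · have h1 : I = Finset.univ := by
        obtain ⟨i, hi⟩ := hI
        exact Finset.eq_univ_of_forall fun j => by rwa [Subsingleton.elim j i]
      have hne : powerVector (s + 1) a ≠ 0 := fun h0 => by
        have := congrFun h0 0
        simp [powerVector] at this
      rw [h1, Finset.coe_univ, image_univ, range_const, finrank_span_singleton hne]
      simp
  · have := hfin y
    exact Finite.of_injective _ (Subgroup.inclusion_injective (inf_le_inf_right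
      (MulAction.stabilizer (Torus (s + 1)) y) hle))

end GenericCircle

/-! ## Fixed points near the boundary -/

section Boundary

variable {n : ℕ} {X : Type*} [TopologicalSpace X]

theorem halfSpace_mem_nhds {x : Euc (n + 1)} (hx : 0 < x 0) : halfSpace n ∈ 𝓝 x := by
  have : IsOpen {x : Euc (n + 1) | 0 < x 0} := isOpen_lt continuous_const (by fun_prop)
  exact mem_of_superset (this.mem_nhds hx) fun y hy => (le_of_lt hy : (0 : ℝ) ≤ y 0)

theorem halfSpace_notMem_nhds {x : Euc (n + 1)} (hx : x 0 = 0) : halfSpace n ∉ 𝓝 x := by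
  intro h
  have ht : Tendsto (fun t : ℝ => x - t • EuclideanSpace.single (0 : Fin (n + 1)) (1 : ℝ)) (𝓝[>] 0)
      (𝓝 x) := by
    have : Tendsto (fun t : ℝ => x - t • EuclideanSpace.single (0 : Fin (n + 1)) (1 : ℝ)) (𝓝 0)
      (𝓝 (x - (0 : ℝ) • EuclideanSpace.single (0 : Fin (n + 1)) (1 : ℝ))) :=
      Continuous.tendsto (by fun_prop) _
    simpa using this.mono_left nhdsWithin_le_nhds
  obtain ⟨t, h1, h2⟩ := ((ht.eventually h).and self_mem_nhdsWithin).exists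
  simp only [PiLp.sub_apply, PiLp.smul_apply, hx,
    PiLp.single_apply, if_true, smul_eq_mul, mul_one, zero_sub] at h1
  have : (0 : ℝ) < t := h2
  linarith

/-- The interior points of a chart are not boundary points. -/
theorem OrbifoldAtlas.proj_notMem_boundary (A : OrbifoldWithBoundary n X)
    {c : OrbifoldChart (halfSpace n) X} (hc : c ∈ A.charts) {u : Euc (n + 1)} (hu : u ∈ c.dom)
    (hu0 : 0 < u 0) : c.proj u ∉ A.boundary := by
  rintro ⟨c', hc', x, hx, hx0, hproj⟩
  obtain ⟨h, ⟨⟨O, hO, hs⟩, ⟨O', hO', ht⟩, hsm, hsm'⟩, hus, hux, -⟩ :=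
    A.compatible c hc c' hc' u hu x hx hproj.symm
  have hxt : x ∈ h.target := hux ▸ h.map_source hus
  have hsrc : h.source ∈ 𝓝 u := by
    rw [hs] at hus ⊢
    obtain ⟨O₂, hO₂, hd⟩ := c.relOpen_dom
    rw [hd] at hus ⊢
    exact inter_mem (inter_mem (halfSpace_mem_nhds hu0) (hO₂.mem_nhds hus.1.2)) (hO.mem_nhds hus.2)
  have htgt : h.target ∈ 𝓝[halfSpace n] x := by
    rw [ht] at hxt ⊢
    exact inter_mem (c'.dom_mem hx) (mem_nhdsWithin_of_mem_nhds (hO'.mem_nhds hxt.2))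
  have htsub : h.target ⊆ halfSpace n := by
    rw [ht]; exact inter_subset_left.trans c'.dom_subset
  have hcd : ContDiffAt ℝ ∞ h u := (hsm u hus).contDiffAt hsrc
  have hsx : h.symm x = u := by rw [← hux]; exact h.left_inv hus
  have hk : HasFDerivWithinAt h.symm (fderivWithin ℝ h.symm (halfSpace n) x) (halfSpace n) x :=
    (((hsm' x hxt).mono_of_mem_nhdsWithin htgt).differentiableWithinAt (by simp)).hasFDerivWithinAt
  have hD : HasFDerivAt h (fderiv ℝ h u) u := (hcd.differentiableAt (by simp)).hasFDerivAt
  have hcomp := HasFDerivAt.comp_hasFDerivWithinAt (g := h) (f := h.symm) x (by rwa [hsx]) hk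
  have hid : HasFDerivWithinAt (h ∘ h.symm) (ContinuousLinearMap.id ℝ _) (halfSpace n) x := by
    refine (hasFDerivWithinAt_id x _).congr_of_eventuallyEq ?_ (h.right_inv hxt)
    filter_upwards [htgt] with y hy using h.right_inv hy
  have heq := ((isModelSet_halfSpace n).uniqueDiffWithinAt (c'.dom_subset hx)).eq hcomp hid
  have hsurj : (fderiv ℝ h u).range = ⊤ := by
    rw [LinearMap.range_eq_top]
    intro v
    exact ⟨_, congrArg (fun T : Euc (n + 1) →L[ℝ] Euc (n + 1) => T v) heq⟩
  -- The change of charts is open at the interior point u, so its image, which lies in the half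
  -- space, would be a full neighbourhood of the boundary point x.
  have hmap := HasStrictFDerivAt.map_nhds_eq_of_surj (hcd.hasStrictFDerivAt (by simp)) hsurj
  refine halfSpace_notMem_nhds hx0 ?_
  rw [← hux, ← hmap, mem_map]
  filter_upwards [hsrc] with y hy using htsub (h.map_source hy)

variable {W : Type*} {q : Euc (n + 1) → W} {x : Euc (n + 1)}

/-- Finitely many local symmetries at a boundary point have common fixed points in the interior. -/
theorem exists_interior_fixed {ι : Type*} [Finite ι] (hx0 : x 0 = 0)
    {h : ι → Euc (n + 1) → Euc (n + 1)}
    (hh : ∀ a, IsLocalSymm q (halfSpace n) x (h a))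
    (hcov : ∀ᶠ p in 𝓝[halfSpace n] x ×ˢ 𝓝[halfSpace n] x, q p.1 = q p.2 → ∃ a, h a p.1 = p.2) :
    ∃ᶠ u in 𝓝[halfSpace n] x, 0 < u 0 ∧ ∀ a, h a u = u := by
  classical
  have hH := isModelSet_halfSpace n
  have hx : x ∈ halfSpace n := hx0.ge
  obtain ⟨Γ, hΓ, b, ψ, hb, hψ, ⟨ψ', hψ'v, hψ'⟩, hall, heqv, -⟩ := exists_linearization hH hx hh hcov
  set m : ℝ := (Fintype.card Γ : ℝ)
  have hm : 1 ≤ m := Nat.one_le_cast.2 (Fintype.card_pos (α := Γ))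
  set e₀ : Euc (n + 1) := EuclideanSpace.single 0 1 with he₀
  -- A symmetry maps the half space to itself and fixes x, so its first coordinate is minimal at x;
  -- the derivative in the inward direction is therefore nonnegative.
  have hpos : ∀ g : Γ, 0 ≤ ((g : Euc (n + 1) ≃L[ℝ] Euc (n + 1)) e₀) 0 := by
    intro g
    have h1 : HasFDerivWithinAt (fun y => (h (b g) y) 0)
        ((EuclideanSpace.proj (0 : Fin (n + 1)) : Euc (n + 1) →L[ℝ] ℝ).comp
          ((g : Euc (n + 1) ≃L[ℝ] Euc (n + 1)) : Euc (n + 1) →L[ℝ] Euc (n + 1)))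
        (halfSpace n) x :=
      (EuclideanSpace.proj (0 : Fin (n + 1)) : Euc (n + 1) →L[ℝ] ℝ).hasFDerivAt.comp_hasFDerivWithinAt
        x (hb g)
    have h2 : IsLocalMinOn (fun y => (h (b g) y) 0) (halfSpace n) x := by
      filter_upwards [(hh (b g)).maps] with y hy
      rw [(hh (b g)).fix, hx0]
      exact hy
    refine h2.hasFDerivWithinAt_nonneg h1 (mem_posTangentConeAt_of_segment_subset ?_)
    refine hH.convex.segment_subset hx ?_
    simp [halfSpace, he₀, hx0]
  -- The orbit sum of the inward normal is Γ-invariant, and the term g = 1 makes it point strictly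
  -- inward.
  set v₁ : Euc (n + 1) := ∑ g : Γ, (g : Euc (n + 1) ≃L[ℝ] Euc (n + 1)) e₀ with hv₁
  have hv₁fix : ∀ g : Γ, (g : Euc (n + 1) ≃L[ℝ] Euc (n + 1)) v₁ = v₁ := by
    intro g
    rw [hv₁, map_sum]
    exact Fintype.sum_equiv (Equiv.mulLeft g) _ _ fun g' => rfl
  have hv₁pos : 0 < v₁ 0 := by
    rw [hv₁, WithLp.ofLp_sum, Finset.sum_apply]
    refine Finset.sum_pos' (fun g _ => hpos g) ⟨1, Finset.mem_univ _, ?_⟩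
    change 0 < e₀ 0
    simp [he₀]
  have hψs : ContDiffWithinAt ℝ 1 ψ (halfSpace n) x := by
    rw [hψ]
    refine ContDiffWithinAt.sum fun g _ => ?_
    exact ((g : Euc (n + 1) ≃L[ℝ] Euc (n + 1)).symm.contDiff.contDiffAt).comp_contDiffWithinAt x
      ((hh (b g)).smooth.sub contDiffWithinAt_const)
  have hψx : ψ x = 0 := by simp [hψ, (hh _).fix]
  set δ : ℝ := v₁ 0 / 2 with hδ
  have hδpos : 0 < δ := by positivity
  -- From C (‖v₁‖ + δ) = δ ≤ m δ the error C ε ‖v₁‖ of the linear approximation at x + ε v₁ is at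
  -- most (m - C) ε δ, the radius of the ball that ψ covers.
  set C : ℝ := δ / (‖v₁‖ + δ) with hC
  have hCpos : 0 < C := by positivity
  obtain ⟨ρ, hρ, happ⟩ := hψs.eventually_approx hH hx hψ' hCpos
  have hlin : ApproximatesLinearOn ψ (ψ' : Euc (n + 1) →L[ℝ] Euc (n + 1))
      (halfSpace n ∩ Metric.ball x ρ) ⟨C, hCpos.le⟩ := fun y hy z hz => happ y hy z hz
  let R : (ψ' : Euc (n + 1) →L[ℝ] Euc (n + 1)).NonlinearRightInverse :=
    { toFun := fun v => m⁻¹ • v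
      nnnorm := ⟨m⁻¹, by positivity⟩
      bound' := fun v => by
        rw [norm_smul, Real.norm_of_nonneg (by positivity)]; rfl
      right_inv' := fun v => by
        change ψ' (m⁻¹ • v) = v
        rw [hψ'v, smul_smul, mul_inv_cancel₀ (by positivity), one_smul] }
  have hcoord : ∀ v : Euc (n + 1), |v 0| ≤ ‖v‖ := fun v => by
    simpa using EuclideanSpace.norm_eq v ▸ (PiLp.norm_apply_le v 0)
  -- The equation ψ u = ψ' (ε v₁) is solved in the ball of radius ε δ about x + ε v₁. As δ is half
  -- the first coordinate of v₁, this ball avoids the boundary.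
  have key : ∀ ε : ℝ, 0 < ε → ε * (‖v₁‖ + δ) < ρ → ∃ u ∈ halfSpace n, dist u x ≤ ε * (‖v₁‖ + δ) ∧
      0 < u 0 ∧ ψ u = ψ' (ε • v₁) := by
    intro ε hε hερ
    set p := x + ε • v₁ with hp
    have hsub : ∀ y ∈ Metric.closedBall p (ε * δ), 0 < y 0 ∧ dist y x ≤ ε * (‖v₁‖ + δ) := by
      intro y hy
      rw [Metric.mem_closedBall, dist_eq_norm] at hy
      constructor
      · have h1 := (abs_le.1 ((hcoord (y - p)).trans hy)).1
        simp only [hp, PiLp.sub_apply, PiLp.add_apply, PiLp.smul_apply, hx0, smul_eq_mul,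
          zero_add] at h1
        have : ε * v₁ 0 = 2 * (ε * δ) := by rw [hδ]; ring
        have : 0 < ε * δ := by positivity
        linarith
      · calc dist y x ≤ dist y p + dist p x := dist_triangle _ _ _
          _ ≤ ε * δ + ε * ‖v₁‖ := by
            rw [dist_eq_norm, dist_eq_norm]
            refine add_le_add hy ?_
            rw [hp, add_sub_cancel_left, norm_smul, Real.norm_of_nonneg hε.le]
          _ = ε * (‖v₁‖ + δ) := by ring
    have hball : Metric.closedBall p (ε * δ) ⊆ halfSpace n ∩ Metric.ball x ρ := fun y hy =>
      ⟨(hsub y hy).1.le, (hsub y hy).2.trans_lt hερ⟩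
    have hsurj := hlin.surjOn_closedBall_of_nonlinearRightInverse R (by positivity) hball
    have hpmem : p ∈ halfSpace n ∩ Metric.ball x ρ :=
      hball (Metric.mem_closedBall_self (by positivity))
    have htarget : ψ' (ε • v₁) ∈ Metric.closedBall (ψ p) (((m⁻¹)⁻¹ - C) * (ε * δ)) := by
      have h1 := happ p hpmem x ⟨hx, Metric.mem_ball_self hρ⟩
      rw [hψx, sub_zero, hp, add_sub_cancel_left, norm_smul, Real.norm_of_nonneg hε.le] at h1
      rw [Metric.mem_closedBall, dist_comm, dist_eq_norm]
      refine h1.trans ?_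
      rw [inv_inv]
      have h2 : C * (‖v₁‖ + δ) = δ := by rw [hC]; field_simp
      nlinarith [mul_pos hε hδpos]
    obtain ⟨u, hu, hu2⟩ := hsurj htarget
    exact ⟨u, (hball hu).1, (hsub u hu).2, (hsub u hu).1, hu2⟩
  -- If ψ u is a multiple of v₁ it is Γ-fixed, so ψ takes the same value at u and at its images, and
  -- local injectivity of ψ fixes u.
  have hfixed : ∀ᶠ u in 𝓝[halfSpace n] x, ∀ ε : ℝ, ψ u = ψ' (ε • v₁) → ∀ a, h a u = u := by
    have h1 : ∀ᶠ u in 𝓝[halfSpace n] x, ∀ g : Γ,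
        ψ (h (b g) u) = (g : Euc (n + 1) ≃L[ℝ] Euc (n + 1)) (ψ u) := eventually_all.2 heqv
    have h2 : ∀ᶠ u in 𝓝[halfSpace n] x, ∀ g : Γ, ψ (h (b g) u) = ψ u → h (b g) u = u := by
      rw [eventually_all]
      intro g
      obtain ⟨ε, hε, hinj⟩ := hψs.eventually_injective hH hx hψ'
      have hb' := inter_mem_nhdsWithin (halfSpace n) (Metric.ball_mem_nhds x hε)
      filter_upwards [(hh (b g)).tendsto hb', hb'] with u k1 k2 k3 using hinj _ k1 _ k2 k3
    have h3 : ∀ᶠ u in 𝓝[halfSpace n] x, ∀ a, ∃ g, h a u = h (b g) u := by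
      rw [eventually_all]
      intro a
      obtain ⟨g, hg⟩ := hall a
      exact hg.mono fun u hu => ⟨g, hu⟩
    filter_upwards [h1, h2, h3] with u k1 k2 k3 ε hε a
    obtain ⟨g, hg⟩ := k3 a
    rw [hg]
    refine k2 g ?_
    rw [k1, hε, hψ'v, map_smul, map_smul, hv₁fix]
  refine fun hcon => ?_
  have hev := hfixed.and hcon
  obtain ⟨η, hη, hηsub⟩ := Metric.mem_nhdsWithin_iff.1 hev
  have hnpos : 0 < ‖v₁‖ + δ := by positivity
  set ε := min ρ η / (2 * (‖v₁‖ + δ)) with hεdef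
  have hmin : 0 < min ρ η := lt_min hρ hη
  have hε : 0 < ε := by positivity
  have hεeq : ε * (‖v₁‖ + δ) = min ρ η / 2 := by rw [hεdef]; field_simp
  obtain ⟨u, hu1, hu2, hu3, hu4⟩ := key ε hε (by
    rw [hεeq]; exact (half_lt_self hmin).trans_le (min_le_left _ _))
  have hu5 : dist u x < η := by
    refine hu2.trans_lt ?_
    rw [hεeq]; exact (half_lt_self hmin).trans_le (min_le_right _ _)
  obtain ⟨k1, k2⟩ := hηsub ⟨hu5, hu1⟩
  exact k2 ⟨hu3, k1 ε hu4⟩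

end Boundary

/-! ## Vanishing of vector fields near fixed points on the boundary -/

section Vanishing

variable {r n : ℕ} {X : Type*} [TopologicalSpace X] [MulAction (Torus r) X]

/-- Coordinates of a torsion element are N-th roots of unity. Finiteness is what allows lifts of the
torsion elements to be linearized simultaneously. -/
instance finite_torsion_torus (N : ℕ) [NeZero N] :
    Finite (powMonoidHom N : Torus r →* Torus r).ker := by
  have h1 : {z : Circle | z ^ N = 1}.Finite := by
    refine ((Polynomial.nthRoots N (1 : ℂ)).toFinset.finite_toSet.preimage
      (f := ((↑) : Circle → ℂ)) Circle.coe_injective.injOn).subset fun z hz => ?_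
    have hz : z ^ N = 1 := hz
    simp only [mem_preimage, Finset.mem_coe, Multiset.mem_toFinset,
      Polynomial.mem_nthRoots (NeZero.pos N)]
    exact congrArg ((↑) : Circle → ℂ) hz
  refine ((Set.Finite.pi' fun _ : Fin r => h1).subset (?_ : {τ : Torus r | τ ^ N = 1} ⊆ _)).to_subtype
  exact fun τ hτ i => congrFun hτ i

/-- A closed orbit of a short period of a local flow near a fixed point is constant. -/
theorem deriv_eq_zero_of_periodic {E : Type*} [NormedAddCommGroup E] [NormedSpace ℝ E]
    {G : ℝ → E → E} {u : E} {p : ℝ} (hp : 0 < p) {f : E} (hf : HasDerivAt (fun s => G s u) f 0)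
    (h0 : G 0 u = u) (hper : G p u = u) {T : ℝ → E →L[ℝ] E}
    (hT : ∀ s ∈ Icc 0 p, HasFDerivAt (G s) (T s) u ∧ ‖T s - ContinuousLinearMap.id ℝ E‖ ≤ 1 / 2)
    (hadd : ∀ s ∈ Icc 0 p, ∀ᶠ h in 𝓝 (0 : ℝ), G s (G h u) = G (s + h) u) : f = 0 := by
  -- By additivity the velocity at time s is T s f, which differs from f by at most ‖f‖/2. Over a
  -- full period G s u - s f changes by -p f, so ‖f‖ ≤ ‖f‖/2.
  have hder : ∀ s ∈ Icc 0 p, HasDerivAt (fun s => G s u - s • f) (T s f - f) s := by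
    intro s hs
    have h1 : HasDerivAt (fun h => G s (G h u)) (T s f) 0 := by
      have h2 : HasFDerivAt (G s) (T s) (G 0 u) := by rw [h0]; exact (hT s hs).1
      exact h2.comp_hasDerivAt 0 hf
    have h3 : HasDerivAt (fun h => G (s + h) u) (T s f) 0 :=
      h1.congr_of_eventuallyEq ((hadd s hs).mono fun h hh => hh.symm)
    have h4 : HasDerivAt (fun s => G s u) (T s f) s := by
      have := HasDerivAt.comp_sub_const (f := fun h => G (s + h) u) s s (by rwa [sub_self])
      simpa using this
    have h5 : HasDerivAt (fun s : ℝ => s • f) ((1 : ℝ) • f) s := (hasDerivAt_id s).smul_const f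
    rw [one_smul] at h5
    exact h4.sub h5
  have hb := norm_image_sub_le_of_norm_deriv_le_segment' (f := fun s => G s u - s • f)
    (f' := fun s => T s f - f) (C := 1 / 2 * ‖f‖)
    (fun s hs => (hder s hs).hasDerivWithinAt) (fun s hs => ?_) p (right_mem_Icc.2 hp.le)
  · simp only [hper, h0, zero_smul, sub_zero, sub_sub_cancel_left, norm_neg, norm_smul,
      Real.norm_of_nonneg hp.le] at hb
    have : ‖f‖ ≤ 0 := by nlinarith [norm_nonneg f]
    exact norm_le_zero_iff.1 this
  · have := (T s - ContinuousLinearMap.id ℝ E).le_of_opNorm_le (hT s (Ico_subset_Icc_self hs)).2 f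
    simpa using this

/-- A common fixed point u of the lifted N-torsion and of the chart group elements fixing x has
closed orbits of period 2π/N under the coordinate flows. For large N these orbits are constant, so
the derivative of the local flow at u vanishes in every torus direction. -/
theorem SmoothAction.frequently_vanishing {A : OrbifoldWithBoundary n X}
    (hA : SmoothAction (r := r) A) {c : OrbifoldChart (halfSpace n) X} (hc : c ∈ A.charts)
    {x : Euc (n + 1)} (hx : x ∈ c.dom) (hx0 : x 0 = 0) (hfix : ∀ τ : Torus r, τ • c.proj x = c.proj x) :
    ∃ᶠ u in 𝓝[halfSpace n] x, c.proj u ∉ A.boundary ∧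
      ∀ φ : X → Fin r → ℝ, VectorFieldVanishesAt A φ (c.proj u) := by
  classical
  have hH := isModelSet_halfSpace n
  let H := halfSpace n
  have hxH := c.dom_subset hx
  set S : Set ((Fin r → ℝ) × Euc (n + 1)) := univ ×ˢ H with hSdef
  have hS : IsModelSet S := hH.univ_prod
  have hpS : ((0 : Fin r → ℝ), x) ∈ S := ⟨mem_univ _, hxH⟩
  obtain ⟨g, hg⟩ := hA.exists_isLocalFlow hH hc hx
  have hgx : g (0, x) = x := hg.zero.self_of_nhdsWithin hxH
  have hgs := hg.toIsLocalLift.smoothAt hxH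
  have hgt : Tendsto g (𝓝[S] (0, x)) (𝓝[H] x) := by simpa [hgx] using hg.toIsLocalLift.tendsto hxH
  have hfst : Tendsto (fun v : (Fin r → ℝ) × Euc (n + 1) => v.2) (𝓝[S] (0, x)) (𝓝[H] x) := by
    rw [hSdef, nhdsWithin_prod_eq]; exact tendsto_snd
  -- the derivative in the second variable
  have hinr : (fderivWithin ℝ g S (0, x)).comp (ContinuousLinearMap.inr ℝ (Fin r → ℝ) (Euc (n + 1)))
      = ContinuousLinearMap.id ℝ (Euc (n + 1)) := by
    have h1 : HasFDerivWithinAt g (fderivWithin ℝ g S (0, x)) S (0, x) :=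
      (hgs.differentiableWithinAt (by simp)).hasFDerivWithinAt
    have h2 := HasFDerivWithinAt.comp x (g := g) (t := S) h1
      (hasFDerivWithinAt_zero_prodMk (Q := Fin r → ℝ) (H := H) (x := x))
      (fun y hy => ⟨mem_univ _, hy⟩)
    have h3 := (hasFDerivWithinAt_id (𝕜 := ℝ) x H).congr_of_eventuallyEq (f₁ := g ∘ fun y => (0, y))
      (hg.zero.mono fun y hy => hy) hgx
    exact (hH.uniqueDiffWithinAt hxH).eq h2 h3
  have hcont : ∀ᶠ v in 𝓝[S] ((0 : Fin r → ℝ), x),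
      ‖(fderivWithin ℝ g S v).comp (ContinuousLinearMap.inr ℝ (Fin r → ℝ) (Euc (n + 1))) -
        ContinuousLinearMap.id ℝ (Euc (n + 1))‖ ≤ 1 / 2 := by
    have h1 : ContinuousWithinAt (fderivWithin ℝ g S) S (0, x) :=
      (hgs.fderivWithin_right (m := 0) (fun y hy => hS.uniqueDiffWithinAt hy) (by simp)
        hpS).continuousWithinAt
    have h2 : ContinuousWithinAt (fun v => ‖(fderivWithin ℝ g S v).comp
        (ContinuousLinearMap.inr ℝ (Fin r → ℝ) (Euc (n + 1))) - ContinuousLinearMap.id ℝ (Euc (n + 1))‖)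
        S (0, x) := ((h1.clm_comp continuousWithinAt_const).sub continuousWithinAt_const).norm
    have h3 := Filter.Tendsto.eventually_lt_const (u := 1 / 2) (by simp [hinr]) h2.tendsto
    exact h3.mono fun v hv => le_of_lt hv
  -- returning elements of the group
  have := c.finite_group
  have hcov := eventually_exists_subtype (q := c.proj) (s := H) (x := x)
    (h := fun γ : c.group => ((γ : Equiv.Perm (Euc (n + 1))) : Euc (n + 1) → Euc (n + 1)))
    (fun γ => (c.tendsto_group γ.2 hx).mono_right nhdsWithin_le_nhds)
    (c.eventually_exists_group hx)
  have hcov' := (hfst.prodMk hgt).eventually hcov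
  obtain ⟨δ₁, hδ₁, hnear⟩ := Metric.mem_nhdsWithin_iff.1
    ((hg.smooth.and hg.maps).and ((hg.lifts.and hcont).and hcov'))
  obtain ⟨δ₂, hδ₂, hadd⟩ := Metric.mem_nhdsWithin_iff.1 hg.add
  set δ := min δ₁ δ₂ with hδdef
  have hδ : 0 < δ := lt_min hδ₁ hδ₂
  -- The period 2π/N must be below δ, so that the whole closed orbit stays where the flow is
  -- additive and close to the identity to first order.
  obtain ⟨N, hN⟩ := exists_nat_gt (2 * Real.pi / δ)
  have hNpos : (0 : ℝ) < N := lt_trans (by positivity) hN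
  have : NeZero N := ⟨by rintro rfl; simp at hNpos⟩
  set p : ℝ := 2 * Real.pi / N with hp
  have hp0 : 0 < p := by positivity
  have hpδ : p < δ := by
    rw [hp, div_lt_iff₀ hNpos]
    rw [div_lt_iff₀ hδ] at hN
    linarith [mul_comm δ N]
  -- the symmetries of order `N`
  set F := (powMonoidHom N : Torus r →* Torus r).ker with hF
  choose l hl hlx using fun τ : F => hA.exists_isLocalLift hc hc (τ := (τ : Torus r)) hx hx (hfix _)
  -- Points are identified when they lie over the same orbit of the N-torsion. The local symmetries
  -- of this relation are the lifts of torsion elements followed by chart group elements.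
  set q : Euc (n + 1) → Set X := fun y => MulAction.orbit F (c.proj y) with hq
  set h : F × c.group → Euc (n + 1) → Euc (n + 1) := fun a y => (a.2 : Equiv.Perm _) (l a.1 (0, y))
    with hh
  have hhl : ∀ a : F × c.group, IsLocalLift c c (a.1 : Torus r) x ((a.2 : Equiv.Perm _) ∘ l a.1) := fun a =>
    (hl (a : F × c.group).1).group_comp a.2.2
  have hht : ∀ a : F × c.group, Tendsto (h a) (𝓝[H] x) (𝓝 (h a x)) := fun a =>
    ((hhl a).tendsto_zero hxH).mono_right nhdsWithin_le_nhds
  have hlt : ∀ τ : F, Tendsto (fun y => l τ (0, y)) (𝓝[H] x) (𝓝[H] x) := fun τ => by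
    simpa [hlx] using (hl τ).tendsto_zero hxH
  have hqcov : ∀ᶠ p in 𝓝[H] x ×ˢ 𝓝[H] x, q p.1 = q p.2 → ∃ a, h a p.1 = p.2 := by
    have h1 : ∀ᶠ p in 𝓝[H] x ×ˢ 𝓝[H] x, ∀ τ : F, c.proj (l τ (0, p.1)) = c.proj p.2 →
        ∃ γ : c.group, (γ : Equiv.Perm _) (l τ (0, p.1)) = p.2 :=
      eventually_all.2 fun τ =>
        (((hlt τ).comp tendsto_fst).prodMk tendsto_snd).eventually (c.eventually_exists_group hx)
    have h2 : ∀ᶠ p in 𝓝[H] x ×ˢ 𝓝[H] x, ∀ τ : F, c.proj (l τ (0, p.1)) = τ • c.proj p.1 :=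
      eventually_all.2 fun τ => tendsto_fst.eventually (hl τ).lifts_zero
    filter_upwards [h1, h2] with y k1 k2 k3
    have : c.proj y.2 ∈ MulAction.orbit F (c.proj y.1) := by
      rw [show MulAction.orbit F (c.proj y.1) = _ from k3]; exact MulAction.mem_orbit_self _
    obtain ⟨τ, hτ⟩ := this
    obtain ⟨γ, hγ⟩ := k1 τ ((k2 τ).trans hτ)
    exact ⟨(τ, γ), hγ⟩
  have hqcov' := eventually_exists_subtype hht hqcov
  have hsymm : ∀ a : {a // h a x = x}, IsLocalSymm q H x (h a) := by
    intro a
    refine ⟨a.2, ((hhl a).smooth_zero hxH).of_le (by simp),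
      (hhl a).maps_zero.mono fun y hy => c.dom_subset hy, ?_⟩
    filter_upwards [(hhl a).lifts_zero] with y hy
    have hy : c.proj (h a y) = a.1.1 • c.proj y := hy
    simp only [hq, hy]
    exact MulAction.orbit_eq_iff.2 ⟨a.1.1, rfl⟩
  have hfreq := exists_interior_fixed (q := q) hx0 hsymm hqcov'
  have hev : ∀ᶠ u in 𝓝[H] x, (u ∈ c.dom ∧ dist u x < δ) ∧ (∀ τ : F, c.proj (l τ (0, u)) = τ • c.proj u)
      ∧ g (0, u) = u :=
    (Filter.Eventually.and (c.dom_mem hx) (mem_nhdsWithin_of_mem_nhds (Metric.ball_mem_nhds x hδ))).and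
      ((eventually_all.2 fun τ => (hl τ).lifts_zero).and hg.zero)
  refine (hfreq.and_eventually hev).mono ?_
  rintro u ⟨⟨hu0, hua⟩, ⟨hud, hux⟩, hul, hgu⟩
  have huH := c.dom_subset hud
  refine ⟨A.proj_notMem_boundary hc hud hu0, ?_⟩
  have hmem : ∀ ξ : Fin r → ℝ, ‖ξ‖ < δ → (ξ, u) ∈ Metric.ball (0, x) δ₁ ∩ S := by
    intro ξ hξ
    refine ⟨?_, mem_univ _, huH⟩
    rw [Metric.mem_ball, Prod.dist_eq, max_lt_iff, dist_zero_right]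
    exact ⟨hξ.trans_le (min_le_left _ _), hux.trans_le (min_le_left _ _)⟩
  have hSnhds : ∀ ξ : Fin r → ℝ, S ∈ 𝓝 (ξ, u) := fun ξ =>
    prod_mem_nhds univ_mem (halfSpace_mem_nhds hu0)
  have hdiff : ∀ ξ : Fin r → ℝ, ‖ξ‖ < δ → HasFDerivAt g (fderivWithin ℝ g S (ξ, u)) (ξ, u) := by
    intro ξ hξ
    have h1 : ContDiffWithinAt ℝ ∞ g S (ξ, u) := (hnear (hmem ξ hξ)).1.1
    exact ((h1.differentiableWithinAt (by simp)).hasFDerivWithinAt).hasFDerivAt (hSnhds ξ)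
  set e : Fin r → Fin r → ℝ := fun j => Pi.single j 1 with he
  have hnorm : ∀ j s, ‖(s : ℝ) • e j‖ = |s| := fun j s => by
    rw [norm_smul, he, Pi.norm_single, norm_one, mul_one, Real.norm_eq_abs]
  have hcore : ∀ j, fderivWithin ℝ g S (0, u) (e j, 0) = 0 := by
    intro j
    have hcurve : HasDerivAt (fun s : ℝ => (s • e j, u)) (e j, 0) 0 := by
      have := (hasDerivAt_id (0 : ℝ)).smul_const (e j)
      rw [one_smul] at this
      exact this.prodMk (hasDerivAt_const _ _)
    -- The element exp(p e_j) is N-torsion and its lift fixes u, so it fixes the image of u. Hence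
    -- the flow brings u to γ u for some chart group element γ fixing x, and u is fixed by γ as
    -- well.
    have hper : g (p • e j, u) = u := by
      have hτF : torusExp (p • e j) ∈ F := by
        change torusExp (p • e j) ^ N = 1
        funext i
        change Circle.exp ((p • e j) i) ^ N = 1
        rw [← Circle.exp_natCast_mul]
        have : (N : ℝ) * (p • e j) i = if i = j then 2 * Real.pi else 0 := by
          simp only [he, Pi.smul_apply, Pi.single_apply, smul_eq_mul]
          split_ifs
          · rw [hp]; field_simp
          · simp
        rw [this]
        split_ifs <;> simp
      have hone : ∀ τ : F, l τ (0, u) = u := fun τ => hua ⟨(τ, 1), hlx τ⟩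
      have h1 := hnear (hmem (p • e j) (by rw [hnorm, abs_of_pos hp0]; exact hpδ))
      have h2 : c.proj (g (p • e j, u)) = torusExp (p • e j) • (1 : Torus r) • c.proj u := h1.2.1.1
      have h3 := hul ⟨_, hτF⟩
      rw [hone] at h3
      have h3 : c.proj u = torusExp (p • e j) • c.proj u := h3
      obtain ⟨⟨γ, hγx⟩, hγ⟩ := h1.2.2 (show c.proj u = c.proj (g (p • e j, u)) by
        rw [h2, one_smul, ← h3])
      have h4 := hua ⟨(1, γ), by
        change (γ : Equiv.Perm _) (l 1 (0, x)) = x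
        rw [hlx]; exact hγx⟩
      have h4 : (γ : Equiv.Perm _) (l 1 (0, u)) = u := h4
      rw [hone] at h4
      exact hγ.symm.trans h4
    refine deriv_eq_zero_of_periodic (G := fun s y => g (s • e j, y)) (u := u) hp0 ?_
      (by simpa using hgu) hper (T := fun s => (fderivWithin ℝ g S (s • e j, u)).comp
        (ContinuousLinearMap.inr ℝ (Fin r → ℝ) (Euc (n + 1)))) ?_ ?_
    · have h1 : HasFDerivAt g (fderivWithin ℝ g S (0, u)) ((0 : ℝ) • e j, u) := by
        simpa using hdiff 0 (by simpa using hδ)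
      exact h1.comp_hasDerivAt (0 : ℝ) hcurve
    · intro s hs
      have hsn : ‖s • e j‖ < δ := by
        rw [hnorm, abs_of_nonneg hs.1]; exact hs.2.trans_lt hpδ
      refine ⟨?_, (hnear (hmem _ hsn)).2.1.2⟩
      exact (hdiff _ hsn).comp u (hasFDerivAt_prodMk_right (s • e j) u)
    · intro s hs
      have hsn : ‖s • e j‖ < δ := by
        rw [hnorm, abs_of_nonneg hs.1]; exact hs.2.trans_lt hpδ
      filter_upwards [Metric.ball_mem_nhds (0 : ℝ) hδ] with t ht
      have ht : |t| < δ := by simpa using ht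
      have := @hadd (s • e j, t • e j, u) ⟨?_, mem_univ _, mem_univ _, huH⟩
      · simpa [add_smul] using this
      · simp only [Metric.mem_ball, Prod.dist_eq, max_lt_iff, dist_zero_right, hnorm]
        exact ⟨hsn.trans_le (min_le_right _ _) |> fun h => by simpa [hnorm] using h,
          ht.trans_le (min_le_right _ _), hux.trans_le (min_le_right _ _)⟩
  have hzero : ∀ ξ : Fin r → ℝ, fderivWithin ℝ g S (0, u) (ξ, 0) = 0 := by
    intro ξ
    have : (ξ, (0 : Euc (n + 1))) = ∑ j, ξ j • (e j, (0 : Euc (n + 1))) := by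
      ext i
      · simp [he, Prod.fst_sum, Finset.sum_apply, Pi.single_apply]
      · simp [Prod.snd_sum]
    rw [this, map_sum]
    exact Finset.sum_eq_zero fun j _ => by rw [map_smul, hcore, smul_zero]
  intro φ
  set ξ := φ (c.proj u)
  have hcv : HasDerivAt (fun t : ℝ => (-(t • ξ), u)) (-ξ, 0) 0 := by
    have := ((hasDerivAt_id (0 : ℝ)).smul_const ξ).neg
    rw [one_smul] at this
    exact this.prodMk (hasDerivAt_const _ _)
  refine ⟨c, hc, fun t => g (-(t • ξ), u), by simp [hgu], ?_, ?_⟩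
  · have h1 : Tendsto (fun t : ℝ => -(t • ξ)) (𝓝 0) (𝓝 0) := by
      have : Continuous (fun t : ℝ => -(t • ξ)) := by fun_prop
      simpa using this.tendsto 0
    filter_upwards [h1.eventually (Metric.ball_mem_nhds 0 hδ)] with t ht
    have h2 := hnear (hmem (-(t • ξ)) (by simpa using ht))
    exact ⟨h2.1.2, by simpa using h2.2.1.1⟩
  · have h1 : HasFDerivAt g (fderivWithin ℝ g S (0, u)) (-((0 : ℝ) • ξ), u) := by
      simpa using hdiff 0 (by simpa using hδ)
    have := h1.comp_hasDerivAt (0 : ℝ) hcv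
    rwa [hzero] at this

end Vanishing

/-- A torus fixed point on the boundary would be a limit of interior zeros of V^φ. The vanishing set
is compact, hence closed, and misses the boundary, so there is no such point. -/
theorem exists_isGoodCover_of_isCompact_vanishing {n r : ℕ} {Y : Type u} {X : Type v}
    [TopologicalSpace Y] [CompactSpace Y] [T2Space Y] [MulAction (Torus r) Y]
    [ContinuousSMul (Torus r) Y] {B : Orbifold n Y}
    [TopologicalSpace X] [T2Space X] [MulAction (Torus r) X]
    {A : OrbifoldWithBoundary n X} (hA : SmoothAction (r := r) A)
    {f : Y → X} (hf : IsBoundaryIso B A f) (hfT : ∀ (τ : Torus r) (m : Y), f (τ • m) = τ • f m)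
    {φ : X → Fin r → ℝ} (hK : IsCompact {m | m ∈ A.boundaryᶜ ∧ VectorFieldVanishesAt A φ m}) :
    ∃ (k : ℕ) (U : Fin k → Set Y) (σ : Fin k → Circle →ₜ* Torus r), IsGoodCover U σ := by
  refine exists_isGoodCover_of_no_fixed_point fun y => ?_
  by_contra! hy
  have hyb : f y ∈ A.boundary := hf.2.1 ▸ mem_range_self y
  have hyK : f y ∈ {m | m ∈ A.boundaryᶜ ∧ VectorFieldVanishesAt A φ m}ᶜ := fun h => h.1 hyb
  obtain ⟨c, hc, x, hx, hx0, hproj⟩ := id hyb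
  have h1 := hA.frequently_vanishing hc hx hx0 fun τ => by rw [hproj, ← hfT, hy]
  have h2 : Tendsto c.proj (𝓝[halfSpace n] x) (𝓝 (f y)) := by
    rw [← hproj, ← c.nhdsWithin_dom hx]
    exact c.continuousOn_proj x hx
  obtain ⟨u, h3, h4⟩ := (h1.and_eventually (h2.eventually (hK.isClosed.isOpen_compl.mem_nhds hyK))).exists
  exact h4 ⟨h3.1, h3.2 φ⟩

/-! ## Critical values of real functions -/

section Sard

open MeasureTheory

theorem eventually_nhds_contDiffAt_comp {E F G : Type*} [NormedAddCommGroup E] [NormedSpace ℝ E]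
    [NormedAddCommGroup F] [NormedSpace ℝ F] [NormedAddCommGroup G] [NormedSpace ℝ G]
    {g : F → G} {f : E → F} {x : E} (hg : ∀ᶠ y in 𝓝 (f x), ContDiffAt ℝ ∞ g y)
    (hf : ∀ᶠ y in 𝓝 x, ContDiffAt ℝ ∞ f y) : ∀ᶠ y in 𝓝 x, ContDiffAt ℝ ∞ (fun z => g (f z)) y := by
  filter_upwards [hf.self_of_nhds.continuousAt.eventually hg, hf] with y h1 h2 using h1.comp y h2

/-- A level set is locally parametrized at a regular point. -/
theorem exists_level_parametrization {E V : Type*} [NormedAddCommGroup E] [NormedSpace ℝ E]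
    [FiniteDimensional ℝ E] [NormedAddCommGroup V] [NormedSpace ℝ V] [FiniteDimensional ℝ V]
    {F : E → V} {x : E} (hF : ∀ᶠ y in 𝓝 x, ContDiffAt ℝ ∞ F y)
    (hs : Function.Surjective (fderiv ℝ F x)) :
    ∃ (G : Submodule ℝ E) (Ω : Set G) (Ψ : G → E), Module.finrank ℝ G + Module.finrank ℝ V =
      Module.finrank ℝ E ∧ IsOpen Ω ∧ ContDiffOn ℝ ∞ Ψ Ω ∧ (∀ u ∈ Ω, F (Ψ u) = F x) ∧
      ∀ᶠ y in 𝓝 x, F y = F x → ∃ u ∈ Ω, Ψ u = y := by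
  set D := fderiv ℝ F x with hD
  set G : Submodule ℝ E := LinearMap.ker (D : E →ₗ[ℝ] V) with hG
  obtain ⟨π₀, hπ₀⟩ := LinearMap.exists_leftInverse_of_injective G.subtype G.ker_subtype
  have hπ : ∀ g : G, π₀ g = g := fun g => LinearMap.congr_fun hπ₀ g
  let π : E →L[ℝ] G := LinearMap.toContinuousLinearMap π₀
  -- A projection onto ker D completes F to a local coordinate system, in which the level set is a
  -- coordinate plane.
  have hbij : Function.Bijective (D.prod π) := by
    constructor
    · rw [injective_iff_map_eq_zero]
      intro v hv
      have h1 : D v = 0 := congrArg Prod.fst hv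
      have h2 : π₀ v = 0 := congrArg Prod.snd hv
      have h3 := hπ ⟨v, h1⟩
      rw [h2] at h3
      exact (congrArg Subtype.val h3).symm
    · rintro ⟨b, g⟩
      obtain ⟨v, rfl⟩ := hs b
      refine ⟨v + ((g - π₀ v : G) : E), ?_⟩
      have h1 : D ((g - π₀ v : G) : E) = 0 := (g - π₀ v).2
      refine Prod.ext ?_ ?_
      · change D _ = D v
        rw [map_add, h1, add_zero]
      · change π₀ _ = g
        rw [map_add, hπ]; abel
  let T : E ≃L[ℝ] V × G := ContinuousLinearEquiv.ofBijective (D.prod π)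
    (LinearMap.ker_eq_bot.2 hbij.1) (LinearMap.range_eq_top.2 hbij.2)
  have hder : HasFDerivAt (fun v => (F v, π v)) (T : E →L[ℝ] V × G) x := by
    have : (T : E →L[ℝ] V × G) = D.prod π := by ext1 v; rfl
    rw [this]
    exact (hF.self_of_nhds.differentiableAt (by simp)).hasFDerivAt.prodMk π.hasFDerivAt
  obtain ⟨e, he, hxe, -, -, hsm⟩ := exists_openPartialHomeomorph_contDiffOn
    (f := fun v => (F v, π v)) (hF.mono fun y hy => hy.prodMk π.contDiff.contDiffAt) hder univ_mem
  have hΩ : Continuous fun u : G => (F x, u) := by fun_prop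
  refine ⟨G, {u | (F x, u) ∈ e.target}, fun u => e.symm (F x, u), ?_, e.open_target.preimage hΩ,
    hsm.comp (contDiff_prodMk_right _).contDiffOn fun u hu => hu, fun u hu => ?_, ?_⟩
  · have := LinearMap.finrank_range_add_finrank_ker (D : E →ₗ[ℝ] V)
    rw [LinearMap.range_eq_top.2 hs, finrank_top] at this
    exact (add_comm _ _).trans this
  · have := congrArg Prod.fst (e.right_inv hu)
    rwa [he] at this
  · filter_upwards [e.open_source.mem_nhds hxe] with y hy hyx
    refine ⟨π y, ?_, ?_⟩
    · rw [← hyx, ← he y]; exact e.map_source hy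
    · rw [← hyx, ← he y]; exact e.left_inv hy

/-- Countably many of the given neighbourhoods cover A, by second countability. -/
theorem volume_image_eq_zero_of_local {E : Type*} [TopologicalSpace E] [SecondCountableTopology E]
    {f : E → ℝ} {A : Set E} (h : ∀ x ∈ A, ∃ N ∈ 𝓝 x, volume (f '' (A ∩ N)) = 0) :
    volume (f '' A) = 0 := by
  choose! N hN hf using h
  obtain ⟨t, htA, ht, hcov⟩ := TopologicalSpace.countable_cover_nhdsWithin
    (f := N) fun x hx => mem_nhdsWithin_of_mem_nhds (hN x hx)
  refine measure_mono_null (t := ⋃ x ∈ t, f '' (A ∩ N x)) ?_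
    ((measure_biUnion_null_iff ht).2 fun x hx => hf x (htA hx))
  rintro _ ⟨y, hy, rfl⟩
  obtain ⟨x, hx, hyx⟩ := mem_iUnion₂.1 (hcov hy)
  exact mem_iUnion₂.2 ⟨x, hx, y, ⟨hy, hyx⟩, rfl⟩

variable {E : Type} [NormedAddCommGroup E] [NormedSpace ℝ E]

/-- A function whose derivatives up to order `m` vanish at a point. -/
theorem norm_sub_le_of_iteratedFDeriv_eq_zero {x : E} {ε C : ℝ} (m : ℕ) :
    ∀ {F : Type} [NormedAddCommGroup F] [NormedSpace ℝ F] {h : E → F},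
      (∀ y ∈ Metric.ball x ε, ContDiffAt ℝ (m + 1) h y) →
      (∀ i, 1 ≤ i → i ≤ m → iteratedFDeriv ℝ i h x = 0) →
      (∀ y ∈ Metric.ball x ε, ‖iteratedFDeriv ℝ (m + 1) h y‖ ≤ C) →
      ∀ y ∈ Metric.ball x ε, ‖h y - h x‖ ≤ C * ‖y - x‖ ^ (m + 1) := by
  induction m with
  | zero =>
    intro F _ _ h hs _ hC y hy
    have hx : x ∈ Metric.ball x ε := Metric.mem_ball_self (dist_nonneg.trans_lt hy)
    rw [zero_add, pow_one]
    refine (convex_ball x ε).norm_image_sub_le_of_norm_fderiv_le (𝕜 := ℝ) (fun z hz =>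
      (hs z hz).differentiableAt (by simp)) (fun z hz => ?_) hx hy
    have := hC z hz
    rwa [zero_add, norm_iteratedFDeriv_one] at this
  | succ m ih =>
    intro F _ _ h hs h0 hC y hy
    have hx : x ∈ Metric.ball x ε := Metric.mem_ball_self (dist_nonneg.trans_lt hy)
    have hdx : fderiv ℝ h x = 0 := by
      have := congrArg norm (h0 1 le_rfl (by omega))
      rw [norm_iteratedFDeriv_one, norm_zero] at this
      exact norm_eq_zero.1 this
    -- The derivative vanishes at x and satisfies the hypotheses one order lower. The resulting
    -- bound along the segment gains one power through the mean value inequality.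
    have key := ih (h := fderiv ℝ h) (fun z hz => (hs z hz).fderiv_right (by norm_cast))
      (fun i hi hi' => by
        have := congrArg norm (h0 (i + 1) (by omega) (by omega))
        rw [← norm_iteratedFDeriv_fderiv, norm_zero] at this
        exact norm_eq_zero.1 this)
      (fun z hz => by rw [norm_iteratedFDeriv_fderiv]; exact hC z hz)
    have hsub : segment ℝ x y ⊆ Metric.ball x ε := (convex_ball x ε).segment_subset hx hy
    have hC0 : 0 ≤ C := (norm_nonneg _).trans (hC x hx)
    have := (convex_segment x y).norm_image_sub_le_of_norm_hasFDerivWithin_le (𝕜 := ℝ) (f := h)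
      (f' := fderiv ℝ h) (C := C * ‖y - x‖ ^ (m + 1))
      (fun z hz => ((hs z (hsub hz)).differentiableAt (by simp)).hasFDerivAt.hasFDerivWithinAt)
      (fun z hz => ?_) (left_mem_segment ℝ x y) (right_mem_segment ℝ x y)
    · rwa [mul_assoc, ← pow_succ] at this
    · have h1 := key z (hsub hz)
      rw [hdx, sub_zero] at h1
      refine h1.trans ?_
      gcongr
      obtain ⟨t, ht, rfl⟩ := (segment_eq_image' ℝ x y ▸ hz : z ∈ _)
      rw [add_sub_cancel_left, norm_smul, Real.norm_of_nonneg ht.1]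
      exact mul_le_of_le_one_left (norm_nonneg _) ht.2

/-- Where all derivatives up to order d vanish, f is Hölder of exponent d + 1 on A locally. The
image then has Hausdorff dimension at most d/(d+1) < 1 and is null. -/
theorem volume_image_eq_zero_of_flat [FiniteDimensional ℝ E] {f : E → ℝ} {A : Set E}
    (hf : ∀ x ∈ A, ∀ᶠ y in 𝓝 x, ContDiffAt ℝ ∞ f y)
    (h0 : ∀ x ∈ A, ∀ i, 1 ≤ i → i ≤ Module.finrank ℝ E → iteratedFDeriv ℝ i f x = 0) :
    volume (f '' A) = 0 := by
  have := FiniteDimensional.proper_real E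
  refine volume_image_eq_zero_of_local fun x hx => ?_
  set d := Module.finrank ℝ E
  have hc : ContinuousAt (fun y => ‖iteratedFDeriv ℝ (d + 1) f y‖) x :=
    ((hf x hx).self_of_nhds.iteratedFDeriv_right (m := 0) (i := d + 1)
      (by exact_mod_cast le_top)).continuousAt.norm
  set C : NNReal := ⟨‖iteratedFDeriv ℝ (d + 1) f x‖ + 1, by positivity⟩ with hCdef
  have hCe : ∀ᶠ y in 𝓝 x, ‖iteratedFDeriv ℝ (d + 1) f y‖ ≤ C :=
    (hc.eventually (Iic_mem_nhds (lt_add_one _)))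
  obtain ⟨ε, hε, hball⟩ := Metric.eventually_nhds_iff_ball.1 ((hf x hx).and hCe)
  -- Two points within ε/4 of x lie in each other's ball of radius ε/2, which stays inside the ball
  -- of radius ε where the bounds hold.
  refine ⟨Metric.ball x (ε / 4), Metric.ball_mem_nhds x (by positivity), ?_⟩
  have hhol : HolderOnWith C ((d + 1 : ℕ) : NNReal) f (A ∩ Metric.ball x (ε / 4)) := by
    intro y hy z hz
    have hy2 : dist y x < ε / 4 := hy.2
    have hz2 : dist z x < ε / 4 := hz.2
    have hsub : Metric.ball z (ε / 2) ⊆ Metric.ball x ε :=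
      Metric.ball_subset_ball' (by linarith)
    have hyz : y ∈ Metric.ball z (ε / 2) := by
      rw [Metric.mem_ball]
      linarith [dist_triangle_right y z x]
    have h1 := norm_sub_le_of_iteratedFDeriv_eq_zero (x := z) (ε := ε / 2) (C := C) d (h := f)
      (fun w hw => (hball w (hsub hw)).1.of_le (by exact_mod_cast le_top))
      (h0 z hz.1) (fun w hw => (hball w (hsub hw)).2) y hyz
    rw [edist_nndist, edist_nndist, NNReal.coe_natCast, ENNReal.rpow_natCast, ← ENNReal.coe_pow,
      ← ENNReal.coe_mul, ENNReal.coe_le_coe, ← NNReal.coe_le_coe]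
    simpa [dist_eq_norm] using h1
  have h1 := hhol.dimH_image_le (by positivity)
  have h2 : dimH (f '' (A ∩ Metric.ball x (ε / 4))) < 1 := by
    refine h1.trans_lt ?_
    have h3 : dimH (A ∩ Metric.ball x (ε / 4)) ≤ d :=
      (dimH_mono (subset_univ _)).trans (Real.dimH_univ_eq_finrank E).le
    refine (ENNReal.div_le_div_right h3 _).trans_lt ?_
    rw [ENNReal.div_lt_iff (by simp) (by simp), one_mul]
    push_cast
    exact_mod_cast Nat.lt_succ_self d
  have h4 := hausdorffMeasure_of_dimH_lt (d := 1) (by simpa using h2)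
  rwa [NNReal.coe_one, hausdorffMeasure_real] at h4

/-- The critical values of a smooth real function are a null set. -/
theorem volume_critical_values (d : ℕ) : ∀ {E : Type} [NormedAddCommGroup E] [NormedSpace ℝ E]
    [FiniteDimensional ℝ E], Module.finrank ℝ E = d → ∀ {f : E → ℝ} {A : Set E},
    (∀ x ∈ A, ∀ᶠ y in 𝓝 x, ContDiffAt ℝ ∞ f y) → (∀ x ∈ A, fderiv ℝ f x = 0) →
    volume (f '' A) = 0 := by
  induction d using Nat.strong_induction_on with
  | _ d ihd =>
  intro E _ _ _ hd f A hf hA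
  have := FiniteDimensional.proper_real E
  -- Inside the induction on dimension, e bounds how many further orders of vanishing are needed:
  -- derivatives up to order j vanish on A, and once j ≥ d the flat case applies.
  suffices key : ∀ (e j : ℕ), 1 ≤ j → d ≤ j + e → ∀ A : Set E,
      (∀ x ∈ A, ∀ᶠ y in 𝓝 x, ContDiffAt ℝ ∞ f y) →
      (∀ x ∈ A, ∀ i, 1 ≤ i → i ≤ j → iteratedFDeriv ℝ i f x = 0) → volume (f '' A) = 0 by
    refine key d 1 le_rfl (by omega) A hf fun x hx i h1 h2 => ?_
    obtain rfl : i = 1 := le_antisymm h2 h1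
    rw [← norm_eq_zero, norm_iteratedFDeriv_one, hA x hx, norm_zero]
  intro e
  induction e with
  | zero =>
    intro j _ hj A hf h0
    exact volume_image_eq_zero_of_flat hf fun x hx i h1 h2 => h0 x hx i h1 (by omega)
  | succ e ihe =>
    intro j hj1 hj A hf h0
    have hA1 := ihe (j + 1) (by omega) (by omega) {x ∈ A | iteratedFDeriv ℝ (j + 1) f x = 0}
      (fun x hx => hf x hx.1) fun x hx i h1 h2 => by
        rcases h2.eq_or_lt with rfl | h3
        · exact hx.2
        · exact h0 x hx.1 i h1 (by omega)
    -- Where the derivative of order j + 1 is nonzero, a component of the derivative of order j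
    -- vanishes on A and has nonzero differential. Locally A lies in its zero hypersurface, where
    -- the induction on dimension applies to f.
    have hA2 : volume (f '' {x ∈ A | iteratedFDeriv ℝ (j + 1) f x ≠ 0}) = 0 := by
      refine volume_image_eq_zero_of_local fun x hx => ?_
      obtain ⟨m, hm⟩ : ∃ m, iteratedFDeriv ℝ (j + 1) f x m ≠ 0 := by
        by_contra! hcon
        exact hx.2 (ContinuousMultilinearMap.ext hcon)
      have hit : ∀ y, ContDiffAt ℝ ∞ f y → ContDiffAt ℝ ∞ (iteratedFDeriv ℝ j f) y := fun y hy =>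
        hy.iteratedFDeriv_right (by exact_mod_cast le_rfl)
      set ev : (E [×j]→L[ℝ] ℝ) →L[ℝ] ℝ := ContinuousMultilinearMap.apply ℝ (fun _ => E) ℝ (Fin.tail m)
      have hw : ∀ᶠ y in 𝓝 x, ContDiffAt ℝ ∞ (fun y => ev (iteratedFDeriv ℝ j f y)) y :=
        (hf x hx.1).mono fun y hy => ev.contDiff.contDiffAt.comp y (hit y hy)
      have hder : fderiv ℝ (fun y => ev (iteratedFDeriv ℝ j f y)) x (m 0) ≠ 0 := by
        rw [iteratedFDeriv_succ_apply_left] at hm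
        have := (ev.hasFDerivAt.comp x ((hit x (hf x hx.1).self_of_nhds).differentiableAt
          (by simp)).hasFDerivAt).fderiv
        change fderiv ℝ (ev ∘ iteratedFDeriv ℝ j f) x (m 0) ≠ 0
        rw [this]
        exact hm
      have hsurj : Function.Surjective (fderiv ℝ (fun y => ev (iteratedFDeriv ℝ j f y)) x) := by
        intro b
        refine ⟨(b / fderiv ℝ (fun y => ev (iteratedFDeriv ℝ j f y)) x (m 0)) • m 0, ?_⟩
        rw [map_smul, smul_eq_mul, div_mul_cancel₀ _ hder]
      obtain ⟨G, Ω, Ψ, hG, hΩ, hΨ, -, hN⟩ := exists_level_parametrization hw hsurj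
      rw [Module.finrank_self] at hG
      refine ⟨_, hN, measure_mono_null (t := (fun u => f (Ψ u)) '' {u ∈ Ω | Ψ u ∈ A}) ?_ ?_⟩
      · rintro _ ⟨y, ⟨⟨hyA, -⟩, hy⟩, rfl⟩
        have hz : ∀ z ∈ A, ev (iteratedFDeriv ℝ j f z) = 0 := fun z hz => by
          rw [h0 z hz j hj1 le_rfl, map_zero]
        obtain ⟨u, hu, rfl⟩ := hy (by rw [hz y hyA, hz x hx.1])
        exact ⟨u, ⟨hu, hyA⟩, rfl⟩
      · have hΨa : ∀ u ∈ Ω, ContDiffAt ℝ ∞ Ψ u := fun u hu => hΨ.contDiffAt (hΩ.mem_nhds hu)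
        refine ihd (Module.finrank ℝ G) (by omega) rfl
          (fun u hu => eventually_nhds_contDiffAt_comp (hf _ hu.2)
            (Filter.mem_of_superset (hΩ.mem_nhds hu.1) hΨa)) fun u hu => ?_
        have h1 := ((hf _ hu.2).self_of_nhds.differentiableAt (by simp)).hasFDerivAt
        have h1' : fderiv ℝ f (Ψ u) = 0 := by
          rw [← norm_eq_zero, ← norm_iteratedFDeriv_one, h0 _ hu.2 1 le_rfl hj1, norm_zero]
        rw [h1'] at h1
        have h2 := h1.comp u ((hΨa u hu.1).differentiableAt (by simp)).hasFDerivAt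
        rw [ContinuousLinearMap.zero_comp] at h2
        exact h2.fderiv
    refine measure_mono_null (t := f '' {x ∈ A | iteratedFDeriv ℝ (j + 1) f x = 0} ∪
      f '' {x ∈ A | iteratedFDeriv ℝ (j + 1) f x ≠ 0}) ?_ (measure_union_null hA1 hA2)
    rintro _ ⟨x, hx, rfl⟩
    by_cases h : iteratedFDeriv ℝ (j + 1) f x = 0
    · exact Or.inl ⟨x, ⟨hx, h⟩, rfl⟩
    · exact Or.inr ⟨x, ⟨hx, h⟩, rfl⟩

/-- The critical values of the restriction of a smooth real function to a level set. -/
theorem volume_critical_values_level [FiniteDimensional ℝ E] {V : Type} [NormedAddCommGroup V]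
    [NormedSpace ℝ V] [FiniteDimensional ℝ V] {F : E → V} {f : E → ℝ} {A : Set E} {a : V}
    (hF : ∀ x ∈ A, ∀ᶠ y in 𝓝 x, ContDiffAt ℝ ∞ F y) (hf : ∀ x ∈ A, ∀ᶠ y in 𝓝 x, ContDiffAt ℝ ∞ f y)
    (hFa : ∀ x ∈ A, F x = a) (hs : ∀ x ∈ A, Function.Surjective (fderiv ℝ F x))
    (hker : ∀ x ∈ A, ∀ v, fderiv ℝ F x v = 0 → fderiv ℝ f x v = 0) :
    volume (f '' A) = 0 := by
  have := FiniteDimensional.proper_real E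
  refine volume_image_eq_zero_of_local fun x hx => ?_
  obtain ⟨G, Ω, Ψ, -, hΩ, hΨ, hFΨ, hN⟩ := exists_level_parametrization (hF x hx) (hs x hx)
  refine ⟨_, hN, measure_mono_null (t := (fun u => f (Ψ u)) '' {u ∈ Ω | Ψ u ∈ A}) ?_ ?_⟩
  · rintro _ ⟨y, ⟨hyA, hy⟩, rfl⟩
    obtain ⟨u, hu, rfl⟩ := hy (by rw [hFa y hyA, hFa x hx])
    exact ⟨u, ⟨hu, hyA⟩, rfl⟩
  · have hΨa : ∀ u ∈ Ω, ContDiffAt ℝ ∞ Ψ u := fun u hu => hΨ.contDiffAt (hΩ.mem_nhds hu)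
    refine volume_critical_values (Module.finrank ℝ G) rfl
      (fun u hu => eventually_nhds_contDiffAt_comp (hf _ hu.2)
        (Filter.mem_of_superset (hΩ.mem_nhds hu.1) hΨa)) fun u hu => ?_
    have hΨd := ((hΨa u hu.1).differentiableAt (by simp)).hasFDerivAt
    have h1 := ((hf _ hu.2).self_of_nhds.differentiableAt (by simp)).hasFDerivAt.comp u hΨd
    have h2 := ((hF _ hu.2).self_of_nhds.differentiableAt (by simp)).hasFDerivAt.comp u hΨd
    -- F is constant along the parametrization, so the derivative of Ψ takes values in ker dF, where
    -- df vanishes by hypothesis.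
    have h3 : HasFDerivAt (F ∘ Ψ) (0 : G →L[ℝ] V) u :=
      (hasFDerivAt_const (F x) u).congr_of_eventuallyEq
        (Filter.mem_of_superset (hΩ.mem_nhds hu.1) hFΨ)
    have h4 := h2.unique h3
    rw [show (fun u => f (Ψ u)) = f ∘ Ψ from rfl, h1.fderiv]
    ext v
    exact hker _ hu.2 _ (congrArg (fun T : G →L[ℝ] V => T v) h4)

end Sard

/-! ## Smooth functions on orbifolds -/

section SmoothFunctions

variable {n : ℕ} {Y : Type*} [TopologicalSpace Y]

theorem OrbifoldChart.isOpen_dom (c : OrbifoldChart (univ : Set (Euc n)) Y) : IsOpen c.dom := by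
  obtain ⟨O, hO, hd⟩ := c.relOpen_dom
  rw [hd, univ_inter]; exact hO

theorem IsLocalDiffeo.contDiffAt_surjective {E F : Type*} [NormedAddCommGroup E] [NormedSpace ℝ E]
    [NormedAddCommGroup F] [NormedSpace ℝ F] {A : Set E} {B : Set F} (hA : IsOpen A)
    (hB : IsOpen B) {h : PartialEquiv E F} (hh : IsLocalDiffeo A B h) {x : E} (hx : x ∈ h.source) :
    h.source ∈ 𝓝 x ∧ ContDiffAt ℝ ∞ h x ∧ Function.Surjective (fderiv ℝ h x) := by
  obtain ⟨⟨O, hO, hs⟩, ⟨O', hO', ht⟩, h1, h2⟩ := hh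
  have hsrc : IsOpen h.source := hs ▸ hA.inter hO
  have htgt : IsOpen h.target := ht ▸ hB.inter hO'
  have k1 : ContDiffAt ℝ ∞ h x := h1.contDiffAt (hsrc.mem_nhds hx)
  have k2 : ContDiffAt ℝ ∞ h.symm (h x) := h2.contDiffAt (htgt.mem_nhds (h.map_source hx))
  refine ⟨hsrc.mem_nhds hx, k1, fun w => ⟨fderiv ℝ h.symm (h x) w, ?_⟩⟩
  have k3 : HasFDerivAt h (fderiv ℝ h x) (h.symm (h x)) := by
    rw [h.left_inv hx]
    exact (k1.differentiableAt (by simp)).hasFDerivAt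
  have k4 := k3.comp (h x) (k2.differentiableAt (by simp)).hasFDerivAt
  have k5 : HasFDerivAt (h ∘ h.symm) (ContinuousLinearMap.id ℝ F) (h x) :=
    (hasFDerivAt_id _).congr_of_eventuallyEq
      (mem_of_superset (htgt.mem_nhds (h.map_source hx)) fun y hy => h.right_inv hy)
  exact congrArg (fun T : F →L[ℝ] F => T w) (k4.unique k5)

/-- Local diffeomorphisms over Y carry smoothness at a point from one chart to any other, so one
chart per point suffices. -/
theorem OrbifoldAtlas.smoothFunction_of_local {B : Orbifold n Y} {f : Y → ℝ}
    (h : ∀ p, ∃ c ∈ B.charts, ∃ x ∈ c.dom, c.proj x = p ∧ ContDiffAt ℝ ∞ (fun u => f (c.proj u)) x) :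
    B.SmoothFunction f := by
  intro c hc x hx
  obtain ⟨c', hc', x', hx', hp, hs⟩ := h (c.proj x)
  obtain ⟨e, he, hxe, hex, hpe⟩ := B.compatible c hc c' hc' x hx x' hx' hp.symm
  obtain ⟨h1, h2, -⟩ := he.contDiffAt_surjective c.isOpen_dom c'.isOpen_dom hxe
  rw [← hex] at hs
  have h3 : ContDiffAt ℝ ∞ ((fun u => f (c'.proj u)) ∘ e) x := hs.comp x h2
  refine (h3.congr_of_eventuallyEq ?_).contDiffWithinAt
  filter_upwards [h1] with v hv
  simp [hpe v hv]

theorem OrbifoldAtlas.SmoothFunction.contDiffAt {B : Orbifold n Y} {f : Y → ℝ}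
    (hf : B.SmoothFunction f) {c : OrbifoldChart univ Y} (hc : c ∈ B.charts) {x : Euc n}
    (hx : x ∈ c.dom) : ContDiffAt ℝ ∞ (fun u => f (c.proj u)) x :=
  (hf c hc).contDiffAt (c.isOpen_dom.mem_nhds hx)

theorem OrbifoldAtlas.SmoothFunction.continuous {B : Orbifold n Y} {f : Y → ℝ}
    (hf : B.SmoothFunction f) : Continuous f := by
  refine continuous_iff_continuousAt.2 fun p => ?_
  obtain ⟨c, hc, x, hx, rfl⟩ := B.covers p
  intro O hO
  obtain ⟨O', hO', hO'o, hp⟩ := mem_nhds_iff.1 hO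
  have h1 : IsOpen (c.dom ∩ (fun u => f (c.proj u)) ⁻¹' O') :=
    (hf c hc).continuousOn.isOpen_inter_preimage c.isOpen_dom hO'o
  have h2 := c.isOpen_image_proj _ h1
  rw [mem_map]
  refine mem_of_superset (h2.mem_nhds ⟨x, ⟨hx, hx, hp⟩, rfl⟩) ?_
  rintro _ ⟨u, ⟨-, -, hu⟩, rfl⟩
  exact hO' hu

/-- A Euclidean bump summed over the chart group descends to Y. Extension by zero is smooth because
the image of a compact ball is closed in the Hausdorff space Y. -/
theorem OrbifoldAtlas.exists_bump [T2Space Y] (B : Orbifold n Y) {p : Y} {U : Set Y} (hU : IsOpen U)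
    (hp : p ∈ U) : ∃ b : Y → ℝ, B.SmoothFunction b ∧ (∀ y, 0 ≤ b y) ∧ 0 < b p ∧
      ∃ C : Set Y, IsClosed C ∧ C ⊆ U ∧ ∀ y, y ∉ C → b y = 0 := by
  classical
  obtain ⟨c, hc, x, hx, rfl⟩ := B.covers p
  have := c.finite_group
  have := Fintype.ofFinite c.group
  have hV : IsOpen (c.dom ∩ c.proj ⁻¹' U) := c.continuousOn_proj.isOpen_inter_preimage c.isOpen_dom hU
  obtain ⟨ρ, hρ, hball⟩ := Metric.nhds_basis_closedBall.mem_iff.1 (hV.mem_nhds ⟨hx, hp⟩)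
  obtain ⟨β, hβs, hβ0, hβx, hβz⟩ : ∃ β : Euc n → ℝ, ContDiff ℝ ∞ β ∧ (∀ y, 0 ≤ β y) ∧ 0 < β x ∧
      ∀ y, ρ ≤ dist y x → β y = 0 := by
    let β : ContDiffBump x := ⟨ρ / 2, ρ, by positivity, by linarith⟩
    exact ⟨β, β.contDiff, fun y => β.nonneg, β.pos_of_mem_ball (Metric.mem_ball_self hρ),
      fun y hy => β.zero_of_le_dist hy⟩
  set s : Euc n → ℝ := fun u => ∑ γ : c.group, β ((γ : Equiv.Perm (Euc n)) u)
  set b : Y → ℝ := fun y => if h : ∃ u ∈ c.dom, c.proj u = y then s h.choose else 0 with hb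
  have hbs : ∀ u ∈ c.dom, b (c.proj u) = s u := by
    intro u hu
    have hex : ∃ u' ∈ c.dom, c.proj u' = c.proj u := ⟨u, hu, rfl⟩
    simp only [hb, dif_pos hex]
    obtain ⟨h1, h2⟩ := hex.choose_spec
    obtain ⟨γ₀, hγ₀, h3⟩ := (c.proj_eq_iff u hu _ h1).1 h2.symm
    rw [← h3]
    exact Equiv.sum_comp (Equiv.mulRight (⟨γ₀, hγ₀⟩ : c.group))
      fun γ : c.group => β ((γ : Equiv.Perm (Euc n)) u)
  have hC : IsCompact (c.proj '' Metric.closedBall x ρ) :=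
    (isCompact_closedBall x ρ).image_of_continuousOn (c.continuousOn_proj.mono fun y hy => (hball hy).1)
  have hzero : ∀ y, y ∉ c.proj '' Metric.closedBall x ρ → b y = 0 := by
    intro y hy
    by_cases hex : ∃ u ∈ c.dom, c.proj u = y
    · obtain ⟨u, hu, rfl⟩ := hex
      rw [hbs u hu]
      refine Finset.sum_eq_zero fun γ _ => ?_
      refine hβz _ ?_
      by_contra! hlt
      refine hy ⟨_, Metric.mem_closedBall.2 hlt.le, ?_⟩
      exact ((c.proj_eq_iff u hu _ (c.mapsTo_group _ γ.2 hu)).2 ⟨γ, γ.2, rfl⟩).symm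
    · simp only [hb, dif_neg hex]
  refine ⟨b, B.smoothFunction_of_local fun q => ?_, fun y => ?_, ?_, _, hC.isClosed, ?_, hzero⟩
  · by_cases hq : q ∈ c.proj '' Metric.closedBall x ρ
    · obtain ⟨u, hu, rfl⟩ := hq
      have hu := (hball hu).1
      refine ⟨c, hc, u, hu, rfl, ?_⟩
      have h1 : ContDiffAt ℝ ∞ s u := ContDiffAt.sum fun γ _ => hβs.contDiffAt.comp u
        ((c.smooth_group γ γ.2).contDiffAt (c.isOpen_dom.mem_nhds hu))
      exact h1.congr_of_eventuallyEq (mem_of_superset (c.isOpen_dom.mem_nhds hu) hbs)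
    · obtain ⟨c', hc', x', hx', rfl⟩ := B.covers q
      refine ⟨c', hc', x', hx', rfl, ?_⟩
      refine (contDiffAt_const (c := (0 : ℝ))).congr_of_eventuallyEq ?_
      filter_upwards [(c'.continuousOn_proj.continuousAt (c'.isOpen_dom.mem_nhds hx')).eventually
        (hC.isClosed.isOpen_compl.mem_nhds hq)] with v hv using hzero _ hv
  · by_cases hex : ∃ u ∈ c.dom, c.proj u = y
    · simp only [hb, dif_pos hex]
      exact Finset.sum_nonneg fun γ _ => hβ0 _
    · simp only [hb, dif_neg hex]; exact le_rfl
  · rw [hbs x hx]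
    exact Finset.sum_pos' (fun γ _ => hβ0 _) ⟨1, Finset.mem_univ _, hβx⟩
  · rintro _ ⟨u, hu, rfl⟩
    exact (hball hu).2

/-- Finitely many bumps with positive sum are grouped by the member of the cover to which each is
subordinate, and divided by the sum. -/
theorem OrbifoldAtlas.exists_smooth_partition [CompactSpace Y] [T2Space Y] (B : Orbifold n Y) {k : ℕ}
    {U : Fin k → Set Y} (hU : ∀ i, IsOpen (U i)) (hcov : ⋃ i, U i = univ) :
    ∃ ψ : Fin k → Y → ℝ, (∀ i, B.SmoothFunction (ψ i)) ∧ (∀ i y, 0 ≤ ψ i y) ∧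
      (∀ y, ∑ i, ψ i y = 1) ∧ ∀ i, ∃ C : Set Y, IsClosed C ∧ C ⊆ U i ∧ ∀ y, y ∉ C → ψ i y = 0 := by
  classical
  have h1 : ∀ p : Y, ∃ i, p ∈ U i := fun p => mem_iUnion.1 (hcov ▸ mem_univ p)
  choose i hi using h1
  choose b hbs hb0 hbp C hC hCU hbC using fun p : Y => B.exists_bump (hU (i p)) (hi p)
  obtain ⟨t, -, ht⟩ := isCompact_univ.elim_nhds_subcover (fun p => {y | 0 < b p y})
    fun p _ => (isOpen_lt continuous_const (hbs p).continuous).mem_nhds (hbp p)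
  set σ : Y → ℝ := fun y => ∑ p ∈ t, b p y with hσ
  have hσpos : ∀ y, 0 < σ y := by
    intro y
    obtain ⟨p, hp, hy⟩ := mem_iUnion₂.1 (ht (mem_univ y))
    exact Finset.sum_pos' (fun p _ => hb0 p y) ⟨p, hp, hy⟩
  refine ⟨fun j y => (∑ p ∈ t with i p = j, b p y) / σ y, fun j => ?_, fun j y => ?_, fun y => ?_,
    fun j => ⟨⋃ p ∈ {p ∈ t | i p = j}, C p, ?_, ?_, ?_⟩⟩
  · intro c hc
    refine ContDiffOn.div (ContDiffOn.sum fun p _ => hbs p c hc)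
      (ContDiffOn.sum fun p _ => hbs p c hc) fun x _ => (hσpos _).ne'
  · exact div_nonneg (Finset.sum_nonneg fun p _ => hb0 p y) (hσpos y).le
  · rw [← Finset.sum_div, Finset.sum_fiberwise]
    exact div_self (hσpos y).ne'
  · exact isClosed_biUnion_finset fun p _ => hC p
  · refine iUnion₂_subset fun p hp => ?_
    obtain ⟨-, rfl⟩ := Finset.mem_filter.1 hp
    exact hCU p
  · intro y hy
    refine div_eq_zero_iff.2 (Or.inl (Finset.sum_eq_zero fun p hp => ?_))
    exact hbC p y fun h => hy (mem_iUnion₂.2 ⟨p, hp, h⟩)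

/-! ## Regular values -/

/-- The index set I is moved from the codomain into a condition on a fixed family, so that
surjectivity can be compared for different I and in different charts. -/
theorem surjective_fderiv_pi_iff {k : ℕ} {E : Type*} [NormedAddCommGroup E] [NormedSpace ℝ E]
    {F : Fin k → E → ℝ} {x : E} (hF : ∀ i, DifferentiableAt ℝ (F i) x) (I : Finset (Fin k)) :
    Function.Surjective (fderiv ℝ (fun v (i : I) => F i v) x) ↔
      ∀ b : Fin k → ℝ, ∃ u, ∀ i ∈ I, fderiv ℝ (F i) x u = b i := by
  classical
  have h := fderiv_pi (𝕜 := ℝ) (φ := fun (i : I) v => F i v) (x := x) fun i => hF i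
  rw [h]
  constructor
  · intro hs b
    obtain ⟨u, hu⟩ := hs fun i => b i
    exact ⟨u, fun i hi => congrFun hu ⟨i, hi⟩⟩
  · intro hs b
    obtain ⟨u, hu⟩ := hs fun i => if hi : i ∈ I then b ⟨i, hi⟩ else 0
    refine ⟨u, funext fun i => ?_⟩
    have := hu i i.2
    rw [dif_pos i.2] at this
    exact this

/-- The levels are chosen one index at a time: α_j avoids the critical values of t φ_j on the level
sets already chosen, a null set by Sard. Compactness leaves finitely many charts to consider, and
transition maps carry regularity to the others. -/
theorem OrbifoldAtlas.exists_regular_levels [CompactSpace Y] (B : Orbifold n Y) {k : ℕ}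
    {φ : Fin k → Y → ℝ} (hφ : ∀ i, B.SmoothFunction (φ i)) :
    ∃ α : Fin k → ℝ, (∀ i, 1 < α i) ∧ ∀ I : Finset (Fin k), ∀ c ∈ B.charts, ∀ x ∈ c.dom, ∀ t : ℝ,
      (∀ i ∈ I, t * φ i (c.proj x) = α i) →
        Function.Surjective
          (fderiv ℝ (fun (v : Euc n × ℝ) (i : I) => v.2 * φ i (c.proj v.1)) (x, t)) := by
  classical
  have hsm : ∀ (i : Fin k), ∀ c ∈ B.charts, ∀ x ∈ c.dom, ∀ t : ℝ,
      ContDiffAt ℝ ∞ (fun v : Euc n × ℝ => v.2 * φ i (c.proj v.1)) (x, t) := fun i c hc x hx t =>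
    contDiffAt_snd.mul (ContDiffAt.comp (g := fun u => φ i (c.proj u)) (x, t) ((hφ i).contDiffAt hc hx)
      contDiffAt_fst)
  have hsme : ∀ (i : Fin k), ∀ c ∈ B.charts, ∀ v : Euc n × ℝ, v.1 ∈ c.dom →
      ∀ᶠ w in 𝓝 v, ContDiffAt ℝ ∞ (fun v : Euc n × ℝ => v.2 * φ i (c.proj v.1)) w := by
    intro i c hc v hv
    filter_upwards [continuousAt_fst.eventually (c.isOpen_dom.mem_nhds hv)] with w hw
    exact hsm i c hc w.1 hw w.2
  obtain ⟨T, hT⟩ : ∃ T : Finset Y, ∀ y : Y, ∃ p ∈ T, y ∈ (B.covers p).choose.proj '' (B.covers p).choose.dom := by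
    obtain ⟨T, -, hT⟩ := isCompact_univ.elim_nhds_subcover
      (fun p => (B.covers p).choose.proj '' (B.covers p).choose.dom) fun p _ => by
        obtain ⟨-, x, hx, hp⟩ := (B.covers p).choose_spec
        have := (B.covers p).choose.isOpen_image_proj univ isOpen_univ
        rw [inter_univ] at this
        exact this.mem_nhds ⟨x, hx, hp⟩
    exact ⟨T, fun y => by simpa using hT (mem_univ y)⟩
  set ch : Y → OrbifoldChart univ Y := fun p => (B.covers p).choose with hch
  have hchB : ∀ p, ch p ∈ B.charts := fun p => (B.covers p).choose_spec.1
  suffices key : ∀ s : Finset (Fin k), ∃ α : Fin k → ℝ, (∀ i, 1 < α i) ∧ ∀ I ⊆ s, ∀ p ∈ T,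
      ∀ x ∈ (ch p).dom, ∀ t : ℝ, (∀ i ∈ I, t * φ i ((ch p).proj x) = α i) →
        Function.Surjective
          (fderiv ℝ (fun (v : Euc n × ℝ) (i : I) => v.2 * φ i ((ch p).proj v.1)) (x, t)) by
    obtain ⟨α, hα, hreg⟩ := key Finset.univ
    refine ⟨α, hα, fun I c hc x hx t heq => ?_⟩
    obtain ⟨p, hpT, x', hx', hp⟩ := hT (c.proj x)
    obtain ⟨e, he, hxe, hex, hpe⟩ := B.compatible c hc (ch p) (hchB p) x hx x' hx' hp.symm
    obtain ⟨h1, h2, h3⟩ := he.contDiffAt_surjective c.isOpen_dom (ch p).isOpen_dom hxe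
    have h4 := hreg I (Finset.subset_univ I) p hpT x' hx' t (by
      intro i hi
      rw [← heq i hi, ← hp])
    rw [surjective_fderiv_pi_iff (F := fun i (v : Euc n × ℝ) => v.2 * φ i ((ch p).proj v.1))
      fun i => (hsm i _ (hchB p) x' hx' t).differentiableAt (by simp)] at h4
    rw [surjective_fderiv_pi_iff (F := fun i (v : Euc n × ℝ) => v.2 * φ i (c.proj v.1))
      fun i => (hsm i c hc x hx t).differentiableAt (by simp)]
    intro b
    obtain ⟨⟨u₁, u₂⟩, hu⟩ := h4 b
    obtain ⟨w₁, rfl⟩ := h3 u₁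
    refine ⟨(w₁, u₂), fun i hi => ?_⟩
    rw [← hu i hi]
    have hd : HasFDerivAt (fun v : Euc n × ℝ => (e v.1, v.2))
        (((fderiv ℝ e x).comp (ContinuousLinearMap.fst ℝ (Euc n) ℝ)).prod
          (ContinuousLinearMap.snd ℝ (Euc n) ℝ)) (x, t) :=
      ((h2.differentiableAt (by simp)).hasFDerivAt.comp (x, t) hasFDerivAt_fst).prodMk hasFDerivAt_snd
    have hF : HasFDerivAt (fun v : Euc n × ℝ => v.2 * φ i ((ch p).proj v.1))
        (fderiv ℝ (fun v : Euc n × ℝ => v.2 * φ i ((ch p).proj v.1)) (x', t)) (e x, t) := by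
      rw [hex]
      exact ((hsm i _ (hchB p) x' hx' t).differentiableAt (by simp)).hasFDerivAt
    have hcomp := HasFDerivAt.comp (x, t) hF hd
    have hcongr : (fun v : Euc n × ℝ => v.2 * φ i (c.proj v.1)) =ᶠ[𝓝 (x, t)]
        ((fun v : Euc n × ℝ => v.2 * φ i ((ch p).proj v.1)) ∘ fun v => (e v.1, v.2)) := by
      filter_upwards [continuousAt_fst.eventually h1] with v hv
      simp [hpe v.1 hv]
    rw [(hcomp.congr_of_eventuallyEq hcongr).fderiv]
    rfl
  intro s
  induction s using Finset.induction_on with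
  | empty =>
    refine ⟨fun _ => 2, fun _ => one_lt_two, fun I hI p _ x _ t _ => ?_⟩
    obtain rfl := Finset.subset_empty.1 hI
    exact fun b => ⟨0, Subsingleton.elim _ _⟩
  | insert j s hj ih =>
    obtain ⟨α, hα, hreg⟩ := ih
    -- The points of the level set for I at which adding the index j destroys surjectivity.
    set A : Finset (Fin k) → Y → Set (Euc n × ℝ) := fun I p => {v | v.1 ∈ (ch p).dom ∧
      (∀ i ∈ I, v.2 * φ i ((ch p).proj v.1) = α i) ∧ ¬ Function.Surjective
        (fderiv ℝ (fun (v : Euc n × ℝ) (i : (insert j I : Finset (Fin k))) =>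
          v.2 * φ i ((ch p).proj v.1)) v)} with hA
    have hnull : ∀ I ⊆ s, ∀ p ∈ T, MeasureTheory.volume
        ((fun v : Euc n × ℝ => v.2 * φ j ((ch p).proj v.1)) '' A I p) = 0 := by
      intro I hI p hp
      refine volume_critical_values_level
        (F := fun (v : Euc n × ℝ) (i : I) => v.2 * φ i ((ch p).proj v.1)) (a := fun i => α i)
        (fun v hv => ?_) (fun v hv => hsme j _ (hchB p) v hv.1) (fun v hv => funext fun i =>
          hv.2.1 i i.2) (fun v hv => hreg I hI p hp v.1 hv.1 v.2 hv.2.1) ?_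
      · filter_upwards [eventually_all.2 fun i => hsme i _ (hchB p) v hv.1] with w hw
        exact contDiffAt_pi.2 fun i => hw i
      · intro v hv u hu
        have hd : ∀ i, DifferentiableAt ℝ (fun v : Euc n × ℝ => v.2 * φ i ((ch p).proj v.1)) v :=
          fun i => (hsm i _ (hchB p) v.1 hv.1 v.2).differentiableAt (by simp)
        have hI2 := hreg I hI p hp v.1 hv.1 v.2 hv.2.1
        rw [surjective_fderiv_pi_iff
          (F := fun i (v : Euc n × ℝ) => v.2 * φ i ((ch p).proj v.1)) hd] at hI2
        have hu' : ∀ i ∈ I, fderiv ℝ (fun v : Euc n × ℝ => v.2 * φ i ((ch p).proj v.1)) v u = 0 := by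
          intro i hi
          rw [fderiv_pi fun i => hd _] at hu
          exact congrFun hu ⟨i, hi⟩
        -- If the j-th differential were nonzero on a common kernel vector u of the others, a
        -- multiple of u would correct the j-th component without disturbing the rest.
        by_contra hne
        refine hv.2.2 ((surjective_fderiv_pi_iff
          (F := fun i (v : Euc n × ℝ) => v.2 * φ i ((ch p).proj v.1)) hd _).2 fun b => ?_)
        obtain ⟨w, hw⟩ := hI2 b
        refine ⟨w + ((b j - fderiv ℝ (fun v : Euc n × ℝ => v.2 * φ j ((ch p).proj v.1)) v w) /
          fderiv ℝ (fun v : Euc n × ℝ => v.2 * φ j ((ch p).proj v.1)) v u) • u, fun i hi => ?_⟩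
        rw [map_add, map_smul, smul_eq_mul]
        rcases Finset.mem_insert.1 hi with rfl | hi
        · rw [div_mul_cancel₀ _ hne]; ring
        · rw [hw i hi, hu' i hi, mul_zero, add_zero]
    have hall : MeasureTheory.volume (⋃ I ∈ s.powerset, ⋃ p ∈ T,
        (fun v : Euc n × ℝ => v.2 * φ j ((ch p).proj v.1)) '' A I p) = 0 := by
      refine (MeasureTheory.measure_biUnion_null_iff s.powerset.countable_toSet).2 fun I hI => ?_
      refine (MeasureTheory.measure_biUnion_null_iff T.countable_toSet).2 fun p hp => ?_
      exact hnull I (Finset.mem_powerset.1 hI) p hp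
    obtain ⟨a, ha1, ha⟩ : ∃ a : ℝ, 1 < a ∧ a ∉ (⋃ I ∈ s.powerset, ⋃ p ∈ T,
        (fun v : Euc n × ℝ => v.2 * φ j ((ch p).proj v.1)) '' A I p) := by
      by_contra! hcon
      have h1 : MeasureTheory.volume (Ioi (1 : ℝ)) = 0 :=
        MeasureTheory.measure_mono_null (fun a ha => hcon a ha) hall
      simp at h1
    refine ⟨Function.update α j a, fun i => ?_, fun I hI p hp x hx t heq => ?_⟩
    · rcases eq_or_ne i j with rfl | hne
      · simpa using ha1
      · simpa [hne] using hα i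
    · by_cases hjI : j ∈ I
      · by_contra hns
        have hins : insert j (I.erase j) = I := Finset.insert_erase hjI
        refine ha (mem_iUnion₂.2 ⟨I.erase j, ?_, mem_iUnion₂.2 ⟨p, hp, (x, t), ⟨hx, ?_, ?_⟩, ?_⟩⟩)
        · rw [Finset.mem_powerset]
          intro i hi
          exact (Finset.mem_insert.1 (hI (Finset.mem_of_mem_erase hi))).resolve_left
            (Finset.ne_of_mem_erase hi)
        · intro i hi
          rw [heq i (Finset.mem_of_mem_erase hi), Function.update_of_ne (Finset.ne_of_mem_erase hi)]
        · rwa [hins]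
        · have := heq j hjI
          rwa [Function.update_self] at this
      · refine hreg I ?_ p hp x hx t fun i hi => ?_
        · intro i hi
          exact (Finset.mem_insert.1 (hI hi)).resolve_left (by rintro rfl; exact hjI hi)
        · rw [heq i hi, Function.update_of_ne (by rintro rfl; exact hjI hi)]

end SmoothFunctions

/-! ## Averaging over the torus -/

section Averaging

variable {E : Type} [NormedAddCommGroup E] [NormedSpace ℝ E] [FiniteDimensional ℝ E]

theorem hasFDerivAt_parametric_intervalIntegral {F : Type} [NormedAddCommGroup F] [NormedSpace ℝ F]
    {D : Set E} (hD : IsOpen D) {f : ℝ × E → F}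
    (hf : ContDiffOn ℝ ∞ f (univ ×ˢ D)) (a b : ℝ) {x : E} (hx : x ∈ D) :
    HasFDerivAt (fun x => ∫ θ in a..b, f (θ, x))
      (∫ θ in a..b, (fderiv ℝ f (θ, x)).comp (ContinuousLinearMap.inr ℝ ℝ E)) x := by
  have := FiniteDimensional.proper_real E
  obtain ⟨ε, hε, hball⟩ := Metric.nhds_basis_closedBall.mem_iff.1 (hD.mem_nhds hx)
  have hO : IsOpen ((univ : Set ℝ) ×ˢ D) := isOpen_univ.prod hD
  have hf' : ContinuousOn (fun v : ℝ × E => (fderiv ℝ f v).comp (ContinuousLinearMap.inr ℝ ℝ E))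
      (univ ×ˢ D) :=
    (hf.continuousOn_fderiv_of_isOpen hO (by simp)).clm_comp continuousOn_const
  have hslice : ∀ y ∈ D, Continuous fun θ : ℝ => f (θ, y) := fun y hy =>
    hf.continuousOn.comp_continuous (by fun_prop) fun θ => ⟨mem_univ _, hy⟩
  have hslice' : ∀ y ∈ D, Continuous fun θ : ℝ =>
      (fderiv ℝ f (θ, y)).comp (ContinuousLinearMap.inr ℝ ℝ E) := fun y hy =>
    hf'.comp_continuous (f := fun θ => (θ, y)) (by fun_prop) fun θ => ⟨mem_univ _, hy⟩
  obtain ⟨C, hC⟩ := (isCompact_uIcc (a := a) (b := b)).prod (isCompact_closedBall x ε)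
    |>.exists_bound_of_continuousOn (hf'.mono (prod_mono (subset_univ _) hball))
  refine intervalIntegral.hasFDerivAt_integral_of_dominated_of_fderiv_le
    (F := fun y θ => f (θ, y)) (bound := fun _ => C) (s := Metric.closedBall x ε)
    (F' := fun y θ => (fderiv ℝ f (θ, y)).comp (ContinuousLinearMap.inr ℝ ℝ E))
    (Metric.closedBall_mem_nhds x hε) ?_ ((hslice x hx).intervalIntegrable _ _)
    (hslice' x hx).aestronglyMeasurable ?_ (by simp) ?_
  · filter_upwards [hD.mem_nhds hx] with y hy using (hslice y hy).aestronglyMeasurable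
  · exact Eventually.of_forall fun θ hθ y hy => hC (θ, y) ⟨uIoc_subset_uIcc hθ, hy⟩
  · refine Eventually.of_forall fun θ _ y hy => ?_
    have h1 : DifferentiableAt ℝ f (θ, y) :=
      (hf.contDiffAt (hO.mem_nhds ⟨mem_univ _, hball hy⟩)).differentiableAt (by simp)
    exact h1.hasFDerivAt.comp y (hasFDerivAt_prodMk_right θ y)

/-- The derivative of the integral is the integral of the partial derivative, again of the same form
but with operator values; hence the induction over all target spaces. -/
theorem contDiffOn_parametric_intervalIntegral {D : Set E} (hD : IsOpen D) (a b : ℝ) (m : ℕ) :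
    ∀ {F : Type} [NormedAddCommGroup F] [NormedSpace ℝ F] {f : ℝ × E → F},
      ContDiffOn ℝ ∞ f (univ ×ˢ D) → ContDiffOn ℝ m (fun x => ∫ θ in a..b, f (θ, x)) D := by
  induction m with
  | zero =>
    intro F _ _ f hf
    exact contDiffOn_zero.2 fun x hx =>
      (hasFDerivAt_parametric_intervalIntegral hD hf a b hx).continuousAt.continuousWithinAt
  | succ m ih =>
    intro F _ _ f hf
    have hO : IsOpen ((univ : Set ℝ) ×ˢ D) := isOpen_univ.prod hD
    push_cast
    rw [contDiffOn_succ_iff_fderiv_of_isOpen hD]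
    refine ⟨fun x hx => (hasFDerivAt_parametric_intervalIntegral hD hf a b
      hx).differentiableAt.differentiableWithinAt, by simp, ?_⟩
    refine (ih (f := fun v => (fderiv ℝ f v).comp (ContinuousLinearMap.inr ℝ ℝ E)) ?_).congr
      fun x hx => (hasFDerivAt_parametric_intervalIntegral hD hf a b hx).fderiv
    exact (hf.fderiv_of_isOpen hO (by simp)).clm_comp contDiffOn_const

variable {n r : ℕ} {Y : Type*} [TopologicalSpace Y] [MulAction (Torus r) Y]

/-- The average of a function over the circle subgroup with direction `ξ`. -/
noncomputable def circleAverage (ξ : Fin r → ℝ) (f : Y → ℝ) (y : Y) : ℝ :=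
  (2 * Real.pi)⁻¹ * ∫ θ in (0 : ℝ)..(2 * Real.pi), f (torusExp (θ • ξ) • y)

theorem SmoothAction.contDiffAt_comp_torusExp {B : Orbifold n Y} (hB : SmoothAction (r := r) B)
    {f : Y → ℝ} (hf : B.SmoothFunction f) (ξ : Fin r → ℝ) {c : OrbifoldChart univ Y}
    (hc : c ∈ B.charts) {x : Euc n} (hx : x ∈ c.dom) (θ₀ : ℝ) :
    ContDiffAt ℝ ∞ (fun v : ℝ × Euc n => f (torusExp (v.1 • ξ) • c.proj v.2)) (θ₀, x) := by
  obtain ⟨c', hc', y, hy, hp⟩ := B.covers (torusExp (θ₀ • ξ) • c.proj x)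
  obtain ⟨l, hl, hly⟩ := hB.exists_isLocalLift hc hc' hx hy hp.symm
  have hl1 := hl.smoothAt (mem_univ x)
  have hl2 := hl.lifts
  rw [univ_prod_univ, contDiffWithinAt_univ] at hl1
  rw [univ_prod_univ, nhdsWithin_univ] at hl2
  set κ : ℝ × Euc n → (Fin r → ℝ) × Euc n := fun v => ((v.1 - θ₀) • ξ, v.2) with hκ
  have hκx : κ (θ₀, x) = (0, x) := by simp [hκ]
  have hκs : ContDiff ℝ ∞ κ := by fun_prop
  have h1 : ContDiffAt ℝ ∞ (fun v => f (c'.proj (l (κ v)))) (θ₀, x) := by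
    refine ContDiffAt.comp (g := fun u => f (c'.proj u)) (θ₀, x) ?_
      (ContDiffAt.comp (g := l) (θ₀, x) ?_ hκs.contDiffAt)
    · rw [hκx, hly]; exact hf.contDiffAt hc' hy
    · rwa [hκx]
  refine h1.congr_of_eventuallyEq ?_
  have h2 : Tendsto κ (𝓝 (θ₀, x)) (𝓝 (0, x)) := hκx ▸ hκs.continuous.tendsto (θ₀, x)
  filter_upwards [h2.eventually hl2] with v hv
  rw [hv, smul_smul, ← torusExp_add, ← add_smul, sub_add_cancel]

theorem SmoothAction.smoothFunction_circleAverage {B : Orbifold n Y} (hB : SmoothAction (r := r) B)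
    {f : Y → ℝ} (hf : B.SmoothFunction f) (ξ : Fin r → ℝ) :
    B.SmoothFunction (circleAverage ξ f) := by
  intro c hc
  refine contDiffOn_const.mul (contDiffOn_infty.2 fun m => ?_)
  exact contDiffOn_parametric_intervalIntegral c.isOpen_dom 0 (2 * Real.pi) m
    (f := fun v : ℝ × Euc n => f (torusExp (v.1 • ξ) • c.proj v.2)) fun v hv =>
      (hB.contDiffAt_comp_torusExp hf ξ hc hv.2 v.1).contDiffWithinAt

theorem continuous_comp_torusExp [ContinuousSMul (Torus r) Y] {f : Y → ℝ} (hf : Continuous f)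
    (ξ : Fin r → ℝ) (y : Y) : Continuous fun θ : ℝ => f (torusExp (θ • ξ) • y) :=
  hf.comp ((continuous_torusExp.comp (by fun_prop)).smul continuous_const)

theorem torusExp_single_periodic (j : Fin r) (θ : ℝ) :
    torusExp ((θ + 2 * Real.pi) • (Pi.single j 1 : Fin r → ℝ)) = torusExp (θ • Pi.single j 1) := by
  funext i
  change Circle.exp _ = Circle.exp _
  simp only [Pi.smul_apply, Pi.single_apply, smul_eq_mul]
  split_ifs
  · simp only [mul_one]; exact Circle.periodic_exp θ
  · simp

-- The integrand is 2π-periodic along a coordinate circle, so translating it leaves the integral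
-- over a period unchanged.
omit [TopologicalSpace Y] in
theorem circleAverage_torusExp_smul (f : Y → ℝ) (j : Fin r) (s : ℝ) (y : Y) :
    circleAverage (Pi.single j 1) f (torusExp (s • Pi.single j 1) • y) =
      circleAverage (Pi.single j 1) f y := by
  unfold circleAverage
  congr 1
  have h1 : Function.Periodic
      (fun θ : ℝ => f (torusExp (θ • (Pi.single j 1 : Fin r → ℝ)) • y)) (2 * Real.pi) := fun θ => by
    simp only [torusExp_single_periodic]
  have h2 := h1.intervalIntegral_add_eq s 0
  rw [zero_add] at h2
  have h3 := intervalIntegral.integral_comp_add_right (a := 0) (b := 2 * Real.pi)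
    (fun θ : ℝ => f (torusExp (θ • (Pi.single j 1 : Fin r → ℝ)) • y)) s
  rw [zero_add, add_comm _ s, h2] at h3
  simpa only [add_smul, torusExp_add, mul_smul] using h3

/-- A partition of unity is averaged over the coordinate circles one after the other. Averaging
preserves nonnegativity and the sum, and keeps the invariances already obtained because the torus is
commutative. -/
theorem exists_invariant_partition [CompactSpace Y] [T2Space Y] {B : Orbifold n Y}
    (hB : SmoothAction (r := r) B) {k : ℕ} {U : Fin k → Set Y} (hU : ∀ i, IsOpen (U i))
    (hcov : ⋃ i, U i = univ) (hinv : ∀ (i : Fin k) (τ : Torus r), ∀ x ∈ U i, τ • x ∈ U i) :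
    ∃ φ : Fin k → Y → ℝ, (∀ i, B.SmoothFunction (φ i)) ∧
      (∀ (i : Fin k) (τ : Torus r) (y : Y), φ i (τ • y) = φ i y) ∧ (∀ i y, 0 ≤ φ i y) ∧
      (∀ y, ∑ i, φ i y = 1) ∧ ∀ i, tsupport (φ i) ⊆ U i := by
  have := hB.1
  obtain ⟨ψ, hψs, hψ0, hψ1, hψC⟩ := B.exists_smooth_partition hU hcov
  choose C hC hCU hψz using hψC
  -- The torus saturations of the supports: compact as images of compact sets, contained in the
  -- invariant U i, and stable under averaging.
  set C' : Fin k → Set Y := fun i => (fun p : Torus r × Y => p.1 • p.2) '' (univ ×ˢ C i) with hC'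
  have hC'c : ∀ i, IsClosed (C' i) := fun i =>
    ((isCompact_univ.prod (hC i).isCompact).image continuous_smul).isClosed
  have hC'U : ∀ i, C' i ⊆ U i := by
    rintro i _ ⟨⟨τ, y⟩, ⟨-, hy⟩, rfl⟩
    exact hinv i τ y (hCU i hy)
  have hC'inv : ∀ i (τ : Torus r) y, τ • y ∈ C' i → y ∈ C' i := by
    rintro i τ y ⟨⟨τ', y'⟩, ⟨-, hy'⟩, hyy⟩
    refine ⟨(τ⁻¹ * τ', y'), ⟨mem_univ _, hy'⟩, ?_⟩
    have hyy : τ' • y' = τ • y := hyy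
    change (τ⁻¹ * τ') • y' = y
    rw [mul_smul, hyy, inv_smul_smul]
  suffices key : ∀ s : Finset (Fin r), ∃ φ : Fin k → Y → ℝ, (∀ i, B.SmoothFunction (φ i)) ∧
      (∀ i y, 0 ≤ φ i y) ∧ (∀ y, ∑ i, φ i y = 1) ∧ (∀ i y, y ∉ C' i → φ i y = 0) ∧
      ∀ i, ∀ j ∈ s, ∀ (θ : ℝ) y, φ i (torusExp (θ • Pi.single j 1) • y) = φ i y by
    obtain ⟨φ, h1, h2, h3, h4, h5⟩ := key Finset.univ
    refine ⟨φ, h1, fun i τ y => ?_, h2, h3, fun i => ?_⟩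
    · obtain ⟨ξ, rfl⟩ := torusExp_surjective τ
      have hξ : ξ = ∑ j, ξ j • (Pi.single j 1 : Fin r → ℝ) := by
        funext i
        simp [Finset.sum_apply, Pi.single_apply]
      rw [hξ]
      generalize (Finset.univ : Finset (Fin r)) = s
      induction s using Finset.induction_on with
      | empty => rw [Finset.sum_empty, torusExp_zero, one_smul]
      | insert j s hj ih =>
        rw [Finset.sum_insert hj, torusExp_add, mul_smul, h5 i j (Finset.mem_univ j), ih]
    · refine (closure_minimal (fun y hy => ?_) (hC'c i)).trans (hC'U i)
      by_contra hcon
      exact hy (h4 i y hcon)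
  intro s
  induction s using Finset.induction_on with
  | empty =>
    refine ⟨ψ, hψs, hψ0, hψ1, fun i y hy => hψz i y fun h => hy ?_, by simp⟩
    exact ⟨(1, y), ⟨mem_univ _, h⟩, one_smul _ _⟩
  | insert j s hj ih =>
    obtain ⟨φ, h1, h2, h3, h4, h5⟩ := ih
    refine ⟨fun i => circleAverage (Pi.single j 1) (φ i), fun i =>
      hB.smoothFunction_circleAverage (h1 i) _, fun i y => ?_, fun y => ?_, fun i y hy => ?_, ?_⟩
    · exact mul_nonneg (by positivity) (intervalIntegral.integral_nonneg (by positivity) fun θ _ =>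
        h2 i _)
    · unfold circleAverage
      rw [← Finset.mul_sum, ← intervalIntegral.integral_finsetSum fun i _ =>
        (continuous_comp_torusExp (h1 i).continuous _ y).intervalIntegrable _ _]
      simp only [h3, intervalIntegral.integral_const, sub_zero, smul_eq_mul, mul_one]
      exact inv_mul_cancel₀ (by positivity)
    · unfold circleAverage
      have : ∀ θ : ℝ, φ i (torusExp (θ • Pi.single j 1) • y) = 0 := fun θ =>
        h4 i _ fun h => hy (hC'inv i _ y h)
      simp [this]
    · intro i j' hj' θ y
      rcases Finset.mem_insert.1 hj' with rfl | hj'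
      · exact circleAverage_torusExp_smul _ _ _ _
      · have h6 : ∀ t : ℝ, φ i (torusExp (t • (Pi.single j 1 : Fin r → ℝ)) •
            torusExp (θ • Pi.single j' 1) • y) = φ i (torusExp (t • Pi.single j 1) • y) := fun t => by
          rw [smul_smul, mul_comm, mul_smul, h5 i j' hj']
        simp only [circleAverage, h6]

end Averaging

theorem exists_isCutData {n r k : ℕ} {Y : Type*} [TopologicalSpace Y] [CompactSpace Y] [T2Space Y]
    [MulAction (Torus r) Y] {B : Orbifold n Y} (hB : SmoothAction (r := r) B) {U : Fin k → Set Y}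
    {σ : Fin k → Circle →ₜ* Torus r} (hU : IsGoodCover U σ) :
    ∃ (φ : Fin k → Y → ℝ) (α : Fin k → ℝ), IsCutData (r := r) B U φ α := by
  obtain ⟨φ, h1, h2, h3, h4, h5⟩ := exists_invariant_partition hB hU.isOpen hU.covers hU.invariant
  obtain ⟨α, h6, h7⟩ := B.exists_regular_levels h1
  exact ⟨φ, α, h1, h2, h3, h4, h5, h6, fun I c hc x hx t _ _ h => h7 I c hc x hx t h⟩

/-! ## Slices -/

section Slice

variable {E V : Type*} [NormedAddCommGroup E] [NormedSpace ℝ E] [FiniteDimensional ℝ E]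
  [NormedAddCommGroup V] [NormedSpace ℝ V] [FiniteDimensional ℝ V]

/-- A slice, in the level set `χ = 0`, for a local action `G` of a vector space which preserves
`χ`. -/
theorem exists_slice {χ : E → V} {G : V × E → E} {w : E} {m : ℕ}
    (hχ : ∀ᶠ v in 𝓝 w, ContDiffAt ℝ ∞ χ v) (hχw : χ w = 0)
    (hχs : Function.Surjective (fderiv ℝ χ w))
    (hG : ∀ᶠ v in 𝓝 ((0 : V), w), ContDiffAt ℝ ∞ G v) (hG0 : ∀ᶠ v in 𝓝 w, G (0, v) = v)
    (hGadd : ∀ᶠ v in 𝓝 ((0 : V), (0 : V), w), G (v.1, G v.2) = G (v.1 + v.2.1, v.2.2))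
    (hGχ : ∀ᶠ v in 𝓝 ((0 : V), w), χ (G v) = χ v.2)
    (ha : ∀ ξ : V, fderiv ℝ G (0, w) (ξ, 0) = 0 → ξ = 0)
    (hdim : Module.finrank ℝ E = m + 2 * Module.finrank ℝ V) :
    ∃ (s : Euc m → E) (ρ : E → Euc m) (Ξ : E → V), s 0 = w ∧ ρ w = 0 ∧
      (∀ᶠ y in 𝓝 0, ContDiffAt ℝ ∞ s y) ∧ (∀ᶠ v in 𝓝 w, ContDiffAt ℝ ∞ ρ v) ∧
      Tendsto Ξ (𝓝 w) (𝓝 0) ∧ (∀ᶠ y in 𝓝 0, χ (s y) = 0 ∧ ρ (s y) = y) ∧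
      (∀ᶠ v in 𝓝 w, χ v = 0 → v = G (Ξ v, s (ρ v))) ∧
      ∀ᶠ v in 𝓝 ((0 : V), w), ρ (G v) = ρ v.2 := by
  have hGw : G (0, w) = w := hG0.self_of_nhds
  have hGd : HasFDerivAt G (fderiv ℝ G (0, w)) (0, w) :=
    (hG.self_of_nhds.differentiableAt (by simp)).hasFDerivAt
  set D := fderiv ℝ χ w with hD
  have hχd : HasFDerivAt χ D w := (hχ.self_of_nhds.differentiableAt (by simp)).hasFDerivAt
  set a : V →L[ℝ] E := (fderiv ℝ G (0, w)).comp (ContinuousLinearMap.inl ℝ V E) with ha_def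
  have hainj : Function.Injective a := (injective_iff_map_eq_zero a).2 ha
  -- Since G preserves χ, the infinitesimal orbit directions are tangent to the level set.
  have hDa : ∀ ξ, D (a ξ) = 0 := by
    have h1 : HasFDerivAt (fun ξ : V => G (ξ, w)) a 0 := hGd.comp (0 : V) (hasFDerivAt_prodMk_left 0 w)
    have h2 : HasFDerivAt χ D ((fun ξ : V => G (ξ, w)) 0) := by
      change HasFDerivAt χ D (G (0, w)); rwa [hGw]
    have h3 := h2.comp (0 : V) h1
    have h4 : HasFDerivAt (χ ∘ fun ξ : V => G (ξ, w)) (0 : V →L[ℝ] V) 0 := by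
      refine (hasFDerivAt_const (χ w) (0 : V)).congr_of_eventuallyEq ?_
      have : Tendsto (fun ξ : V => (ξ, w)) (𝓝 0) (𝓝 (0, w)) := Continuous.tendsto (by fun_prop) _
      exact this.eventually hGχ
    exact fun ξ => congrArg (fun T : V →L[ℝ] V => T ξ) (h3.unique h4)
  have hid : (fderiv ℝ G (0, w)).comp (ContinuousLinearMap.inr ℝ V E) = ContinuousLinearMap.id ℝ E :=
    (hGd.comp w (hasFDerivAt_prodMk_right 0 w)).unique
      ((hasFDerivAt_id w).congr_of_eventuallyEq hG0)
  obtain ⟨π₀, hπ₀⟩ := LinearMap.exists_leftInverse_of_injective (a : V →ₗ[ℝ] E)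
    (LinearMap.ker_eq_bot.2 hainj)
  let π : E →L[ℝ] V := LinearMap.toContinuousLinearMap π₀
  have hπa : ∀ ξ, π (a ξ) = ξ := fun ξ => LinearMap.congr_fun hπ₀ ξ
  have hDπ : Function.Surjective (D.prod π) := by
    rintro ⟨b, b'⟩
    obtain ⟨v, rfl⟩ := hχs b
    refine ⟨v + a (b' - π v), Prod.ext ?_ ?_⟩
    · change D (v + a (b' - π v)) = D v
      rw [map_add, hDa, add_zero]
    · change π (v + a (b' - π v)) = b'
      rw [map_add, hπa]; abel
  -- The tangent space of the slice: a complement of the orbit directions inside ker D. Two copies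
  -- of V are lost, one to the equations and one to the orbits, which leaves dimension m.
  set K : Submodule ℝ E := LinearMap.ker ((D.prod π : E →L[ℝ] V × V) : E →ₗ[ℝ] V × V) with hK
  have hKdim : Module.finrank ℝ K = Module.finrank ℝ (Euc m) := by
    have := LinearMap.finrank_range_add_finrank_ker ((D.prod π : E →L[ℝ] V × V) : E →ₗ[ℝ] V × V)
    rw [LinearMap.range_eq_top.2 hDπ, finrank_top, Module.finrank_prod, hdim] at this
    rw [finrank_euclideanSpace_fin]
    have h2 : Module.finrank ℝ K = _ := rfl
    rw [hK] at h2 ⊢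
    linarith
  obtain ⟨l₀, hl₀⟩ := LinearMap.exists_leftInverse_of_injective K.subtype K.ker_subtype
  let l : E →L[ℝ] Euc m := ((ContinuousLinearEquiv.ofFinrankEq hKdim : K ≃L[ℝ] Euc m) : K →L[ℝ] Euc m).comp
    (LinearMap.toContinuousLinearMap l₀)
  have hl : ∀ v : E, D v = 0 → π v = 0 → l v = 0 → v = 0 := by
    intro v h1 h2 h3
    have h4 : (ContinuousLinearEquiv.ofFinrankEq hKdim : K ≃L[ℝ] Euc m) (l₀ v) = 0 := h3
    have h5 : l₀ v = 0 := by simpa using h4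
    have h6 : l₀ v = ⟨v, Prod.ext h1 h2⟩ :=
      LinearMap.congr_fun hl₀ (⟨v, Prod.ext h1 h2⟩ : K)
    rw [h5] at h6
    exact (congrArg Subtype.val h6).symm
  have hdim' : Module.finrank ℝ E = Module.finrank ℝ (V × V × Euc m) := by
    rw [Module.finrank_prod, Module.finrank_prod, finrank_euclideanSpace_fin, hdim]; ring
  have hTinj : Function.Injective (D.prod (π.prod l)) := by
    rw [injective_iff_map_eq_zero]
    intro v hv
    exact hl v (congrArg Prod.fst hv) (congrArg (fun p => p.2.1) hv) (congrArg (fun p => p.2.2) hv)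
  let T : E ≃L[ℝ] V × V × Euc m := (LinearMap.linearEquivOfInjective
    ((D.prod (π.prod l) : E →L[ℝ] V × V × Euc m) : E →ₗ[ℝ] V × V × Euc m) hTinj hdim').toContinuousLinearEquiv
  have hT : (T : E →L[ℝ] V × V × Euc m) = D.prod (π.prod l) := by ext1 v; rfl
  obtain ⟨e₁, he₁, hwe₁, -, -, hsm₁⟩ := exists_openPartialHomeomorph_contDiffOn (x := w) (f' := T)
    (f := fun v => (χ v, π (v - w), l (v - w)))
    (by
      filter_upwards [hχ] with v hv
      exact hv.prodMk (ContDiffAt.prodMk (by fun_prop) (by fun_prop)))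
    (by
      rw [hT]
      refine hχd.prodMk (HasFDerivAt.prodMk ?_ ?_)
      · exact π.hasFDerivAt.comp w ((hasFDerivAt_id w).sub_const w)
      · exact l.hasFDerivAt.comp w ((hasFDerivAt_id w).sub_const w)) univ_mem
  have he₁w : e₁ w = 0 := by rw [he₁]; simp [hχw]
  have h0t₁ : (0 : V × V × Euc m) ∈ e₁.target := he₁w ▸ e₁.map_source hwe₁
  have he₁s0 : e₁.symm 0 = w := by rw [← he₁w, e₁.left_inv hwe₁]
  have hsm₁' : ∀ᶠ p in 𝓝 (0 : V × V × Euc m), ContDiffAt ℝ ∞ e₁.symm p := by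
    filter_upwards [e₁.open_target.mem_nhds h0t₁] with p hp
    exact hsm₁.contDiffAt (e₁.open_target.mem_nhds hp)
  have hder₁ : HasFDerivAt e₁.symm (T.symm : V × V × Euc m →L[ℝ] E) 0 := by
    refine e₁.hasFDerivAt_symm h0t₁ ?_
    rw [he₁s0, show (e₁ : E → V × V × Euc m) = fun v => (χ v, π (v - w), l (v - w)) from funext he₁, hT]
    refine hχd.prodMk (HasFDerivAt.prodMk ?_ ?_)
    · exact π.hasFDerivAt.comp w ((hasFDerivAt_id w).sub_const w)
    · exact l.hasFDerivAt.comp w ((hasFDerivAt_id w).sub_const w)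
  -- the map `(b, y) ↦ e₁.symm (b, 0, y)`
  let j : V × V × Euc m →L[ℝ] V × V × Euc m :=
    ((ContinuousLinearMap.fst ℝ V (Euc m)).comp (ContinuousLinearMap.snd ℝ V (V × Euc m))).prod
      ((0 : V × V × Euc m →L[ℝ] V).prod
        ((ContinuousLinearMap.snd ℝ V (Euc m)).comp (ContinuousLinearMap.snd ℝ V (V × Euc m))))
  have hj : ∀ p, j p = (p.2.1, 0, p.2.2) := fun p => rfl
  -- Flowing from the transversal where the π-coordinate vanishes: (ξ, b, y) ↦ G (ξ, e₁⁻¹(b, 0, y))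
  -- is a local diffeomorphism. Of its inverse, ξ is the displacement along the orbit, y the slice
  -- coordinate, and b will be the value of χ.
  set Φ : V × V × Euc m → E := fun p => G (p.1, e₁.symm (j p)) with hΦ
  have hjt : Tendsto j (𝓝 0) (𝓝 0) := by simpa using j.continuous.tendsto 0
  have hin : Tendsto (fun p : V × V × Euc m => (p.1, e₁.symm (j p))) (𝓝 0) (𝓝 (0, w)) := by
    refine (continuous_fst.tendsto (0 : V × V × Euc m)).prodMk_nhds ?_
    rw [← he₁s0]
    exact hder₁.continuousAt.tendsto.comp hjt
  let L : V × V × Euc m →L[ℝ] E := (fderiv ℝ G (0, w)).comp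
    ((ContinuousLinearMap.fst ℝ V (V × Euc m)).prod ((T.symm : V × V × Euc m →L[ℝ] E).comp j))
  have hL : ∀ p, L p = a p.1 + T.symm (j p) := by
    intro p
    have h1 : L p = fderiv ℝ G (0, w) (p.1, T.symm (j p)) := rfl
    have h2 : (p.1, T.symm (j p)) = (p.1, (0 : E)) + ((0 : V), T.symm (j p)) := by simp
    rw [h1, h2, map_add]
    congr 1
    exact congrArg (fun S : E →L[ℝ] E => S (T.symm (j p))) hid
  have hLinj : Function.Injective L := by
    rw [injective_iff_map_eq_zero]
    intro p hp
    rw [hL] at hp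
    have h1 : T (a p.1) + j p = 0 := by
      rw [← T.apply_symm_apply (j p), ← map_add, hp, map_zero]
    have h2 : T (a p.1) = (0, p.1, l (a p.1)) := by
      have : T (a p.1) = (D (a p.1), π (a p.1), l (a p.1)) := rfl
      rw [this, hDa, hπa]
    rw [h2, hj] at h1
    have k1 : p.2.1 = 0 := by simpa using congrArg Prod.fst h1
    have k2 : p.1 = 0 := by simpa using congrArg (fun q => q.2.1) h1
    have k3 : p.2.2 = 0 := by simpa [k2] using congrArg (fun q => q.2.2) h1
    exact Prod.ext k2 (Prod.ext k1 k3)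
  let L' : (V × V × Euc m) ≃L[ℝ] E := (LinearMap.linearEquivOfInjective
    (L : V × V × Euc m →ₗ[ℝ] E) hLinj hdim'.symm).toContinuousLinearEquiv
  have hL' : (L' : V × V × Euc m →L[ℝ] E) = L := ContinuousLinearMap.ext fun v => rfl
  have hΦs : ∀ᶠ p in 𝓝 (0 : V × V × Euc m), ContDiffAt ℝ ∞ Φ p := by
    filter_upwards [hin.eventually hG, hjt.eventually hsm₁'] with p h1 h2
    exact h1.comp p (contDiffAt_fst.prodMk (h2.comp p j.contDiff.contDiffAt))
  have hΦd : HasFDerivAt Φ (L' : V × V × Euc m →L[ℝ] E) 0 := by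
    rw [hL']
    have h1 : HasFDerivAt e₁.symm (T.symm : V × V × Euc m →L[ℝ] E) (j 0) := by rwa [map_zero]
    have h2 := (hasFDerivAt_fst (𝕜 := ℝ) (p := (0 : V × V × Euc m))).prodMk (h1.comp 0 j.hasFDerivAt)
    refine HasFDerivAt.comp 0 ?_ h2
    simpa [he₁s0] using hGd
  obtain ⟨e₂, he₂, h0e₂, -, -, hsm₂⟩ := exists_openPartialHomeomorph_contDiffOn hΦs hΦd univ_mem
  have hΦ0 : Φ 0 = w := by simp [hΦ, he₁s0, hGw]
  have hwt₂ : w ∈ e₂.target := by rw [← hΦ0, ← he₂]; exact e₂.map_source h0e₂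
  have he₂w : e₂.symm w = 0 := by rw [← hΦ0, ← he₂, e₂.left_inv h0e₂]
  have hc₂ : Tendsto e₂.symm (𝓝 w) (𝓝 0) := by
    rw [← he₂w]; exact (e₂.continuousAt_symm hwt₂).tendsto
  let i : Euc m →L[ℝ] V × V × Euc m := (0 : Euc m →L[ℝ] V).prod
    ((0 : Euc m →L[ℝ] V).prod (ContinuousLinearMap.id ℝ (Euc m)))
  have hi : ∀ y, i y = (0, 0, y) := fun y => rfl
  have hit : Tendsto i (𝓝 0) (𝓝 0) := by simpa using i.continuous.tendsto 0
  have hst : Tendsto (fun y => e₁.symm (i y)) (𝓝 0) (𝓝 w) := by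
    rw [← he₁s0]
    exact hder₁.continuousAt.tendsto.comp hit
  have hu : Tendsto (fun v => ((e₂.symm v).1, e₁.symm (j (e₂.symm v)))) (𝓝 w) (𝓝 (0, w)) := hin.comp hc₂
  have hv₂ : ∀ᶠ v in 𝓝 w, v = G ((e₂.symm v).1, e₁.symm (j (e₂.symm v))) := by
    filter_upwards [e₂.open_target.mem_nhds hwt₂] with v hv
    exact (((he₂ _).symm.trans (e₂.right_inv hv))).symm
  refine ⟨fun y => e₁.symm (i y), fun v => (e₂.symm v).2.2, fun v => (e₂.symm v).1, ?_, ?_, ?_, ?_, ?_,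
    ?_, ?_, ?_⟩
  · simp [he₁s0]
  · simp [he₂w]
  · filter_upwards [hit.eventually hsm₁'] with y hy
    exact hy.comp y i.contDiff.contDiffAt
  · filter_upwards [e₂.open_target.mem_nhds hwt₂] with v hv
    have := hsm₂.contDiffAt (e₂.open_target.mem_nhds hv)
    exact contDiffAt_snd.comp v (contDiffAt_snd.comp v this)
  · exact (continuous_fst.tendsto (0 : V × V × Euc m)).comp hc₂
  · filter_upwards [hit.eventually (e₁.open_target.mem_nhds h0t₁),
      hit.eventually (e₂.open_source.mem_nhds h0e₂), hst.eventually hG0] with y h1 h2 h3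
    constructor
    · have := congrArg Prod.fst (e₁.right_inv h1)
      rwa [he₁] at this
    · have h4 : e₁.symm (i y) = e₂ (i y) := by
        rw [he₂, hΦ]; exact h3.symm
      change (e₂.symm (e₁.symm (i y))).2.2 = y
      rw [h4, e₂.left_inv h2, hi]
  · filter_upwards [hv₂, hu.eventually hGχ, (hjt.comp hc₂).eventually (e₁.open_target.mem_nhds h0t₁)]
      with v h1 h2 h3 h4
    -- The flow does not change χ, and e₁ has χ as its first coordinate; on the level χ = 0 the
    -- starting point therefore lies on the slice.
    have h5 : χ v = (e₂.symm v).2.1 := by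
      rw [← h1] at h2
      rw [h2]
      have := congrArg Prod.fst (e₁.right_inv h3)
      rwa [he₁] at this
    have h6 : j (e₂.symm v) = i (e₂.symm v).2.2 := by
      rw [hj, hi, ← h5, h4]
    rwa [h6] at h1
  · have ht : Tendsto (fun v : V × E => (v.1, (e₂.symm v.2).1, e₁.symm (j (e₂.symm v.2))))
        (𝓝 (0, w)) (𝓝 (0, 0, w)) := by
      refine (continuous_fst.tendsto ((0 : V), w)).prodMk_nhds ?_
      exact hu.comp (continuous_snd.tendsto ((0 : V), w))
    have ht' : Tendsto (fun v : V × E => (v.1 + (e₂.symm v.2).1, (e₂.symm v.2).2)) (𝓝 (0, w))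
        (𝓝 0) := by
      have h1 : Tendsto (fun v : V × E => e₂.symm v.2) (𝓝 (0, w)) (𝓝 0) :=
        hc₂.comp (continuous_snd.tendsto ((0 : V), w))
      have h2 := (continuous_fst.tendsto ((0 : V), w)).add ((continuous_fst.tendsto _).comp h1)
      have h3 := (continuous_snd.tendsto _).comp h1
      have h4 : (0 : V × V × Euc m) = ((0 : V) + 0, 0) := Prod.ext (add_zero _).symm rfl
      rw [h4]
      exact h2.prodMk_nhds h3
    filter_upwards [ht.eventually hGadd, (continuous_snd.tendsto ((0 : V), w)).eventually hv₂,
      ht'.eventually (e₂.open_source.mem_nhds h0e₂)] with v h1 h2 h3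
    -- By additivity the action only translates the first coordinate of e₂, so the slice coordinate
    -- is invariant.
    have h4 : G v = e₂ (v.1 + (e₂.symm v.2).1, (e₂.symm v.2).2) := by
      rw [he₂]
      refine Eq.trans ?_ h1
      conv_lhs => rw [← Prod.mk.eta (p := v), h2]
    change (e₂.symm (G v)).2.2 = _
    rw [h4, e₂.left_inv h3]

end Slice

/-! ## Lifts of the identity -/

section Lifts

variable {E : Type*} [NormedAddCommGroup E] [NormedSpace ℝ E] [FiniteDimensional ℝ E] {H : Set E}
  {X : Type*} [TopologicalSpace X]

/-- Lifts of the identity to a chart are given by elements of the group. -/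
theorem OrbifoldChart.exists_group_eventually_eq (hH : IsModelSet H) (c : OrbifoldChart H X) {x : E}
    (hx : x ∈ c.dom) {F : E → E} (hF : ContDiffWithinAt ℝ 1 F H x)
    (hd : ∀ᶠ y in 𝓝[H] x, F y ∈ c.dom) (hp : ∀ᶠ y in 𝓝[H] x, c.proj (F y) = c.proj y) :
    ∃ γ ∈ c.group, ∀ᶠ y in 𝓝[H] x, F y = γ y := by
  have hxH := c.dom_subset hx
  have hD := (hF.differentiableWithinAt (by simp)).hasFDerivWithinAt
  obtain ⟨γ, hγ, h1, h2⟩ := c.exists_group_fderivWithin_eq hH hxH hD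
    (hasFDerivWithinAt_id (𝕜 := ℝ) x H) hd (c.dom_mem hx) hp
  refine ⟨γ, hγ, ?_⟩
  obtain ⟨T, hT⟩ := c.exists_fderivWithin_group_equiv hH hγ hx
  have hT' := hT.fderivWithin (hH.uniqueDiffWithinAt hxH)
  simp only [id, ContinuousLinearMap.comp_id] at h1 h2
  refine c.eventually_eq_of_fderivWithin_eq hH hH hxH hF
    ((c.contDiffWithinAt_group hγ hx).of_le (by simp)) hd
    (Filter.Eventually.mono (c.dom_mem hx) fun y hy => c.mapsTo_group γ hγ hy) ?_ h1
    (κ' := ContinuousLinearMap.id ℝ E) (D := (T : E →L[ℝ] E)) ?_ ?_ T.surjective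
  · filter_upwards [hp, c.dom_mem hx] with y k1 k2
    rw [k1, c.proj_group hγ k2]
  · rw [ContinuousLinearMap.comp_id, h2, hT']
  · rw [ContinuousLinearMap.comp_id, hT']

/-- A smooth local lift of the identity from one chart to another. -/
structure IsIdentityLift (c c' : OrbifoldChart H X) (x : E) (h : E → E) : Prop where
  smooth : ∀ᶠ v in 𝓝[H] x, ContDiffWithinAt ℝ ∞ h H v
  maps : ∀ᶠ v in 𝓝[H] x, h v ∈ c'.dom
  lifts : ∀ᶠ v in 𝓝[H] x, c'.proj (h v) = c.proj v

variable {c c' c'' : OrbifoldChart H X} {x : E} {h k : E → E}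

omit [FiniteDimensional ℝ E] in
theorem IsIdentityLift.tendsto (hh : IsIdentityLift c c' x h) (hx : x ∈ H) :
    Tendsto h (𝓝[H] x) (𝓝[H] (h x)) :=
  tendsto_nhdsWithin_iff.2 ⟨(hh.smooth.self_of_nhdsWithin hx).continuousWithinAt,
    hh.maps.mono fun _ hy => c'.dom_subset hy⟩

omit [FiniteDimensional ℝ E] in
theorem IsIdentityLift.comp (hk : IsIdentityLift c' c'' (h x) k) (hh : IsIdentityLift c c' x h)
    (hx : x ∈ H) : IsIdentityLift c c'' x (k ∘ h) where
  smooth := by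
    filter_upwards [(hh.tendsto hx).eventually hk.smooth, hh.smooth,
      eventually_eventually_nhdsWithin.2 hh.maps, self_mem_nhdsWithin] with v h1 h2 h3 h4
    exact ContDiffWithinAt.comp_of_preimage_mem_nhdsWithin (t := H) v h1 h2
      (h3.mono fun y hy => c'.dom_subset hy)
  maps := (hh.tendsto hx).eventually hk.maps
  lifts := by
    filter_upwards [(hh.tendsto hx).eventually hk.lifts, hh.lifts] with v h1 h2
    exact h1.trans h2

omit [FiniteDimensional ℝ E] in
theorem OrbifoldChart.isIdentityLift_group (c : OrbifoldChart H X) {γ : Equiv.Perm E} (hγ : γ ∈ c.group)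
    (hx : x ∈ c.dom) : IsIdentityLift c c x γ where
  smooth := Filter.Eventually.mono (c.dom_mem hx) fun _ hy => c.contDiffWithinAt_group hγ hy
  maps := Filter.Eventually.mono (c.dom_mem hx) fun _ hy => c.mapsTo_group γ hγ hy
  lifts := Filter.Eventually.mono (c.dom_mem hx) fun _ hy => c.proj_group hγ hy

theorem IsIdentityLift.exists_group (hH : IsModelSet H) (hx : x ∈ c.dom)
    (hh : IsIdentityLift c c x h) : ∃ γ ∈ c.group, ∀ᶠ y in 𝓝[H] x, h y = γ y :=
  c.exists_group_eventually_eq hH hx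
    ((hh.smooth.self_of_nhdsWithin (c.dom_subset hx)).of_le (by simp)) hh.maps hh.lifts

/-- Lifts of the identity, in both directions, are local diffeomorphisms. -/
theorem IsIdentityLift.exists_isLocalDiffeo (hH : IsModelSet H) (hx : x ∈ c.dom)
    (hh : IsIdentityLift c c' x h) (hy : h x ∈ c'.dom) (hk : IsIdentityLift c' c (h x) k)
    (hkx : k (h x) = x) :
    ∃ e : PartialEquiv E E, IsLocalDiffeo c.dom c'.dom e ∧ x ∈ e.source ∧ e x = h x ∧
      ∀ v ∈ e.source, c'.proj (e v) = c.proj v := by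
  have hxH := c.dom_subset hx
  have hyH := c'.dom_subset hy
  -- The round trip is a group element fixing x; correcting k by its inverse gives an exact left
  -- inverse of h near x.
  obtain ⟨γ, hγ, hγe⟩ := (hk.comp hh hxH).exists_group hH hx
  have hγx : γ x = x := by
    rw [← hγe.self_of_nhdsWithin hxH]; exact hkx
  have hγx' : γ⁻¹ x = x := by
    conv_lhs => rw [← hγx]
    exact γ.symm_apply_apply x
  set k₁ : E → E := ⇑γ⁻¹ ∘ k with hk₁
  have hk₁y : k₁ (h x) = x := by rw [hk₁, Function.comp_apply, hkx, hγx']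
  have hk₁l : IsIdentityLift c' c (h x) k₁ :=
    (c.isIdentityLift_group (inv_mem hγ) (hkx.symm ▸ hx)).comp hk hyH
  have hleft : ∀ᶠ v in 𝓝[H] x, k₁ (h v) = v := by
    filter_upwards [hγe] with v hv
    have hv : k (h v) = γ v := hv
    rw [hk₁, Function.comp_apply, hv]
    exact γ.symm_apply_apply v
  have hh' : IsIdentityLift c c' (k₁ (h x)) h := hk₁y.symm ▸ hh
  obtain ⟨γ', hγ', hγ'e⟩ := (hh'.comp hk₁l hyH).exists_group hH hy
  have hγ'y : γ' (h x) = h x := by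
    rw [← hγ'e.self_of_nhdsWithin hyH, Function.comp_apply, hk₁y]
  -- The other round trip is also a group element. In finite dimension a one-sided inverse
  -- derivative is two-sided, so its first jet is that of the identity and it is trivial.
  have hright : ∀ᶠ v in 𝓝[H] (h x), h (k₁ v) = v := by
    have hA := ((hh.smooth.self_of_nhdsWithin hxH).differentiableWithinAt (by simp)).hasFDerivWithinAt
    have hB := ((hk₁l.smooth.self_of_nhdsWithin hyH).differentiableWithinAt (by simp)).hasFDerivWithinAt
    set A := fderivWithin ℝ h H x
    set B := fderivWithin ℝ k₁ H (h x)
    have hBA : B.comp A = ContinuousLinearMap.id ℝ E :=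
      (hH.uniqueDiffWithinAt hxH).eq
        (HasFDerivWithinAt.comp_of_tendsto (t := H) x hB hA (hh.tendsto hxH))
        ((hasFDerivWithinAt_id x H).congr_of_eventuallyEq hleft (hleft.self_of_nhdsWithin hxH))
    have hAB : A.comp B = ContinuousLinearMap.id ℝ E := by
      have h1 : (B : E →ₗ[ℝ] E) * (A : E →ₗ[ℝ] E) = 1 :=
        LinearMap.ext fun v => congrArg (fun T : E →L[ℝ] E => T v) hBA
      have h2 := mul_eq_one_comm.1 h1
      exact ContinuousLinearMap.ext fun v => LinearMap.congr_fun h2 v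
    have hd : HasFDerivWithinAt (h ∘ k₁) (A.comp B) H (h x) :=
      HasFDerivWithinAt.comp_of_tendsto (t := H) (h x) (by rwa [hk₁y]) hB (hk₁l.tendsto hyH)
    rw [hAB] at hd
    have hd' : HasFDerivWithinAt γ' (ContinuousLinearMap.id ℝ E) H (h x) :=
      hd.congr_of_eventuallyEq (hγ'e.mono fun v hv => hv.symm) (hγ'e.self_of_nhdsWithin hyH).symm
    have h1 := c'.eq_one_of_fderivWithin_eq_id hH hγ' hy hγ'y
      (hd'.fderivWithin (hH.uniqueDiffWithinAt hyH))
    filter_upwards [hγ'e] with v hv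
    rw [h1] at hv
    exact hv
  obtain ⟨O₁, hO₁, hx₁, hP₁⟩ := mem_nhdsWithin.1 ((hleft.and hh.smooth).and (hh.maps.and hh.lifts))
  obtain ⟨O₂, hO₂, hy₂, hP₂⟩ := mem_nhdsWithin.1 ((hright.and hk₁l.smooth).and hk₁l.maps)
  have hP₁ : ∀ v ∈ c.dom ∩ O₁, _ := fun v hv => hP₁ ⟨hv.2, c.dom_subset hv.1⟩
  have hP₂ : ∀ v ∈ c'.dom ∩ O₂, _ := fun v hv => hP₂ ⟨hv.2, c'.dom_subset hv.1⟩
  have hc₁ : ContinuousOn h (c.dom ∩ O₁) := fun v hv =>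
    (hP₁ v hv).1.2.continuousWithinAt.mono (inter_subset_left.trans c.dom_subset)
  have hc₂ : ContinuousOn k₁ (c'.dom ∩ O₂) := fun v hv =>
    (hP₂ v hv).1.2.continuousWithinAt.mono (inter_subset_left.trans c'.dom_subset)
  let e : PartialEquiv E E :=
    { toFun := h
      invFun := k₁
      source := c.dom ∩ O₁ ∩ h ⁻¹' O₂
      target := c'.dom ∩ O₂ ∩ k₁ ⁻¹' O₁
      map_source' := fun v hv => ⟨⟨(hP₁ v hv.1).2.1, hv.2⟩, by
        rw [mem_preimage, (hP₁ v hv.1).1.1]; exact hv.1.2⟩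
      map_target' := fun v hv => ⟨⟨(hP₂ v hv.1).2, hv.2⟩, by
        rw [mem_preimage, (hP₂ v hv.1).1.1]; exact hv.1.2⟩
      left_inv' := fun v hv => (hP₁ v hv.1).1.1
      right_inv' := fun v hv => (hP₂ v hv.1).1.1 }
  refine ⟨e, ⟨?_, ?_, ?_, ?_⟩, ⟨⟨hx, hx₁⟩, hy₂⟩, rfl, fun v hv => (hP₁ v hv.1).2.2⟩
  · obtain ⟨O, hO, hOe⟩ := continuousOn_iff'.1 hc₁ O₂ hO₂
    refine ⟨O₁ ∩ O, hO₁.inter hO, ?_⟩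
    change c.dom ∩ O₁ ∩ h ⁻¹' O₂ = _
    rw [inter_comm, hOe, inter_comm, inter_assoc]
  · obtain ⟨O, hO, hOe⟩ := continuousOn_iff'.1 hc₂ O₁ hO₁
    refine ⟨O₂ ∩ O, hO₂.inter hO, ?_⟩
    change c'.dom ∩ O₂ ∩ k₁ ⁻¹' O₁ = _
    rw [inter_comm, hOe, inter_comm, inter_assoc]
  · exact fun v hv => (hP₁ v hv.1).1.2.mono fun u hu => c.dom_subset hu.1.1
  · exact fun v hv => (hP₂ v hv.1).1.2.mono fun u hu => c'.dom_subset hu.1.1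

end Lifts

/-! ## Lifts of the quotient map of a cut -/

section CutLift

variable {n r k : ℕ} {Y W : Type*} [TopologicalSpace Y] [TopologicalSpace W]
  [MulAction (Torus r) Y] {σ : Fin k → Circle →ₜ* Torus r}
  {φ : Fin k → Y → ℝ} {α : Fin k → ℝ} {p : Y × ℝ × (Fin k → ℂ) → W}

omit [TopologicalSpace Y] in
theorem cutRotate_mem_cutLevel (hinv : ∀ (i : Fin k) (τ : Torus r) (m : Y), φ i (τ • m) = φ i m)
    {l : Fin k → Circle} {w : Y × ℝ × (Fin k → ℂ)} :
    cutRotate σ l w ∈ cutLevel φ α ↔ w ∈ cutLevel φ α := by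
  simp only [cutLevel, cutRotate, mem_ofPred_eq, hinv, norm_mul, Circle.norm_coe, one_mul]

omit [TopologicalSpace Y] in
theorem cutRotate_mul (l l' : Fin k → Circle) (w : Y × ℝ × (Fin k → ℂ)) :
    cutRotate σ (l * l') w = cutRotate σ l (cutRotate σ l' w) := by
  refine Prod.ext ?_ (Prod.ext rfl (funext fun i => ?_))
  · change (∏ i, σ i (l i * l' i)) • w.1 = (∏ i, σ i (l i)) • (∏ i, σ i (l' i)) • w.1
    simp only [map_mul, Finset.prod_mul_distrib, mul_smul]
  · change ((l i * l' i : Circle) : ℂ) * _ = _ * (_ * _)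
    rw [Circle.coe_mul, mul_assoc]

omit [TopologicalSpace Y] in
theorem cutRotate_one (w : Y × ℝ × (Fin k → ℂ)) : cutRotate σ 1 w = w := by
  refine Prod.ext ?_ (Prod.ext rfl (funext fun i => ?_))
  · change (∏ i, σ i 1) • w.1 = w.1
    simp
  · change ((1 : Circle) : ℂ) * _ = _
    simp

/-- `p` is an equivariant quotient map of the zero level of a cut by `(S¹)ᵏ`. -/
structure IsCutMap [MulAction (Torus r) W] (σ : Fin k → Circle →ₜ* Torus r) (φ : Fin k → Y → ℝ)
    (α : Fin k → ℝ) (p : Y × ℝ × (Fin k → ℂ) → W) : Prop where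
  continuousOn : ContinuousOn p (cutLevel φ α)
  isOpen_image : ∀ O : Set (Y × ℝ × (Fin k → ℂ)), IsOpen O → IsOpen (p '' (cutLevel φ α ∩ O))
  surj : SurjOn p (cutLevel φ α) univ
  equivariant : ∀ (τ : Torus r), ∀ w ∈ cutLevel φ α, p (τ • w.1, w.2) = τ • p w
  fibre : ∀ w ∈ cutLevel φ α, ∀ w' ∈ cutLevel φ α,
    p w = p w' ↔ ∃ l : Fin k → Circle, cutRotate σ l w = w'

/-- A local lift `g` of the quotient map `p` of a cut, with a local section `s`, to a set `D` with
a map `q` to the quotient. -/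
structure IsCutLift (φ : Fin k → Y → ℝ) (α : Fin k → ℝ) (p : Y × ℝ × (Fin k → ℂ) → W)
    (c : OrbifoldChart (univ : Set (Euc n)) Y) (D : Set (Euc (n + 1))) (q : Euc (n + 1) → W)
    (w : Euc n × ℝ × (Fin k → ℂ)) (y : Euc (n + 1)) (g : Euc n × ℝ × (Fin k → ℂ) → Euc (n + 1))
    (s : Euc (n + 1) → Euc n × ℝ × (Fin k → ℂ)) : Prop where
  map_eq : g w = y
  section_eq : s y = w
  smooth : ∀ᶠ v in 𝓝[cutLevelChart c φ α] w, ContDiffWithinAt ℝ ∞ g (cutLevelChart c φ α) v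
  lifts : ∀ᶠ v in 𝓝[cutLevelChart c φ α] w, g v ∈ D ∧ q (g v) = p (c.proj v.1, v.2)
  smooth_section : ∀ᶠ v in 𝓝[halfSpace n] y, ContDiffWithinAt ℝ ∞ s (halfSpace n) v
  isSection : ∀ᶠ v in 𝓝[halfSpace n] y, s v ∈ cutLevelChart c φ α ∧ g (s v) = v

/-- Charts of the quotient orbifold of a cut. -/
def IsCutChart (B : Orbifold n Y) (φ : Fin k → Y → ℝ) (α : Fin k → ℝ) (p : Y × ℝ × (Fin k → ℂ) → W)
    (κ : OrbifoldChart (halfSpace n) W) : Prop :=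
  ∀ c ∈ B.charts, ∀ w ∈ cutLevelChart c φ α, ∀ y ∈ κ.dom, p (c.proj w.1, w.2) = κ.proj y →
    ∃ g s, IsCutLift φ α p c κ.dom κ.proj w y g s

variable {B : Orbifold n Y} {c c' : OrbifoldChart (univ : Set (Euc n)) Y} {D : Set (Euc (n + 1))}
  {q : Euc (n + 1) → W} {w w' : Euc n × ℝ × (Fin k → ℂ)} {y : Euc (n + 1)}
  {g : Euc n × ℝ × (Fin k → ℂ) → Euc (n + 1)} {s : Euc (n + 1) → Euc n × ℝ × (Fin k → ℂ)}

omit [TopologicalSpace W] [MulAction (Torus r) Y] in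
theorem IsCutLift.tendsto (h : IsCutLift φ α p c D q w y g s) (hw : w ∈ cutLevelChart c φ α)
    (hD : D ⊆ halfSpace n) :
    Tendsto g (𝓝[cutLevelChart c φ α] w) (𝓝[halfSpace n] y) :=
  tendsto_nhdsWithin_iff.2 ⟨h.map_eq ▸ (h.smooth.self_of_nhdsWithin hw).continuousWithinAt,
    h.lifts.mono fun _ hv => hD hv.1⟩

omit [TopologicalSpace W] [MulAction (Torus r) Y] in
theorem IsCutLift.tendsto_section (h : IsCutLift φ α p c D q w y g s) (hy : y ∈ halfSpace n) :
    Tendsto s (𝓝[halfSpace n] y) (𝓝[cutLevelChart c φ α] w) :=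
  tendsto_nhdsWithin_iff.2 ⟨h.section_eq ▸
    (h.smooth_section.self_of_nhdsWithin hy).continuousWithinAt, h.isSection.mono fun _ hv => hv.1⟩

omit [TopologicalSpace W] [MulAction (Torus r) Y] in
theorem IsCutLift.lifts_section (h : IsCutLift φ α p c D q w y g s) (hy : y ∈ halfSpace n) :
    ∀ᶠ v in 𝓝[halfSpace n] y, p (c.proj (s v).1, (s v).2) = q v := by
  filter_upwards [(h.tendsto_section hy).eventually h.lifts, h.isSection] with v h1 h2
  rw [← h1.2, h2.2]

/-- A rotation acts on Y through one torus element. Its lift has invertible derivative, so the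
inverse function theorem gives L' as an exact local inverse, not merely a lift of the inverse
rotation. -/
theorem SmoothAction.exists_cutRotate_lift (hB : SmoothAction (r := r) B)
    (hinv : ∀ (i : Fin k) (τ : Torus r) (m : Y), φ i (τ • m) = φ i m)
    (hc : c ∈ B.charts) (hc' : c' ∈ B.charts) (hw : w ∈ cutLevelChart c φ α)
    (hw' : w' ∈ cutLevelChart c' φ α) {l : Fin k → Circle}
    (h : cutRotate σ l (c'.proj w'.1, w'.2) = (c.proj w.1, w.2)) :
    ∃ L L' : Euc n × ℝ × (Fin k → ℂ) → Euc n × ℝ × (Fin k → ℂ), L w' = w ∧ L' w = w' ∧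
      (∀ᶠ v in 𝓝 w', ContDiffAt ℝ ∞ L v) ∧ (∀ᶠ v in 𝓝 w, ContDiffAt ℝ ∞ L' v) ∧
      (∀ᶠ v in 𝓝[cutLevelChart c' φ α] w', L v ∈ cutLevelChart c φ α ∧
        cutRotate σ l (c'.proj v.1, v.2) = (c.proj (L v).1, (L v).2)) ∧
      ∀ᶠ v in 𝓝[cutLevelChart c φ α] w, L' v ∈ cutLevelChart c' φ α ∧ L (L' v) = v := by
  set τ : Torus r := ∏ i, σ i (l i) with hτ
  have h1 : τ • c'.proj w'.1 = c.proj w.1 := congrArg Prod.fst h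
  have h2 : w'.2.1 = w.2.1 := congrArg (fun v => v.2.1) h
  have h3 : ∀ i, (l i : ℂ) * w'.2.2 i = w.2.2 i := fun i => congrFun (congrArg (fun v => v.2.2) h) i
  obtain ⟨f, hf, hfx⟩ := hB.exists_isLocalLift hc' hc hw'.1 hw.1 h1
  obtain ⟨T₀, hT₀, hT₀s⟩ := hf.exists_fderiv_surjective isModelSet_univ hB hc' hc hw'.1
  rw [hasFDerivWithinAt_univ] at hT₀
  let T : Euc n ≃L[ℝ] Euc n := ContinuousLinearEquiv.ofBijective T₀
    (LinearMap.ker_eq_bot.2 ((LinearMap.injective_iff_surjective (f := (T₀ : Euc n →ₗ[ℝ] Euc n))).2 hT₀s))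
    (LinearMap.range_eq_top.2 hT₀s)
  have hT : (T : Euc n →L[ℝ] Euc n) = T₀ := ContinuousLinearMap.ext fun v => rfl
  have hz : Tendsto (fun v : Euc n => ((0 : Fin r → ℝ), v)) (𝓝 w'.1) (𝓝[univ ×ˢ univ] (0, w'.1)) := by
    rw [univ_prod_univ, nhdsWithin_univ]
    exact Continuous.tendsto (by fun_prop) _
  have hfs : ∀ᶠ v in 𝓝 w'.1, ContDiffAt ℝ ∞ (fun v => f (0, v)) v := by
    filter_upwards [hz.eventually hf.smooth] with v hv
    rw [univ_prod_univ, contDiffWithinAt_univ] at hv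
    exact hv.comp v (contDiffAt_const.prodMk contDiffAt_id)
  obtain ⟨e, he, hxe, -, hes, hes'⟩ := exists_openPartialHomeomorph_contDiffOn hfs (f' := T)
    (by rwa [hT]) univ_mem
  have hex : e w'.1 = w.1 := by rw [he, hfx]
  have hyt : w.1 ∈ e.target := hex ▸ e.map_source hxe
  have hey : e.symm w.1 = w'.1 := by rw [← hex, e.left_inv hxe]
  have hP : ∀ᶠ u in 𝓝 w'.1, u ∈ c'.dom ∧ e u ∈ c.dom ∧ c.proj (e u) = τ • c'.proj u := by
    filter_upwards [hz.eventually hf.maps, hz.eventually hf.lifts, c'.isOpen_dom.mem_nhds hw'.1]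
      with u k1 k2 k3
    rw [he]
    rw [torusExp_zero, one_smul] at k2
    exact ⟨k3, k1, k2⟩
  have hlin : ∀ l : Fin k → Circle, ContDiff ℝ ∞ fun (z : Fin k → ℂ) (i : Fin k) => (l i : ℂ) * z i :=
    fun l => by fun_prop
  have hrot : ∀ u ∈ c'.dom, c.proj (e u) = τ • c'.proj u → ∀ t (z : Fin k → ℂ),
      cutRotate σ l (c'.proj u, t, z) = (c.proj (e u), t, fun i => (l i : ℂ) * z i) := by
    intro u _ hu t z
    rw [hu]; rfl
  refine ⟨fun v => (e v.1, v.2.1, fun i => (l i : ℂ) * v.2.2 i),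
    fun v => (e.symm v.1, v.2.1, fun i => ((l i)⁻¹ : Circle) * v.2.2 i), ?_, ?_, ?_, ?_, ?_, ?_⟩
  · exact Prod.ext hex (Prod.ext h2 (funext h3))
  · refine Prod.ext hey (Prod.ext h2.symm (funext fun i => ?_))
    change ((l i)⁻¹ : Circle) * w.2.2 i = w'.2.2 i
    rw [← h3, ← mul_assoc, ← Circle.coe_mul, inv_mul_cancel, Circle.coe_one, one_mul]
  · filter_upwards [continuousAt_fst.eventually (e.open_source.mem_nhds hxe)] with v hv
    refine ContDiffAt.prodMk ?_ (contDiffAt_snd.fst.prodMk ((hlin l).contDiffAt.comp v contDiffAt_snd.snd))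
    exact (hes.contDiffAt (e.open_source.mem_nhds hv)).comp v contDiffAt_fst
  · filter_upwards [continuousAt_fst.eventually (e.open_target.mem_nhds hyt)] with v hv
    refine ContDiffAt.prodMk ?_
      (contDiffAt_snd.fst.prodMk ((hlin fun i => (l i)⁻¹).contDiffAt.comp v contDiffAt_snd.snd))
    exact (hes'.contDiffAt (e.open_target.mem_nhds hv)).comp v contDiffAt_fst
  · filter_upwards [mem_nhdsWithin_of_mem_nhds (continuousAt_fst.eventually hP),
      self_mem_nhdsWithin] with v ⟨k1, k2, k3⟩ k4
    have k5 := hrot v.1 k1 k3 v.2.1 v.2.2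
    refine ⟨⟨k2, ?_⟩, k5⟩
    change (c.proj (e v.1), v.2.1, fun i => (l i : ℂ) * v.2.2 i) ∈ cutLevel φ α
    rw [← k5]
    exact (cutRotate_mem_cutLevel hinv).2 k4.2
  · have hs : Tendsto (fun v : Euc n × ℝ × (Fin k → ℂ) => e.symm v.1) (𝓝 w) (𝓝 w'.1) := by
      rw [← hey]
      exact (e.continuousAt_symm hyt).tendsto.comp continuousAt_fst
    filter_upwards [mem_nhdsWithin_of_mem_nhds (hs.eventually hP), self_mem_nhdsWithin,
      mem_nhdsWithin_of_mem_nhds (continuousAt_fst.eventually (e.open_target.mem_nhds hyt))]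
      with v ⟨k1, k2, k3⟩ k4 k5
    have k6 := hrot _ k1 k3 v.2.1 fun i => ((l i)⁻¹ : Circle) * v.2.2 i
    have k7 : (fun i => (l i : ℂ) * (((l i)⁻¹ : Circle) * v.2.2 i)) = v.2.2 := by
      funext i
      rw [← mul_assoc, ← Circle.coe_mul, mul_inv_cancel, Circle.coe_one, one_mul]
    rw [k7, e.right_inv k5] at k6
    refine ⟨⟨k1, (cutRotate_mem_cutLevel (σ := σ) (l := l) hinv).1 ?_⟩, ?_⟩
    · rw [k6]; exact k4.2
    · exact Prod.ext (e.right_inv k5) (Prod.ext rfl k7)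

/-- Lifts to charts at one point of a fibre give lifts at all points of the fibre. -/
theorem IsCutLift.transfer [MulAction (Torus r) W] (hp : IsCutMap σ φ α p)
    (hB : SmoothAction (r := r) B)
    (hinv : ∀ (i : Fin k) (τ : Torus r) (m : Y), φ i (τ • m) = φ i m)
    (hc : c ∈ B.charts) (hc' : c' ∈ B.charts) (hw : w ∈ cutLevelChart c φ α)
    (hw' : w' ∈ cutLevelChart c' φ α) (hy : y ∈ halfSpace n) (h : IsCutLift φ α p c D q w y g s)
    (heq : p (c'.proj w'.1, w'.2) = p (c.proj w.1, w.2)) :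
    ∃ g' s', IsCutLift φ α p c' D q w' y g' s' := by
  obtain ⟨l, hl⟩ := (hp.fibre _ hw'.2 _ hw.2).1 heq
  obtain ⟨L, L', hL, hL', hLs, hLs', hLl, hLl'⟩ := hB.exists_cutRotate_lift hinv hc hc' hw hw' hl
  have hLt : Tendsto L (𝓝[cutLevelChart c' φ α] w') (𝓝[cutLevelChart c φ α] w) :=
    tendsto_nhdsWithin_iff.2 ⟨hL ▸ hLs.self_of_nhds.continuousAt.continuousWithinAt,
      hLl.mono fun v hv => hv.1⟩
  have hst := h.tendsto_section hy
  refine ⟨g ∘ L, L' ∘ s, by simp [hL, h.map_eq], by simp [hL', h.section_eq], ?_, ?_, ?_, ?_⟩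
  · filter_upwards [hLt.eventually h.smooth, mem_nhdsWithin_of_mem_nhds hLs,
      eventually_eventually_nhdsWithin.2 hLl] with v h1 h2 h3
    exact ContDiffWithinAt.comp_of_preimage_mem_nhdsWithin v h1 h2.contDiffWithinAt
      (h3.mono fun u hu => hu.1)
  · filter_upwards [hLt.eventually h.lifts, hLl, self_mem_nhdsWithin] with v h1 h2 h3
    refine ⟨h1.1, h1.2.trans ?_⟩
    rw [← h2.2]
    exact ((hp.fibre _ h3.2 _ ((cutRotate_mem_cutLevel hinv).2 h3.2)).2 ⟨l, rfl⟩).symm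
  · filter_upwards [h.smooth_section, hst.eventually (mem_nhdsWithin_of_mem_nhds hLs')] with v h1 h2
    exact h2.comp_contDiffWithinAt v h1
  · filter_upwards [h.isSection, hst.eventually hLl'] with v h1 h2
    refine ⟨h2.1, ?_⟩
    change g (L (L' (s v))) = v
    rw [h2.2, h1.2]

theorem exists_mem_cutLevelChart [MulAction (Torus r) W] (hp : IsCutMap σ φ α p) (B : Orbifold n Y)
    (q : W) : ∃ c ∈ B.charts, ∃ w ∈ cutLevelChart c φ α, p (c.proj w.1, w.2) = q := by
  obtain ⟨⟨m, tz⟩, hw, rfl⟩ := hp.surj (mem_univ q)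
  obtain ⟨c, hc, x, hx, rfl⟩ := B.covers m
  exact ⟨c, hc, (x, tz), ⟨hx, hw⟩, rfl⟩

/-- Passing to the level set by the section of one chart and down by the lift to the other gives
lifts of the identity in both directions; by rigidity these are local diffeomorphisms. Both lifts
are taken at the same point w of the level set. -/
theorem IsCutChart.compatible [MulAction (Torus r) W] (hp : IsCutMap σ φ α p)
    {κ κ' : OrbifoldChart (halfSpace n) W}
    (hκ : IsCutChart B φ α p κ) (hκ' : IsCutChart B φ α p κ') : κ.Compatible κ' := by
  intro y hy y' hy' heq
  obtain ⟨c, hc, w, hw, hpw⟩ := exists_mem_cutLevelChart hp B (κ.proj y)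
  obtain ⟨g, s, h⟩ := hκ c hc w hw y hy hpw
  obtain ⟨g', s', h'⟩ := hκ' c hc w hw y' hy' (hpw.trans heq)
  have key : ∀ {κ κ' : OrbifoldChart (halfSpace n) W} {y y' g g' s s'}, y ∈ κ.dom → y' ∈ κ'.dom →
      IsCutLift φ α p c κ.dom κ.proj w y g s → IsCutLift φ α p c κ'.dom κ'.proj w y' g' s' →
      IsIdentityLift κ κ' y (g' ∘ s) := by
    intro κ κ' y y' g g' s s' hy hy' h h'
    have hst := h.tendsto_section (κ.dom_subset hy)
    refine ⟨?_, hst.eventually (h'.lifts.mono fun v hv => hv.1), ?_⟩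
    · filter_upwards [hst.eventually h'.smooth, h.smooth_section,
        eventually_eventually_nhdsWithin.2 h.isSection] with v h1 h2 h3
      exact ContDiffWithinAt.comp_of_preimage_mem_nhdsWithin v h1 h2 (h3.mono fun u hu => hu.1)
    · filter_upwards [hst.eventually h'.lifts, h.lifts_section (κ.dom_subset hy)] with v h1 h2
      exact h1.2.trans h2
  have hgy : (g' ∘ s) y = y' := by rw [Function.comp_apply, h.section_eq, h'.map_eq]
  obtain ⟨e, he1, he2, he3, he4⟩ := (key hy hy' h h').exists_isLocalDiffeo (isModelSet_halfSpace n) hy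
    (hgy.symm ▸ hy') (k := g ∘ s') (hgy.symm ▸ key hy' hy h' h)
    (by rw [hgy, Function.comp_apply, h'.section_eq, h.map_eq])
  exact ⟨e, he1, he2, he3.trans hgy, he4⟩

theorem IsCutLift.submersion {κ : OrbifoldChart (halfSpace n) W}
    (hy : y ∈ κ.dom) (h : IsCutLift φ α p c κ.dom κ.proj w y g s) :
    ∃ (O : Set (Euc n × ℝ × (Fin k → ℂ))) (O' : Set (Euc (n + 1))),
        IsOpen O ∧ w ∈ O ∧ IsOpen O' ∧ y ∈ O' ∧ g w = y ∧ s y = w ∧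
        ContDiffOn ℝ ∞ g (cutLevelChart c φ α ∩ O) ∧
        (∀ v ∈ cutLevelChart c φ α ∩ O,
          g v ∈ κ.dom ∧ κ.proj (g v) = p (c.proj v.1, v.2)) ∧
        ContDiffOn ℝ ∞ s (κ.dom ∩ O') ∧
        ∀ v ∈ κ.dom ∩ O', s v ∈ cutLevelChart c φ α ∩ O ∧ g (s v) = v := by
  obtain ⟨O, hO, hwO, hP⟩ := mem_nhdsWithin.1 (h.smooth.and h.lifts)
  have hst := h.tendsto_section (κ.dom_subset hy)
  have hsO := hst.eventually (mem_nhdsWithin_of_mem_nhds (hO.mem_nhds hwO))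
  obtain ⟨O', hO', hyO', hP'⟩ := mem_nhdsWithin.1 (h.smooth_section.and (h.isSection.and hsO))
  refine ⟨O, O', hO, hwO, hO', hyO', h.map_eq, h.section_eq, fun v hv => ?_, fun v hv => ?_,
    fun v hv => ?_, fun v hv => ?_⟩
  · exact (hP ⟨hv.2, hv.1⟩).1.mono inter_subset_left
  · exact (hP ⟨hv.2, hv.1⟩).2
  · exact (hP' ⟨hv.2, κ.dom_subset hv.1⟩).1.mono (inter_subset_left.trans κ.dom_subset)
  · have := hP' ⟨hv.2, κ.dom_subset hv.1⟩
    exact ⟨⟨this.2.1.1, this.2.2⟩, this.2.1.2⟩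

/-- The action is lifted by going up along a local section, moving by a lift of the action on Y, and
coming down by the lift of p at the displaced point. -/
theorem IsCutChart.exists_action_lift [MulAction (Torus r) W] (hp : IsCutMap σ φ α p)
    (hB : SmoothAction (r := r) B)
    (hinv : ∀ (i : Fin k) (τ : Torus r) (m : Y), φ i (τ • m) = φ i m)
    {κ κ' : OrbifoldChart (halfSpace n) W} (hκ : IsCutChart B φ α p κ)
    (hκ' : IsCutChart B φ α p κ') (τ : Torus r) {y y' : Euc (n + 1)} (hy : y ∈ κ.dom)
    (hy' : y' ∈ κ'.dom) (heq : τ • κ.proj y = κ'.proj y') :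
    ∃ (g : (Fin r → ℝ) × Euc (n + 1) → Euc (n + 1)) (O : Set ((Fin r → ℝ) × Euc (n + 1))),
      IsOpen O ∧ (0, y) ∈ O ∧ g (0, y) = y' ∧ ContDiffOn ℝ ∞ g (O ∩ univ ×ˢ κ.dom) ∧
        ∀ v ∈ O ∩ univ ×ˢ κ.dom, g v ∈ κ'.dom ∧
          κ'.proj (g v) = (torusExp v.1 * τ) • κ.proj v.2 := by
  obtain ⟨c, hc, ⟨x, tz⟩, hw, hpw⟩ := exists_mem_cutLevelChart hp B (κ.proj y)
  obtain ⟨g, s, h⟩ := hκ c hc _ hw y hy hpw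
  obtain ⟨c', hc', x', hx', hxx'⟩ := B.covers (τ • c.proj x)
  have hw' : (x', tz) ∈ cutLevelChart c' φ α := by
    refine ⟨hx', ?_⟩
    have := hw.2
    simpa [cutLevel, hxx', hinv] using this
  obtain ⟨g', s', h'⟩ := hκ' c' hc' (x', tz) hw' y' hy' (by
    change p (c'.proj x', tz) = _
    rw [hxx', ← heq, ← hpw]
    exact hp.equivariant τ (c.proj x, tz) hw.2)
  obtain ⟨f, hf, hfx⟩ := hB.exists_isLocalLift hc hc' hw.1 hx' hxx'.symm
  let H : Set (Euc (n + 1)) := halfSpace n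
  have hyH := κ.dom_subset hy
  have hst := h.tendsto_section hyH
  -- the lift of the action to the level sets
  set M : (Fin r → ℝ) × Euc (n + 1) → Euc n × ℝ × (Fin k → ℂ) :=
    fun v => (f (v.1, (s v.2).1), (s v.2).2) with hM
  have hsnd : Tendsto (fun v : (Fin r → ℝ) × Euc (n + 1) => v.2) (𝓝[univ ×ˢ H] (0, y)) (𝓝[H] y) := by
    rw [nhdsWithin_prod_eq (0 : Fin r → ℝ) y]; exact tendsto_snd
  have hst' : Tendsto (fun v : (Fin r → ℝ) × Euc (n + 1) => s v.2) (𝓝[univ ×ˢ H] (0, y))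
    (𝓝[cutLevelChart c φ α] (x, tz)) := hst.comp hsnd
  have hin : Tendsto (fun v : (Fin r → ℝ) × Euc (n + 1) => (v.1, (s v.2).1)) (𝓝[univ ×ˢ H] (0, y))
      (𝓝[univ ×ˢ univ] (0, x)) := by
    rw [univ_prod_univ, nhdsWithin_univ]
    refine Tendsto.prodMk_nhds ((continuous_fst.tendsto _).mono_left nhdsWithin_le_nhds) ?_
    exact ((continuous_fst.tendsto (x, tz)).mono_left nhdsWithin_le_nhds).comp hst'
  have hMs : ∀ᶠ v in 𝓝[univ ×ˢ H] ((0 : Fin r → ℝ), y), ContDiffWithinAt ℝ ∞ M (univ ×ˢ H) v := by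
    filter_upwards [hin.eventually hf.smooth, hsnd.eventually h.smooth_section] with v h1 h2
    rw [univ_prod_univ, contDiffWithinAt_univ] at h1
    have h3 : ContDiffWithinAt ℝ ∞ (fun v : (Fin r → ℝ) × Euc (n + 1) => s v.2) (univ ×ˢ H) v :=
      h2.comp v contDiffWithinAt_snd fun u hu => hu.2
    exact (h1.comp_contDiffWithinAt v (contDiffWithinAt_fst.prodMk h3.fst)).prodMk h3.snd
  have hMl : ∀ᶠ v in 𝓝[univ ×ˢ H] ((0 : Fin r → ℝ), y), M v ∈ cutLevelChart c' φ α ∧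
      p (c'.proj (M v).1, (M v).2) = (torusExp v.1 * τ) • p (c.proj (s v.2).1, (s v.2).2) := by
    filter_upwards [hin.eventually hf.maps, hin.eventually hf.lifts,
      hst'.eventually self_mem_nhdsWithin] with v h1 h2 h3
    have h4 : c'.proj (M v).1 = (torusExp v.1 * τ) • c.proj (s v.2).1 := by
      rw [mul_smul]; exact h2
    refine ⟨⟨h1, ?_⟩, ?_⟩
    · rw [h4]
      have := h3.2
      simpa [cutLevel, hinv] using this
    · rw [h4]
      exact hp.equivariant _ (c.proj (s v.2).1, (s v.2).2) h3.2
  have hM0 : M (0, y) = (x', tz) := by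
    simp only [hM, h.section_eq, hfx]
  have hmem : ((0 : Fin r → ℝ), y) ∈ (univ ×ˢ H : Set ((Fin r → ℝ) × Euc (n + 1))) := ⟨mem_univ _, hyH⟩
  have hMt : Tendsto M (𝓝[univ ×ˢ H] (0, y)) (𝓝[cutLevelChart c' φ α] (x', tz)) :=
    tendsto_nhdsWithin_iff.2 ⟨hM0 ▸ (hMs.self_of_nhdsWithin hmem).continuousWithinAt,
      hMl.mono fun v hv => hv.1⟩
  have hgs : ∀ᶠ v in 𝓝[univ ×ˢ H] ((0 : Fin r → ℝ), y), ContDiffWithinAt ℝ ∞ (g' ∘ M) (univ ×ˢ H) v := by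
    filter_upwards [hMt.eventually h'.smooth, hMs, eventually_eventually_nhdsWithin.2 hMl] with v h1 h2 h3
    exact ContDiffWithinAt.comp_of_preimage_mem_nhdsWithin v h1 h2 (h3.mono fun u hu => hu.1)
  have hgl : ∀ᶠ v in 𝓝[univ ×ˢ H] ((0 : Fin r → ℝ), y), g' (M v) ∈ κ'.dom ∧
      κ'.proj (g' (M v)) = (torusExp v.1 * τ) • κ.proj v.2 := by
    filter_upwards [hMt.eventually h'.lifts, hMl, hsnd.eventually (h.lifts_section hyH)] with v h1 h2 h3
    exact ⟨h1.1, by rw [h1.2, h2.2, h3]⟩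
  obtain ⟨O, hO, hyO, hP⟩ := mem_nhdsWithin.1 (hgs.and hgl)
  refine ⟨g' ∘ M, O, hO, hyO, by rw [Function.comp_apply, hM0, h'.map_eq], fun v hv => ?_, fun v hv => ?_⟩
  · exact (hP ⟨hv.1, mem_univ _, κ.dom_subset hv.2.2⟩).1.mono fun u hu =>
      ⟨mem_univ _, κ.dom_subset hu.2.2⟩
  · exact (hP ⟨hv.1, mem_univ _, κ.dom_subset hv.2.2⟩).2

end CutLift

/-! ## Charts of a cut -/

section CutCharts

variable {n r k : ℕ} {Y W : Type*} [TopologicalSpace Y] [TopologicalSpace W]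
  [MulAction (Torus r) Y] [MulAction (Torus r) W] {σ : Fin k → Circle →ₜ* Torus r}
  {U : Fin k → Set Y} {φ : Fin k → Y → ℝ} {α : Fin k → ℝ} {p : Y × ℝ × (Fin k → ℂ) → W}
  {B : Orbifold n Y}

theorem OrbifoldChart.tendsto_cutLevel {c : OrbifoldChart (univ : Set (Euc n)) Y}
    {w : Euc n × ℝ × (Fin k → ℂ)} (hw : w ∈ cutLevelChart c φ α) :
    Tendsto (fun v : Euc n × ℝ × (Fin k → ℂ) => (c.proj v.1, v.2)) (𝓝[cutLevelChart c φ α] w)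
      (𝓝[cutLevel φ α] (c.proj w.1, w.2)) := by
  refine tendsto_nhdsWithin_iff.2 ⟨?_, eventually_mem_nhdsWithin.mono fun v hv => hv.2⟩
  have h1 : ContinuousAt c.proj w.1 := c.continuousOn_proj.continuousAt (c.isOpen_dom.mem_nhds hw.1)
  exact ((h1.tendsto.comp continuousAt_fst).prodMk_nhds continuousAt_snd).mono_left nhdsWithin_le_nhds

/-- The construction of a chart of the quotient from local lifts. -/
theorem exists_isCutChart (hp : IsCutMap σ φ α p) (hB : SmoothAction (r := r) B)
    (hφ : IsCutData (r := r) B U φ α) {D : Set (Euc (n + 1))}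
    (hDo : ∃ O : Set (Euc (n + 1)), IsOpen O ∧ D = halfSpace n ∩ O) (hDc : IsConnected D)
    (Γ : Subgroup (Equiv.Perm (Euc (n + 1)))) (hfin : Finite Γ) (hmaps : ∀ γ ∈ Γ, MapsTo γ D D)
    (hsmooth : ∀ γ ∈ Γ, ContDiffOn ℝ ∞ γ D) (heff : ∀ γ ∈ Γ, (∀ x ∈ D, γ x = x) → γ = 1)
    {q : Euc (n + 1) → W} (hq : ∀ x ∈ D, ∀ y ∈ D, q x = q y ↔ ∃ γ ∈ Γ, γ x = y)
    (hlift : ∀ y ∈ D, ∃ c ∈ B.charts, ∃ w ∈ cutLevelChart c φ α, p (c.proj w.1, w.2) = q y ∧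
      ∃ g s, IsCutLift φ α p c D q w y g s) :
    ∃ κ : OrbifoldChart (halfSpace n) W, κ.dom = D ∧ κ.proj = q ∧ IsCutChart B φ α p κ := by
  have hDH : D ⊆ halfSpace n := by
    obtain ⟨O, -, rfl⟩ := hDo; exact inter_subset_left
  have hDn : ∀ y ∈ D, 𝓝[D] y = 𝓝[halfSpace n] y := by
    obtain ⟨O, hO, rfl⟩ := hDo
    exact fun y hy => nhdsWithin_inter_of_mem' (mem_nhdsWithin_of_mem_nhds (hO.mem_nhds hy.2))
  let κ : OrbifoldChart (halfSpace n) W :=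
    { dom := D
      relOpen_dom := hDo
      isConnected_dom := hDc
      group := Γ
      finite_group := hfin
      mapsTo_group := hmaps
      smooth_group := hsmooth
      effective_group := heff
      proj := q
      continuousOn_proj := by
        intro y hy
        obtain ⟨c, hc, w, hw, hpw, g, s, h⟩ := hlift y hy
        have h1 := ((hp.continuousOn _ hw.2).tendsto.comp (c.tendsto_cutLevel hw)).comp
          (h.tendsto_section (hDH hy))
        rw [hpw] at h1
        rw [ContinuousWithinAt, hDn y hy]
        exact h1.congr' (h.lifts_section (hDH hy))
      isOpen_image_proj := by
        intro O hO
        rw [isOpen_iff_mem_nhds]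
        rintro _ ⟨y, ⟨hy, hyO⟩, rfl⟩
        obtain ⟨c, hc, w, hw, hpw, g, s, h⟩ := hlift y hy
        obtain ⟨O', hO', hwO', hP⟩ := mem_nhdsWithin.1 (h.lifts.and
          ((h.tendsto hw hDH).eventually (mem_nhdsWithin_of_mem_nhds (hO.mem_nhds hyO))))
        obtain ⟨A, A', hA, hwA, hA', hwA', hAA'⟩ := mem_nhds_prod_iff'.1 (hO'.mem_nhds hwO')
        have hN : IsOpen ((c.proj '' (c.dom ∩ A)) ×ˢ A') := (c.isOpen_image_proj A hA).prod hA'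
        refine mem_of_superset ((hp.isOpen_image _ hN).mem_nhds ?_) ?_
        · exact ⟨_, ⟨hw.2, ⟨w.1, ⟨hw.1, hwA⟩, rfl⟩, hwA'⟩, hpw⟩
        · rintro _ ⟨⟨_, tz⟩, ⟨hm, ⟨u, ⟨hu, huA⟩, rfl⟩, htz⟩, rfl⟩
          have := hP (⟨hAA' ⟨huA, htz⟩, hu, hm⟩ : (u, tz) ∈ O' ∩ cutLevelChart c φ α)
          exact ⟨g (u, tz), ⟨this.1.1, this.2⟩, this.1.2⟩
      proj_eq_iff := hq }
  refine ⟨κ, rfl, rfl, fun c hc w hw y hy hpw => ?_⟩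
  obtain ⟨c', hc', w', hw', hpw', g, s, h⟩ := hlift y hy
  -- A lift at one point of the fibre is enough, since rotations lift to local diffeomorphisms of
  -- level sets.
  exact h.transfer hp hB hφ.invariant hc' hc hw' hw (hDH hy) (hpw.trans hpw'.symm)

omit [TopologicalSpace Y] in
theorem cutRotate_exp {ξ : Fin k → Fin r → ℝ}
    (hξ : ∀ i θ, σ i (Circle.exp θ) = torusExp (θ • ξ i)) (θ : Fin k → ℝ)
    (w : Y × ℝ × (Fin k → ℂ)) :
    cutRotate σ (fun i => Circle.exp (θ i)) w =
      (torusExp (∑ i, θ i • ξ i) • w.1, w.2.1, fun i => (Circle.exp (θ i) : ℂ) * w.2.2 i) := by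
  simp only [cutRotate, hξ, torusExp_sum]

/-! ### Charts at the boundary -/

/-- The last coordinates of a vector. -/
noncomputable def eucTail (v : Euc (n + 1)) : Euc n := WithLp.toLp 2 fun i => v i.succ

/-- The vector with given first coordinate and last coordinates. -/
noncomputable def eucCons (t : ℝ) (x : Euc n) : Euc (n + 1) := WithLp.toLp 2 (Fin.cons t x)

@[simp] theorem eucCons_zero (t : ℝ) (x : Euc n) : eucCons t x 0 = t := rfl

@[simp] theorem eucTail_eucCons (t : ℝ) (x : Euc n) : eucTail (eucCons t x) = x := rfl

@[simp] theorem eucCons_eucTail (v : Euc (n + 1)) : eucCons (v 0) (eucTail v) = v := by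
  ext i
  refine Fin.cases rfl (fun j => rfl) i

theorem contDiff_eucTail : ContDiff ℝ ∞ (eucTail (n := n)) :=
  (contDiff_euclidean (𝕜 := ℝ)).2 fun i => by unfold eucTail; fun_prop

theorem contDiff_eucCons : ContDiff ℝ ∞ fun v : ℝ × Euc n => eucCons v.1 v.2 :=
  (contDiff_euclidean (𝕜 := ℝ)).2 fun i => by
    refine Fin.cases ?_ (fun j => ?_) i
    · exact contDiff_fst
    · change ContDiff ℝ ∞ fun v : ℝ × Euc n => v.2 j
      fun_prop

theorem contDiff_zero_coord : ContDiff ℝ ∞ fun v : Euc (n + 1) => v 0 := by fun_prop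

/-- The action of a permutation on the last coordinates. -/
noncomputable def eucTailPerm (n : ℕ) : Equiv.Perm (Euc n) →* Equiv.Perm (Euc (n + 1)) where
  toFun γ :=
    { toFun := fun v => eucCons (v 0) (γ (eucTail v))
      invFun := fun v => eucCons (v 0) (γ⁻¹ (eucTail v))
      left_inv := fun v => by simp
      right_inv := fun v => by simp }
  map_one' := by ext1 v; exact eucCons_eucTail v
  map_mul' γ γ' := by ext1 v; rfl

theorem eucTailPerm_apply (γ : Equiv.Perm (Euc n)) (v : Euc (n + 1)) :
    eucTailPerm n γ v = eucCons (v 0) (γ (eucTail v)) := rfl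

/-- The domain of a chart at the boundary of a cut. -/
def collarDom (c : OrbifoldChart (univ : Set (Euc n)) Y) (ε : ℝ) : Set (Euc (n + 1)) :=
  {v | eucTail v ∈ c.dom ∧ 0 ≤ v 0 ∧ v 0 < ε}

/-- A section of the quotient map of a cut near the boundary. -/
noncomputable def collarSection (c : OrbifoldChart (univ : Set (Euc n)) Y) (φ : Fin k → Y → ℝ)
    (α : Fin k → ℝ) (v : Euc (n + 1)) : Euc n × ℝ × (Fin k → ℂ) :=
  (eucTail v, 1 + v 0, fun i => ((√(α i - (1 + v 0) * φ i (c.proj (eucTail v))) : ℝ) : ℂ))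

/-- The projection of a chart at the boundary of a cut. -/
noncomputable def collarProj (c : OrbifoldChart (univ : Set (Euc n)) Y) (φ : Fin k → Y → ℝ)
    (α : Fin k → ℝ) (p : Y × ℝ × (Fin k → ℂ) → W) (v : Euc (n + 1)) : W :=
  p (c.proj (collarSection c φ α v).1, (collarSection c φ α v).2)

theorem IsCutData.le_one (hφ : IsCutData (r := r) B U φ α) (i : Fin k) (m : Y) : φ i m ≤ 1 := by
  rw [← hφ.sum_eq_one m]
  exact Finset.single_le_sum (fun j _ => hφ.nonneg j m) (Finset.mem_univ i)

/-- Since φ_i ≤ 1 and α_i ≥ 1 + ε, no z_i can vanish on the collar; this is why (S¹)ᵏ acts freely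
there. -/
theorem IsCutData.collar_pos (hφ : IsCutData (r := r) B U φ α) {ε : ℝ} (hε : ∀ i, 1 + ε ≤ α i)
    (i : Fin k) {t : ℝ} (h0 : 0 ≤ t) (ht : t < ε) (m : Y) : 0 < α i - (1 + t) * φ i m := by
  have h1 := hφ.le_one i m
  have h2 := hφ.nonneg i m
  have h3 := hε i
  nlinarith

theorem IsCutData.collarSection_mem (hφ : IsCutData (r := r) B U φ α) {ε : ℝ}
    (hε : ∀ i, 1 + ε ≤ α i) {c : OrbifoldChart (univ : Set (Euc n)) Y} {v : Euc (n + 1)}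
    (hv : v ∈ collarDom c ε) : collarSection c φ α v ∈ cutLevelChart c φ α := by
  refine ⟨hv.1, ?_, fun i => ?_⟩
  · change (1 : ℝ) ≤ 1 + v 0
    linarith [hv.2.1]
  · have h1 := hφ.collar_pos hε i hv.2.1 hv.2.2 (c.proj (eucTail v))
    change α i - (1 + v 0) * φ i (c.proj (eucTail v)) - ‖((√(α i - (1 + v 0) * φ i (c.proj (eucTail v))) : ℝ) : ℂ)‖ ^ 2 = 0
    rw [Complex.norm_real, Real.norm_of_nonneg (Real.sqrt_nonneg _), Real.sq_sqrt h1.le, sub_self]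

/-- Used to see that positive real coordinates leave no freedom to rotate, so that the collar
section determines l uniquely. -/
theorem Circle.eq_one_of_mul_ofReal {l : Circle} {a b : ℝ} (ha : 0 < a) (hb : 0 < b)
    (h : (l : ℂ) * a = b) : l = 1 := by
  have h1 : a = b := by
    have := congrArg norm h
    rwa [norm_mul, Circle.norm_coe, one_mul, Complex.norm_real, Complex.norm_real,
      Real.norm_of_nonneg ha.le, Real.norm_of_nonneg hb.le] at this
  ext
  have ha' : (a : ℂ) ≠ 0 := by exact_mod_cast ha.ne'
  rw [Circle.coe_one]
  refine mul_right_cancel₀ ha' ?_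
  rw [h, h1, one_mul]

/-- Rotating z_i by minus its argument makes it positive, at the cost of moving m by the local flow
with the same angles. Smoothness holds because z_i stays in the slit plane near the section. -/
theorem IsCutData.exists_collar_lift (hp : IsCutMap σ φ α p) (hB : SmoothAction (r := r) B)
    (hφ : IsCutData (r := r) B U φ α) {ε : ℝ} (hε : ∀ i, 1 + ε ≤ α i)
    {c : OrbifoldChart (univ : Set (Euc n)) Y} (hc : c ∈ B.charts) {y : Euc (n + 1)}
    (hy : y ∈ collarDom c ε) : ∃ g, IsCutLift φ α p c (collarDom c ε) (collarProj c φ α p)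
      (collarSection c φ α y) y g (collarSection c φ α) := by
  choose ξ hξ using fun i => exists_eq_torusExp (σ i)
  obtain ⟨f, hf⟩ := hB.exists_isLocalFlow isModelSet_univ hc hy.1
  have hfs := hf.smooth
  have hfm := hf.maps
  have hfl := hf.lifts
  have hf0 := hf.zero
  rw [univ_prod_univ, nhdsWithin_univ] at hfs hfm hfl
  rw [nhdsWithin_univ] at hf0
  set w := collarSection c φ α y with hw
  have hwz : ∀ i, w.2.2 i = ((√(α i - (1 + y 0) * φ i (c.proj (eucTail y))) : ℝ) : ℂ) := fun i => rfl
  have hpos := fun i => hφ.collar_pos hε i hy.2.1 hy.2.2 (c.proj (eucTail y))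
  have hslit : ∀ i, w.2.2 i ∈ Complex.slitPlane := fun i => by
    rw [hwz, Complex.ofReal_mem_slitPlane]; exact Real.sqrt_pos.2 (hpos i)
  have harg0 : ∀ i, Complex.arg (w.2.2 i) = 0 := fun i => by
    rw [hwz]; exact Complex.arg_ofReal_of_nonneg (Real.sqrt_nonneg _)
  -- the rotation making the last coordinates positive
  set θ : Euc n × ℝ × (Fin k → ℂ) → Fin r → ℝ :=
    fun v => ∑ i, (-Complex.arg (v.2.2 i)) • ξ i with hθ
  have hθs : ∀ᶠ v in 𝓝 w, ContDiffAt ℝ ∞ θ v := by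
    have h1 : ∀ᶠ v in 𝓝 w, ∀ i, v.2.2 i ∈ Complex.slitPlane := eventually_all.2 fun i => by
      have : Continuous fun v : Euc n × ℝ × (Fin k → ℂ) => v.2.2 i := by fun_prop
      exact this.continuousAt.eventually (Complex.isOpen_slitPlane.mem_nhds (hslit i))
    filter_upwards [h1] with v hv
    refine ContDiffAt.sum fun i _ => ?_
    have h2 : ContDiffAt ℝ ∞ Complex.log (v.2.2 i) := (Complex.contDiffAt_log (hv i)).restrict_scalars ℝ
    have h3 : ContDiffAt ℝ ∞ (fun v : Euc n × ℝ × (Fin k → ℂ) => Complex.imCLM (Complex.log (v.2.2 i))) v :=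
      Complex.imCLM.contDiff.contDiffAt.comp v
        (h2.comp v (g := Complex.log) (f := fun v : Euc n × ℝ × (Fin k → ℂ) => v.2.2 i) (by fun_prop))
    have h4 : ContDiffAt ℝ ∞ (fun v : Euc n × ℝ × (Fin k → ℂ) => Complex.arg (v.2.2 i)) v := by
      simpa only [Complex.imCLM_apply, Complex.log_im] using h3
    exact h4.neg.smul (contDiffAt_const (c := ξ i))
  have hθw : θ w = 0 := by simp [hθ, harg0]
  have hin : Tendsto (fun v => (θ v, v.1)) (𝓝 w) (𝓝 (0, eucTail y)) := by
    refine Tendsto.prodMk_nhds ?_ (continuous_fst.tendsto w)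
    rw [← hθw]; exact hθs.self_of_nhds.continuousAt
  set g : Euc n × ℝ × (Fin k → ℂ) → Euc (n + 1) := fun v => eucCons (v.2.1 - 1) (f (θ v, v.1)) with hg
  have hgs : ∀ᶠ v in 𝓝 w, ContDiffAt ℝ ∞ g v := by
    filter_upwards [hθs, hin.eventually hfs] with v h1 h2
    rw [contDiffWithinAt_univ] at h2
    refine contDiff_eucCons.contDiffAt.comp v (ContDiffAt.prodMk (by fun_prop) ?_)
    exact h2.comp v (h1.prodMk contDiffAt_fst)
  have hst : ContinuousWithinAt (collarSection c φ α) (halfSpace n) y ∧ ∀ᶠ v in 𝓝[halfSpace n] y,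
      ContDiffWithinAt ℝ ∞ (collarSection c φ α) (halfSpace n) v := by
    have h1 : ∀ᶠ v in 𝓝 y, ContDiffAt ℝ ∞ (collarSection c φ α) v := by
      have ht : Tendsto (eucTail (n := n)) (𝓝 y) (𝓝 (eucTail y)) := contDiff_eucTail.continuous.tendsto y
      have h2 : ∀ i, ContDiffAt ℝ ∞ (fun v : Euc (n + 1) => α i - (1 + v 0) * φ i (c.proj (eucTail v))) y :=
        fun i => contDiffAt_const.sub ((contDiffAt_const.add contDiff_zero_coord.contDiffAt).mul
          (((hφ.smooth i).contDiffAt hc hy.1).comp y contDiff_eucTail.contDiffAt))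
      have h3 : ∀ᶠ v in 𝓝 y, ∀ i, 0 < α i - (1 + v 0) * φ i (c.proj (eucTail v)) :=
        eventually_all.2 fun i => (h2 i).continuousAt.eventually (lt_mem_nhds (hpos i))
      filter_upwards [ht.eventually (c.isOpen_dom.mem_nhds hy.1), h3] with v h4 h5
      refine contDiff_eucTail.contDiffAt.prodMk
        ((contDiffAt_const.add contDiff_zero_coord.contDiffAt).prodMk (contDiffAt_pi.2 fun i => ?_))
      have h6 : ContDiffAt ℝ ∞ (fun v : Euc (n + 1) => √(α i - (1 + v 0) * φ i (c.proj (eucTail v)))) v :=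
        ContDiffAt.sqrt (contDiffAt_const.sub
          ((contDiffAt_const.add contDiff_zero_coord.contDiffAt).mul
            (((hφ.smooth i).contDiffAt hc h4).comp v contDiff_eucTail.contDiffAt))) (h5 i).ne'
      exact Complex.ofRealCLM.contDiff.contDiffAt.comp v h6
    exact ⟨h1.self_of_nhds.continuousAt.continuousWithinAt,
      mem_nhdsWithin_of_mem_nhds (h1.mono fun v hv => hv.contDiffWithinAt)⟩
  have hdom : ∀ᶠ v in 𝓝[halfSpace n] y, v ∈ collarDom c ε := by
    have h1 : ∀ᶠ v in 𝓝 y, eucTail v ∈ c.dom := contDiff_eucTail.continuous.continuousAt.eventually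
      (c.isOpen_dom.mem_nhds hy.1)
    have h2 : ∀ᶠ v : Euc (n + 1) in 𝓝 y, v 0 < ε :=
      contDiff_zero_coord.continuous.continuousAt.eventually (gt_mem_nhds hy.2.2)
    filter_upwards [mem_nhdsWithin_of_mem_nhds h1, mem_nhdsWithin_of_mem_nhds h2,
      self_mem_nhdsWithin] with v k1 k2 k3 using ⟨k1, k3, k2⟩
  have hgy : g w = y := by
    rw [hg]
    change eucCons (1 + y 0 - 1) (f (θ w, eucTail y)) = y
    rw [hθw, hf0.self_of_nhds, add_sub_cancel_left, eucCons_eucTail]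
  refine ⟨g, hgy, rfl, ?_, ?_, hst.2, ?_⟩
  · exact mem_nhdsWithin_of_mem_nhds (hgs.mono fun v hv => hv.contDiffWithinAt)
  · have h1 : ∀ᶠ v in 𝓝 w, v.2.1 < 1 + ε := by
      have : Continuous fun v : Euc n × ℝ × (Fin k → ℂ) => v.2.1 := by fun_prop
      refine this.continuousAt.eventually (gt_mem_nhds ?_)
      change 1 + y 0 < 1 + ε
      linarith [hy.2.2]
    filter_upwards [self_mem_nhdsWithin, mem_nhdsWithin_of_mem_nhds h1,
      mem_nhdsWithin_of_mem_nhds (hin.eventually hfm),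
      mem_nhdsWithin_of_mem_nhds (hin.eventually hfl)] with v k1 k2 k3 k4
    have k5 : 1 ≤ v.2.1 := k1.2.1
    have hgd : g v ∈ collarDom c ε := by
      refine ⟨k3, ?_, ?_⟩
      · change 0 ≤ v.2.1 - 1; linarith
      · change v.2.1 - 1 < ε; linarith
    refine ⟨hgd, ?_⟩
    have k6 : c.proj (f (θ v, v.1)) = torusExp (θ v) • c.proj v.1 := k4.trans (by rw [one_smul])
    have k7 : (c.proj (collarSection c φ α (g v)).1, (collarSection c φ α (g v)).2) =
        cutRotate σ (fun i => Circle.exp (-Complex.arg (v.2.2 i))) (c.proj v.1, v.2) := by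
      rw [cutRotate_exp hξ]
      refine Prod.ext k6 (Prod.ext ?_ (funext fun i => ?_))
      · change 1 + (v.2.1 - 1) = v.2.1
        ring
      · change ((√(α i - (1 + (v.2.1 - 1)) * φ i (c.proj (f (θ v, v.1)))) : ℝ) : ℂ) =
          (Circle.exp (-Complex.arg (v.2.2 i)) : ℂ) * v.2.2 i
        rw [k6, hφ.invariant, add_sub_cancel]
        have k8 : α i - v.2.1 * φ i (c.proj v.1) = ‖v.2.2 i‖ ^ 2 := by
          linarith [k1.2.2 i]
        rw [k8, Real.sqrt_sq (norm_nonneg _), Circle.coe_exp]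
        conv_rhs => rw [← Complex.norm_mul_exp_arg_mul_I (v.2.2 i)]
        rw [mul_left_comm, ← Complex.exp_add]
        simp
    rw [collarProj, k7]
    exact ((hp.fibre _ k1.2 _ ((cutRotate_mem_cutLevel hφ.invariant).2 k1.2)).2 ⟨_, rfl⟩).symm
  · have ht : Tendsto (eucTail (n := n)) (𝓝[halfSpace n] y) (𝓝 (eucTail y)) :=
      (contDiff_eucTail.continuous.tendsto y).mono_left nhdsWithin_le_nhds
    filter_upwards [hdom, ht.eventually hf0] with v h1 h2
    refine ⟨hφ.collarSection_mem hε h1, ?_⟩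
    have h3 : θ (collarSection c φ α v) = 0 := by
      refine Finset.sum_eq_zero fun i _ => ?_
      change (-Complex.arg ((√(α i - (1 + v 0) * φ i (c.proj (eucTail v))) : ℝ) : ℂ)) • ξ i = 0
      rw [Complex.arg_ofReal_of_nonneg (Real.sqrt_nonneg _), neg_zero, zero_smul]
    change eucCons (1 + v 0 - 1) (f (θ (collarSection c φ α v), eucTail v)) = v
    rw [h3, h2, add_sub_cancel_left, eucCons_eucTail]

/-- Two points of the section in one orbit differ by the trivial rotation, so the only
identifications left are those of the chart group of c, acting on the last coordinates. -/
theorem IsCutData.exists_collar_chart (hp : IsCutMap σ φ α p) (hB : SmoothAction (r := r) B)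
    (hφ : IsCutData (r := r) B U φ α) {ε : ℝ} (hε0 : 0 < ε) (hε : ∀ i, 1 + ε ≤ α i)
    {c : OrbifoldChart (univ : Set (Euc n)) Y} (hc : c ∈ B.charts) :
    ∃ κ : OrbifoldChart (halfSpace n) W, κ.dom = collarDom c ε ∧ κ.proj = collarProj c φ α p ∧
      IsCutChart B φ α p κ := by
  have hfin := c.finite_group
  refine exists_isCutChart hp hB hφ ?_ ?_ (c.group.map (eucTailPerm n)) ?_ ?_ ?_ ?_ ?_ fun y hy =>
    ⟨c, hc, _, hφ.collarSection_mem hε hy, rfl, ?_⟩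
  · refine ⟨{v | eucTail v ∈ c.dom ∧ v 0 < ε}, ?_, ?_⟩
    · exact (c.isOpen_dom.preimage contDiff_eucTail.continuous).inter
        (isOpen_lt contDiff_zero_coord.continuous continuous_const)
    · ext v
      simp only [collarDom, halfSpace, mem_ofPred_eq, mem_inter_iff]
      tauto
  · have h1 : collarDom c ε = (fun v : ℝ × Euc n => eucCons v.1 v.2) '' (Ico 0 ε ×ˢ c.dom) := by
      ext v
      constructor
      · exact fun hv => ⟨(v 0, eucTail v), ⟨⟨hv.2.1, hv.2.2⟩, hv.1⟩, eucCons_eucTail v⟩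
      · rintro ⟨⟨t, x⟩, ⟨ht, hx⟩, rfl⟩
        exact ⟨hx, ht.1, ht.2⟩
    rw [h1]
    exact ((isConnected_Ico hε0).prod c.isConnected_dom).image _
      contDiff_eucCons.continuous.continuousOn
  · exact ((Set.toFinite (c.group : Set (Equiv.Perm (Euc n)))).image (eucTailPerm n)).to_subtype
  · rintro _ ⟨γ, hγ, rfl⟩ v hv
    exact ⟨c.mapsTo_group γ hγ hv.1, hv.2⟩
  · rintro _ ⟨γ, hγ, rfl⟩
    refine contDiff_eucCons.comp_contDiffOn (contDiff_zero_coord.contDiffOn.prodMk ?_)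
    exact (c.smooth_group γ hγ).comp contDiff_eucTail.contDiffOn fun v hv => hv.1
  · rintro _ ⟨γ, hγ, rfl⟩ h
    rw [c.effective_group γ hγ fun x hx => ?_, map_one]
    have := h (eucCons 0 x) ⟨hx, le_rfl, hε0⟩
    exact congrArg eucTail this
  · intro v hv v' hv'
    rw [collarProj, collarProj, hp.fibre _ (hφ.collarSection_mem hε hv).2 _
      (hφ.collarSection_mem hε hv').2]
    constructor
    · rintro ⟨l, hl⟩
      have hl1 : l = 1 := by
        funext i
        have := congrFun (congrArg (fun w => w.2.2) hl) i
        exact Circle.eq_one_of_mul_ofReal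
          (Real.sqrt_pos.2 (hφ.collar_pos hε i hv.2.1 hv.2.2 _))
          (Real.sqrt_pos.2 (hφ.collar_pos hε i hv'.2.1 hv'.2.2 _)) this
      rw [hl1, cutRotate_one] at hl
      have h1 : c.proj (eucTail v) = c.proj (eucTail v') := congrArg Prod.fst hl
      have h2 : 1 + v 0 = 1 + v' 0 := congrArg (fun w => w.2.1) hl
      obtain ⟨γ, hγ, h3⟩ := (c.proj_eq_iff _ hv.1 _ hv'.1).1 h1
      refine ⟨_, ⟨γ, hγ, rfl⟩, ?_⟩
      rw [eucTailPerm_apply, h3, add_left_cancel h2, eucCons_eucTail]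
    · rintro ⟨_, ⟨γ, hγ, rfl⟩, rfl⟩
      refine ⟨1, ?_⟩
      rw [cutRotate_one]
      have h1 : c.proj (γ (eucTail v)) = c.proj (eucTail v) := c.proj_group hγ hv.1
      simp only [collarSection, eucTailPerm_apply, eucCons_zero, eucTail_eucCons, h1]
  · obtain ⟨g, hg⟩ := hφ.exists_collar_lift hp hB hε hc hy
    exact ⟨g, _, hg⟩

end CutCharts

/-! ## Charts in the interior of a cut -/

section InteriorCharts

variable {n r k : ℕ} {Y W : Type*} [TopologicalSpace Y] [TopologicalSpace W]
  [MulAction (Torus r) Y] [MulAction (Torus r) W] {σ : Fin k → Circle →ₜ* Torus r}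
  {φ : Fin k → Y → ℝ} {α : Fin k → ℝ} {p : Y × ℝ × (Fin k → ℂ) → W} {B : Orbifold n Y}
  {U : Fin k → Set Y} {c : OrbifoldChart (univ : Set (Euc n)) Y}

/-- The function defining the zero level of a cut, in a chart. -/
noncomputable def cutFun (c : OrbifoldChart (univ : Set (Euc n)) Y) (φ : Fin k → Y → ℝ)
    (α : Fin k → ℝ) (v : Euc n × ℝ × (Fin k → ℂ)) (i : Fin k) : ℝ :=
  α i - v.2.1 * φ i (c.proj v.1) - ‖v.2.2 i‖ ^ 2

omit [MulAction (Torus r) Y] in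
theorem contDiffAt_cutFun (hφ : ∀ i, B.SmoothFunction (φ i)) (hc : c ∈ B.charts)
    {v : Euc n × ℝ × (Fin k → ℂ)} (hv : v.1 ∈ c.dom) : ContDiffAt ℝ ∞ (cutFun c φ α) v := by
  refine contDiffAt_pi.2 fun i => ?_
  have h1 : ContDiffAt ℝ ∞ (fun v : Euc n × ℝ × (Fin k → ℂ) => φ i (c.proj v.1)) v :=
    ((hφ i).contDiffAt hc hv).comp v contDiffAt_fst
  have h2 : ContDiffAt ℝ ∞ (fun v : Euc n × ℝ × (Fin k → ℂ) => ‖v.2.2 i‖ ^ 2) v :=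
    ContDiffAt.norm_sq ℝ (by fun_prop)
  exact (contDiffAt_const.sub (contDiffAt_snd.fst.mul h1)).sub h2

/-- Components with z_i ≠ 0 are reached by scaling z_i. Where z_i = 0 the equation reads t φ_i = α_i
with α_i > 1, which places the point in the support of φ_i, and regularity of the value applies. -/
theorem IsCutData.surjective_fderiv_cutFun (hφ : IsCutData (r := r) B U φ α) (hc : c ∈ B.charts)
    {w : Euc n × ℝ × (Fin k → ℂ)} (hw : w ∈ cutLevelChart c φ α) :
    Function.Surjective (fderiv ℝ (cutFun c φ α) w) := by
  classical
  have hd : ∀ i, DifferentiableAt ℝ (fun v : Euc n × ℝ => v.2 * φ i (c.proj v.1)) (w.1, w.2.1) := by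
    intro i
    have h1 : DifferentiableAt ℝ (fun v : Euc n × ℝ => φ i (c.proj v.1)) (w.1, w.2.1) :=
      DifferentiableAt.comp (g := fun u => φ i (c.proj u)) (f := Prod.fst) (w.1, w.2.1)
        (((hφ.smooth i).contDiffAt hc hw.1).differentiableAt (by simp)) differentiableAt_fst
    exact differentiableAt_snd.mul h1
  set a : Fin k → (Euc n × ℝ →L[ℝ] ℝ) :=
    fun i => fderiv ℝ (fun v : Euc n × ℝ => v.2 * φ i (c.proj v.1)) (w.1, w.2.1) with ha
  set J : Finset (Fin k) := Finset.univ.filter fun i => w.2.2 i = 0 with hJ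
  have hJe : ∀ i ∈ J, w.2.1 * φ i (c.proj w.1) = α i := by
    intro i hi
    have h1 := hw.2.2 i
    have h2 : w.2.2 i = 0 := (Finset.mem_filter.1 hi).2
    change α i - w.2.1 * φ i (c.proj w.1) - ‖w.2.2 i‖ ^ 2 = 0 at h1
    rw [h2, norm_zero] at h1
    linarith
  have hreg := hφ.regular J c hc w.1 hw.1 w.2.1 hw.2.1 (fun i hi => ?_) hJe
  · rw [surjective_fderiv_pi_iff (F := fun i (v : Euc n × ℝ) => v.2 * φ i (c.proj v.1)) hd] at hreg
    intro b
    obtain ⟨u, hu⟩ := hreg fun i => -b i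
    -- Along c z_i the function -|z_i|² has derivative -2c|z_i|², and the coefficient makes this b_i
    -- + a_i u, which cancels the contribution of u. For z_i = 0 the division by zero is harmless,
    -- since the coefficient multiplies z_i.
    refine ⟨(u.1, u.2, fun i => ((-(b i + a i u) / (2 * ‖w.2.2 i‖ ^ 2) : ℝ) : ℂ) * w.2.2 i), ?_⟩
    have hdχ : ∀ i, HasFDerivAt (fun v => cutFun c φ α v i)
        (0 - (a i).comp ((ContinuousLinearMap.fst ℝ _ _).prod
          ((ContinuousLinearMap.fst ℝ _ _).comp (ContinuousLinearMap.snd ℝ _ _))) -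
          2 • (innerSL ℝ (w.2.2 i)).comp ((ContinuousLinearMap.proj i).comp
            ((ContinuousLinearMap.snd ℝ _ _).comp (ContinuousLinearMap.snd ℝ _ _)))) w := by
      intro i
      have h1 : HasFDerivAt (fun v : Euc n × ℝ × (Fin k → ℂ) => v.2.1 * φ i (c.proj v.1)) _ w :=
        HasFDerivAt.comp (g := fun v : Euc n × ℝ => v.2 * φ i (c.proj v.1))
          (f := fun v : Euc n × ℝ × (Fin k → ℂ) => (v.1, v.2.1)) w (hd i).hasFDerivAt
          ((ContinuousLinearMap.fst ℝ (Euc n) (ℝ × (Fin k → ℂ))).prod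
            ((ContinuousLinearMap.fst ℝ ℝ (Fin k → ℂ)).comp
              (ContinuousLinearMap.snd ℝ (Euc n) (ℝ × (Fin k → ℂ))))).hasFDerivAt
      have h2 : HasFDerivAt (fun v : Euc n × ℝ × (Fin k → ℂ) => v.2.2 i) _ w :=
        ((ContinuousLinearMap.proj i).comp
            ((ContinuousLinearMap.snd ℝ _ _).comp (ContinuousLinearMap.snd ℝ _ _)) :
            (Euc n × ℝ × (Fin k → ℂ)) →L[ℝ] ℂ).hasFDerivAt
      exact ((hasFDerivAt_const (α i) w).sub h1).sub h2.norm_sq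
    rw [(hasFDerivAt_pi.2 hdχ).fderiv]
    funext i
    change 0 - a i u - 2 • inner ℝ (w.2.2 i)
      (((-(b i + a i u) / (2 * ‖w.2.2 i‖ ^ 2) : ℝ) : ℂ) * w.2.2 i) = b i
    by_cases hi : w.2.2 i = 0
    · have h1 : a i u = -b i := hu i (Finset.mem_filter.2 ⟨Finset.mem_univ _, hi⟩)
      rw [hi, inner_zero_left, h1]; simp
    · have h1 : ‖w.2.2 i‖ ≠ 0 := norm_ne_zero_iff.2 hi
      rw [← Complex.real_smul, inner_smul_right, real_inner_self_eq_norm_sq]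
      field_simp
      ring
  · refine hφ.support_subset i (subset_tsupport _ fun h0 => ?_)
    have h1 := hJe i hi
    have h2 := hφ.one_lt i
    rw [h0, mul_zero] at h1
    linarith

/-- A vector generating a locally free group and with vanishing velocity at a point is zero. -/
theorem IsLocalFlow.eq_zero_of_locallyFree {x : Euc n} {f : (Fin r → ℝ) × Euc n → Euc n}
    (hf : IsLocalFlow c x f) {S : Subgroup (Torus r)}
    (hS : Finite (S ⊓ MulAction.stabilizer (Torus r) (c.proj x) : Subgroup (Torus r)))
    {η : Fin r → ℝ} (hη : ∀ t : ℝ, torusExp (t • η) ∈ S) (h0 : fderiv ℝ f (0, x) (η, 0) = 0) :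
    η = 0 := by
  have hfs := hf.smooth
  have hfl := hf.lifts
  have hfa := hf.add
  have hf0 := hf.zero
  simp only [univ_prod_univ, nhdsWithin_univ, contDiffWithinAt_univ] at hfs hfl hfa hf0
  have hcurve : Tendsto (fun s : ℝ => (s • η, x)) (𝓝 0) (𝓝 (0, x)) := by
    have : Continuous fun s : ℝ => (s • η, x) := by fun_prop
    simpa using this.tendsto 0
  have hcurve' : Tendsto (fun s : ℝ => (s • η, (0 : Fin r → ℝ), x)) (𝓝 0) (𝓝 (0, 0, x)) := by
    have : Continuous fun s : ℝ => (s • η, (0 : Fin r → ℝ), x) := by fun_prop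
    simpa using this.tendsto 0
  obtain ⟨ε, hε, hP⟩ := Metric.eventually_nhds_iff.1 ((hcurve.eventually hfs).and
    ((hcurve.eventually hfl).and (hcurve'.eventually hfa.eventually_nhds)))
  have hder0 : HasDerivAt (fun t : ℝ => f (t • η, x)) 0 0 := by
    have h1 : HasDerivAt (fun t : ℝ => (t • η, x)) (η, (0 : Euc n)) 0 := by
      have := (hasDerivAt_id (0 : ℝ)).smul_const η
      rw [one_smul] at this
      exact this.prodMk (hasDerivAt_const _ _)
    have h2 : HasFDerivAt f (fderiv ℝ f (0, x)) ((fun t : ℝ => (t • η, x)) 0) := by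
      simpa using (hfs.self_of_nhds.differentiableAt (by simp)).hasFDerivAt
    have := h2.comp_hasDerivAt (0 : ℝ) h1
    rwa [h0] at this
  have hx0 : f ((0 : ℝ) • η, x) = x := by rw [zero_smul]; exact hf0.self_of_nhds
  -- Additivity transports the zero velocity at time 0 to all small times, so the orbit is constant
  -- and a one-parameter group fixes the point for a while.
  have hder : ∀ s : ℝ, |s| < ε → HasDerivAt (fun s : ℝ => f (s • η, x)) 0 s := by
    intro s hs
    obtain ⟨h1, -, h2⟩ := hP (y := s) (by simpa using hs)
    have h3 : HasFDerivAt (fun u => f (s • η, u))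
        ((fderiv ℝ f (s • η, x)).comp (ContinuousLinearMap.inr ℝ _ _)) (f ((0 : ℝ) • η, x)) := by
      rw [hx0]
      exact (h1.differentiableAt (by simp)).hasFDerivAt.comp x (hasFDerivAt_prodMk_right (s • η) x)
    have h4 := h3.comp_hasDerivAt (0 : ℝ) hder0
    rw [map_zero] at h4
    have h5 : Tendsto (fun t : ℝ => (s • η, t • η, x)) (𝓝 0) (𝓝 (s • η, 0, x)) := by
      have : Continuous fun t : ℝ => (s • η, t • η, x) := by fun_prop
      simpa using this.tendsto 0
    have h6 : HasDerivAt (fun t : ℝ => f ((s + t) • η, x)) 0 0 := by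
      refine h4.congr_of_eventuallyEq ?_
      filter_upwards [h5.eventually h2] with t ht
      rw [add_smul]; exact ht.symm
    have := HasDerivAt.comp_sub_const (f := fun t : ℝ => f ((s + t) • η, x)) s s (by rwa [sub_self])
    simpa using this
  refine _root_.eq_zero_of_locallyFree hS hη (half_pos hε) fun t ht => ?_
  have hconst : f (t • η, x) = x := by
    have := norm_image_sub_le_of_norm_deriv_le_segment' (f := fun s : ℝ => f (s • η, x))
      (f' := fun _ => 0) (C := 0) (a := 0) (b := t)
      (fun s hs => (hder s (by rw [abs_of_nonneg hs.1]; linarith [hs.2, ht.2])).hasDerivWithinAt)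
      (fun s _ => by simp) t (right_mem_Icc.2 ht.1.le)
    rw [zero_mul, norm_le_zero_iff, sub_eq_zero] at this
    exact this.trans hx0
  have h1 := (hP (y := t) (by
    rw [Real.dist_eq, sub_zero, abs_of_pos ht.1]; linarith [ht.2])).2.1
  rw [one_smul] at h1
  rw [← h1, hconst]

/-- The local action of `ℝᵏ` on a chart of the product which lifts the action of `(S¹)ᵏ`. -/
noncomputable def cutFlow (f : (Fin r → ℝ) × Euc n → Euc n) (ξ : Fin k → Fin r → ℝ)
    (v : (Fin k → ℝ) × (Euc n × ℝ × (Fin k → ℂ))) : Euc n × ℝ × (Fin k → ℂ) :=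
  (f (∑ i, v.1 i • ξ i, v.2.1), v.2.2.1, fun i => (Circle.exp (v.1 i) : ℂ) * v.2.2.2 i)

/-- A slice for the action of `(S¹)ᵏ` on the zero level of a cut. -/
theorem IsCutData.exists_cut_slice (hU : IsGoodCover U σ) (hφ : IsCutData (r := r) B U φ α) {ξ : Fin k → Fin r → ℝ}
    (hξ : ∀ i θ, σ i (Circle.exp θ) = torusExp (θ • ξ i)) (hc : c ∈ B.charts)
    {w : Euc n × ℝ × (Fin k → ℂ)} (hw : w ∈ cutLevelChart c φ α) (ht : 1 < w.2.1)
    {f : (Fin r → ℝ) × Euc n → Euc n} (hf : IsLocalFlow c w.1 f) :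
    ∃ (s : Euc (n + 1) → Euc n × ℝ × (Fin k → ℂ)) (ρ : Euc n × ℝ × (Fin k → ℂ) → Euc (n + 1))
      (Ξ : Euc n × ℝ × (Fin k → ℂ) → Fin k → ℝ), s 0 = w ∧ ρ w = 0 ∧
      (∀ᶠ y in 𝓝 0, ContDiffAt ℝ ∞ s y) ∧ (∀ᶠ v in 𝓝 w, ContDiffAt ℝ ∞ ρ v) ∧
      Tendsto Ξ (𝓝 w) (𝓝 0) ∧ (∀ᶠ y in 𝓝 0, s y ∈ cutLevelChart c φ α ∧ ρ (s y) = y) ∧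
      (∀ᶠ v in 𝓝[cutLevelChart c φ α] w, v = cutFlow f ξ (Ξ v, s (ρ v))) ∧
      ∀ᶠ v in 𝓝 ((0 : Fin k → ℝ), w), ρ (cutFlow f ξ v) = ρ v.2 := by
  classical
  have hfs := hf.smooth
  have hfl := hf.lifts
  have hfa := hf.add
  have hf0 := hf.zero
  simp only [univ_prod_univ, nhdsWithin_univ, contDiffWithinAt_univ] at hfs hfl hfa hf0
  have hin : Tendsto (fun v : (Fin k → ℝ) × (Euc n × ℝ × (Fin k → ℂ)) => (∑ i, v.1 i • ξ i, v.2.1))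
      (𝓝 (0, w)) (𝓝 (0, w.1)) := by
    have : Continuous fun v : (Fin k → ℝ) × (Euc n × ℝ × (Fin k → ℂ)) =>
      (∑ i, v.1 i • ξ i, v.2.1) := by fun_prop
    simpa using this.tendsto (0, w)
  have hGs : ∀ᶠ v in 𝓝 ((0 : Fin k → ℝ), w), ContDiffAt ℝ ∞ (cutFlow f ξ) v := by
    filter_upwards [hin.eventually hfs] with v hv
    refine (hv.comp v ?_).prodMk (contDiffAt_snd.snd.fst.prodMk (contDiffAt_pi.2 fun i => ?_))
    · fun_prop
    · simp only [Circle.coe_exp]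
      have h1 : ContDiffAt ℝ ∞ (fun v : (Fin k → ℝ) × (Euc n × ℝ × (Fin k → ℂ)) =>
          Complex.ofRealCLM (v.1 i) * Complex.I) v := by fun_prop
      exact h1.cexp.mul (by fun_prop)
  have hG0 : ∀ᶠ v in 𝓝 w, cutFlow f ξ (0, v) = v := by
    filter_upwards [continuousAt_fst.eventually hf0] with v hv
    refine Prod.ext ?_ (Prod.ext rfl (funext fun i => ?_))
    · simpa [cutFlow] using hv
    · simp [cutFlow]
  have hGd : HasFDerivAt (cutFlow f ξ) (fderiv ℝ (cutFlow f ξ) (0, w)) (0, w) :=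
    (hGs.self_of_nhds.differentiableAt (by simp)).hasFDerivAt
  have hslice := exists_slice (m := n + 1) (w := w)
    (χ := cutFun c φ α) (G := cutFlow f ξ)
    ((continuousAt_fst.eventually (c.isOpen_dom.mem_nhds hw.1)).mono fun v hv =>
      contDiffAt_cutFun hφ.smooth hc hv) (funext hw.2.2) (hφ.surjective_fderiv_cutFun hc hw)
    hGs hG0 ?_ ?_ ?_ ?_
  · obtain ⟨s, ρ, Ξ, h1, h2, h3, h4, h5, h6, h7, h8⟩ := hslice
    have hst : Tendsto s (𝓝 0) (𝓝 w) := h1 ▸ h3.self_of_nhds.continuousAt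
    have hnear : ∀ᶠ v in 𝓝 w, v.1 ∈ c.dom ∧ 1 < v.2.1 :=
      (continuousAt_fst.eventually (c.isOpen_dom.mem_nhds hw.1)).and
        (continuousAt_snd.fst.eventually (lt_mem_nhds ht))
    refine ⟨s, ρ, Ξ, h1, h2, h3, h4, h5, ?_, ?_, h8⟩
    · filter_upwards [h6, hst.eventually hnear] with y k1 k2
      exact ⟨⟨k2.1, k2.2.le, fun i => congrFun k1.1 i⟩, k1.2⟩
    · filter_upwards [mem_nhdsWithin_of_mem_nhds h7, self_mem_nhdsWithin] with v k1 k2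
      exact k1 (funext k2.2.2)
  · have hin' : Tendsto (fun v : (Fin k → ℝ) × (Fin k → ℝ) × (Euc n × ℝ × (Fin k → ℂ)) =>
        (∑ i, v.1 i • ξ i, ∑ i, v.2.1 i • ξ i, v.2.2.1)) (𝓝 (0, 0, w)) (𝓝 (0, 0, w.1)) := by
      have : Continuous fun v : (Fin k → ℝ) × (Fin k → ℝ) × (Euc n × ℝ × (Fin k → ℂ)) =>
        (∑ i, v.1 i • ξ i, ∑ i, v.2.1 i • ξ i, v.2.2.1) := by fun_prop
      simpa using this.tendsto (0, 0, w)
    filter_upwards [hin'.eventually hfa] with v hv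
    refine Prod.ext ?_ (Prod.ext rfl (funext fun i => ?_))
    · simpa only [cutFlow, Pi.add_apply, add_smul, Finset.sum_add_distrib] using hv
    · simp only [cutFlow, Pi.add_apply, Circle.exp_add, Circle.coe_mul, mul_assoc]
  · filter_upwards [hin.eventually hfl] with v hv
    funext i
    rw [one_smul] at hv
    simp only [cutFun, cutFlow, hv, hφ.invariant, norm_mul, Circle.norm_coe, one_mul]
  · intro θ hθ
    have hcv : HasDerivAt (fun t : ℝ => (t • θ, w)) (θ, (0 : Euc n × ℝ × (Fin k → ℂ))) 0 := by
      have := (hasDerivAt_id (0 : ℝ)).smul_const θ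
      rw [one_smul] at this
      exact this.prodMk (hasDerivAt_const _ _)
    have hder : HasDerivAt (fun t : ℝ => cutFlow f ξ (t • θ, w)) 0 0 := by
      have h1 : HasFDerivAt (cutFlow f ξ) (fderiv ℝ (cutFlow f ξ) (0, w))
        ((fun t : ℝ => (t • θ, w)) 0) := by simpa using hGd
      have := h1.comp_hasDerivAt (0 : ℝ) hcv
      rwa [hθ] at this
    -- A nonzero z_i is moved by its own circle, so an infinitesimal stabilizer θ is supported on J.
    set J : Finset (Fin k) := Finset.univ.filter fun i => w.2.2 i = 0 with hJ
    have hθJ : ∀ i, i ∉ J → θ i = 0 := by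
      intro i hi
      have hz : w.2.2 i ≠ 0 := fun h => hi (Finset.mem_filter.2 ⟨Finset.mem_univ _, h⟩)
      have h1 : HasDerivAt (fun t : ℝ => Complex.exp (((t * θ i : ℝ) : ℂ) * Complex.I) * w.2.2 i) 0 0 := by
        have := ((ContinuousLinearMap.proj i).comp
            ((ContinuousLinearMap.snd ℝ _ _).comp (ContinuousLinearMap.snd ℝ _ _)) :
            (Euc n × ℝ × (Fin k → ℂ)) →L[ℝ] ℂ).hasFDerivAt.comp_hasDerivAt (0 : ℝ) hder
        rwa [map_zero] at this
      have h2 : HasDerivAt (fun t : ℝ => Complex.exp (((t * θ i : ℝ) : ℂ) * Complex.I) * w.2.2 i)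
          (Complex.exp ((((0 : ℝ) * θ i : ℝ) : ℂ) * Complex.I) * (((1 * θ i : ℝ) : ℂ) * Complex.I) * w.2.2 i) 0 := by
        have h3 : HasDerivAt (fun t : ℝ => t * θ i) (1 * θ i) 0 := (hasDerivAt_id (0 : ℝ)).mul_const _
        exact ((h3.ofReal_comp.mul_const Complex.I).cexp).mul_const _
      have := h2.unique h1
      simpa [hz] using this
    have hsum : ∑ i, θ i • ξ i = ∑ i ∈ J, θ i • ξ i :=
      (Finset.sum_subset (Finset.subset_univ J) fun i _ hi => by rw [hθJ i hi, zero_smul]).symm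
    have hvel : fderiv ℝ f (0, w.1) (∑ i, θ i • ξ i, 0) = 0 := by
      have h1 : HasDerivAt (fun t : ℝ => f (t • ∑ i, θ i • ξ i, w.1)) 0 0 := by
        have := (ContinuousLinearMap.fst ℝ (Euc n) (ℝ × (Fin k → ℂ))).hasFDerivAt.comp_hasDerivAt
          (0 : ℝ) hder
        rw [map_zero] at this
        refine this.congr_of_eventuallyEq (Eventually.of_forall fun t => ?_)
        simp [cutFlow, Finset.smul_sum, smul_smul]
      have h2 : HasDerivAt (fun t : ℝ => (t • ∑ i, θ i • ξ i, w.1)) (∑ i, θ i • ξ i, (0 : Euc n)) 0 := by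
        have := (hasDerivAt_id (0 : ℝ)).smul_const (∑ i, θ i • ξ i)
        rw [one_smul] at this
        exact this.prodMk (hasDerivAt_const _ _)
      have h3 : HasFDerivAt f (fderiv ℝ f (0, w.1)) ((fun t : ℝ => (t • ∑ i, θ i • ξ i, w.1)) 0) := by
        simpa using (hfs.self_of_nhds.differentiableAt (by simp)).hasFDerivAt
      exact (h3.comp_hasDerivAt (0 : ℝ) h2).unique h1
    have hmem : c.proj w.1 ∈ ⋂ i ∈ J, U i := by
      -- For i ∈ J a vanishing φ_i would give α_i = 0 in the level equation.
      refine mem_iInter₂.2 fun i hi => hφ.support_subset i (subset_tsupport _ fun h0 => ?_)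
      have k1 : α i - w.2.1 * φ i (c.proj w.1) - ‖w.2.2 i‖ ^ 2 = 0 := hw.2.2 i
      have k2 := hφ.one_lt i
      rw [h0, (Finset.mem_filter.1 hi).2] at k1
      simp at k1
      linarith
    obtain ⟨hrank, hfree⟩ := hU.compatible J ⟨_, hmem⟩
    -- The vector has zero velocity and generates a subgroup of S_J, which is locally free at this
    -- point; independence of the generators will then kill θ.
    have hzero : ∑ i ∈ J, θ i • ξ i = 0 := by
      rw [← hsum]
      refine hf.eq_zero_of_locallyFree (hfree _ hmem) (fun t => ?_) hvel
      rw [hsum, Finset.smul_sum]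
      simp only [smul_smul]
      exact torusExp_mem_circlesSubgroup hξ J fun i => t * θ i
    have hli := linearIndependent_of_finrank_lieAlg hξ hrank
    funext i
    by_cases hi : i ∈ J
    · rw [← Finset.sum_coe_sort J fun i => θ i • ξ i] at hzero
      exact Fintype.linearIndependent_iff.1 hli (fun i => θ i) hzero ⟨i, hi⟩
    · exact hθJ i hi
  -- The real dimension n + 1 + 2k of the ambient chart leaves n + 1 for the slice.
  · simp [Module.finrank_prod, Module.finrank_pi_fintype, Complex.finrank_real_complex]
    ring

end InteriorCharts

/-! ### Identifications on a slice by rotations. -/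

section InteriorCharts

variable {n r k : ℕ} {Y W : Type*} [TopologicalSpace Y] [TopologicalSpace W]
  [MulAction (Torus r) Y] [MulAction (Torus r) W] {σ : Fin k → Circle →ₜ* Torus r}
  {φ : Fin k → Y → ℝ} {α : Fin k → ℝ} {p : Y × ℝ × (Fin k → ℂ) → W} {B : Orbifold n Y}
  {U : Fin k → Set Y} {c : OrbifoldChart (univ : Set (Euc n)) Y}

theorem continuous_cutRotate [ContinuousSMul (Torus r) Y] :
    Continuous fun x : (Fin k → Circle) × (Y × ℝ × (Fin k → ℂ)) => cutRotate σ x.1 x.2 := by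
  have h1 : Continuous fun x : (Fin k → Circle) × (Y × ℝ × (Fin k → ℂ)) => ∏ i, σ i (x.1 i) :=
    continuous_finsetProd _ fun i _ => (σ i).continuous_toFun.comp (by fun_prop)
  refine (h1.smul (by fun_prop)).prodMk (Continuous.prodMk (by fun_prop) (continuous_pi fun i => ?_))
  exact by fun_prop

theorem proj_cutFlow {ξ : Fin k → Fin r → ℝ}
    (hξ : ∀ i θ, σ i (Circle.exp θ) = torusExp (θ • ξ i)) {f : (Fin r → ℝ) × Euc n → Euc n}
    {θ : Fin k → ℝ} {v : Euc n × ℝ × (Fin k → ℂ)}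
    (h : c.proj (f (∑ i, θ i • ξ i, v.1)) = torusExp (∑ i, θ i • ξ i) • (1 : Torus r) • c.proj v.1) :
    (c.proj (cutFlow f ξ (θ, v)).1, (cutFlow f ξ (θ, v)).2) =
      cutRotate σ (fun i => Circle.exp (θ i)) (c.proj v.1, v.2) := by
  rw [cutRotate_exp hξ, ← one_smul (Torus r) (c.proj v.1), ← h, one_smul]
  rfl

set_option maxHeartbeats 800000 in
/-- Finitely many local symmetries of a slice account for all the identifications by `(S¹)ᵏ`. -/
theorem SmoothAction.exists_slice_symmetries [T2Space Y] (hB : SmoothAction (r := r) B)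
    {ξ : Fin k → Fin r → ℝ}
    (hξ : ∀ i θ, σ i (Circle.exp θ) = torusExp (θ • ξ i)) (hc : c ∈ B.charts)
    {w : Euc n × ℝ × (Fin k → ℂ)} (hw : w ∈ cutLevelChart c φ α)
    {f : (Fin r → ℝ) × Euc n → Euc n} (hf : IsLocalFlow c w.1 f)
    {ρ : Euc n × ℝ × (Fin k → ℂ) → Euc (n + 1)}
    (hρ : ∀ᶠ v in 𝓝 ((0 : Fin k → ℝ), w), ρ (cutFlow f ξ v) = ρ v.2) :
    ∃ (ι : Type) (_ : Finite ι) (L : ι → Euc n × ℝ × (Fin k → ℂ) → Euc n × ℝ × (Fin k → ℂ))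
      (l : ι → Fin k → Circle), (∀ a, L a w = w) ∧
      (∀ a, ∀ᶠ v in 𝓝 w, ContDiffAt ℝ ∞ (L a) v) ∧
      (∀ a, ∀ᶠ v in 𝓝 w, (L a v).1 ∈ c.dom ∧
        (c.proj (L a v).1, (L a v).2) = cutRotate σ (l a) (c.proj v.1, v.2)) ∧
      ∀ᶠ v in 𝓝[cutLevelChart c φ α] w ×ˢ 𝓝[cutLevelChart c φ α] w, ∀ l' : Fin k → Circle,
        cutRotate σ l' (c.proj v.1.1, v.1.2) = (c.proj v.2.1, v.2.2) →
          ∃ a, ρ (L a v.1) = ρ v.2 := by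
  classical
  have := hB.1
  have hfin := c.finite_group
  have hfl := hf.lifts
  have hf0 := hf.zero
  simp only [univ_prod_univ, nhdsWithin_univ] at hfl hf0
  have hfx : f (0, w.1) = w.1 := hf0.self_of_nhds
  set pr : Euc n × ℝ × (Fin k → ℂ) → Y × ℝ × (Fin k → ℂ) := fun v => (c.proj v.1, v.2) with hpr
  -- The stabilizer of the image of w. Its finiteness is not needed: compactness of (S¹)ᵏ will
  -- single out finitely many members.
  let M := {l : Fin k → Circle // cutRotate σ l (pr w) = pr w}
  have hM : ∀ l : M, ∃ g, IsLocalLift c c (∏ i, σ i (l.1 i)) w.1 g ∧ g (0, w.1) = w.1 := fun l =>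
    hB.exists_isLocalLift hc hc hw.1 hw.1 (congrArg Prod.fst l.2)
  choose g hg hgx using hM
  let G₀ := {γ : c.group // (γ : Equiv.Perm (Euc n)) w.1 = w.1}
  set L : M → G₀ → Euc n × ℝ × (Fin k → ℂ) → Euc n × ℝ × (Fin k → ℂ) :=
    fun l γ v => (γ.1.1 (g l (0, v.1)), v.2.1, fun i => (l.1 i : ℂ) * v.2.2 i) with hL
  have hLw : ∀ l γ, L l γ w = w := by
    intro l γ
    refine Prod.ext ?_ (by have := congrArg Prod.snd l.2; exact this)
    change γ.1.1 (g l (0, w.1)) = w.1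
    rw [hgx, γ.2]
  have hgγ : ∀ l (γ : G₀), IsLocalLift c c (∏ i, σ i (l.1 i)) w.1 (γ.1.1 ∘ g l) := fun l γ =>
    (hg l).group_comp γ.1.2
  have hz : Tendsto (fun v : Euc n × ℝ × (Fin k → ℂ) => ((0 : Fin r → ℝ), v.1)) (𝓝 w) (𝓝 (0, w.1)) :=
    Continuous.tendsto (by fun_prop) w
  have hLs : ∀ l γ, ∀ᶠ v in 𝓝 w, ContDiffAt ℝ ∞ (L l γ) v := by
    intro l γ
    have h1 := (hgγ l γ).smooth
    simp only [univ_prod_univ, nhdsWithin_univ, contDiffWithinAt_univ] at h1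
    filter_upwards [hz.eventually h1] with v hv
    refine ContDiffAt.prodMk ?_ (contDiffAt_snd.fst.prodMk (by fun_prop))
    exact hv.comp (f := fun v : Euc n × ℝ × (Fin k → ℂ) => ((0 : Fin r → ℝ), v.1)) v (by fun_prop)
  have hLr : ∀ l γ, ∀ᶠ v in 𝓝 w, (L l γ v).1 ∈ c.dom ∧ pr (L l γ v) = cutRotate σ l.1 (pr v) := by
    intro l γ
    have h1 := (hgγ l γ).maps
    have h2 := (hgγ l γ).lifts
    simp only [univ_prod_univ, nhdsWithin_univ] at h1 h2
    filter_upwards [hz.eventually h1, hz.eventually h2] with v k1 k2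
    rw [torusExp_zero, one_smul] at k2
    exact ⟨k1, Prod.ext k2 rfl⟩
  have hLt : ∀ l γ, Tendsto (L l γ) (𝓝 w) (𝓝 w) := fun l γ => by
    have := (hLs l γ).self_of_nhds.continuousAt.tendsto
    rwa [hLw] at this
  have hprt : Tendsto pr (𝓝[cutLevelChart c φ α] w) (𝓝 (pr w)) :=
    (OrbifoldChart.tendsto_cutLevel hw).mono_right nhdsWithin_le_nhds
  have hCw : 𝓝[cutLevelChart c φ α] w ≤ 𝓝 w := nhdsWithin_le_nhds
  -- Near a rotation that moves the image of w there are no identifications close to w. Near a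
  -- stabilizing one, the difference of rotations is absorbed by the flow, which ρ does not see.
  have key : ∀ l : Fin k → Circle, ∀ᶠ x in 𝓝 l ×ˢ (𝓝[cutLevelChart c φ α] w ×ˢ 𝓝[cutLevelChart c φ α] w),
      cutRotate σ x.1 (pr x.2.1) = pr x.2.2 →
        ∃ (h : cutRotate σ l (pr w) = pr w) (γ : G₀), ρ (L ⟨l, h⟩ γ x.2.1) = ρ x.2.2 := by
    intro l
    have t1 : Tendsto (fun x : (Fin k → Circle) × ((Euc n × ℝ × (Fin k → ℂ)) × (Euc n × ℝ × (Fin k → ℂ))) => x.2.1)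
        (𝓝 l ×ˢ (𝓝[cutLevelChart c φ α] w ×ˢ 𝓝[cutLevelChart c φ α] w)) (𝓝[cutLevelChart c φ α] w) :=
      tendsto_fst.comp tendsto_snd
    have t2 : Tendsto (fun x : (Fin k → Circle) × ((Euc n × ℝ × (Fin k → ℂ)) × (Euc n × ℝ × (Fin k → ℂ))) => x.2.2)
        (𝓝 l ×ˢ (𝓝[cutLevelChart c φ α] w ×ˢ 𝓝[cutLevelChart c φ α] w)) (𝓝[cutLevelChart c φ α] w) :=
      tendsto_snd.comp tendsto_snd
    by_cases hl : cutRotate σ l (pr w) = pr w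
    -- Small angles with l' = exp(θ) l; they tend to zero as l' tends to l because the argument is
    -- continuous at 1.
    · set θ : (Fin k → Circle) → Fin k → ℝ := fun l' i => Complex.arg ((l' i / l i : Circle) : ℂ) with hθ
      have hθe : ∀ l', l' = (fun i => Circle.exp (θ l' i)) * l := by
        intro l'
        funext i
        change l' i = Circle.exp (Complex.arg ((l' i / l i : Circle) : ℂ)) * l i
        rw [Circle.exp_arg, div_mul_cancel]
      have hθt : Tendsto θ (𝓝 l) (𝓝 0) := by
        refine tendsto_pi_nhds.2 fun i => ?_
        have h1 : ContinuousAt (fun l' : Fin k → Circle => ((l' i / l i : Circle) : ℂ)) l :=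
          Continuous.continuousAt (by fun_prop)
        have h2 : ContinuousAt Complex.arg ((l i / l i : Circle) : ℂ) := by
          rw [div_self', Circle.coe_one]
          exact Complex.continuousAt_arg Complex.one_mem_slitPlane
        have h3 := ContinuousAt.comp (f := fun l' : Fin k → Circle => ((l' i / l i : Circle) : ℂ)) (x := l) h2 h1
        have h4 : Complex.arg ((l i / l i : Circle) : ℂ) = 0 := by
          rw [div_self', Circle.coe_one, Complex.arg_one]
        have h5 := h3.tendsto
        simp only [Function.comp_def, h4] at h5
        exact h5
      have hθt' : Tendsto (fun x : (Fin k → Circle) × ((Euc n × ℝ × (Fin k → ℂ)) × (Euc n × ℝ × (Fin k → ℂ))) => θ x.1)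
        (𝓝 l ×ˢ (𝓝[cutLevelChart c φ α] w ×ˢ 𝓝[cutLevelChart c φ α] w)) (𝓝 0) :=
        hθt.comp tendsto_fst
      have hsum : Tendsto (fun θ : Fin k → ℝ => ∑ i, θ i • ξ i) (𝓝 0) (𝓝 0) := by
        have : Continuous fun θ : Fin k → ℝ => ∑ i, θ i • ξ i := by fun_prop
        simpa using this.tendsto 0
      have t3 : ∀ γ, Tendsto (fun x : (Fin k → Circle) × ((Euc n × ℝ × (Fin k → ℂ)) × (Euc n × ℝ × (Fin k → ℂ))) =>
          (θ x.1, L ⟨l, hl⟩ γ x.2.1)) (𝓝 l ×ˢ (𝓝[cutLevelChart c φ α] w ×ˢ 𝓝[cutLevelChart c φ α] w))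
          (𝓝 (0, w)) := fun γ => hθt'.prodMk_nhds ((hLt _ γ).comp (t1.mono_right hCw))
      have t4 : ∀ γ, Tendsto (fun x : (Fin k → Circle) × ((Euc n × ℝ × (Fin k → ℂ)) × (Euc n × ℝ × (Fin k → ℂ))) =>
          (∑ i, θ x.1 i • ξ i, (L ⟨l, hl⟩ γ x.2.1).1))
          (𝓝 l ×ˢ (𝓝[cutLevelChart c φ α] w ×ˢ 𝓝[cutLevelChart c φ α] w))
          (𝓝 (0, w.1)) := fun γ => (hsum.comp hθt').prodMk_nhds
            ((continuous_fst.tendsto w).comp ((hLt _ γ).comp (t1.mono_right hCw)))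
      have hfc : ContinuousAt f (0, w.1) := by
        have := hf.toIsLocalLift.smoothAt (mem_univ w.1)
        rw [univ_prod_univ, contDiffWithinAt_univ] at this
        exact this.continuousAt
      let γ₁ : G₀ := ⟨1, rfl⟩
      have t5 : Tendsto (fun x : (Fin k → Circle) × ((Euc n × ℝ × (Fin k → ℂ)) × (Euc n × ℝ × (Fin k → ℂ))) =>
          (f (∑ i, θ x.1 i • ξ i, (L ⟨l, hl⟩ γ₁ x.2.1).1), x.2.2.1))
          (𝓝 l ×ˢ (𝓝[cutLevelChart c φ α] w ×ˢ 𝓝[cutLevelChart c φ α] w)) (𝓝 w.1 ×ˢ 𝓝 w.1) := by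
        refine Tendsto.prodMk ?_ ((continuous_fst.tendsto w).comp (t2.mono_right hCw))
        have := hfc.tendsto.comp (t4 γ₁)
        rwa [hfx] at this
      have hgroup := eventually_exists_subtype (q := c.proj) (s := univ) (x := w.1)
        (h := fun γ : c.group => (γ : Equiv.Perm (Euc n)))
        (fun γ => (c.contDiffWithinAt_group γ.2 hw.1).continuousWithinAt.tendsto)
        (c.eventually_exists_group hw.1)
      rw [nhdsWithin_univ] at hgroup
      -- Chart group elements commute with the local flow, because γ ∘ f is a lift of the action and
      -- is therefore determined by its restriction to ξ = 0.
      have hcomm : ∀ γ : G₀, ∀ᶠ v in 𝓝 ((0 : Fin r → ℝ), w.1), γ.1.1 (f v) = f (v.1, γ.1.1 v.2) := by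
        intro γ
        have h1 : (γ.1.1 ∘ f) (0, w.1) = w.1 := by rw [Function.comp_apply, hfx, γ.2]
        have h2 := (hf.toIsLocalLift.group_comp γ.1.2).eventually_eq_flow isModelSet_univ hB hc hc hw.1
          (f := f) (by rwa [h1])
        rw [univ_prod_univ, nhdsWithin_univ] at h2
        have h3 : Tendsto (fun v : (Fin r → ℝ) × Euc n => v.2) (𝓝 (0, w.1)) (𝓝 w.1) :=
          Continuous.tendsto (by fun_prop) _
        filter_upwards [h2, h3.eventually hf0] with v k1 k2
        rw [Function.comp_apply, Function.comp_apply, k2] at k1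
        exact k1
      filter_upwards [(t1.mono_right hCw).eventually (hLr ⟨l, hl⟩ γ₁), (t4 γ₁).eventually hfl,
        t5.eventually hgroup, eventually_all.2 fun γ => (t4 γ₁).eventually (hcomm γ),
        eventually_all.2 fun γ => (t3 γ).eventually hρ] with x k1 k2 k3 k4 k5 hx
      have e1 := proj_cutFlow hξ k2
      rw [show (c.proj (L ⟨l, hl⟩ γ₁ x.2.1).1, (L ⟨l, hl⟩ γ₁ x.2.1).2) = pr (L ⟨l, hl⟩ γ₁ x.2.1) from rfl,
        k1.2, ← cutRotate_mul, ← hθe, hx] at e1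
      obtain ⟨γ, hγ⟩ := k3 (congrArg Prod.fst e1)
      refine ⟨hl, γ, ?_⟩
      rw [← k5 γ]
      congr 1
      refine Prod.ext ?_ (by have := congrArg Prod.snd e1; exact this)
      change f (∑ i, θ x.1 i • ξ i, γ.1.1 (g ⟨l, hl⟩ (0, x.2.1.1))) = x.2.2.1
      rw [← hγ]
      exact (k4 γ).symm
    · have h1 : Tendsto (fun x : (Fin k → Circle) × ((Euc n × ℝ × (Fin k → ℂ)) × (Euc n × ℝ × (Fin k → ℂ))) =>
          (cutRotate σ x.1 (pr x.2.1), pr x.2.2))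
          (𝓝 l ×ˢ (𝓝[cutLevelChart c φ α] w ×ˢ 𝓝[cutLevelChart c φ α] w))
          (𝓝 (cutRotate σ l (pr w), pr w)) := by
        refine Tendsto.prodMk_nhds ?_ (hprt.comp t2)
        exact Tendsto.comp (g := fun x : (Fin k → Circle) × (Y × ℝ × (Fin k → ℂ)) => cutRotate σ x.1 x.2)
          ((continuous_cutRotate (σ := σ) (Y := Y)).tendsto (l, pr w))
          (tendsto_fst.prodMk_nhds (hprt.comp t1))
      filter_upwards [h1.eventually ((isOpen_ne_fun continuous_fst continuous_snd).mem_nhds hl)] with x hx hx'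
      exact absurd hx' hx
  have key' : ∀ l : Fin k → Circle, ∃ N ∈ 𝓝 l, ∀ᶠ v in 𝓝[cutLevelChart c φ α] w ×ˢ 𝓝[cutLevelChart c φ α] w,
      ∀ l' ∈ N, cutRotate σ l' (pr v.1) = pr v.2 →
        ∃ (h : cutRotate σ l (pr w) = pr w) (γ : G₀), ρ (L ⟨l, h⟩ γ v.1) = ρ v.2 := by
    intro l
    obtain ⟨pa, ha, pb, hb, h⟩ := eventually_prod_iff.1 (key l)
    exact ⟨{l' | pa l'}, ha, hb.mono fun v hv l' hl' hx => h hl' hv hx⟩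
  choose N hN hNe using key'
  obtain ⟨t, -, ht⟩ := isCompact_univ.elim_nhds_subcover N fun l _ => hN l
  let T := {l : M // l.1 ∈ t}
  have hT : Finite T := Finite.of_injective (fun l : T => (⟨l.1.1, l.2⟩ : t)) fun a b h =>
    Subtype.ext (Subtype.ext (congrArg (fun l : t => l.1) h))
  let e := Finite.equivFin (T × G₀)
  refine ⟨Fin (Nat.card (T × G₀)), inferInstance, fun a => L (e.symm a).1.1 (e.symm a).2,
    fun a => (e.symm a).1.1.1, fun a => hLw _ _, fun a => hLs _ _, fun a => hLr _ _, ?_⟩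
  filter_upwards [(Finset.eventually_all t).2 fun l _ => hNe l] with v hv l' hl'
  obtain ⟨l, hlt, hl⟩ := mem_iUnion₂.1 (ht (mem_univ l'))
  obtain ⟨h, γ, hγ⟩ := hv l hlt l' hl hl'
  exact ⟨e (⟨⟨l, h⟩, hlt⟩, γ), by simpa using hγ⟩

end InteriorCharts

/-! ### Linear slices and the charts where t > 1. -/

section InteriorCharts

variable {n r k : ℕ} {Y W : Type*} [TopologicalSpace Y] [TopologicalSpace W]
  [MulAction (Torus r) Y] [MulAction (Torus r) W] {σ : Fin k → Circle →ₜ* Torus r}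
  {φ : Fin k → Y → ℝ} {α : Fin k → ℝ} {p : Y × ℝ × (Fin k → ℂ) → W} {B : Orbifold n Y}
  {U : Fin k → Set Y} {c : OrbifoldChart (univ : Set (Euc n)) Y}

/-- The quotient map of a cut is, near an interior point, the quotient of a slice by a finite
linear group. -/
theorem IsCutData.exists_linear_slice [T2Space Y] (hp : IsCutMap σ φ α p)
    (hB : SmoothAction (r := r) B) (hU : IsGoodCover U σ) (hφ : IsCutData (r := r) B U φ α)
    (hc : c ∈ B.charts) {w : Euc n × ℝ × (Fin k → ℂ)} (hw : w ∈ cutLevelChart c φ α)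
    (ht : 1 < w.2.1) :
    ∃ (s : Euc (n + 1) → Euc n × ℝ × (Fin k → ℂ)) (ρ : Euc n × ℝ × (Fin k → ℂ) → Euc (n + 1))
      (Γ : Subgroup (Euc (n + 1) ≃L[ℝ] Euc (n + 1))), Finite Γ ∧ s 0 = w ∧ ρ w = 0 ∧
      (∀ᶠ y in 𝓝 0, ContDiffAt ℝ ∞ s y) ∧ (∀ᶠ v in 𝓝 w, ContDiffAt ℝ ∞ ρ v) ∧
      (∀ᶠ y in 𝓝 0, s y ∈ cutLevelChart c φ α ∧ ρ (s y) = y) ∧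
      (∀ᶠ v in 𝓝[cutLevelChart c φ α] w,
        p (c.proj (s (ρ v)).1, (s (ρ v)).2) = p (c.proj v.1, v.2)) ∧
      ∀ᶠ u in 𝓝 (0 : Euc (n + 1)) ×ˢ 𝓝 (0 : Euc (n + 1)),
        p (c.proj (s u.1).1, (s u.1).2) = p (c.proj (s u.2).1, (s u.2).2) ↔
          ∃ g : Γ, (g : Euc (n + 1) ≃L[ℝ] Euc (n + 1)) u.1 = u.2 := by
  classical
  choose ξ hξ using fun i => exists_eq_torusExp (σ i)
  obtain ⟨f, hf⟩ := hB.exists_isLocalFlow isModelSet_univ hc hw.1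
  obtain ⟨s, ρ, Ξ, hsw, hρw, hss, hρs, hΞ, hsρ, hflow, hρG⟩ := hφ.exists_cut_slice hU hξ hc hw ht hf
  obtain ⟨ι, hι, L, l, hLw, hLs, hLr, hLcov⟩ := hB.exists_slice_symmetries hξ hc hw hf hρG
  have hfl := hf.lifts
  simp only [univ_prod_univ, nhdsWithin_univ] at hfl
  have hst : Tendsto s (𝓝 0) (𝓝[cutLevelChart c φ α] w) :=
    tendsto_nhdsWithin_iff.2 ⟨hsw ▸ hss.self_of_nhds.continuousAt, hsρ.mono fun y hy => hy.1⟩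
  have hst' : Tendsto s (𝓝 0) (𝓝 w) := hst.mono_right nhdsWithin_le_nhds
  have hρt : Tendsto ρ (𝓝 w) (𝓝 0) := hρw ▸ hρs.self_of_nhds.continuousAt
  set q : Euc (n + 1) → W := fun y => p (c.proj (s y).1, (s y).2) with hq
  -- A level point near w is obtained from its slice point by the flow, that is, by a rotation, so p
  -- does not distinguish them.
  have hquot : ∀ᶠ v in 𝓝[cutLevelChart c φ α] w, q (ρ v) = p (c.proj v.1, v.2) := by
    have h1 : Tendsto (fun v => (∑ i, Ξ v i • ξ i, (s (ρ v)).1)) (𝓝 w) (𝓝 (0, w.1)) := by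
      refine Tendsto.prodMk_nhds ?_ ((continuous_fst.tendsto w).comp (hst'.comp hρt))
      have : Continuous fun θ : Fin k → ℝ => ∑ i, θ i • ξ i := by fun_prop
      have h2 := (this.tendsto 0).comp hΞ
      simp only [Pi.zero_apply, zero_smul, Finset.sum_const_zero] at h2
      exact h2
    filter_upwards [hflow, mem_nhdsWithin_of_mem_nhds (h1.eventually hfl),
      mem_nhdsWithin_of_mem_nhds (hρt.eventually hsρ)] with v h2 h3 h4
    have h5 := proj_cutFlow hξ h3
    rw [← h2] at h5
    rw [h5]
    exact (hp.fibre _ h4.1.2 _ ((cutRotate_mem_cutLevel hφ.invariant).2 h4.1.2)).2 ⟨_, rfl⟩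
  set h : ι → Euc (n + 1) → Euc (n + 1) := fun a y => ρ (L a (s y)) with hh
  have hLt : ∀ a, Tendsto (fun y => L a (s y)) (𝓝 0) (𝓝 w) := fun a => by
    have := (hLs a).self_of_nhds.continuousAt.tendsto
    rw [hLw] at this
    exact this.comp hst'
  have hhs : ∀ a, ∀ᶠ y in 𝓝 0, ContDiffAt ℝ ∞ (h a) y := by
    intro a
    filter_upwards [hss, hst'.eventually (hLs a), (hLt a).eventually hρs] with y h1 h2 h3
    exact h3.comp y (h2.comp y h1)
  have hh0 : ∀ a, h a 0 = 0 := fun a => by simp only [hh, hsw, hLw, hρw]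
  have hsymm : ∀ a, IsLocalSymm q univ 0 (h a) := by
    intro a
    refine ⟨hh0 a, ?_, Eventually.of_forall fun y => mem_univ _, ?_⟩
    · rw [contDiffWithinAt_univ]
      exact (hhs a).self_of_nhds.of_le (by simp)
    · rw [nhdsWithin_univ]
      have hnear : ∀ᶠ v in 𝓝 w, v.1 ∈ c.dom ∧ 1 < v.2.1 :=
        (continuousAt_fst.eventually (c.isOpen_dom.mem_nhds hw.1)).and
          (continuousAt_snd.fst.eventually (lt_mem_nhds ht))
      have h1 : ∀ᶠ y in 𝓝 0, L a (s y) ∈ cutLevelChart c φ α ∧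
          p (c.proj (L a (s y)).1, (L a (s y)).2) = q y := by
        filter_upwards [hst'.eventually (hLr a), hsρ] with y k1 k2
        refine ⟨⟨k1.1, ?_⟩, ?_⟩
        · rw [k1.2]; exact (cutRotate_mem_cutLevel hφ.invariant).2 k2.1.2
        · rw [k1.2]
          exact ((hp.fibre _ k2.1.2 _ ((cutRotate_mem_cutLevel hφ.invariant).2 k2.1.2)).2 ⟨_, rfl⟩).symm
      have h2 : Tendsto (fun y => L a (s y)) (𝓝 0) (𝓝[cutLevelChart c φ α] w) :=
        tendsto_nhdsWithin_iff.2 ⟨hLt a, h1.mono fun y hy => hy.1⟩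
      filter_upwards [h2.eventually hquot, h1] with y k1 k2
      exact k1.trans k2.2
  have hcov : ∀ᶠ u in 𝓝[univ] (0 : Euc (n + 1)) ×ˢ 𝓝[univ] (0 : Euc (n + 1)), q u.1 = q u.2 →
      ∃ a, h a u.1 = u.2 := by
    simp only [nhdsWithin_univ]
    have h1 : Tendsto (fun u : Euc (n + 1) × Euc (n + 1) => (s u.1, s u.2)) (𝓝 0 ×ˢ 𝓝 0)
        (𝓝[cutLevelChart c φ α] w ×ˢ 𝓝[cutLevelChart c φ α] w) := hst.prodMap hst
    filter_upwards [h1.eventually hLcov, prod_mem_prod hsρ hsρ] with u k1 k2 k3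
    obtain ⟨l', hl'⟩ := (hp.fibre _ k2.1.1.2 _ k2.2.1.2).1 k3
    obtain ⟨a, ha⟩ := k1 l' hl'
    exact ⟨a, ha.trans k2.2.2⟩
  -- Bochner coordinates on the slice; changing the slice and ρ by the local inverse of ψ makes the
  -- identifications linear.
  obtain ⟨Γ, hΓ, b, ψ, -, hψ, ⟨ψ', -, hψ'⟩, -, -, hiff⟩ :=
    exists_linearization isModelSet_univ (mem_univ 0) hsymm hcov
  rw [hasFDerivWithinAt_univ] at hψ'
  simp only [nhdsWithin_univ] at hiff
  have hψs : ∀ᶠ y in 𝓝 0, ContDiffAt ℝ ∞ ψ y := by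
    filter_upwards [eventually_all.2 fun g => hhs (b g)] with y hy
    rw [hψ]
    exact ContDiffAt.sum fun g _ =>
      (g : Euc (n + 1) ≃L[ℝ] Euc (n + 1)).symm.contDiff.contDiffAt.comp y ((hy g).sub contDiffAt_const)
  have hψ0 : ψ 0 = 0 := by simp [hψ, hh0]
  obtain ⟨e, he, h0e, -, hes, hes'⟩ := exists_openPartialHomeomorph_contDiffOn hψs hψ' univ_mem
  have he0 : e 0 = 0 := (he 0).trans hψ0
  have h0t : (0 : Euc (n + 1)) ∈ e.target := by rw [← he0]; exact e.map_source h0e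
  have hes0 : e.symm 0 = 0 := by
    have := e.left_inv h0e
    rwa [he0] at this
  have het : Tendsto e.symm (𝓝 0) (𝓝 0) := by
    have := (e.continuousAt_symm h0t).tendsto
    rwa [hes0] at this
  refine ⟨s ∘ e.symm, e ∘ ρ, Γ, inferInstance, by simp [hes0, hsw], by simp [hρw, he0], ?_, ?_, ?_,
    ?_, ?_⟩
  · filter_upwards [het.eventually hss, e.open_target.mem_nhds h0t] with y h1 h2
    exact h1.comp y (hes'.contDiffAt (e.open_target.mem_nhds h2))
  · filter_upwards [hρs, hρt.eventually (e.open_source.mem_nhds h0e)] with v h1 h2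
    exact (hes.contDiffAt (e.open_source.mem_nhds h2)).comp v h1
  · filter_upwards [het.eventually hsρ, e.open_target.mem_nhds h0t] with y h1 h2
    exact ⟨h1.1, by rw [Function.comp_apply, Function.comp_apply, h1.2, e.right_inv h2]⟩
  · filter_upwards [hquot, mem_nhdsWithin_of_mem_nhds (hρt.eventually (e.open_source.mem_nhds h0e))]
      with v h1 h2
    simp only [Function.comp_apply, e.left_inv h2]
    exact h1
  · filter_upwards [(het.prodMap het).eventually hiff, prod_mem_prod (e.open_target.mem_nhds h0t)
      (e.open_target.mem_nhds h0t)] with u h1 h2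
    simp only [Prod.map, ← he, e.right_inv h2.1, e.right_inv h2.2] at h1
    exact h1

/-- A finite linear group has small invariant convex neighbourhoods of zero. -/
theorem exists_invariant_convex_nhds {E : Type*} [NormedAddCommGroup E] [NormedSpace ℝ E]
    (Γ : Subgroup (E ≃L[ℝ] E)) [Finite Γ] {δ : ℝ} (hδ : 0 < δ) :
    ∃ B : Set E, IsOpen B ∧ Convex ℝ B ∧ (0 : E) ∈ B ∧ (∀ v ∈ B, ‖v‖ < δ) ∧
      ∀ g ∈ Γ, ∀ v ∈ B, g v ∈ B := by
  refine ⟨⋂ g : Γ, (g : E ≃L[ℝ] E) ⁻¹' Metric.ball 0 δ, isOpen_iInter_of_finite fun g =>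
    Metric.isOpen_ball.preimage (g : E ≃L[ℝ] E).continuous, convex_iInter fun g =>
    (convex_ball (0 : E) δ).linear_preimage ((g : E ≃L[ℝ] E) : E →ₗ[ℝ] E), ?_, ?_, ?_⟩
  · exact mem_iInter.2 fun g => by simpa using hδ
  · exact fun v hv => mem_ball_zero_iff.1 (mem_iInter.1 hv (1 : Γ))
  · exact fun g hg v hv => mem_iInter.2 fun g' => mem_iInter.1 hv (g' * (⟨g, hg⟩ : Γ))

/-- Linear automorphisms as affine automorphisms with a given fixed point. -/
noncomputable def linearPermAt {E : Type*} [NormedAddCommGroup E] [NormedSpace ℝ E] (a : E) :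
    (E ≃L[ℝ] E) →* Equiv.Perm E where
  toFun g :=
    { toFun := fun v => a + g (v - a)
      invFun := fun v => a + g.symm (v - a)
      left_inv := fun v => by simp
      right_inv := fun v => by simp }
  map_one' := by ext1 v; exact add_sub_cancel a v
  map_mul' g g' := by
    ext1 v
    change a + g (g' (v - a)) = a + g (a + g' (v - a) - a)
    rw [add_sub_cancel_left]

theorem linearPermAt_apply {E : Type*} [NormedAddCommGroup E] [NormedSpace ℝ E] (a : E)
    (g : E ≃L[ℝ] E) (v : E) : linearPermAt a g v = a + g (v - a) := rfl

/-- The linear slice is translated into the open half space and restricted to an invariant convex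
neighbourhood, which provides the connected domain. -/
theorem IsCutData.exists_interior_chart [T2Space Y] (hp : IsCutMap σ φ α p)
    (hB : SmoothAction (r := r) B) (hU : IsGoodCover U σ) (hφ : IsCutData (r := r) B U φ α)
    (hc : c ∈ B.charts) {w : Euc n × ℝ × (Fin k → ℂ)} (hw : w ∈ cutLevelChart c φ α)
    (ht : 1 < w.2.1) :
    ∃ κ : OrbifoldChart (halfSpace n) W, (∀ y ∈ κ.dom, 0 < y 0) ∧
      (∃ y ∈ κ.dom, κ.proj y = p (c.proj w.1, w.2)) ∧ IsCutChart B φ α p κ := by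
  obtain ⟨s, ρ, Γ, hΓ, hsw, hρw, hss, hρs, hsρ, hquot, hiff⟩ :=
    hφ.exists_linear_slice hp hB hU hc hw ht
  have hst : Tendsto s (𝓝 0) (𝓝[cutLevelChart c φ α] w) :=
    tendsto_nhdsWithin_iff.2 ⟨hsw ▸ hss.self_of_nhds.continuousAt, hsρ.mono fun y hy => hy.1⟩
  have hst' : Tendsto s (𝓝 0) (𝓝 w) := hst.mono_right nhdsWithin_le_nhds
  obtain ⟨P, hP, hPiff⟩ := eventually_prod_self_iff'.1 hiff
  have hlift : ∀ᶠ v in 𝓝[cutLevelChart c φ α] w, ContDiffAt ℝ ∞ ρ v ∧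
      p (c.proj (s (ρ v)).1, (s (ρ v)).2) = p (c.proj v.1, v.2) :=
    (hρs.filter_mono nhdsWithin_le_nhds).and hquot
  obtain ⟨δ, hδ, hδP⟩ := Metric.eventually_nhds_iff.1 ((hss.and hsρ).and ((show ∀ᶠ u in 𝓝 0, u ∈ P from hP).and
    (hst.eventually (eventually_eventually_nhdsWithin.2 hlift))))
  -- The neighbourhood has radius less than δ, so centring it at height δ + 1 keeps the first
  -- coordinate positive.
  set a : Euc (n + 1) := EuclideanSpace.single 0 (δ + 1) with ha
  obtain ⟨B₀, hB₀o, hB₀c, hB₀0, hB₀δ, hB₀Γ⟩ := exists_invariant_convex_nhds Γ hδ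
  set D : Set (Euc (n + 1)) := {v | v - a ∈ B₀} with hD
  have hsub : Continuous fun v : Euc (n + 1) => v - a := by fun_prop
  have hDo : IsOpen D := hB₀o.preimage hsub
  have haD : a ∈ D := by change a - a ∈ B₀; rwa [sub_self]
  have hDpos : ∀ v ∈ D, 0 < v 0 := by
    intro v hv
    have h1 := (PiLp.norm_apply_le (v - a) 0).trans_lt (hB₀δ _ hv)
    have h2 : (v - a) 0 = v 0 - (δ + 1) := by simp [ha]
    rw [h2, Real.norm_eq_abs, abs_lt] at h1
    linarith [h1.1]
  have hDP := fun v (hv : v ∈ D) => hδP (y := v - a) (by simpa using hB₀δ _ hv)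
  set q : Euc (n + 1) → W := fun v => p (c.proj (s (v - a)).1, (s (v - a)).2) with hq
  have hchart := exists_isCutChart (D := D) (q := q) hp hB hφ ⟨D, hDo, ?_⟩ ?_
    (Γ.map (linearPermAt a)) ?_ ?_ ?_ ?_ ?_ ?_
  · obtain ⟨κ, hκD, hκq, hκ⟩ := hchart
    refine ⟨κ, hκD ▸ hDpos, ⟨a, hκD ▸ haD, ?_⟩, hκ⟩
    rw [hκq, hq]
    simp only [sub_self, hsw]
  · exact (inter_eq_right.2 fun v hv => (hDpos v hv).le).symm
  · refine ⟨⟨a, haD⟩, ?_⟩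
    have h1 : D = (fun v => v + a) '' B₀ := by
      rw [image_add_right]
      ext v
      rw [hD, mem_ofPred_eq, mem_preimage, sub_eq_add_neg]
    rw [h1]
    exact (hB₀c.isPreconnected).image _ (by fun_prop)
  · exact ((Set.toFinite (Γ : Set (Euc (n + 1) ≃L[ℝ] Euc (n + 1)))).image (linearPermAt a)).to_subtype
  · rintro _ ⟨g, hg, rfl⟩ v hv
    change a + g (v - a) - a ∈ B₀
    rw [add_sub_cancel_left]
    exact hB₀Γ g hg _ hv
  · rintro _ ⟨g, -, rfl⟩
    have : ContDiff ℝ ∞ fun v => a + g (v - a) := by fun_prop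
    exact this.contDiffOn
  · rintro _ ⟨g, -, rfl⟩ h
    -- A linear map which is the identity near zero is the identity, so the linear group is
    -- automatically effective.
    have h1 : ∀ v ∈ B₀, g v = v := by
      intro v hv
      have := h (a + v) (by change a + v - a ∈ B₀; rwa [add_sub_cancel_left])
      rwa [linearPermAt_apply, add_sub_cancel_left, add_right_inj] at this
    have h2 : ((g : Euc (n + 1) ≃L[ℝ] Euc (n + 1)) : Euc (n + 1) →L[ℝ] Euc (n + 1)) =
        ContinuousLinearMap.id ℝ _ := by
      refine HasFDerivAt.unique (f := g) (x := 0) ((g : Euc (n + 1) ≃L[ℝ] Euc (n + 1)).hasFDerivAt) ?_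
      refine (hasFDerivAt_id (𝕜 := ℝ) (0 : Euc (n + 1))).congr_of_eventuallyEq ?_
      filter_upwards [hB₀o.mem_nhds hB₀0] with v hv using h1 v hv
    have h3 : g = 1 := ContinuousLinearEquiv.ext (funext fun v =>
      congrArg (fun T : Euc (n + 1) →L[ℝ] Euc (n + 1) => T v) h2)
    rw [h3, map_one]
  · intro v hv v' hv'
    refine (hPiff _ (hDP v hv).2.1 _ (hDP v' hv').2.1).trans ?_
    constructor
    · rintro ⟨g, hg⟩
      refine ⟨_, ⟨g, g.2, rfl⟩, ?_⟩
      rw [linearPermAt_apply]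
      exact (congrArg (a + ·) hg).trans (add_sub_cancel a v')
    · rintro ⟨_, ⟨g, hg, rfl⟩, rfl⟩
      refine ⟨⟨g, hg⟩, ?_⟩
      rw [linearPermAt_apply, add_sub_cancel_left]
  · intro y hy
    have hyH : y ∈ halfSpace n := (hDpos y hy).le
    obtain ⟨⟨h1, h2⟩, -, h3⟩ := hDP y hy
    refine ⟨c, hc, s (y - a), h2.1, rfl, fun v => a + ρ v, fun v => s (v - a), ?_, rfl, ?_, ?_, ?_, ?_⟩
    · simp only [h2.2, add_sub_cancel]
    · filter_upwards [h3] with v hv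
      exact (contDiffAt_const.add hv.1).contDiffWithinAt
    · have h4 : Tendsto ρ (𝓝[cutLevelChart c φ α] (s (y - a))) (𝓝 (y - a)) := by
        have := (h3.self_of_nhdsWithin h2.1).1.continuousAt.tendsto
        rw [h2.2] at this
        exact this.mono_left nhdsWithin_le_nhds
      filter_upwards [h3, h4.eventually (hB₀o.mem_nhds hy)] with v k1 k2
      refine ⟨?_, ?_⟩
      · change a + ρ v - a ∈ B₀
        rwa [add_sub_cancel_left]
      · simp only [hq, add_sub_cancel_left]
        exact k1.2
    · filter_upwards [mem_nhdsWithin_of_mem_nhds (hDo.mem_nhds hy)] with v hv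
      exact ((hDP v hv).1.1.comp v (by fun_prop)).contDiffWithinAt
    · filter_upwards [mem_nhdsWithin_of_mem_nhds (hDo.mem_nhds hy)] with v hv
      exact ⟨(hDP v hv).1.2.1, by rw [(hDP v hv).1.2.2, add_sub_cancel]⟩

end InteriorCharts

/-! ## The quotient space of a cut -/

section CutSpace

variable {n r k : ℕ} {Y : Type u} [TopologicalSpace Y] [MulAction (Torus r) Y]
  {σ : Fin k → Circle →ₜ* Torus r} {φ : Fin k → Y → ℝ} {α : Fin k → ℝ} {B : Orbifold n Y}
  {U : Fin k → Set Y}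

theorem IsCutData.cutBoundaryPoint_mem (hφ : IsCutData (r := r) B U φ α) (m : Y) :
    cutBoundaryPoint φ α m ∈ cutLevel φ α := by
  refine ⟨le_rfl, fun i => ?_⟩
  have h1 := hφ.le_one i m
  have h2 := hφ.one_lt i
  change α i - 1 * φ i m - ‖((√(α i - φ i m) : ℝ) : ℂ)‖ ^ 2 = 0
  rw [Complex.norm_real, Real.norm_of_nonneg (Real.sqrt_nonneg _), Real.sq_sqrt (by linarith)]
  ring

theorem IsCutData.isClosed_cutLevel (hφ : IsCutData (r := r) B U φ α) : IsClosed (cutLevel φ α) := by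
  have h1 : ∀ i, Continuous (φ i) := fun i => (hφ.smooth i).continuous
  have h2 : cutLevel φ α = {w | 1 ≤ w.2.1} ∩
      ⋂ i, {w : Y × ℝ × (Fin k → ℂ) | α i - w.2.1 * φ i w.1 - ‖w.2.2 i‖ ^ 2 = 0} := by
    ext w
    simp [cutLevel]
  rw [h2]
  refine (isClosed_le continuous_const (by fun_prop)).inter (isClosed_iInter fun i => ?_)
  have := h1 i
  exact isClosed_eq (by fun_prop) continuous_const

/-- Summing the equations and using ∑ φ_i = 1 bounds t by ∑ α_i, although [1, ∞) is not compact;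
then |z_i|² ≤ α_i. -/
theorem IsCutData.isCompact_cutLevel [CompactSpace Y] (hφ : IsCutData (r := r) B U φ α) :
    IsCompact (cutLevel φ α) := by
  have hα : ∀ i, 0 ≤ α i := fun i => (zero_lt_one.trans (hφ.one_lt i)).le
  refine IsCompact.of_isClosed_subset (isCompact_univ.prod ((isCompact_Icc (a := 1) (b := ∑ i, α i)).prod
    (isCompact_closedBall (0 : Fin k → ℂ) (1 + ∑ i, α i)))) hφ.isClosed_cutLevel ?_
  rintro ⟨m, t, z⟩ ⟨h1, h2⟩
  replace h1 : 1 ≤ t := h1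
  replace h2 : ∀ i, α i - t * φ i m - ‖z i‖ ^ 2 = 0 := h2
  have hsum : 0 ≤ ∑ i, α i := Finset.sum_nonneg fun i _ => hα i
  refine ⟨mem_univ _, ⟨h1, ?_⟩, mem_closedBall_zero_iff.2 ((pi_norm_le_iff_of_nonneg (by linarith)).2
    fun i => ?_)⟩
  · calc t = ∑ i, t * φ i m := by rw [← Finset.mul_sum, hφ.sum_eq_one, mul_one]
      _ ≤ ∑ i, α i := Finset.sum_le_sum fun i _ => by nlinarith [h2 i, sq_nonneg ‖z i‖]
  · change ‖z i‖ ≤ 1 + ∑ i, α i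
    have h3 : α i ≤ ∑ i, α i := Finset.single_le_sum (fun j _ => hα j) (Finset.mem_univ i)
    have h4 : 0 ≤ t * φ i m := mul_nonneg (by linarith) (hφ.nonneg i m)
    nlinarith [h2 i, sq_nonneg (‖z i‖ - 1)]

variable (σ φ α) in
/-- The orbit relation of `(S¹)ᵏ` on the zero level of a cut. -/
def cutSetoid : Setoid (cutLevel φ α) where
  r w w' := ∃ l, cutRotate σ l w.1 = w'.1
  iseqv :=
    { refl := fun w => ⟨1, cutRotate_one _⟩
      symm := fun {w w'} ⟨l, hl⟩ => ⟨l⁻¹, by rw [← hl, ← cutRotate_mul, inv_mul_cancel, cutRotate_one]⟩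
      trans := fun {w w' w''} ⟨l, hl⟩ ⟨l', hl'⟩ => ⟨l' * l, by rw [cutRotate_mul, hl, hl']⟩ }

omit [TopologicalSpace Y] in
theorem cutRotate_smul (l : Fin k → Circle) (τ : Torus r) (w : Y × ℝ × (Fin k → ℂ)) :
    cutRotate σ l (τ • w.1, w.2) = (τ • (cutRotate σ l w).1, (cutRotate σ l w).2) := by
  simp only [cutRotate, smul_smul, mul_comm]

/-- The action of the torus on the zero level of a cut. -/
def cutLevelSMul (hinv : ∀ (i : Fin k) (τ : Torus r) (m : Y), φ i (τ • m) = φ i m) (τ : Torus r)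
    (w : cutLevel φ α) : cutLevel φ α :=
  ⟨(τ • w.1.1, w.1.2), w.2.1, fun i => by
    have := w.2.2 i
    simpa only [hinv] using this⟩

/-- The action of the torus on the quotient space of a cut. -/
abbrev cutMulAction (σ : Fin k → Circle →ₜ* Torus r)
    (hinv : ∀ (i : Fin k) (τ : Torus r) (m : Y), φ i (τ • m) = φ i m) :
    MulAction (Torus r) (Quotient (cutSetoid σ φ α)) where
  smul τ := Quotient.map (cutLevelSMul hinv τ) fun w w' ⟨l, hl⟩ => ⟨l, by
    change cutRotate σ l (τ • w.1.1, w.1.2) = (τ • w'.1.1, w'.1.2)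
    rw [cutRotate_smul, hl]⟩
  one_smul := by
    rintro ⟨w⟩
    exact congrArg (Quotient.mk _) (Subtype.ext (Prod.ext (one_smul _ _) rfl))
  mul_smul τ τ' := by
    rintro ⟨w⟩
    exact congrArg (Quotient.mk _) (Subtype.ext (Prod.ext (mul_smul _ _ _) rfl))

/-- The saturation of an open set is a union of its preimages under rotations, each of which is
continuous. -/
theorem isOpenQuotientMap_cutSetoid [ContinuousSMul (Torus r) Y]
    (hinv : ∀ (i : Fin k) (τ : Torus r) (m : Y), φ i (τ • m) = φ i m) :
    IsOpenQuotientMap (Quotient.mk (cutSetoid σ φ α)) := by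
  refine ⟨Quotient.mk_surjective, continuous_quotient_mk', fun O hO => ?_⟩
  let R : (Fin k → Circle) → cutLevel φ α → cutLevel φ α := fun l w =>
    ⟨cutRotate σ l w.1, (cutRotate_mem_cutLevel hinv).2 w.2⟩
  have hR : ∀ l, Continuous (R l) := fun l => Continuous.subtype_mk
    ((continuous_cutRotate (σ := σ)).comp (continuous_const.prodMk continuous_subtype_val)) _
  have h1 : Quotient.mk (cutSetoid σ φ α) ⁻¹' (Quotient.mk (cutSetoid σ φ α) '' O) =
      ⋃ l, R l ⁻¹' O := by
    ext w
    simp only [mem_preimage, mem_image, mem_iUnion]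
    constructor
    · rintro ⟨w', hw', h⟩
      obtain ⟨l, hl⟩ := Quotient.exact h.symm
      exact ⟨l, by rwa [show R l w = w' from Subtype.ext hl]⟩
    · rintro ⟨l, hl⟩
      exact ⟨_, hl, (Quotient.sound (s := cutSetoid σ φ α) ⟨l, rfl⟩).symm⟩
  rw [← isQuotientMap_quotient_mk'.isOpen_preimage]
  change IsOpen (Quotient.mk (cutSetoid σ φ α) ⁻¹' (Quotient.mk (cutSetoid σ φ α) '' O))
  rw [h1]
  exact isOpen_iUnion fun l => hO.preimage (hR l)

/-- For an open quotient map it is enough that the relation is closed. It is the projection of a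
closed set along the compact group (S¹)ᵏ. -/
theorem t2Space_cutSetoid [T2Space Y] [ContinuousSMul (Torus r) Y]
    (hinv : ∀ (i : Fin k) (τ : Torus r) (m : Y), φ i (τ • m) = φ i m) :
    T2Space (Quotient (cutSetoid σ φ α)) := by
  rw [t2Space_iff_of_isOpenQuotientMap (isOpenQuotientMap_cutSetoid (σ := σ) (α := α) hinv)]
  have h1 : {q : cutLevel φ α × cutLevel φ α |
      Quotient.mk (cutSetoid σ φ α) q.1 = Quotient.mk (cutSetoid σ φ α) q.2} =
      Prod.snd '' {x : (Fin k → Circle) × (cutLevel φ α × cutLevel φ α) |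
        cutRotate σ x.1 x.2.1.1 = x.2.2.1} := by
    ext q
    constructor
    · intro h
      obtain ⟨l, hl⟩ := Quotient.exact h
      exact ⟨(l, q), hl, rfl⟩
    · rintro ⟨⟨l, q⟩, h, rfl⟩
      exact Quotient.sound (s := cutSetoid σ φ α) ⟨l, h⟩
  rw [h1]
  refine isClosedMap_snd_of_compactSpace _ (isClosed_eq ?_ (by fun_prop))
  exact (continuous_cutRotate (σ := σ)).comp (by fun_prop :
    Continuous fun x : (Fin k → Circle) × (cutLevel φ α × cutLevel φ α) => (x.1, x.2.1.1))

/-- The quotient space of a cut. -/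
theorem IsCutData.exists_isCutMap [CompactSpace Y] [T2Space Y] [ContinuousSMul (Torus r) Y]
    (hφ : IsCutData (r := r) B U φ α) (σ : Fin k → Circle →ₜ* Torus r) :
    ∃ (W : Type u) (_ : TopologicalSpace W) (_ : CompactSpace W) (_ : T2Space W)
      (_ : MulAction (Torus r) W) (p : Y × ℝ × (Fin k → ℂ) → W),
      ContinuousSMul (Torus r) W ∧ IsCutMap σ φ α p := by
  classical
  have hcomp : CompactSpace (cutLevel φ α) := isCompact_iff_compactSpace.1 hφ.isCompact_cutLevel
  have hopen := isOpenQuotientMap_cutSetoid (σ := σ) (α := α) hφ.invariant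
  let _ := cutMulAction (α := α) σ hφ.invariant
  -- Off the level set the value is irrelevant; the boundary point over w.1 is just an available
  -- element.
  let p : Y × ℝ × (Fin k → ℂ) → Quotient (cutSetoid σ φ α) := fun w =>
    if h : w ∈ cutLevel φ α then Quotient.mk _ ⟨w, h⟩
    else Quotient.mk _ ⟨_, hφ.cutBoundaryPoint_mem w.1⟩
  have hp : ∀ w : cutLevel φ α, p w = Quotient.mk _ w := fun w => dif_pos w.2
  refine ⟨Quotient (cutSetoid σ φ α), inferInstance, inferInstance, t2Space_cutSetoid hφ.invariant,
    inferInstance, p, ⟨?_⟩, ?_, ?_, ?_, ?_, ?_⟩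
  · have h1 : IsOpenQuotientMap (Prod.map id (Quotient.mk (cutSetoid σ φ α)) :
        Torus r × cutLevel φ α → _) := IsOpenQuotientMap.id.prodMap hopen
    rw [h1.isQuotientMap.continuous_iff]
    have h2 : Continuous fun x : Torus r × cutLevel φ α => cutLevelSMul hφ.invariant x.1 x.2 :=
      Continuous.subtype_mk (by fun_prop) _
    exact hopen.continuous.comp h2
  · rw [continuousOn_iff_continuous_domRestrict]
    exact hopen.continuous.congr fun w => (hp w).symm
  · intro O hO
    have h1 : p '' (cutLevel φ α ∩ O) = Quotient.mk (cutSetoid σ φ α) '' ((↑) ⁻¹' O) := by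
      ext x
      constructor
      · rintro ⟨w, ⟨hw, hwO⟩, rfl⟩
        exact ⟨⟨w, hw⟩, hwO, (hp ⟨w, hw⟩).symm⟩
      · rintro ⟨w, hwO, rfl⟩
        exact ⟨w, ⟨w.2, hwO⟩, hp w⟩
    rw [h1]
    exact hopen.isOpenMap _ (hO.preimage continuous_subtype_val)
  · rintro ⟨w⟩ -
    exact ⟨w, w.2, hp w⟩
  · intro τ w hw
    rw [hp ⟨w, hw⟩]
    exact hp (cutLevelSMul hφ.invariant τ ⟨w, hw⟩)
  · intro w hw w' hw'
    rw [hp ⟨w, hw⟩, hp ⟨w', hw'⟩]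
    exact Quotient.eq (r := cutSetoid σ φ α)

end CutSpace

/-! ## The quotient orbifold of a cut -/

section CutOrbifold

variable {n r k : ℕ} {Y W : Type*} [TopologicalSpace Y] [TopologicalSpace W]
  [MulAction (Torus r) Y] [MulAction (Torus r) W] {σ : Fin k → Circle →ₜ* Torus r}
  {φ : Fin k → Y → ℝ} {α : Fin k → ℝ} {p : Y × ℝ × (Fin k → ℂ) → W} {B : Orbifold n Y}
  {U : Fin k → Set Y}

/-- Rotating every z_i by minus its argument brings a point with t = 1 to the section of nonnegative
coordinates, where |z_i|² = α_i - φ_i. -/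
theorem IsCutMap.eq_cutBoundaryPoint (hp : IsCutMap σ φ α p) (hφ : IsCutData (r := r) B U φ α)
    {w : Y × ℝ × (Fin k → ℂ)} (hw : w ∈ cutLevel φ α) (ht : w.2.1 = 1) :
    ∃ m, p w = p (cutBoundaryPoint φ α m) := by
  refine ⟨(∏ i, σ i (Circle.exp (-Complex.arg (w.2.2 i)))) • w.1, ?_⟩
  refine (hp.fibre _ hw _ (hφ.cutBoundaryPoint_mem _)).2
    ⟨fun i => Circle.exp (-Complex.arg (w.2.2 i)), Prod.ext rfl (Prod.ext ht (funext fun i => ?_))⟩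
  change (Circle.exp (-Complex.arg (w.2.2 i)) : ℂ) * w.2.2 i = ((√(α i - φ i (_ • w.1)) : ℝ) : ℂ)
  have h1 := hw.2 i
  rw [ht, one_mul] at h1
  rw [hφ.invariant, show α i - φ i w.1 = ‖w.2.2 i‖ ^ 2 by linarith, Real.sqrt_sq (norm_nonneg _),
    Circle.coe_exp]
  conv_lhs => rw [← Complex.norm_mul_exp_arg_mul_I (w.2.2 i)]
  rw [mul_left_comm, ← Complex.exp_add]
  simp

theorem IsCutData.exists_collar_width (hφ : IsCutData (r := r) B U φ α) :
    ∃ ε > 0, ∀ i, 1 + ε ≤ α i := by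
  have h1 : ∀ᶠ ε : ℝ in 𝓝[>] 0, ∀ i, 1 + ε < α i := eventually_all.2 fun i => by
    have h2 : Tendsto (fun ε : ℝ => 1 + ε) (𝓝 0) (𝓝 1) := by
      have : Continuous fun ε : ℝ => 1 + ε := by fun_prop
      simpa using this.tendsto 0
    exact mem_nhdsWithin_of_mem_nhds (h2.eventually (gt_mem_nhds (hφ.one_lt i)))
  obtain ⟨ε, h2, h3⟩ := (h1.and self_mem_nhdsWithin).exists
  exact ⟨ε, h3, fun i => (h2 i).le⟩

omit [TopologicalSpace W] [MulAction (Torus r) Y] [MulAction (Torus r) W] in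
theorem collarProj_eucCons_zero (c : OrbifoldChart (univ : Set (Euc n)) Y) (x : Euc n) :
    collarProj c φ α p (eucCons 0 x) = p (cutBoundaryPoint φ α (c.proj x)) := by
  simp only [collarProj, collarSection, cutBoundaryPoint, eucCons_zero, eucTail_eucCons, add_zero,
    one_mul]

/-- A chart at a boundary point of the quotient of a cut. -/
theorem IsCutData.exists_boundary_chart (hp : IsCutMap σ φ α p) (hB : SmoothAction (r := r) B)
    (hφ : IsCutData (r := r) B U φ α) {c : OrbifoldChart (univ : Set (Euc n)) Y} (hc : c ∈ B.charts) :
    ∃ κ : OrbifoldChart (halfSpace n) W, IsCutChart B φ α p κ ∧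
      (∀ x, eucCons 0 x ∈ κ.dom ↔ x ∈ c.dom) ∧
      ∀ x, κ.proj (eucCons 0 x) = p (cutBoundaryPoint φ α (c.proj x)) := by
  obtain ⟨ε, hε0, hε⟩ := hφ.exists_collar_width
  obtain ⟨κ, h1, h2, h3⟩ := hφ.exists_collar_chart hp hB hε0 hε hc
  refine ⟨κ, h3, fun x => ?_, fun x => h2 ▸ collarProj_eucCons_zero c x⟩
  rw [h1]
  exact ⟨fun h => h.1, fun h => ⟨h, le_rfl, hε0⟩⟩

/-- Points with t > 1 lie in linear charts that avoid the boundary of the half space, points with t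
= 1 in collar charts. The last clause is what identifies the boundary later. -/
theorem IsCutData.exists_isCutChart_mem [T2Space Y] (hp : IsCutMap σ φ α p)
    (hB : SmoothAction (r := r) B) (hU : IsGoodCover U σ) (hφ : IsCutData (r := r) B U φ α) (q : W) :
    ∃ κ : OrbifoldChart (halfSpace n) W, IsCutChart B φ α p κ ∧ ∃ y ∈ κ.dom, κ.proj y = q ∧
      (y 0 = 0 → ∃ m, q = p (cutBoundaryPoint φ α m)) := by
  obtain ⟨c, hc, w, hw, rfl⟩ := exists_mem_cutLevelChart hp B q
  rcases hw.2.1.lt_or_eq with ht | ht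
  · obtain ⟨κ, h1, ⟨y, hy, hyq⟩, h2⟩ := hφ.exists_interior_chart hp hB hU hc hw ht
    exact ⟨κ, h2, y, hy, hyq, fun h => absurd h (h1 y hy).ne'⟩
  · obtain ⟨m, hm⟩ := hp.eq_cutBoundaryPoint hφ hw.2 ht.symm
    obtain ⟨c', hc', x, hx, rfl⟩ := B.covers m
    obtain ⟨κ, h1, h2, h3⟩ := hφ.exists_boundary_chart hp hB hc'
    exact ⟨κ, h1, _, (h2 x).2 hx, (h3 x).trans hm.symm, fun _ => ⟨_, hm⟩⟩

/-- The orbifold structure of the quotient of a cut. -/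
def cutOrbifold [T2Space Y] (hp : IsCutMap σ φ α p)
    (hB : SmoothAction (r := r) B) (hU : IsGoodCover U σ) (hφ : IsCutData (r := r) B U φ α) :
    OrbifoldWithBoundary n W where
  -- All charts admitting lifts of p are taken at once; any two are compatible, so no particular
  -- family has to be tracked.
  charts := {κ | IsCutChart B φ α p κ}
  covers q := by
    obtain ⟨κ, h1, y, h2, h3, -⟩ := hφ.exists_isCutChart_mem hp hB hU q
    exact ⟨κ, h1, y, h2, h3⟩
  compatible _ hκ _ hκ' := IsCutChart.compatible hp hκ hκ'

variable [T2Space Y] (hp : IsCutMap σ φ α p) (hB : SmoothAction (r := r) B) (hU : IsGoodCover U σ)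
  (hφ : IsCutData (r := r) B U φ α)

theorem smoothAction_cutOrbifold [ContinuousSMul (Torus r) W] :
    SmoothAction (r := r) (cutOrbifold hp hB hU hφ) :=
  ⟨inferInstance, fun _ hκ _ hκ' τ _ hy _ hy' h =>
    IsCutChart.exists_action_lift hp hB hφ.invariant hκ hκ' τ hy hy' h⟩

theorem isCutQuotient_cutOrbifold : IsCutQuotient B (cutOrbifold hp hB hU hφ) σ φ α p where
  continuousOn := hp.continuousOn
  isOpen_image := hp.isOpen_image
  surj := hp.surj
  equivariant := hp.equivariant
  fibre := hp.fibre
  submersion c hc κ hκ w hw y hy h := by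
    obtain ⟨g, s, hgs⟩ := hκ c hc w hw y hy h
    exact ⟨g, s, hgs.submersion hy⟩

/-- Being a boundary point does not depend on the chart, so it can be read off in the chart that
`IsCutData.exists_isCutChart_mem` provides at the point. -/
theorem boundary_cutOrbifold :
    range (fun m => p (cutBoundaryPoint φ α m)) = (cutOrbifold hp hB hU hφ).boundary := by
  ext q
  constructor
  · rintro ⟨m, rfl⟩
    obtain ⟨c, hc, x, hx, rfl⟩ := B.covers m
    obtain ⟨κ, h1, h2, h3⟩ := hφ.exists_boundary_chart hp hB hc
    exact ⟨κ, h1, _, (h2 x).2 hx, rfl, h3 x⟩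
  · intro hq
    obtain ⟨κ, h1, y, hy, rfl, hyq⟩ := hφ.exists_isCutChart_mem hp hB hU q
    obtain ⟨m, hm⟩ := hyq (by_contra fun h0 =>
      (cutOrbifold hp hB hU hφ).proj_notMem_boundary h1 hy
        ((show (0 : ℝ) ≤ y 0 from κ.dom_subset hy).lt_of_ne' h0) hq)
    exact ⟨m, hm.symm⟩

/-- The map is injective because its z-coordinates are positive, and an embedding because Y is
compact. Its lifts are the restrictions to first coordinate zero of the changes of charts out of a
collar chart. -/
theorem isBoundaryIso_cutOrbifold [CompactSpace Y] [T2Space W] :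
    IsBoundaryIso B (cutOrbifold hp hB hU hφ) fun m => p (cutBoundaryPoint φ α m) := by
  set A := cutOrbifold hp hB hU hφ with hA
  have hbd := boundary_cutOrbifold hp hB hU hφ
  refine ⟨?_, hbd, ?_⟩
  · refine (Continuous.isClosedEmbedding ?_ ?_).isEmbedding
    · refine hp.continuousOn.comp_continuous ?_ hφ.cutBoundaryPoint_mem
      have := fun i => (hφ.smooth i).continuous
      unfold cutBoundaryPoint
      exact continuous_id.prodMk (continuous_const.prodMk (continuous_pi fun i =>
        Complex.continuous_ofReal.comp ((continuous_const.sub (this i)).sqrt)))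
    · intro m m' h
      obtain ⟨l, hl⟩ := (hp.fibre _ (hφ.cutBoundaryPoint_mem m) _ (hφ.cutBoundaryPoint_mem m')).1 h
      have hpos : ∀ i m, 0 < √(α i - φ i m) := fun i m => Real.sqrt_pos.2 (by
        linarith [hφ.le_one i m, hφ.one_lt i])
      have hl1 : l = 1 := funext fun i => Circle.eq_one_of_mul_ofReal (hpos i m) (hpos i m')
        (congrFun (congrArg (fun w => w.2.2) hl) i)
      rw [hl1, cutRotate_one] at hl
      exact congrArg Prod.fst hl
  · intro c hc κ' hκ' x hx y hy hxy
    obtain ⟨κ, h1, h2, h3⟩ := hφ.exists_boundary_chart hp hB hc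
    obtain ⟨e, ⟨⟨O, hO, hOs⟩, ⟨O', hO', hOt⟩, hes, hes'⟩, hxe, hexy, hep⟩ :=
      A.compatible κ h1 κ' hκ' _ ((h2 x).2 hx) y hy ((h3 x).trans hxy)
    -- Invariance of the boundary under change of charts: this makes a transition map and its
    -- inverse preserve the hyperplane of first coordinate zero.
    have hzero : ∀ κ ∈ A.charts, ∀ v ∈ κ.dom, κ.proj v ∈ A.boundary → v 0 = 0 := by
      intro κ hκ v hv hb
      by_contra h0
      exact A.proj_notMem_boundary hκ hv
        ((show (0 : ℝ) ≤ v 0 from κ.dom_subset hv).lt_of_ne' h0) hb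
    have hsrc : ∀ v ∈ e.source, v ∈ κ.dom := fun v hv => (hOs ▸ hv : v ∈ κ.dom ∩ O).1
    have htgt : ∀ v ∈ e.target, v ∈ κ'.dom := fun v hv => (hOt ▸ hv : v ∈ κ'.dom ∩ O').1
    have hcont : ContDiff ℝ ∞ fun v : Euc n => eucCons 0 v :=
      contDiff_eucCons.comp (contDiff_const.prodMk contDiff_id)
    have htail : ∀ v ∈ e.target, v 0 = 0 → eucCons 0 (eucTail (e.symm v)) = e.symm v := by
      intro v hv hv0
      have k1 := e.map_target hv
      have k2 : e.symm v 0 = 0 := by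
        refine hzero κ h1 _ (hsrc _ k1) ?_
        rw [← hep _ k1, e.right_inv hv]
        exact ⟨κ', hκ', v, htgt v hv, hv0, rfl⟩
      rw [← k2, eucCons_eucTail]
    refine ⟨{ toFun := fun v => e (eucCons 0 v)
              invFun := fun v => eucTail (e.symm v)
              source := {v | eucCons 0 v ∈ e.source}
              target := e.target ∩ {v | v 0 = 0}
              map_source' := fun v hv => ⟨e.map_source hv, ?_⟩
              map_target' := fun v hv => ?_
              left_inv' := fun v hv => ?_
              right_inv' := fun v hv => ?_ }, ⟨⟨{v | eucCons 0 v ∈ O}, ?_, ?_⟩, ⟨O', hO', ?_⟩, ?_, ?_⟩,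
      hxe, hexy, fun v hv => ?_⟩
    · refine hzero κ' hκ' _ (htgt _ (e.map_source hv)) ?_
      rw [hep _ hv]
      exact ⟨κ, h1, _, hsrc _ hv, rfl, rfl⟩
    · change eucCons 0 (eucTail (e.symm v)) ∈ e.source
      rw [htail v hv.1 hv.2]
      exact e.map_target hv.1
    · rw [e.left_inv hv, eucTail_eucCons]
    · rw [htail v hv.1 hv.2, e.right_inv hv.1]
    · exact hO.preimage hcont.continuous
    · ext v
      change eucCons 0 v ∈ e.source ↔ v ∈ c.dom ∧ eucCons 0 v ∈ O
      rw [hOs, mem_inter_iff, h2]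
    · change e.target ∩ {v | v 0 = 0} = κ'.dom ∩ {v | v 0 = 0} ∩ O'
      rw [hOt, inter_right_comm]
    · exact hes.comp hcont.contDiffOn fun v hv => hv
    · exact contDiff_eucTail.comp_contDiffOn (hes'.mono inter_subset_left)
    · exact (hep _ hv).trans (h3 v)

omit [T2Space Y] in
theorem IsCutMap.smul_cutBoundaryPoint (hp : IsCutMap σ φ α p)
    (hφ : IsCutData (r := r) B U φ α) (τ : Torus r) (m : Y) :
    p (cutBoundaryPoint φ α (τ • m)) = τ • p (cutBoundaryPoint φ α m) := by
  rw [← hp.equivariant τ _ (hφ.cutBoundaryPoint_mem m)]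
  simp only [cutBoundaryPoint, hφ.invariant]

end CutOrbifold

theorem theorema16 :
    -- a compact orbifold with a good cover bounds the compact orbifold obtained by cutting
    (∀ (n r k : ℕ) (Y : Type u) [TopologicalSpace Y] [CompactSpace Y] [T2Space Y]
      [MulAction (Torus r) Y] (B : Orbifold n Y), SmoothAction (r := r) B →
      ∀ (U : Fin k → Set Y) (σ : Fin k → Circle →ₜ* Torus r), IsGoodCover U σ →
        ∃ (φ : Fin k → Y → ℝ) (α : Fin k → ℝ), IsCutData (r := r) B U φ α ∧
        ∃ (W : Type u) (_ : TopologicalSpace W) (_ : CompactSpace W) (_ : T2Space W)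
          (_ : MulAction (Torus r) W) (A : OrbifoldWithBoundary n W)
          (p : Y × ℝ × (Fin k → ℂ) → W),
          SmoothAction (r := r) A ∧ IsCutQuotient B A σ φ α p ∧
          IsBoundaryIso B A (fun m => p (cutBoundaryPoint φ α m)) ∧
          ∀ (τ : Torus r) (m : Y),
            p (cutBoundaryPoint φ α (τ • m)) = τ • p (cutBoundaryPoint φ α m)) ∧
    -- existence of good covers
    (∀ (n r : ℕ) (Y : Type u) (X : Type v) [TopologicalSpace Y] [CompactSpace Y] [T2Space Y]
      [MulAction (Torus r) Y] (B : Orbifold n Y)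
      [TopologicalSpace X] [CompactSpace X] [T2Space X] [MulAction (Torus r) X]
      (A : OrbifoldWithBoundary n X), SmoothAction (r := r) B → SmoothAction (r := r) A →
      ∀ f : Y → X, IsBoundaryIso B A f → (∀ (τ : Torus r) (m : Y), f (τ • m) = τ • f m) →
      ∀ φ : X → Fin r → ℝ, ContinuousOn φ A.boundaryᶜ →
        (∀ (τ : Torus r), ∀ m ∈ A.boundaryᶜ, φ (τ • m) = φ m) →
        IsCompact {m | m ∈ A.boundaryᶜ ∧ VectorFieldVanishesAt A φ m} →
        ∃ (k : ℕ) (U : Fin k → Set Y) (σ : Fin k → Circle →ₜ* Torus r), IsGoodCover U σ) := by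
  refine ⟨fun n r k Y _ _ _ _ B hB U σ hU => ?_, fun n r Y X _ _ _ _ B _ _ _ _ A hB hA f hf hfT φ _ _ hK => ?_⟩
  · have := hB.1
    obtain ⟨φ, α, hφ⟩ := exists_isCutData hB hU
    obtain ⟨W, _, _, _, _, p, _, hp⟩ := hφ.exists_isCutMap σ
    exact ⟨φ, α, hφ, W, inferInstance, inferInstance, inferInstance, inferInstance,
      cutOrbifold hp hB hU hφ, p, smoothAction_cutOrbifold hp hB hU hφ,
      isCutQuotient_cutOrbifold hp hB hU hφ, isBoundaryIso_cutOrbifold hp hB hU hφ,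
      hp.smul_cutBoundaryPoint hφ⟩
  · have := hB.1
    exact exists_isGoodCover_of_isCompact_vanishing hA hf hfT hK
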